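/- **Setting.** Let $k$ be a field, $k'/k$ a finite field extension and $\mathbb K=k'((t))((s))$, regarded as a 2-Tate vector space over $k$: with $S_a=s^ak'((t))[[s]]$ one has $\mathbb K=\operatorname{colim}_a\lim_b S_a/S_b$, where each $S_a/S_b$ is the Tate space over $k$ with its $t$-adic topology. $GL(\mathbb K)$ denotes its group of automorphisms, and $\mathbb K^\times\subset GL(\mathbb K)$ by multiplication. A lattice of $\mathbb K$ is a closed $k$-subspace lying between some $S_b$ and some $S_a$; if $N\subset A$ are lattices, $A/N$ is a Tate space. *Graded lines.* $\mathcal Pic^{\mathbb Z}$ is the symmetric monoidal groupoid of graded lines $(\ell,n)$ ($\ell$ a one-dimensional $k$-space, $n\in\mathbb Z$), with linear isomorphisms between lines of equal degree as morphisms, with $\otimes$ and addition of degrees, and with commutativity constraint $v\otimes w\mapsto(-1)^{mn}w\otimes v$ in degrees $m,n$; the automorphism group of its unit is $k^\times$. For a Tate space $V$, $\mathcal Det(V)$ is the $\mathcal Pic^{\mathbb Z}$-torsor of graded determinantal theories on $V$: rules $\Delta$ assigning a graded line $\Delta(U)$ to each lattice $U$ (open bounded subspace) of $V$, with isomorphisms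 $\Delta(U)\otimes\det(U'/U)\cong\Delta(U')$ for $U\subset U'$, compatible for $U\subset U'\subset U''$; here $\det(W)=\bigwedge^{\dim W}W$ in degree $\dim W$. *The central extension.* Let $L$ be a lattice of $\mathbb K$. The central extension $\mathcal Det$ of $GL(\mathbb K)$ by $\mathcal Pic^{\mathbb Z}$ is the monoidal groupoid $\mathcal E=\coprod_{g}\mathcal E_g$ with $$\mathcal E_g=\mathcal Det(L\,|\,gL):=\mathcal Det\big(gL/(L\cap gL)\big)-\mathcal Det\big(L/(L\cap gL)\big)$$ (difference of $\mathcal Pic^{\mathbb Z}$-torsors), with product $\mathcal E_g\times\mathcal E_{g'}\to\mathcal E_{gg'}$ given by transport $\mathcal Det(L|g'L)\simeq\mathcal Det(gL|gg'L)$ by $g$, followed by $\mathcal Det(L|gL)+\mathcal Det(gL|gg'L)\simeq\mathcal Det(L|gg'L)$. It is a central extension in the following sense: $\mathcal E$ is a groupoid, there is a braided monoidal functor from $\mathcal Pic^{\mathbb Z}$ to the Drinfeld center of $\mathcal E$ with values over $1$, the products are compatible with the grading by $g$, and each $\mathcal E_g$ is a $\mathcal Pic^{\mathbb Z}$-torsor.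 *The triple commutator.* For commuting $g,h$ let $C_2(g,h)\in\mathcal Pic^{\mathbb Z}$ be the object with isomorphisms $C_2(g,h)\otimes(X\otimes Y)\cong Y\otimes X$ for $X\in\mathcal E_g$, $Y\in\mathcal E_h$, natural and $\mathcal Pic^{\mathbb Z}$-linear in $X$ and $Y$; moving $X$ past $Y$ and then past $Z$ gives, for $h'$ commuting with $g$, isomorphisms $C_2(g,hh')\cong C_2(g,h)\otimes C_2(g,h')$. For pairwise commuting $g,h,h'$, $C_3^{\mathcal Det}(g,h,h')\in k^\times$ is the automorphism $$C_2(g,hh')\cong C_2(g,h)\otimes C_2(g,h')\cong C_2(g,h')\otimes C_2(g,h)\cong C_2(g,h'h)=C_2(g,hh'),$$ where the middle map is the commutativity constraint. *The symbol.* Let $\nu_1$ be the $s$-adic valuation of $\mathbb K$, $\nu_2$ the $t$-adic valuation of $k'((t))$, and $\nu(f,g)=\nu_2\big(\overline{f^{\nu_1(g)}/g^{\nu_1(f)}}\big)$ for $f,g\in\mathbb K^\times$, the bar denoting reduction modulo $s$. The two-dimensional tame symbol of $f,g,h\in\mathbb K^\times$ is $$\{f,g,h\}=(-1)^{A}\,f^{\nu(g,h)}g^{\nu(h,f)}h^{\nu(f,g)}\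 \bmod s\ \bmod t\ \in k'^\times,$$ $$A=\nu(f,g)\nu(f,h)+\nu(g,h)\nu(g,f)+\nu(h,f)\nu(h,g)+\nu(f,g)\nu(g,h)\nu(h,f).$$ **Theorem.** For every lattice $L$ of $\mathbb K$, $\mathcal Det$ is a central extension of $GL(\mathbb K)$ by $\mathcal Pic^{\mathbb Z}$, and for all $f,g,h\in\mathbb K^\times$ the triple commutator $C_3^{\mathcal Det}(f,g,h)$ is well defined and $$C_3^{\mathcal Det}(f,g,h)=\operatorname{Nm}_{k'/k}\{f,g,h\}.$$ -/

import Mathlib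

open CategoryTheory MonoidalCategory

universe u

noncomputable section

section General

/-- The data of a (categorical) central extension of a group `G` by a symmetric monoidal category
`P`: a monoidal category `E`, a multiplicative grading `π : E → G` which is constant along
morphisms, and a braided monoidal functor `ι` from `P` to the Drinfeld center of `E` with values
in degree `1`. The objects over `g` form the fibre `E_g`; `P` acts on it by `(x, X) ↦ ι x ⊗ X`. -/
structure CentralExtension (G : Type*) [Group G] (P : Type*) [Category P] [MonoidalCategory P]
    [SymmetricCategory P] (E : Type*) [Category E] [MonoidalCategory E] where
  π : E → G
  ι : P ⥤ Center E
  ιBraided : ι.Braided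
  π_hom : ∀ {X Y : E}, (X ⟶ Y) → π X = π Y
  π_unit : π (𝟙_ E) = 1
  π_tensor : ∀ X Y : E, π (X ⊗ Y) = π X * π Y
  π_ι : ∀ x : P, π (ι.obj x).1 = 1

namespace CentralExtension

attribute [instance] CentralExtension.ιBraided

variable {G : Type*} [Group G] {P : Type*} [Category P] [MonoidalCategory P]
  [SymmetricCategory P] {E : Type*} [Category E] [MonoidalCategory E]
  (D : CentralExtension G P E)

/-- The object of `E` attached to `x : P`. -/
abbrev T (x : P) : E := (D.ι.obj x).1

/-- The central structure `ι x ⊗ X ≅ X ⊗ ι x`. -/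
abbrev swap (x : P) (X : E) : D.T x ⊗ X ≅ X ⊗ D.T x := (D.ι.obj x).2.β X

/-- The structural isomorphism `ι (x + y) ≅ ι x ⊗ ι y`. -/
def split (x y : P) : D.T (x ⊗ y) ⟶ D.T x ⊗ D.T y :=
  (Functor.OplaxMonoidal.δ D.ι x y).f

/-- The property of being a central extension `1 → P → E → G → 1`: `E` is a groupoid, and each
fibre `E_g` is a `P`-torsor (it is nonempty, `P` acts transitively on isomorphism classes, and
`x ↦ ι x ⊗ X` is fully faithful). -/
structure IsCentralExtension : Prop where
  isIso : ∀ {X Y : E} (f : X ⟶ Y), IsIso f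
  exists_obj : ∀ g : G, ∃ X : E, D.π X = g
  exists_iso : ∀ X Y : E, D.π X = D.π Y → ∃ x : P, Nonempty (D.T x ⊗ X ≅ Y)
  fullyFaithful : ∀ (X : E) (x y : P),
    Function.Bijective fun a : x ⟶ y => (D.ι.map a).f ▷ X

/-- A value `C₂(g, h) : P` of the commutator: an object `obj` of `P` with isomorphisms
`obj + (X + Y) ≅ Y + X` for `X` over `g` and `Y` over `h`, natural and `P`-linear in `X`, `Y`. -/
structure Commutator (g h : G) where
  obj : P
  α : ∀ X Y : E, D.π X = g → D.π Y = h → (D.T obj ⊗ (X ⊗ Y) ≅ Y ⊗ X)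
  naturality : ∀ {X X' Y Y' : E} (hX : D.π X = g) (hX' : D.π X' = g) (hY : D.π Y = h)
    (hY' : D.π Y' = h) (a : X ⟶ X') (b : Y ⟶ Y'),
    D.T obj ◁ (a ⊗ₘ b) ≫ (α X' Y' hX' hY').hom = (α X Y hX hY).hom ≫ (b ⊗ₘ a)
  linear_left : ∀ (x : P) {X Y : E} (hX : D.π X = g) (hxX : D.π (D.T x ⊗ X) = g)
    (hY : D.π Y = h),
    (α (D.T x ⊗ X) Y hxX hY).hom =
      𝟙 _ ⊗≫ (D.swap obj (D.T x)).hom ▷ (X ⊗ Y) ⊗≫ D.T x ◁ (α X Y hX hY).hom ⊗≫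
        (D.swap x Y).hom ▷ X ⊗≫ 𝟙 _
  linear_right : ∀ (x : P) {X Y : E} (hX : D.π X = g) (hY : D.π Y = h)
    (hxY : D.π (D.T x ⊗ Y) = h),
    (α X (D.T x ⊗ Y) hX hxY).hom =
      𝟙 _ ⊗≫ D.T obj ◁ (D.swap x X).inv ▷ Y ⊗≫ (D.swap obj (D.T x)).hom ▷ (X ⊗ Y) ⊗≫
        D.T x ◁ (α X Y hX hY).hom ⊗≫ 𝟙 _

variable {D}

/-- `m` is the structural isomorphism `C₂(g, h h') ≅ C₂(g, h) + C₂(g, h')`: commuting `X` past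
`Y + Z` is commuting it first past `Y` and then past `Z`. -/
def IsAdditivity {g h h' k : G} (hk : h * h' = k) (A : D.Commutator g h) (B : D.Commutator g h')
    (C : D.Commutator g k) (m : C.obj ≅ A.obj ⊗ B.obj) : Prop :=
  ∀ (X Y Z : E) (hX : D.π X = g) (hY : D.π Y = h) (hZ : D.π Z = h'),
    (C.α X (Y ⊗ Z) hX (by rw [D.π_tensor, hY, hZ, hk])).hom =
      ((D.ι.map m.hom).f ≫ D.split A.obj B.obj) ▷ (X ⊗ Y ⊗ Z) ⊗≫
        (D.swap A.obj (D.T B.obj)).hom ▷ (X ⊗ Y ⊗ Z) ⊗≫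
        D.T B.obj ◁ (A.α X Y hX hY).hom ▷ Z ⊗≫
        (D.swap B.obj Y).hom ▷ (X ⊗ Z) ⊗≫
        Y ◁ (B.α X Z hX hZ).hom ⊗≫ 𝟙 _

variable (D)

/-- `u : Aut (𝟙_ P) = π₁(P)` is a value of the triple commutator `C₃(g, h, h')`, that is, of the
commutator `Comm(C_g)(h, h')` of `C_g = C₂(g, ·)`: the composite
`C_g(h h') ≅ C_g(h) + C_g(h') ≅ C_g(h') + C_g(h) ≅ C_g(h' h) = C_g(h h')` is `u`. -/
def IsTripleCommutator (g h h' : G) (u : Aut (𝟙_ P)) : Prop :=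
  ∃ (comm : h' * h = h * h') (A : D.Commutator g h) (B : D.Commutator g h')
    (C : D.Commutator g (h * h')) (m : C.obj ≅ A.obj ⊗ B.obj) (m' : C.obj ≅ B.obj ⊗ A.obj),
    IsAdditivity rfl A B C m ∧ IsAdditivity comm B A C m' ∧
      m.hom ≫ (β_ A.obj B.obj).hom ≫ m'.inv =
        (λ_ C.obj).inv ≫ u.hom ▷ C.obj ≫ (λ_ C.obj).hom

end CentralExtension

end General

section GradedLines

open TensorProduct

/-- A graded line over `k`: a one-dimensional vector space placed in an integral degree. These
are the objects of the Picard category `Pic^ℤ(k)`. -/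
structure GradedLine (k : Type u) [Field k] where
  V : Type u
  [addCommGroup : AddCommGroup V]
  [module : Module k V]
  finrank_eq : Module.finrank k V = 1
  deg : ℤ

namespace GradedLine

attribute [instance] GradedLine.addCommGroup GradedLine.module

variable {k : Type u} [Field k]

/-- A morphism of graded lines: a linear isomorphism; it exists only between lines of the same
degree. -/
@[ext]
structure Hom (X Y : GradedLine k) where
  e : X.V ≃ₗ[k] Y.V
  deg_eq : X.deg = Y.deg

instance : Category (GradedLine k) where
  Hom := Hom
  id X := ⟨LinearEquiv.refl k X.V, rfl⟩
  comp f g := ⟨f.e.trans g.e, f.deg_eq.trans g.deg_eq⟩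

@[ext]
theorem hom_ext {X Y : GradedLine k} (f g : X ⟶ Y) (h : ∀ v, f.e v = g.e v) : f = g :=
  Hom.ext (LinearEquiv.ext h)

@[simp]
theorem id_e (X : GradedLine k) (v : X.V) : Hom.e (𝟙 X) v = v := rfl

@[simp]
theorem comp_e {X Y Z : GradedLine k} (f : X ⟶ Y) (g : Y ⟶ Z) (v : X.V) :
    (f ≫ g).e v = g.e (f.e v) := rfl

/-- Build an isomorphism of graded lines. -/
@[simps]
def mkIso {X Y : GradedLine k} (e : X.V ≃ₗ[k] Y.V) (h : X.deg = Y.deg) : X ≅ Y where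
  hom := ⟨e, h⟩
  inv := ⟨e.symm, h.symm⟩
  hom_inv_id := by ext; simp
  inv_hom_id := by ext; simp

/-- The sign `(-1) ^ n`, as a unit of `k`. -/
def sgn (k : Type u) [Field k] (n : ℤ) : kˣ := (-1) ^ n

theorem sgn_add (m n : ℤ) : sgn k (m + n) = sgn k m * sgn k n := zpow_add _ _ _

theorem sgn_mul_self (n : ℤ) : sgn k n * sgn k n = 1 := by
  rw [← sgn_add, sgn, Even.neg_one_zpow ⟨n, rfl⟩]

/-- Multiplication by a sign. -/
def sgnEquiv (n : ℤ) (V : Type*) [AddCommGroup V] [Module k V] : V ≃ₗ[k] V :=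
  LinearEquiv.smulOfUnit (sgn k n)

@[simp]
theorem sgnEquiv_apply (n : ℤ) (V : Type*) [AddCommGroup V] [Module k V] (v : V) :
    sgnEquiv (k := k) n V v = sgn k n • v := rfl

instance : MonoidalCategoryStruct (GradedLine k) where
  tensorObj X Y := ⟨X.V ⊗[k] Y.V, by
    rw [Module.finrank_tensorProduct, X.finrank_eq, Y.finrank_eq], X.deg + Y.deg⟩
  tensorUnit := ⟨k, Module.finrank_self k, 0⟩
  tensorHom f g := ⟨TensorProduct.congr f.e g.e, congrArg₂ (· + ·) f.deg_eq g.deg_eq⟩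
  whiskerLeft X _ _ f := ⟨TensorProduct.congr (LinearEquiv.refl k X.V) f.e,
    congrArg₂ (· + ·) rfl f.deg_eq⟩
  whiskerRight f Y := ⟨TensorProduct.congr f.e (LinearEquiv.refl k Y.V),
    congrArg₂ (· + ·) f.deg_eq rfl⟩
  associator X Y Z := mkIso (TensorProduct.assoc k X.V Y.V Z.V) (add_assoc _ _ _)
  leftUnitor X := mkIso (TensorProduct.lid k X.V) (zero_add _)
  rightUnitor X := mkIso (TensorProduct.rid k X.V) (add_zero _)

@[simp] theorem tensor_deg (X Y : GradedLine k) : (X ⊗ Y).deg = X.deg + Y.deg := rfl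
@[simp] theorem unit_deg : (𝟙_ (GradedLine k)).deg = 0 := rfl

/-- The element `v ⊗ w` of a tensor product of graded lines. -/
def tm {X Y : GradedLine k} (v : X.V) (w : Y.V) : (X ⊗ Y).V := v ⊗ₜ[k] w

theorem tensor_hom_ext {X Y Z : GradedLine k} (f g : X ⊗ Y ⟶ Z)
    (h : ∀ v w, f.e (tm v w) = g.e (tm v w)) : f = g :=
  Hom.ext (LinearEquiv.toLinearMap_injective (TensorProduct.ext' h))

theorem tm_smul {X Y : GradedLine k} (a : kˣ) (v : X.V) (w : Y.V) :
    tm v (a • w) = a • tm (Y := Y) v w := TensorProduct.tmul_smul _ _ _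

theorem smul_tm {X Y : GradedLine k} (a : kˣ) (v : X.V) (w : Y.V) :
    tm (a • v) w = a • tm (X := X) v w := TensorProduct.smul_tmul' _ _ _

theorem e_smul {X Y : GradedLine k} (f : X ⟶ Y) (a : kˣ) (v : X.V) :
    f.e (a • v) = a • f.e v := f.e.map_smul (a : k) v

@[simp] theorem tensorHom_e {X Y X' Y' : GradedLine k} (f : X ⟶ X') (g : Y ⟶ Y') (v : X.V)
    (w : Y.V) : (f ⊗ₘ g).e (tm v w) = tm (f.e v) (g.e w) := rfl
@[simp] theorem whiskerLeft_e {X Y Y' : GradedLine k} (g : Y ⟶ Y') (v : X.V)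
    (w : Y.V) : (X ◁ g).e (tm v w) = tm v (g.e w) := rfl
@[simp] theorem whiskerRight_e {X X' Y : GradedLine k} (f : X ⟶ X') (v : X.V)
    (w : Y.V) : (f ▷ Y).e (tm v w) = tm (f.e v) w := rfl
@[simp] theorem associator_e (X Y Z : GradedLine k) (x : X.V) (y : Y.V) (z : Z.V) :
    (α_ X Y Z).hom.e (tm (tm x y) z) = tm x (tm y z) := rfl
@[simp] theorem associator_inv_e (X Y Z : GradedLine k) (x : X.V) (y : Y.V) (z : Z.V) :
    (α_ X Y Z).inv.e (tm x (tm y z)) = tm (tm x y) z := rfl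
@[simp] theorem leftUnitor_e (X : GradedLine k) (a : (𝟙_ (GradedLine k)).V) (x : X.V) :
    (λ_ X).hom.e (tm a x) = (show k from a) • x := rfl
@[simp] theorem rightUnitor_e (X : GradedLine k) (a : (𝟙_ (GradedLine k)).V) (x : X.V) :
    (ρ_ X).hom.e (tm x a) = (show k from a) • x := rfl

theorem tensor_hom_ext₃ {X Y Z W : GradedLine k} (f g : (X ⊗ Y) ⊗ Z ⟶ W)
    (h : ∀ x y z, f.e (tm (tm x y) z) = g.e (tm (tm x y) z)) : f = g :=
  Hom.ext (LinearEquiv.toLinearMap_injective (TensorProduct.ext_threefold h))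

theorem tensor_hom_ext₃' {X Y Z W : GradedLine k} (f g : X ⊗ (Y ⊗ Z) ⟶ W)
    (h : ∀ x y z, f.e (tm x (tm y z)) = g.e (tm x (tm y z))) : f = g :=
  Hom.ext (LinearEquiv.toLinearMap_injective (TensorProduct.ext_threefold' h))

theorem tensor_hom_ext₄ {X Y Z W V : GradedLine k} (f g : ((X ⊗ Y) ⊗ Z) ⊗ W ⟶ V)
    (h : ∀ x y z w, f.e (tm (tm (tm x y) z) w) = g.e (tm (tm (tm x y) z) w)) : f = g :=
  Hom.ext (LinearEquiv.toLinearMap_injective (TensorProduct.ext_fourfold h))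

instance : MonoidalCategory (GradedLine k) where
  tensorHom_def f g := tensor_hom_ext _ _ fun v w => by simp
  id_tensorHom_id X Y := tensor_hom_ext _ _ fun v w => by simp
  tensorHom_comp_tensorHom f₁ f₂ g₁ g₂ := tensor_hom_ext _ _ fun v w => by simp
  whiskerLeft_id X Y := tensor_hom_ext _ _ fun v w => by simp
  id_whiskerRight X Y := tensor_hom_ext _ _ fun v w => by simp
  associator_naturality f g h := tensor_hom_ext₃ _ _ fun x y z => by simp
  leftUnitor_naturality f := tensor_hom_ext _ _ fun a x => by
    simp only [comp_e, whiskerLeft_e, leftUnitor_e, map_smul]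
  rightUnitor_naturality f := tensor_hom_ext _ _ fun a x => by
    simp only [comp_e, whiskerRight_e, rightUnitor_e, map_smul]
  pentagon W X Y Z := tensor_hom_ext₄ _ _ fun w x y z => by simp
  triangle X Y := tensor_hom_ext₃ _ _ fun x a y => by
    simp only [comp_e, associator_e, whiskerLeft_e, whiskerRight_e, leftUnitor_e, rightUnitor_e]
    exact (TensorProduct.smul_tmul _ _ _).symm

/-- The commutativity constraint `v ⊗ w ↦ (-1) ^ (deg v * deg w) w ⊗ v`. -/
def braid (X Y : GradedLine k) : X ⊗ Y ≅ Y ⊗ X :=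
  mkIso ((TensorProduct.comm k X.V Y.V).trans (sgnEquiv (X.deg * Y.deg) _)) (add_comm _ _)

theorem braid_e (X Y : GradedLine k) (x : X.V) (y : Y.V) :
    (braid X Y).hom.e (tm x y) = sgn k (X.deg * Y.deg) • tm y x := rfl

theorem inv_apply {X Y : GradedLine k} (f : X ≅ Y) {x y} (h : f.hom.e x = y) :
    f.inv.e y = x := by
  rw [← h, ← comp_e, f.hom_inv_id, id_e]

instance : BraidedCategory (GradedLine k) where
  braiding := braid
  braiding_naturality_right X Y Z f := tensor_hom_ext _ _ fun x y => by
    simp only [comp_e, whiskerLeft_e, whiskerRight_e, braid_e, e_smul, f.deg_eq]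
  braiding_naturality_left f Z := tensor_hom_ext _ _ fun x y => by
    simp only [comp_e, whiskerLeft_e, whiskerRight_e, braid_e, e_smul, f.deg_eq]
  hexagon_forward X Y Z := tensor_hom_ext₃ _ _ fun x y z => by
    simp only [comp_e, associator_e, braid_e, e_smul, whiskerLeft_e, whiskerRight_e,
      smul_tm, tm_smul, tensor_deg, mul_add, sgn_add, mul_smul]
  hexagon_reverse X Y Z := tensor_hom_ext₃' _ _ fun x y z => by
    simp only [comp_e, associator_inv_e, braid_e, e_smul, whiskerLeft_e, whiskerRight_e,
      smul_tm, tm_smul, tensor_deg, add_mul, sgn_add, mul_smul]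
    rw [smul_comm]

instance : SymmetricCategory (GradedLine k) where
  symmetry X Y := tensor_hom_ext _ _ fun x y => by
    change (braid Y X).hom.e ((braid X Y).hom.e (tm x y)) = tm x y
    simp only [braid_e, e_smul]
    rw [mul_comm Y.deg, smul_smul, sgn_mul_self, one_smul]

/-- A nonzero scalar, as an automorphism of the unit object. -/
def scalarAut (a : kˣ) : Aut (𝟙_ (GradedLine k)) :=
  mkIso (X := 𝟙_ (GradedLine k)) (Y := 𝟙_ (GradedLine k))
    (LinearEquiv.smulOfUnit (M := k) a) rfl

end GradedLine

end GradedLines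

section TwoTate

/-- The two-dimensional local field `k'((t))((s))`. -/
abbrev LL (k' : Type u) [Field k'] : Type u := LaurentSeries (LaurentSeries k')

namespace LL

variable (k : Type u) {k' : Type u} [Field k] [Field k'] [Algebra k k']

/-- The subspace `s ^ a k'((t))[[s]]`. -/
def S (a : ℤ) : Submodule k (LL k') where
  carrier := {x | ∀ i < a, x.coeff i = 0}
  add_mem' hx hy i hi := by simp [hx i hi, hy i hi]
  zero_mem' i _ := rfl
  smul_mem' c x hx i hi := by simp [hx i hi]

/-- The subspace of all `∑ x_i s ^ i` with `x_i ∈ t ^ n k'[[t]]` for `i < m`; its image in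
`k'((t))((s)) / s ^ m k'((t))[[s]]` is `t ^ n k'[[t]]((s)) / s ^ m`. -/
def Nbd (m n : ℤ) : Submodule k (LL k') where
  carrier := {x | ∀ i < m, ∀ j < n, (x.coeff i).coeff j = 0}
  add_mem' hx hy i hi j hj := by simp [hx i hi j hj, hy i hi j hj]
  zero_mem' i _ j _ := rfl
  smul_mem' c x hx i hi j hj := by simp [hx i hi j hj]

variable {k}

theorem S_anti {a b : ℤ} (h : a ≤ b) : S k b ≤ S (k' := k') k a :=
  fun _ hx i hi => hx i (hi.trans_le h)

theorem S_le_Nbd (m n : ℤ) : S k m ≤ Nbd (k' := k') k m n :=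
  fun x hx i hi j _ => by rw [hx i hi]; rfl

theorem Nbd_anti {m m' n n' : ℤ} (h : m ≤ m') (h' : n ≤ n') :
    Nbd k m' n' ≤ Nbd (k' := k') k m n :=
  fun _ hx i hi j hj => hx i (hi.trans_le h) j (hj.trans_le h')

/-- Endomorphisms of the `2`-Tate space `k'((t))((s)) = colim_a lim_m S_a / S_m`: for every `a`
there is `b` with `f (S_a) ⊆ S_b`, and for every `m` there is `m'` such that `f` induces a
morphism of Tate spaces from `S_a / S_m'` to `S_b / S_m`, that is, a linear map which is
continuous and maps bounded sets to bounded sets. -/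
structure IsTateHom (f : LL k' →ₗ[k] LL k') : Prop where
  map_S : ∀ a, ∃ b, ∀ x ∈ S k a, f x ∈ S k b
  map_Nbd : ∀ a m, ∃ m', (∀ n, ∃ n', ∀ x ∈ S k a ⊓ Nbd k m' n', f x ∈ Nbd k m n) ∧
    (∀ n', ∃ n, ∀ x ∈ S k a ⊓ Nbd k m' n', f x ∈ Nbd k m n)

theorem IsTateHom.id : IsTateHom (LinearMap.id : LL k' →ₗ[k] LL k') where
  map_S a := ⟨a, fun _ h => h⟩
  map_Nbd _ m := ⟨m, fun n => ⟨n, fun _ h => h.2⟩, fun n => ⟨n, fun _ h => h.2⟩⟩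

theorem IsTateHom.comp {f g : LL k' →ₗ[k] LL k'} (hf : IsTateHom f) (hg : IsTateHom g) :
    IsTateHom (f ∘ₗ g) where
  map_S a := by
    obtain ⟨b, hb⟩ := hg.map_S a
    obtain ⟨c, hc⟩ := hf.map_S b
    exact ⟨c, fun x hx => hc _ (hb x hx)⟩
  map_Nbd a m := by
    obtain ⟨b, hb⟩ := hg.map_S a
    obtain ⟨m₁, h₁, h₁'⟩ := hf.map_Nbd b m
    obtain ⟨m₂, h₂, h₂'⟩ := hg.map_Nbd a m₁
    refine ⟨m₂, fun n => ?_, fun n => ?_⟩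
    · obtain ⟨n₁, h⟩ := h₁ n
      obtain ⟨n₂, h'⟩ := h₂ n₁
      exact ⟨n₂, fun x hx => h _ ⟨hb x hx.1, h' x hx⟩⟩
    · obtain ⟨n₁, h'⟩ := h₂' n
      obtain ⟨n₂, h⟩ := h₁' n₁
      exact ⟨n₂, fun x hx => h _ ⟨hb x hx.1, h' x hx⟩⟩

theorem IsTateHom.exists_S {f : LL k' →ₗ[k] LL k'} (hf : IsTateHom f) (m : ℤ) :
    ∃ b, ∀ x ∈ S k b, f x ∈ S k m := by
  obtain ⟨m', h, -⟩ := hf.map_Nbd 0 m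
  refine ⟨max 0 m', fun x hx i hi => HahnSeries.ext (funext fun j => ?_)⟩
  obtain ⟨n', h'⟩ := h (j + 1)
  exact h' x ⟨S_anti (le_max_left _ _) hx, S_le_Nbd _ _ (S_anti (le_max_right _ _) hx)⟩ i hi j
    (by omega)

variable (k k')

/-- The automorphism group `TateGL` of the `2`-Tate space `k'((t))((s))` over `k`. -/
def TateGL : Subgroup (LL k' ≃ₗ[k] LL k') where
  carrier := {g | IsTateHom g.toLinearMap ∧ IsTateHom g.symm.toLinearMap}
  mul_mem' ha hb := ⟨ha.1.comp hb.1, hb.2.comp ha.2⟩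
  one_mem' := ⟨IsTateHom.id, IsTateHom.id⟩
  inv_mem' ha := ⟨ha.2, ha.1⟩

variable {k k'}

theorem mul_vanish {R : Type*} [CommRing R] {x y : HahnSeries ℤ R} {a b : ℤ}
    (hx : ∀ i < a, x.coeff i = 0) (hy : ∀ i < b, y.coeff i = 0) :
    ∀ i < a + b, (x * y).coeff i = 0 := by
  intro i hi
  rw [HahnSeries.coeff_mul]
  refine Finset.sum_eq_zero fun p hp => ?_
  obtain ⟨-, -, h⟩ := Finset.mem_antidiagonal.1 hp
  by_cases h1 : p.1 < a
  · rw [hx _ h1, zero_mul]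
  · rw [hy p.2 (by omega), mul_zero]

theorem exists_vanish {R : Type*} [Zero R] (x : HahnSeries ℤ R) :
    ∃ a, ∀ i < a, x.coeff i = 0 :=
  ⟨x.order, fun _ hi => HahnSeries.coeff_eq_zero_of_lt_order hi⟩

theorem exists_vanish_finset {R ι : Type*} [Zero R] (s : Finset ι) (x : ι → HahnSeries ℤ R) :
    ∃ a, ∀ p ∈ s, ∀ i < a, (x p).coeff i = 0 := by
  classical
  induction s using Finset.induction_on with
  | empty => exact ⟨0, by simp⟩
  | insert p s _ ih =>
    obtain ⟨a, ha⟩ := ih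
    obtain ⟨b, hb⟩ := exists_vanish (x p)
    refine ⟨min a b, fun q hq i hi => ?_⟩
    rcases Finset.mem_insert.1 hq with rfl | hq
    · exact hb i (hi.trans_le (min_le_right _ _))
    · exact ha q hq i (hi.trans_le (min_le_left _ _))

theorem smul_eq (c : k) (x : LL k') :
    c • x = HahnSeries.C (HahnSeries.C (algebraMap k k' c)) * x := by
  ext i j
  simp [Algebra.smul_def]

variable (k) in
/-- Multiplication by `f`. -/
def mulMap (f : LL k') : LL k' →ₗ[k] LL k' where
  toFun x := f * x
  map_add' := mul_add f
  map_smul' c x := by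
    rw [smul_eq, mul_left_comm, ← smul_eq, RingHom.id_apply]

theorem isTateHom_mul (f : LL k') : IsTateHom (mulMap k f) := by
  obtain ⟨c, hc⟩ := exists_vanish f
  refine ⟨fun a => ⟨c + a, fun x hx => mul_vanish hc hx⟩, fun a m => ⟨m - c, ?_⟩⟩
  obtain ⟨d, hd⟩ := exists_vanish_finset (Finset.Ico c (m - a)) f.coeff
  have key : ∀ n, ∀ x ∈ S k a ⊓ Nbd k (m - c) n, f * x ∈ Nbd k m (d + n) := by
    intro n x hx i hi j hj
    rw [HahnSeries.coeff_mul, HahnSeries.coeff_sum]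
    refine Finset.sum_eq_zero fun p hp => ?_
    obtain ⟨-, -, h⟩ := Finset.mem_antidiagonal.1 hp
    by_cases h1 : p.1 < c
    · rw [hc _ h1, zero_mul]; rfl
    by_cases h2 : p.2 < a
    · rw [hx.1 _ h2, mul_zero]; rfl
    exact mul_vanish (hd p.1 (Finset.mem_Ico.2 (by omega))) (hx.2 p.2 (by omega)) j hj
  refine ⟨fun n => ⟨n - d, fun x hx => ?_⟩, fun n => ⟨d + n, key n⟩⟩
  simpa [mulMap] using key _ x hx

variable (k) in
/-- The action of `k'((t))((s))ˣ` on `k'((t))((s))` by multiplication. -/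
def mulGL (f : (LL k')ˣ) : TateGL k k' :=
  ⟨LinearEquiv.ofLinearMap (mulMap k (f : LL k')) (mulMap k (f⁻¹ : (LL k')ˣ))
    (by ext1 x; simp [mulMap]) (by ext1 x; simp [mulMap]), isTateHom_mul _, isTateHom_mul _⟩

/-- The lattices of the `2`-Tate space: the subspaces lying between two of the `S_a` and closed
in `k'((t))((s))`. -/
structure IsLattice (A : Submodule k (LL k')) : Prop where
  exists_le : ∃ a, A ≤ S k a
  exists_ge : ∃ b, S k b ≤ A
  closed : ∀ x, (∀ m n, x ∈ A ⊔ Nbd k m n) → x ∈ A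

theorem IsLattice.inf {A B : Submodule k (LL k')} (hA : IsLattice A) (hB : IsLattice B) :
    IsLattice (A ⊓ B) where
  exists_le := hA.exists_le.imp fun _ h => inf_le_left.trans h
  exists_ge := by
    obtain ⟨a, ha⟩ := hA.exists_ge
    obtain ⟨b, hb⟩ := hB.exists_ge
    exact ⟨max a b, le_inf ((S_anti (le_max_left _ _)).trans ha)
      ((S_anti (le_max_right _ _)).trans hb)⟩
  closed x hx := ⟨hA.closed x fun m n => sup_le_sup_right (inf_le_left : A ⊓ B ≤ A) _ (hx m n),
    hB.closed x fun m n => sup_le_sup_right (inf_le_right : A ⊓ B ≤ B) _ (hx m n)⟩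

/-- For lattices `N ≤ A`, so that `A / N` is a Tate space: `U / N` is a lattice of `A / N`, that
is, an open and bounded subspace. -/
structure IsLattice₁ (A N U : Submodule k (LL k')) : Prop where
  ge : N ≤ U
  le : U ≤ A
  isOpen : ∃ m n, A ⊓ Nbd k m n ≤ U
  bounded : ∀ m, ∃ n, U ≤ Nbd k m n ⊔ N

/-- Image of a subspace under `g`. -/
abbrev im (g : TateGL k k') (A : Submodule k (LL k')) : Submodule k (LL k') :=
  A.map (g : LL k' ≃ₗ[k] LL k').toLinearMap

theorem mem_im {g : TateGL k k'} {A : Submodule k (LL k')} {x : LL k'} :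
    x ∈ im g A ↔ (g : LL k' ≃ₗ[k] LL k').symm x ∈ A :=
  ⟨by rintro ⟨y, hy, rfl⟩; simpa using hy, fun h => ⟨_, h, by simp⟩⟩

theorem mem_of_forall_S {A : Submodule k (LL k')} {a : ℤ} (hA : A ≤ S k a) {x : LL k'}
    (hx : ∀ m n, x ∈ A ⊔ Nbd k m n) : x ∈ S k a := by
  intro i hi
  ext j
  obtain ⟨y, hy, z, hz, rfl⟩ := Submodule.mem_sup.1 (hx (i + 1) (j + 1))
  rw [HahnSeries.coeff_add, hA hy i hi, zero_add]
  exact hz i (by omega) j (by omega)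

theorem IsLattice.im {A : Submodule k (LL k')} (hA : IsLattice A) (g : TateGL k k') :
    IsLattice (im g A) := by
  obtain ⟨a, ha⟩ := hA.exists_le
  obtain ⟨b, hb⟩ := hA.exists_ge
  obtain ⟨a', ha'⟩ := g.2.1.map_S a
  have hle : LL.im g A ≤ S k a' := by
    rintro _ ⟨x, hx, rfl⟩
    exact ha' x (ha hx)
  refine ⟨⟨a', hle⟩, ?_, fun x hx => ?_⟩
  · obtain ⟨b', hb'⟩ := g.2.2.exists_S b
    exact ⟨b', fun x hx => mem_im.2 (hb (hb' x hx))⟩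
  · have hxa := mem_of_forall_S hle hx
    refine mem_im.2 (hA.closed _ fun m n => ?_)
    obtain ⟨m', h, -⟩ := g.2.2.map_Nbd a' m
    obtain ⟨n', h'⟩ := h n
    obtain ⟨y, hy, z, hz, rfl⟩ := Submodule.mem_sup.1 (hx m' n')
    rw [map_add]
    refine Submodule.add_mem_sup (mem_im.1 hy) (h' z ⟨?_, hz⟩)
    simpa using sub_mem hxa (hle hy)

theorem Nbd_le_sup {m n a : ℤ} (x : LL k') (hx : x ∈ S k a ⊓ Nbd k m n) (m' : ℤ) :
    ∃ y ∈ S k a ⊓ Nbd k m' n, x - y ∈ S k m := by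
  refine ⟨⟨fun i => if i < m then x.coeff i else 0, x.isPWO_support.mono fun i hi => ?_⟩,
    ⟨fun i hi => ?_, fun i hi j hj => ?_⟩, fun i hi => ?_⟩
  · intro h
    simp [h] at hi
  · simp [hx.1 i hi]
  · by_cases h : i < m
    · simpa [h] using hx.2 i h j hj
    · simp [h]
  · simp [hi]

theorem IsLattice₁.im {A N U : Submodule k (LL k')} (hA : IsLattice A) (hN : IsLattice N)
    (h : IsLattice₁ A N U) (g : TateGL k k') : IsLattice₁ (im g A) (im g N) (im g U) := by
  obtain ⟨a, ha⟩ := hA.exists_le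
  obtain ⟨b, hb⟩ := hN.exists_ge
  refine ⟨Submodule.map_mono h.ge, Submodule.map_mono h.le, ?_, fun m => ?_⟩
  · obtain ⟨a', ha'⟩ := g.2.1.map_S a
    obtain ⟨m, n, hmn⟩ := h.isOpen
    obtain ⟨m', h₁, -⟩ := g.2.2.map_Nbd a' m
    obtain ⟨n', h₂⟩ := h₁ n
    refine ⟨m', n', fun x hx => mem_im.2 (hmn ⟨mem_im.1 hx.1, h₂ x ⟨?_, hx.2⟩⟩)⟩
    obtain ⟨y, hy, rfl⟩ := hx.1
    exact ha' y (ha hy)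
  · obtain ⟨m', -, h₁⟩ := g.2.1.map_Nbd a m
    obtain ⟨n', h₂⟩ := h.bounded b
    obtain ⟨n, h₃⟩ := h₁ n'
    refine ⟨n, ?_⟩
    rintro _ ⟨x, hx, rfl⟩
    obtain ⟨z, hz, w, hw, rfl⟩ := Submodule.mem_sup.1 (h₂ hx)
    have hza : z ∈ S k a := by
      simpa using sub_mem (ha (h.le hx)) (ha ((h.ge.trans h.le) hw))
    obtain ⟨y, hy, hy'⟩ := Nbd_le_sup z ⟨hza, hz⟩ m'
    have : z + w = y + ((z - y) + w) := by ring
    rw [this, map_add]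
    exact Submodule.add_mem_sup (h₃ y hy) ⟨_, add_mem (hb hy') hw, rfl⟩

variable (k k')

/-- The subspaces of `k'((t))((s))`, such as `k'[[t]]((s))`, whose image in every subquotient
`A / N` (`N ≤ A` lattices) is a lattice of the Tate space `A / N`. -/
def Colat : Type u :=
  {M : Submodule k (LL k') // ∀ A N : Submodule k (LL k'), IsLattice A → IsLattice N → N ≤ A →
    IsLattice₁ A N (M ⊓ A ⊔ N)}

variable {k k'}

theorem comap_inf_sup (g : TateGL k k') (M A N : Submodule k (LL k')) :
    M.comap (g : LL k' ≃ₗ[k] LL k').toLinearMap ⊓ A ⊔ N = im g⁻¹ (M ⊓ im g A ⊔ im g N) := by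
  apply le_antisymm
  · intro x hx
    obtain ⟨y, hy, z, hz, rfl⟩ := Submodule.mem_sup.1 hx
    exact ⟨(g : LL k' ≃ₗ[k] LL k') (y + z), by
      rw [map_add]
      exact Submodule.add_mem_sup ⟨hy.1, y, hy.2, rfl⟩ ⟨z, hz, rfl⟩, by
      exact (g : LL k' ≃ₗ[k] LL k').symm_apply_apply _⟩
  · rintro _ ⟨x, hx, rfl⟩
    obtain ⟨y, ⟨hy, w, hw, rfl⟩, _, ⟨z, hz, rfl⟩, rfl⟩ := Submodule.mem_sup.1 hx
    rw [← map_add]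
    change (g : LL k' ≃ₗ[k] LL k').symm ((g : LL k' ≃ₗ[k] LL k') (w + z)) ∈ _
    rw [LinearEquiv.symm_apply_apply]
    exact Submodule.add_mem_sup ⟨hy, hw⟩ hz

/-- The inverse image `g⁻¹ M`. -/
def act (g : TateGL k k') (M : Colat k k') : Colat k k' :=
  ⟨M.1.comap (g : LL k' ≃ₗ[k] LL k').toLinearMap, fun A N hA hN h => by
    rw [comap_inf_sup]
    have h' := (M.2 _ _ (hA.im g) (hN.im g) (Submodule.map_mono h)).im (hA.im g) (hN.im g) g⁻¹
    have key : ∀ B : Submodule k (LL k'), im g⁻¹ (im g B) = B := fun B => by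
      ext x
      rw [mem_im, mem_im]
      exact iff_of_eq (congrArg (· ∈ B) ((g : LL k' ≃ₗ[k] LL k').symm_apply_apply x))
    rwa [key, key] at h'⟩

/-- `M' = M + k v` with `v ∉ M`. -/
structure IsStep (M M' : Colat k k') (v : LL k') : Prop where
  notMem : v ∉ M.1
  eq : M'.1 = M.1 ⊔ Submodule.span k {v}

theorem IsStep.act {M M' : Colat k k'} {v : LL k'} (h : IsStep M M' v) (g : TateGL k k') :
    IsStep (act g M) (act g M') ((g : LL k' ≃ₗ[k] LL k').symm v) := by
  refine ⟨fun hv => h.notMem (by simpa [LL.act] using hv), ?_⟩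
  ext x
  change (g : LL k' ≃ₗ[k] LL k') x ∈ M'.1 ↔ _
  rw [h.eq, Submodule.mem_sup, Submodule.mem_sup]
  constructor
  · rintro ⟨y, hy, z, hz, e⟩
    obtain ⟨c, rfl⟩ := Submodule.mem_span_singleton.1 hz
    refine ⟨(g : LL k' ≃ₗ[k] LL k').symm y, by simpa [LL.act] using hy, _,
      Submodule.smul_mem _ c (Submodule.mem_span_singleton_self _), ?_⟩
    rw [← map_smul, ← map_add, e, LinearEquiv.symm_apply_apply]
  · rintro ⟨y, hy, z, hz, e⟩
    obtain ⟨c, rfl⟩ := Submodule.mem_span_singleton.1 hz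
    refine ⟨(g : LL k' ≃ₗ[k] LL k') y, hy, _,
      Submodule.smul_mem _ c (Submodule.mem_span_singleton_self _), ?_⟩
    rw [← e, map_add, map_smul, LinearEquiv.apply_symm_apply]

/-- `M` and `M'` have the same image in `S_a / S_b`. -/
def Agree (a b : ℤ) (M M' : Colat k k') : Prop :=
  M.1 ⊓ S k a ⊔ S k b = M'.1 ⊓ S k a ⊔ S k b

theorem Agree.symm {a b : ℤ} {M M' : Colat k k'} (h : Agree a b M M') : Agree a b M' M :=
  Eq.symm h

theorem Agree.inf_sup {a b : ℤ} {M M' : Colat k k'} (h : Agree a b M M')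
    {A N : Submodule k (LL k')} (hA : A ≤ S k a) (hN : S k b ≤ N) (hNA : N ≤ A) :
    M.1 ⊓ A ⊔ N = M'.1 ⊓ A ⊔ N := by
  have key : ∀ M M' : Colat k k', Agree a b M M' → M.1 ⊓ A ⊔ N ≤ M'.1 ⊓ A ⊔ N := by
    intro M M' h
    refine sup_le (fun x hx => ?_) le_sup_right
    have hx' : x ∈ M'.1 ⊓ S k a ⊔ S k b := h ▸ Submodule.mem_sup_left ⟨hx.1, hA hx.2⟩
    obtain ⟨y, hy, z, hz, rfl⟩ := Submodule.mem_sup.1 hx'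
    refine Submodule.add_mem_sup ⟨hy.1, ?_⟩ (hN hz)
    simpa using sub_mem hx.2 (hNA (hN hz))
  exact le_antisymm (key M M' h) (key M' M h.symm)

theorem Agree.mono {a b a' b' : ℤ} (ha : a' ≤ a) (hb : b ≤ b') {M M' : Colat k k'}
    (h : Agree a' b' M M') : Agree a b M M' := by
  by_cases hab : a ≤ b
  · exact h.inf_sup (S_anti ha) (S_anti hb) (S_anti hab)
  · have key : ∀ M : Colat k k', M.1 ⊓ S k a ⊔ S k b = S k b := fun M =>
      sup_eq_right.2 (inf_le_right.trans (S_anti (not_le.1 hab).le))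
    rw [Agree, key, key]

theorem Agree.exists_act (g : TateGL k k') (a b : ℤ) :
    ∃ a' b', ∀ M M' : Colat k k', Agree a' b' M M' → Agree a b (LL.act g M) (LL.act g M') := by
  obtain ⟨a', ha'⟩ := g.2.1.map_S a
  obtain ⟨b', hb'⟩ := g.2.2.exists_S b
  refine ⟨a', b', ?_⟩
  by_cases hab : a ≤ b
  · have key : ∀ M M' : Colat k k', Agree a' b' M M' →
        (LL.act g M).1 ⊓ S k a ⊔ S k b ≤ (LL.act g M').1 ⊓ S k a ⊔ S k b := by
      intro M M' h
      refine sup_le (fun x hx => ?_) le_sup_right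
      have hx' : (g : LL k' ≃ₗ[k] LL k') x ∈ M'.1 ⊓ S k a' ⊔ S k b' :=
        h ▸ Submodule.mem_sup_left ⟨hx.1, ha' x hx.2⟩
      obtain ⟨y, hy, z, hz, e⟩ := Submodule.mem_sup.1 hx'
      have hz' := hb' z hz
      have e' : x = (g : LL k' ≃ₗ[k] LL k').symm y + (g : LL k' ≃ₗ[k] LL k').symm z := by
        rw [← map_add, e, LinearEquiv.symm_apply_apply]
      rw [e']
      refine Submodule.add_mem_sup ⟨by simpa [LL.act] using hy.1, ?_⟩ hz'
      rw [e'] at hx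
      simpa using sub_mem hx.2 (S_anti hab hz')
    exact fun M M' h => le_antisymm (key M M' h) (key M' M h.symm)
  · have key : ∀ M : Colat k k', M.1 ⊓ S k a ⊔ S k b = S k b := fun M =>
      sup_eq_right.2 (inf_le_right.trans (S_anti (not_le.1 hab).le))
    intro M M' _
    rw [Agree, key, key]

end LL

end TwoTate

section Systems

namespace LL

open GradedLine

variable (k k' : Type u) [Field k] [Field k'] [Algebra k k']

/-- A system of graded lines over `g ∈ GL`: a graded line for every `M`, and linear maps between
the lines of `M` and of `M + k v`, such that the line depends only on the image of `M` in some
fixed `S_a / S_b`. The systems which underlie the determinantal extension are singled out below;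
they play the role of formal expressions in relative determinantal theories. -/
structure Sys where
  g : TateGL k k'
  line : Colat k k' → GradedLine k
  step : ∀ {M M' : Colat k k'} {v : LL k'}, IsStep M M' v → ((line M).V →ₗ[k] (line M').V)
  stable : ∃ a b, ∀ M M', Agree a b M M' → line M = line M'

namespace Sys

variable {k k'}

/-- Morphisms of systems: compatible families of isomorphisms of graded lines which depend only on
the image of `M` in some fixed `S_a / S_b`. -/
@[ext]
structure Hom (X Y : Sys k k') where
  g_eq : X.g = Y.g
  app : ∀ M, X.line M ⟶ Y.line M
  comm : ∀ {M M' : Colat k k'} {v : LL k'} (h : IsStep M M' v) (x : (X.line M).V),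
    (app M').e (X.step h x) = Y.step h ((app M).e x)
  stable : ∃ a b, ∀ M M', Agree a b M M' → ∃ (hX : X.line M = X.line M')
    (hY : Y.line M = Y.line M'), app M ≫ eqToHom hY = eqToHom hX ≫ app M'

/-- Two windows are contained in a third one. -/
theorem exists_window {p q : Colat k k' → Colat k k' → Prop}
    (hp : ∃ a b, ∀ M M', Agree a b M M' → p M M') (hq : ∃ a b, ∀ M M', Agree a b M M' → q M M') :
    ∃ a b, ∀ M M', Agree a b M M' → p M M' ∧ q M M' := by
  obtain ⟨a, b, h⟩ := hp
  obtain ⟨a', b', h'⟩ := hq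
  exact ⟨min a a', max b b', fun M M' H =>
    ⟨h M M' (H.mono (min_le_left _ _) (le_max_left _ _)),
      h' M M' (H.mono (min_le_right _ _) (le_max_right _ _))⟩⟩

theorem exists_window_act {p : Colat k k' → Colat k k' → Prop} (g : TateGL k k')
    (hp : ∃ a b, ∀ M M', Agree a b M M' → p M M') :
    ∃ a b, ∀ M M', Agree a b M M' → p (act g M) (act g M') := by
  obtain ⟨a, b, h⟩ := hp
  obtain ⟨a', b', h'⟩ := Agree.exists_act g a b
  exact ⟨a', b', fun M M' H => h _ _ (h' M M' H)⟩

theorem window_mono {p q : Colat k k' → Colat k k' → Prop}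
    (hp : ∃ a b, ∀ M M', Agree a b M M' → p M M') (h : ∀ M M', p M M' → q M M') :
    ∃ a b, ∀ M M', Agree a b M M' → q M M' := by
  obtain ⟨a, b, H⟩ := hp
  exact ⟨a, b, fun M M' h' => h _ _ (H _ _ h')⟩

instance : Category (Sys k k') where
  Hom := Hom
  id X := ⟨rfl, fun M => 𝟙 _, fun h x => rfl, window_mono X.stable fun M M' h => ⟨h, h, by simp⟩⟩
  comp {X Y Z} f e := ⟨f.g_eq.trans e.g_eq, fun M => f.app M ≫ e.app M,
    fun h x => by rw [comp_e, f.comm, e.comm, comp_e],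
    window_mono (exists_window f.stable e.stable) fun M M' ⟨⟨h, _, h₁⟩, ⟨_, h', h₂⟩⟩ =>
      ⟨h, h', by rw [Category.assoc, h₂, reassoc_of% h₁]⟩⟩
  id_comp f := by ext; simp
  comp_id f := by ext; simp
  assoc f g h := by ext; simp

@[ext]
theorem hom_ext {X Y : Sys k k'} (f e : X ⟶ Y) (h : ∀ M, f.app M = e.app M) : f = e :=
  Hom.ext (funext h)

@[simp] theorem id_app (X : Sys k k') (M) : Hom.app (𝟙 X) M = 𝟙 _ := rfl
@[simp] theorem comp_app {X Y Z : Sys k k'} (f : X ⟶ Y) (e : Y ⟶ Z) (M) :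
    (f ≫ e).app M = f.app M ≫ e.app M := rfl

/-- A morphism of systems whose components are given isomorphisms is an isomorphism. -/
@[simps hom]
def isoOfHom {X Y : Sys k k'} (f : X ⟶ Y) (i : ∀ M, X.line M ≅ Y.line M)
    (hi : ∀ M, (i M).hom = f.app M) : X ≅ Y where
  hom := f
  inv := ⟨f.g_eq.symm, fun M => (i M).inv, fun {M M' v} h y => by
    obtain ⟨x, rfl⟩ := (f.app M).e.surjective y
    rw [← f.comm, ← hi, ← hi, inv_apply (i M') rfl, inv_apply (i M) rfl],
    window_mono f.stable fun M M' ⟨h, h', e⟩ => ⟨h', h, by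
      rw [← hi, ← hi] at e
      rw [Iso.inv_comp_eq, reassoc_of% e, Iso.hom_inv_id, Category.comp_id]⟩⟩
  hom_inv_id := by ext1 M; simp [← hi]
  inv_hom_id := by ext1 M; simp [← hi]

/-- The constant system of a graded line. -/
def const (x : GradedLine k) : Sys k k' where
  g := 1
  line _ := x
  step _ := LinearMap.id
  stable := ⟨0, 0, fun _ _ _ => rfl⟩

/-- The product of systems, `M ↦ X (M) ⊗ Y (g⁻¹ M)` for `X` over `g`. The sign in the steps comes
from moving the step of `Y` past that of `X`. -/
def mul (X Y : Sys k k') : Sys k k' where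
  g := X.g * Y.g
  line M := X.line M ⊗ Y.line (act X.g M)
  step {M M' _} h := (sgn k (((X.line M').deg - (X.line M).deg) * (Y.line (act X.g M)).deg) : k) •
    TensorProduct.map (X.step h) (Y.step (h.act X.g))
  stable := window_mono (exists_window X.stable (exists_window_act X.g Y.stable))
    fun _ _ h => by rw [h.1, h.2]

theorem mul_step (X Y : Sys k k') {M M' : Colat k k'} {v : LL k'} (h : IsStep M M' v)
    (x : (X.line M).V) (y : (Y.line (act X.g M)).V) :
    (mul X Y).step h (tm x y) =
      sgn k (((X.line M').deg - (X.line M).deg) * (Y.line (act X.g M)).deg) •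
        tm (X := X.line M') (Y := Y.line (act X.g M')) (X.step h x) (Y.step (h.act X.g) y) := rfl

theorem tensor_stable {A A' B B' C C' D D' : GradedLine k} {f : A ⟶ B} {f' : A' ⟶ B'}
    {e : C ⟶ D} {e' : C' ⟶ D'} (hA : A = A') (hB : B = B') (hC : C = C') (hD : D = D')
    (h : f ≫ eqToHom hB = eqToHom hA ≫ f') (h' : e ≫ eqToHom hD = eqToHom hC ≫ e') :
    ∃ (hX : A ⊗ C = A' ⊗ C') (hY : B ⊗ D = B' ⊗ D'),
      (f ⊗ₘ e) ≫ eqToHom hY = eqToHom hX ≫ (f' ⊗ₘ e') := by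
  subst hA hB hC hD
  refine ⟨rfl, rfl, ?_⟩
  simp only [eqToHom_refl, Category.comp_id, Category.id_comp] at h h' ⊢
  rw [h, h']

theorem line_act {g g' : TateGL k k'} (h : g = g') (Y : Sys k k') (M : Colat k k') :
    Y.line (act g M) = Y.line (act g' M) := by rw [h]

theorem step_act {g g' : TateGL k k'} (h : g = g') (Y : Sys k k') {M M' : Colat k k'}
    {v : LL k'} (hs : IsStep M M' v) (y : (Y.line (act g M)).V) :
    Hom.e (eqToHom (line_act h Y M')) (Y.step (hs.act g) y) =
      Y.step (hs.act g') (Hom.e (eqToHom (line_act h Y M)) y) := by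
  subst h
  rfl

theorem sgn_zero : sgn k 0 = 1 := zpow_zero _

theorem assoc_signs {U V W : Type*} [AddCommGroup U] [Module k U] [AddCommGroup V] [Module k V]
    [AddCommGroup W] [Module k W] {a b c d : kˣ} (h : a * b = c * d) (x : U) (y : V) (z : W) :
    TensorProduct.assoc k U V W (a • (b • (x ⊗ₜ[k] y)) ⊗ₜ[k] z) =
      c • (x ⊗ₜ[k] (d • (y ⊗ₜ[k] z))) := by
  simp only [Units.smul_def, ← TensorProduct.smul_tmul', TensorProduct.tmul_smul, map_smul,
    smul_smul, TensorProduct.assoc_tmul, ← Units.val_mul, h]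

theorem step_smul (X : Sys k k') {M M' : Colat k k'} {v : LL k'} (h : IsStep M M' v) (a : kˣ)
    (x : (X.line M).V) : X.step h (a • x) = a • X.step h x :=
  (X.step h).map_smul (a : k) x

theorem smul_congr {V : Type*} [AddCommGroup V] [Module k V] {a b : kˣ} {v w : V} (h : a = b)
    (h' : v = w) : a • v = b • w := by rw [h, h']

theorem tm_congr {X Y : GradedLine k} {v v' : X.V} {w w' : Y.V} (h : v = v') (h' : w = w') :
    tm v w = tm v' w' := by rw [h, h']

theorem comm_mul {X Y Z : Sys k k'} {M M' : Colat k k'} {v : LL k'}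
    (h : IsStep M M' v) {a : X.line M ⊗ Y.line (act X.g M) ⟶ Z.line M}
    {b : X.line M' ⊗ Y.line (act X.g M') ⟶ Z.line M'}
    (H : ∀ x y, b.e (sgn k (((X.line M').deg - (X.line M).deg) * (Y.line (act X.g M)).deg) •
      tm (X.step h x) (Y.step (h.act X.g) y)) = Z.step h (a.e (tm x y)))
    (z : ((mul X Y).line M).V) : b.e ((mul X Y).step h z) = Z.step h (a.e z) :=
  LinearMap.congr_fun (f := b.e.toLinearMap ∘ₗ (mul X Y).step h)
    (g := Z.step h ∘ₗ a.e.toLinearMap) (TensorProduct.ext' H) z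

/-- The product of morphisms of systems. -/
def mulHom {X X' Y Y' : Sys k k'} (f : X ⟶ X') (e : Y ⟶ Y') : mul X Y ⟶ mul X' Y' where
  g_eq := congrArg₂ (· * ·) f.g_eq e.g_eq
  app M := f.app M ⊗ₘ (e.app (act X.g M) ≫ eqToHom (line_act f.g_eq Y' M))
  comm {M M' v} h := by
    refine comm_mul (Z := mul X' Y') h fun x y => ?_
    refine (e_smul _ _ _).trans (Eq.trans ?_ (mul_step X' Y' h _ _).symm)
    refine smul_congr ?_ (tm_congr (f.comm h x) ?_)
    · rw [(f.app M').deg_eq, (f.app M).deg_eq,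
        (e.app (act X.g M) ≫ eqToHom (line_act f.g_eq Y' M)).deg_eq]
    · change Hom.e (eqToHom (line_act f.g_eq Y' M')) (Hom.e (e.app (act X.g M')) (Y.step _ y)) = _
      rw [e.comm, step_act f.g_eq Y' h]
      rfl
  stable := window_mono (exists_window f.stable (exists_window_act X.g e.stable))
    fun M M' ⟨⟨h₁, h₂, h⟩, ⟨h₁', h₂', h'⟩⟩ => by
      have h₃ : Y'.line (act X'.g M) = Y'.line (act X'.g M') := by
        rw [← line_act f.g_eq Y', ← line_act f.g_eq Y', h₂']
      refine tensor_stable h₁ h₂ h₁' h₃ h ?_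
      rw [← reassoc_of% h', Category.assoc, eqToHom_trans, eqToHom_trans]

theorem assoc_stable {A A' B B' C C' : GradedLine k} (hA : A = A') (hB : B = B') (hC : C = C') :
    ∃ (hX : (A ⊗ B) ⊗ C = (A' ⊗ B') ⊗ C') (hY : A ⊗ (B ⊗ C) = A' ⊗ (B' ⊗ C')),
      (α_ A B C).hom ≫ eqToHom hY = eqToHom hX ≫ (α_ A' B' C').hom := by
  subst hA hB hC
  exact ⟨rfl, rfl, by simp⟩

theorem leftUnitor_stable {A A' : GradedLine k} (hA : A = A') :
    ∃ (hX : 𝟙_ _ ⊗ A = 𝟙_ _ ⊗ A'), (λ_ A).hom ≫ eqToHom hA = eqToHom hX ≫ (λ_ A').hom := by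
  subst hA
  exact ⟨rfl, by simp⟩

theorem rightUnitor_stable {A A' : GradedLine k} (hA : A = A') :
    ∃ (hX : A ⊗ 𝟙_ _ = A' ⊗ 𝟙_ _), (ρ_ A).hom ≫ eqToHom hA = eqToHom hX ≫ (ρ_ A').hom := by
  subst hA
  exact ⟨rfl, by simp⟩

theorem braiding_stable (x : GradedLine k) {A A' : GradedLine k} (hA : A = A') :
    ∃ (hX : x ⊗ A = x ⊗ A') (hY : A ⊗ x = A' ⊗ x),
      (β_ x A).hom ≫ eqToHom hY = eqToHom hX ≫ (β_ x A').hom := by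
  subst hA
  exact ⟨rfl, rfl, by simp⟩

/-- Associativity of the product. -/
def mulAssoc (X Y Z : Sys k k') : mul (mul X Y) Z ≅ mul X (mul Y Z) :=
  isoOfHom
    { g_eq := mul_assoc _ _ _
      app := fun M => (α_ (X.line M) (Y.line (act X.g M)) (Z.line (act Y.g (act X.g M)))).hom
      comm := fun {M M' v} h => by
        intro w
        refine LinearMap.congr_fun
          (f := LinearEquiv.toLinearMap (Hom.e (α_ (X.line M') (Y.line (act X.g M'))
            (Z.line (act Y.g (act X.g M')))).hom) ∘ₗ (mul (mul X Y) Z).step h)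
          (g := (mul X (mul Y Z)).step h ∘ₗ
            LinearEquiv.toLinearMap (Hom.e (α_ (X.line M) (Y.line (act X.g M))
              (Z.line (act Y.g (act X.g M)))).hom))
          (TensorProduct.ext_threefold fun x y z => ?_) w
        change TensorProduct.assoc k (X.line M').V (Y.line (act X.g M')).V
          (Z.line (act Y.g (act X.g M'))).V
            (sgn k ((((X.line M').deg + (Y.line (act X.g M')).deg) -
              ((X.line M).deg + (Y.line (act X.g M)).deg)) *
                (Z.line (act Y.g (act X.g M))).deg) • (sgn k (((X.line M').deg -
                  (X.line M).deg) * (Y.line (act X.g M)).deg) •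
              (X.step h x ⊗ₜ[k] Y.step (h.act X.g) y)) ⊗ₜ[k] (Z.step _ z)) =
          sgn k (((X.line M').deg - (X.line M).deg) * ((Y.line (act X.g M)).deg +
            (Z.line (act Y.g (act X.g M))).deg)) • (X.step h x ⊗ₜ[k]
              (sgn k (((Y.line (act X.g M')).deg - (Y.line (act X.g M)).deg) *
                (Z.line (act Y.g (act X.g M))).deg) •
                (Y.step (h.act X.g) y ⊗ₜ[k] Z.step _ z)))
        refine assoc_signs ?_ _ _ _
        rw [← sgn_add, ← sgn_add]
        congr 1
        ring
      stable := window_mono (exists_window X.stable (exists_window_act X.g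
        (exists_window Y.stable (exists_window_act Y.g Z.stable))))
          fun _ _ h => assoc_stable h.1 h.2.1 h.2.2 }
    (fun M => α_ (X.line M) (Y.line (act X.g M)) (Z.line (act Y.g (act X.g M)))) fun _ => rfl

/-- Left unit. -/
def oneMul (X : Sys k k') : mul (const (𝟙_ _)) X ≅ X :=
  isoOfHom
    { g_eq := one_mul _
      app := fun M => (λ_ (X.line M)).hom
      comm := fun {M M' v} h => by
        refine comm_mul (Z := X) h fun x y => ?_
        change Hom.e (λ_ (X.line M')).hom (sgn k ((0 - 0) * _) •
          tm (X := 𝟙_ _) (Y := X.line M') x (X.step h y)) = X.step h ((show k from x) • y)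
        rw [sub_zero, zero_mul, sgn_zero, one_smul]
        exact (LinearMap.map_smul (X.step h) (show k from x) y).symm
      stable := window_mono X.stable fun _ _ h => by
        obtain ⟨h', e⟩ := leftUnitor_stable h
        exact ⟨h', h, e⟩ }
    (fun M => λ_ (X.line M)) fun _ => rfl

/-- Right unit. -/
def mulOne (X : Sys k k') : mul X (const (𝟙_ _)) ≅ X :=
  isoOfHom
    { g_eq := mul_one _
      app := fun M => (ρ_ (X.line M)).hom
      comm := fun {M M' v} h => by
        refine comm_mul (Z := X) h fun x y => ?_
        change Hom.e (ρ_ (X.line M')).hom (sgn k (_ * 0) •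
          tm (X := X.line M') (Y := 𝟙_ _) (X.step h x) y) = X.step h ((show k from y) • x)
        rw [mul_zero, sgn_zero, one_smul]
        exact (LinearMap.map_smul (X.step h) (show k from y) x).symm
      stable := window_mono X.stable fun _ _ h => by
        obtain ⟨h', e⟩ := rightUnitor_stable h
        exact ⟨h', h, e⟩ }
    (fun M => ρ_ (X.line M)) fun _ => rfl

/-- Constant systems are central. -/
def constSwap (x : GradedLine k) (X : Sys k k') : mul (const x) X ≅ mul X (const x) :=
  isoOfHom
    { g_eq := (one_mul _).trans (mul_one _).symm
      app := fun M => (β_ x (X.line M)).hom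
      comm := fun {M M' v} h => by
        refine comm_mul (Z := mul X (const x)) h fun a b => ?_
        change Hom.e (braid x (X.line M')).hom (sgn k ((x.deg - x.deg) * _) •
          tm (Y := X.line M') a (X.step h b)) =
            (mul X (const x)).step h (sgn k (x.deg * (X.line M).deg) • tm (X := X.line M) b a)
        rw [sub_self, zero_mul, sgn_zero, one_smul]
        refine (braid_e x (X.line M') a (X.step h b)).trans ?_
        refine Eq.trans ?_ (step_smul (mul X (const x)) h _ _).symm
        refine Eq.trans ?_ (congrArg _ (mul_step X (const x) h b a).symm)
        refine Eq.trans (smul_congr ?_ rfl) (smul_smul _ _ _).symm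
        rw [← sgn_add]
        change _ = sgn k (_ + _ * x.deg)
        congr 1
        ring
      stable := window_mono X.stable fun _ _ h => braiding_stable x h }
    (fun M => β_ x (X.line M)) fun _ => rfl

theorem app_act {g g' : TateGL k k'} (h : g = g') {Y Y' : Sys k k'} (e : Y ⟶ Y')
    (M : Colat k k') : eqToHom (line_act h Y M) ≫ e.app (act g' M) =
      e.app (act g M) ≫ eqToHom (line_act h Y' M) := by
  subst h
  simp

instance : MonoidalCategoryStruct (Sys k k') where
  tensorObj := mul
  tensorUnit := const (𝟙_ _)
  tensorHom := mulHom
  whiskerLeft X _ _ e := mulHom (𝟙 X) e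
  whiskerRight f Y := mulHom f (𝟙 Y)
  associator := mulAssoc
  leftUnitor := oneMul
  rightUnitor := mulOne

theorem comp_eqToHom_mul {g g' : TateGL k k'} (h : g = g') (Y Z : Sys k k') (M : Colat k k')
    {A B : GradedLine k} (a : A ⟶ Y.line (act g M)) (b : B ⟶ Z.line (act Y.g (act g M))) :
    (a ≫ eqToHom (line_act h Y M)) ⊗ₘ (b ≫ eqToHom (by rw [h])) =
      (a ⊗ₘ b) ≫ eqToHom (line_act h (mul Y Z) M) := by
  subst h
  simp only [eqToHom_refl, Category.comp_id]
  exact (Category.comp_id _).symm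

instance : MonoidalCategory (Sys k k') := MonoidalCategory.ofTensorHom
  (id_tensorHom_id := fun X Y => by
    ext1 M
    change 𝟙 _ ⊗ₘ (𝟙 _ ≫ 𝟙 _) = 𝟙 _
    rw [Category.comp_id, id_tensorHom_id])
  (id_tensorHom := fun X _ _ f => rfl)
  (tensorHom_id := fun f Y => rfl)
  (tensorHom_comp_tensorHom := fun {X₁ Y₁ Z₁ X₂ Y₂ Z₂} f₁ f₂ g₁ g₂ => by
    ext1 M
    change (_ ⊗ₘ _) ≫ (_ ⊗ₘ _) = (_ ⊗ₘ _)
    rw [MonoidalCategory.tensorHom_comp_tensorHom, Category.assoc,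
      reassoc_of% app_act f₁.g_eq g₂, eqToHom_trans, comp_app, comp_app, Category.assoc])
  (associator_naturality := fun {X₁ X₂ X₃ Y₁ Y₂ Y₃} f₁ f₂ f₃ => by
    ext1 M
    have key : ∀ {A B C A' B' C' : GradedLine k} (f : A ⟶ A') (e : B ⟶ B') (c : C ⟶ C'),
      ((f ⊗ₘ e) ⊗ₘ c) ≫ (α_ A' B' C').hom = (α_ A B C).hom ≫ (f ⊗ₘ (e ⊗ₘ c)) :=
        fun f e c => MonoidalCategory.associator_naturality f e c
    refine (key (f₁.app M) (f₂.app (act X₁.g M) ≫ eqToHom (line_act f₁.g_eq Y₂ M)) _).trans ?_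
    refine congrArg (fun c => (α_ _ _ _).hom ≫ c) (congrArg (fun c => _ ⊗ₘ c) ?_)
    refine Eq.trans (congrArg (fun c => (f₂.app (act X₁.g M) ≫
      eqToHom (line_act f₁.g_eq Y₂ M)) ⊗ₘ c) ?_) (comp_eqToHom_mul f₁.g_eq Y₂ Y₃ M _
        (f₃.app (act X₂.g (act X₁.g M)) ≫ eqToHom (line_act f₂.g_eq Y₃ (act X₁.g M))))
    exact (congrArg (fun c => f₃.app (act X₂.g (act X₁.g M)) ≫ c)
      (eqToHom_trans _ _).symm).trans (Category.assoc _ _ _).symm)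
  (leftUnitor_naturality := fun {X Y} f => by
    ext1 M
    change (𝟙 _ ⊗ₘ (f.app M ≫ 𝟙 _)) ≫ (λ_ _).hom = (λ_ _).hom ≫ f.app M
    rw [Category.comp_id, id_tensorHom]
    exact MonoidalCategory.leftUnitor_naturality _)
  (rightUnitor_naturality := fun {X Y} f => by
    ext1 M
    change (f.app M ⊗ₘ (𝟙 _ ≫ 𝟙 _)) ≫ (ρ_ _).hom = (ρ_ _).hom ≫ f.app M
    rw [Category.comp_id, tensorHom_id]
    exact MonoidalCategory.rightUnitor_naturality _)
  (pentagon := fun W X Y Z => by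
    ext1 M
    change (_ ⊗ₘ (𝟙 _ ≫ 𝟙 _)) ≫ _ ≫ (𝟙 _ ⊗ₘ (_ ≫ 𝟙 _)) = _
    simp only [Category.comp_id, tensorHom_id, id_tensorHom]
    exact MonoidalCategory.pentagon _ _ _ _)
  (triangle := fun X Y => by
    ext1 M
    change _ ≫ (𝟙 _ ⊗ₘ (_ ≫ 𝟙 _)) = _ ⊗ₘ (𝟙 _ ≫ 𝟙 _)
    simp only [Category.comp_id, tensorHom_id, id_tensorHom]
    exact MonoidalCategory.triangle _ _)

end Sys

end LL

end Systems

section Determinants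

namespace LL

open GradedLine TensorProduct

variable {k k' : Type u} [Field k] [Field k'] [Algebra k k']

/-- The quotient `U' / U`, for `U ≤ U'`, as a subspace of `k'((t))((s)) / U`. -/
abbrev quot (U U' : Submodule k (LL k')) : Submodule k (LL k' ⧸ U) := U'.map U.mkQ

/-- The determinant line of a finite-dimensional vector space: its top exterior power, in degree
the dimension. -/
def det (k : Type u) [Field k] (W : Type u) [AddCommGroup W] [Module k W] : GradedLine k where
  V := ⋀[k]^(Module.finrank k W) W
  finrank_eq := by
    by_cases h : Module.Finite k W
    · rw [exteriorPower.finrank_eq, Nat.choose_self]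
    · rw [Module.finrank_of_not_finite h, (exteriorPower.zeroEquiv k W).finrank_eq,
        Module.finrank_self]
  deg := Module.finrank k W

/-- The determinant line of `U' / U`. -/
abbrev detLine (U U' : Submodule k (LL k')) : GradedLine k := det k (quot U U')

/-- The element `a₁ ∧ ⋯ ∧ a_n` of the determinant of `U' / U`, with `n = dim (U' / U)`. -/
def decomp {U U' : Submodule k (LL k')} {n : ℕ} (hn : Module.finrank k (quot U U') = n)
    (a : Fin n → U') : (detLine U U').V :=
  exteriorPower.ιMulti k _ fun i =>
    (⟨U.mkQ (a (Fin.cast hn i)), Submodule.mem_map_of_mem (a (Fin.cast hn i)).2⟩ : quot U U')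

/-- The lattices of the Tate space `A / N`, as subspaces `N ≤ U ≤ A`. -/
abbrev Lattice₁ (A N : Submodule k (LL k')) : Type u :=
  {U : Submodule k (LL k') // IsLattice₁ A N U}

/-- A graded determinantal theory on the Tate space `A / N`: graded lines `Δ (U)` for the lattices
`U` of `A / N`, with isomorphisms `Δ (U) ⊗ det (U' / U) ≅ Δ (U')` for `U ≤ U'`, compatible with
the isomorphisms `det (U' / U) ⊗ det (U'' / U') ≅ det (U'' / U)` for `U ≤ U' ≤ U''`. -/
structure DetTheory (A N : Submodule k (LL k')) where
  Δ : Lattice₁ A N → GradedLine k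
  iso : ∀ U U' : Lattice₁ A N, U.1 ≤ U'.1 → (Δ U ⊗ detLine U.1 U'.1 ≅ Δ U')
  cocycle : ∀ (U U' U'' : Lattice₁ A N) (h : U.1 ≤ U'.1) (h' : U'.1 ≤ U''.1) {p q : ℕ}
    (hp : Module.finrank k (quot U.1 U'.1) = p)
    (hq : Module.finrank k (quot U'.1 U''.1) = q)
    (hpq : Module.finrank k (quot U.1 U''.1) = p + q)
    (a : Fin p → U'.1) (b : Fin q → U''.1) (x : (Δ U).V),
    (iso U' U'' h').hom.e (tm ((iso U U' h).hom.e (tm x (decomp hp a))) (decomp hq b)) =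
      (iso U U'' (h.trans h')).hom.e
        (tm x (decomp hpq (Fin.append (fun i => Submodule.inclusion h' (a i)) b)))

namespace DetTheory

variable {A N : Submodule k (LL k')} (D : DetTheory A N)

/-- The isomorphism `Δ (U) → Δ (U')`, `x ↦ x ∧ a`, when `a` spans `U' / U`, or `x ↦ x` when
`U = U'`. -/
def wedge (U U' : Lattice₁ A N) (h : U.1 ≤ U'.1) (a : U'.1) : (D.Δ U).V →ₗ[k] (D.Δ U').V :=
  (D.iso U U' h).hom.e.toLinearMap ∘ₗ
    (TensorProduct.mk k (D.Δ U).V (detLine U.1 U'.1).V).flip (decomp rfl fun _ => a)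

end DetTheory

/-- The graded line `Hom (X, Y)`, in degree `deg Y - deg X`. -/
def homLine (X Y : GradedLine k) : GradedLine k where
  V := X.V →ₗ[k] Y.V
  finrank_eq := by
    have := Module.finite_of_finrank_pos (R := k) (M := X.V) (by rw [X.finrank_eq]; exact one_pos)
    have := Module.finite_of_finrank_pos (R := k) (M := Y.V) (by rw [Y.finrank_eq]; exact one_pos)
    rw [Module.finrank_linearMap, X.finrank_eq, Y.finrank_eq]
  deg := Y.deg - X.deg

/-- The map `f ↦ b ∘ f ∘ a`. -/
def homMap {V V' W W' : Type*} [AddCommGroup V] [Module k V] [AddCommGroup W] [Module k W]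
    [AddCommGroup V'] [Module k V'] [AddCommGroup W'] [Module k W'] (a : V' →ₗ[k] V)
    (b : W →ₗ[k] W') : (V →ₗ[k] W) →ₗ[k] (V' →ₗ[k] W') where
  toFun f := b ∘ₗ f ∘ₗ a
  map_add' f f' := by rw [LinearMap.add_comp, LinearMap.comp_add]
  map_smul' c f := by rw [LinearMap.smul_comp, LinearMap.comp_smul, RingHom.id_apply]

open Classical in
/-- The inverse of a bijective linear map (and `0` for other linear maps). -/
def inverse {V W : Type*} [AddCommGroup V] [Module k V] [AddCommGroup W] [Module k W]
    (f : V →ₗ[k] W) : W →ₗ[k] V :=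
  if h : Function.Bijective f then (LinearEquiv.ofBijective f h).symm.toLinearMap else 0

/-- The lattice `(M ∩ A + N) / N` of `A / N`. -/
def win {A N : Submodule k (LL k')} (hA : IsLattice A) (hN : IsLattice N) (h : N ≤ A)
    (M : Colat k k') : Lattice₁ A N :=
  ⟨M.1 ⊓ A ⊔ N, M.2 A N hA hN h⟩

open Classical in
/-- A representative in `A` of the class of `v` modulo `M`, if there is one (and `0` otherwise). -/
def rep (A : Submodule k (LL k')) (M : Colat k k') (v : LL k') : LL k' :=
  if h : ∃ a ∈ A, a - v ∈ M.1 then h.choose else 0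

theorem IsStep.le {M M' : Colat k k'} {v : LL k'} (h : IsStep M M' v) : M.1 ≤ M'.1 :=
  h.eq ▸ le_sup_left

theorem IsStep.win_le {M M' : Colat k k'} {v : LL k'} (h : IsStep M M' v)
    (A N : Submodule k (LL k')) : M.1 ⊓ A ⊔ N ≤ M'.1 ⊓ A ⊔ N :=
  sup_le_sup_right (inf_le_inf_right _ h.le) _

theorem IsStep.rep_mem {M M' : Colat k k'} {v : LL k'} (h : IsStep M M' v)
    (A N : Submodule k (LL k')) : rep A M v ∈ M'.1 ⊓ A ⊔ N := by
  refine Submodule.mem_sup_left ?_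
  rw [rep]
  split_ifs with H
  · refine ⟨?_, H.choose_spec.1⟩
    have := add_mem (h.le H.choose_spec.2)
      (show v ∈ M'.1 from h.eq ▸ Submodule.mem_sup_right (Submodule.mem_span_singleton_self v))
    simpa using this
  · exact zero_mem _

/-- The multiplication with the class of `v` on a determinantal theory. -/
def DetTheory.stepMap {A N : Submodule k (LL k')} (D : DetTheory A N) (hA : IsLattice A)
    (hN : IsLattice N) (hNA : N ≤ A) {M M' : Colat k k'} {v : LL k'} (h : IsStep M M' v) :
    (D.Δ (win hA hN hNA M)).V →ₗ[k] (D.Δ (win hA hN hNA M')).V :=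
  D.wedge (win hA hN hNA M) (win hA hN hNA M') (h.win_le A N) ⟨rep A M v, h.rep_mem A N⟩

/-- The system of the relative determinantal theories `Det (gL / L ∩ gL) - Det (L / L ∩ gL)`:
a pair of determinantal theories on `gL / L ∩ gL` and on `L / L ∩ gL`, evaluated at
`M ↦ Hom (Δ₋ (M ∩ L + L ∩ gL), Δ₊ (M ∩ gL + L ∩ gL))`. -/
def leaf {L : Submodule k (LL k')} (hL : IsLattice L) (g : TateGL k k')
    (Dp : DetTheory (im g L) (L ⊓ im g L)) (Dm : DetTheory L (L ⊓ im g L)) : Sys k k' where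
  g := g
  line M := homLine (Dm.Δ (win hL (hL.inf (hL.im g)) inf_le_left M))
    (Dp.Δ (win (hL.im g) (hL.inf (hL.im g)) inf_le_right M))
  step {M M' _} h :=
    (sgn k (((Dp.Δ (win (hL.im g) (hL.inf (hL.im g)) inf_le_right M')).deg -
      (Dp.Δ (win (hL.im g) (hL.inf (hL.im g)) inf_le_right M)).deg) *
      (Dm.Δ (win hL (hL.inf (hL.im g)) inf_le_left M')).deg) : k) •
    homMap (inverse (Dm.stepMap hL (hL.inf (hL.im g)) inf_le_left h))
      (Dp.stepMap (hL.im g) (hL.inf (hL.im g)) inf_le_right h)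
  stable := by
    obtain ⟨a, ha⟩ := hL.exists_le
    obtain ⟨a', ha'⟩ := (hL.im g).exists_le
    obtain ⟨b, hb⟩ := (hL.inf (hL.im g)).exists_ge
    refine ⟨min a a', b, fun M M' h => ?_⟩
    have h₁ : win hL (hL.inf (hL.im g)) inf_le_left M =
        win hL (hL.inf (hL.im g)) inf_le_left M' :=
      Subtype.ext (h.inf_sup (ha.trans (S_anti (min_le_left _ _))) hb inf_le_left)
    have h₂ : win (hL.im g) (hL.inf (hL.im g)) inf_le_right M =
        win (hL.im g) (hL.inf (hL.im g)) inf_le_right M' :=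
      Subtype.ext (h.inf_sup (ha'.trans (S_anti (min_le_right _ _))) hb inf_le_right)
    rw [h₁, h₂]

/-- The systems which are built from graded lines and relative determinantal theories. -/
inductive IsDet {L : Submodule k (LL k')} (hL : IsLattice L) : ObjectProperty (Sys k k')
  | const (x : GradedLine k) : IsDet hL (Sys.const x)
  | leaf (g : TateGL k k') (Dp : DetTheory (im g L) (L ⊓ im g L))
      (Dm : DetTheory L (L ⊓ im g L)) : IsDet hL (leaf hL g Dp Dm)
  | tensor (X Y : Sys k k') : IsDet hL X → IsDet hL Y → IsDet hL (X ⊗ Y)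

instance {L : Submodule k (LL k')} (hL : IsLattice L) : (IsDet hL).IsMonoidal where
  prop_unit := IsDet.const _
  prop_tensor X Y := IsDet.tensor X Y

/-- The category of the determinantal central extension of the lattice `L`. -/
abbrev DetCat {L : Submodule k (LL k')} (hL : IsLattice L) := (IsDet hL).FullSubcategory

end LL

end Determinants

section DetExtension

namespace LL

open GradedLine

variable {k k' : Type u} [Field k] [Field k'] [Algebra k k']

namespace Sys

/-- The morphism of constant systems given by a morphism of graded lines. -/
def constMap {x y : GradedLine k} (f : x ⟶ y) : const (k' := k') x ⟶ const y where
  g_eq := rfl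
  app _ := f
  comm _ _ := rfl
  stable := ⟨0, 0, fun _ _ _ => ⟨rfl, rfl, (Category.comp_id f).trans (Category.id_comp f).symm⟩⟩

/-- The constant system of a tensor product. -/
def constTensor (x y : GradedLine k) : mul (const (k' := k') x) (const y) ≅ const (x ⊗ y) :=
  isoOfHom
    { g_eq := one_mul _
      app := fun _ => 𝟙 (x ⊗ y)
      comm := fun h => by
        refine comm_mul (Z := const (x ⊗ y)) h fun a b => ?_
        change sgn k ((x.deg - x.deg) * _) • tm (X := x) (Y := y) a b = tm a b
        rw [sub_self, zero_mul, sgn_zero, one_smul]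
        rfl
      stable := ⟨0, 0, fun _ _ _ => ⟨rfl, rfl, rfl⟩⟩ }
    (fun _ => Iso.refl _) fun _ => rfl

theorem constSwap_natural (x : GradedLine k) {X Y : Sys k k'} (f : X ⟶ Y) :
    const x ◁ f ≫ (constSwap x Y).hom = (constSwap x X).hom ≫ f ▷ const x := by
  ext1 M
  change (𝟙 x ⊗ₘ (f.app M ≫ 𝟙 _)) ≫ (β_ x (Y.line M)).hom =
    (β_ x (X.line M)).hom ≫ (f.app M ⊗ₘ (𝟙 x ≫ 𝟙 x))
  rw [Category.comp_id, Category.comp_id, id_tensorHom, tensorHom_id]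
  exact BraidedCategory.braiding_naturality_right _ _

theorem constSwap_mul (x : GradedLine k) (X Y : Sys k k') :
    (constSwap x (X ⊗ Y)).hom = (α_ (const x) X Y).inv ≫ (constSwap x X).hom ▷ Y ≫
      (α_ X (const x) Y).hom ≫ X ◁ (constSwap x Y).hom ≫ (α_ X Y (const x)).inv := by
  ext1 M
  change _ = (α_ _ _ _).inv ≫ (_ ⊗ₘ (𝟙 _ ≫ 𝟙 _)) ≫ _ ≫ (𝟙 _ ⊗ₘ (_ ≫ 𝟙 _)) ≫ (α_ _ _ _).inv
  simp only [Category.comp_id, id_tensorHom]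
  exact BraidedCategory.braiding_tensor_right_hom _ _ _

theorem constMap_swap {x y : GradedLine k} (f : x ⟶ y) (X : Sys k k') :
    constMap f ▷ X ≫ (constSwap y X).hom = (constSwap x X).hom ≫ X ◁ constMap f := by
  ext1 M
  change (f ⊗ₘ (𝟙 _ ≫ 𝟙 _)) ≫ (β_ y (X.line M)).hom = (β_ x (X.line M)).hom ≫ (𝟙 _ ⊗ₘ (f ≫ 𝟙 _))
  simp only [Category.comp_id, id_tensorHom]
  exact BraidedCategory.braiding_naturality_left _ _

theorem constSwap_unit (X : Sys k k') :
    (constSwap (𝟙_ _) X).hom = (λ_ X).hom ≫ (ρ_ X).inv := by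
  ext1 M
  change (β_ (𝟙_ _) (X.line M)).hom = (λ_ (X.line M)).hom ≫ (ρ_ (X.line M)).inv
  exact braiding_tensorUnit_left _

theorem constSwap_tensor (x y : GradedLine k) (X : Sys k k') :
    (constTensor x y).hom ▷ X ≫ (constSwap (x ⊗ y) X).hom =
      ((α_ (const x) (const y) X).hom ≫ const x ◁ (constSwap y X).hom ≫
        (α_ (const x) X (const y)).inv ≫ (constSwap x X).hom ▷ const y ≫
          (α_ X (const x) (const y)).hom) ≫ X ◁ (constTensor x y).hom := by
  ext1 M
  have key : ∀ A : GradedLine k, (𝟙 (x ⊗ y) ⊗ₘ (𝟙 A ≫ 𝟙 A)) ≫ (β_ (x ⊗ y) A).hom =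
      ((α_ x y A).hom ≫ (𝟙 x ⊗ₘ ((β_ y A).hom ≫ 𝟙 (A ⊗ y))) ≫
        (α_ x A y).inv ≫ ((β_ x A).hom ⊗ₘ (𝟙 y ≫ 𝟙 y)) ≫
          (α_ A x y).hom) ≫ (𝟙 A ⊗ₘ (𝟙 (x ⊗ y) ≫ 𝟙 (x ⊗ y))) := by
    intro A
    simp only [Category.comp_id, Category.id_comp, id_tensorHom, tensorHom_id, id_whiskerRight]
    exact BraidedCategory.braiding_tensor_left_hom _ _ _
  exact key (X.line M)

theorem constTensor_left {x y : GradedLine k} (f : x ⟶ y) (z : GradedLine k) :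
    constMap (k' := k') f ▷ const z ≫ (constTensor y z).hom =
      (constTensor x z).hom ≫ constMap (f ▷ z) := by
  ext1 M
  change (f ⊗ₘ (𝟙 _ ≫ 𝟙 _)) ≫ 𝟙 _ = 𝟙 _ ≫ (f ▷ z)
  rw [Category.comp_id, Category.comp_id, Category.id_comp, tensorHom_id]

theorem constTensor_right {x y : GradedLine k} (z : GradedLine k) (f : x ⟶ y) :
    const z ◁ constMap (k' := k') f ≫ (constTensor z y).hom =
      (constTensor z x).hom ≫ constMap (z ◁ f) := by
  ext1 M
  change (𝟙 _ ⊗ₘ (f ≫ 𝟙 _)) ≫ 𝟙 _ = 𝟙 _ ≫ (z ◁ f)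
  rw [Category.comp_id, Category.comp_id, Category.id_comp, id_tensorHom]

theorem constTensor_assoc (x y z : GradedLine k) :
    (constTensor (k' := k') x y).hom ▷ const z ≫ (constTensor (x ⊗ y) z).hom ≫
        constMap (α_ x y z).hom =
      (α_ (const x) (const y) (const z)).hom ≫ const x ◁ (constTensor y z).hom ≫
        (constTensor x (y ⊗ z)).hom := by
  ext1 M
  change (𝟙 _ ⊗ₘ (𝟙 _ ≫ 𝟙 _)) ≫ 𝟙 _ ≫ (α_ x y z).hom = (α_ x y z).hom ≫ (𝟙 _ ⊗ₘ (𝟙 _ ≫ 𝟙 _)) ≫ 𝟙 _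
  simp

theorem constTensor_lunit (x : GradedLine k) :
    (λ_ (const (k' := k') x)).hom =
      𝟙 (const (𝟙_ _)) ▷ const x ≫ (constTensor (𝟙_ _) x).hom ≫ constMap (λ_ x).hom := by
  ext1 M
  change (λ_ x).hom = (𝟙 _ ⊗ₘ (𝟙 _ ≫ 𝟙 _)) ≫ 𝟙 _ ≫ (λ_ x).hom
  simp

theorem constTensor_runit (x : GradedLine k) :
    (ρ_ (const (k' := k') x)).hom =
      const x ◁ 𝟙 (const (𝟙_ _)) ≫ (constTensor x (𝟙_ _)).hom ≫ constMap (ρ_ x).hom := by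
  ext1 M
  change (ρ_ x).hom = (𝟙 _ ⊗ₘ (𝟙 _ ≫ 𝟙 _)) ≫ 𝟙 _ ≫ (ρ_ x).hom
  simp

theorem constSwap_const (x y : GradedLine k) :
    (constTensor (k' := k') x y).hom ≫ constMap (β_ x y).hom =
      (constSwap x (const y)).hom ≫ (constTensor y x).hom := by
  ext1 M
  change 𝟙 _ ≫ (β_ x y).hom = (β_ x y).hom ≫ 𝟙 _
  simp

end Sys

variable {L : Submodule k (LL k')} (hL : IsLattice L)

/-- The constant systems, with their half-braidings. -/
def centerObj (x : GradedLine k) : Center (DetCat hL) :=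
  ⟨⟨Sys.const x, IsDet.const x⟩,
    { β X := (IsDet hL).isoMk (Sys.constSwap x X.obj)
      monoidal X Y := by
        ext1
        exact Sys.constSwap_mul x X.obj Y.obj
      naturality f := by
        ext1
        exact Sys.constSwap_natural x f.hom }⟩

/-- The functor from graded lines to the center of the determinantal category. -/
def centerFunctor : GradedLine k ⥤ Center (DetCat hL) where
  obj := centerObj hL
  map f := ⟨ObjectProperty.homMk (Sys.constMap f), fun X => by
    ext1
    exact Sys.constMap_swap f X.obj⟩
  map_id _ := rfl
  map_comp _ _ := rfl

/-- Build an isomorphism in the center from an isomorphism of underlying objects. -/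
def centerIso {X Y : Center (DetCat hL)} (e : X.1.obj ≅ Y.1.obj)
    (h : ∀ U : DetCat hL, e.hom ▷ U.obj ≫ (Y.2.β U).hom.hom =
      (X.2.β U).hom.hom ≫ U.obj ◁ e.hom) : X ≅ Y :=
  have : IsIso (((IsDet hL).isoMk e).hom : X.1 ⟶ Y.1) := inferInstance
  Center.isoMk ⟨((IsDet hL).isoMk e).hom, fun U => ObjectProperty.hom_ext _ (h U)⟩

instance centerFunctorMonoidal : (centerFunctor hL).Monoidal :=
  Functor.CoreMonoidal.toMonoidal
    { εIso := centerIso hL (Iso.refl _) fun U => by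
        refine (congrArg (· ≫ _) (id_whiskerRight (Sys.const (𝟙_ _)) U.obj)).trans ?_
        refine (Category.id_comp _).trans ((Sys.constSwap_unit U.obj).trans ?_)
        refine ((Category.comp_id _).symm.trans
          (congrArg (_ ≫ ·) (MonoidalCategory.whiskerLeft_id U.obj (Sys.const (𝟙_ _))).symm))
      μIso x y := centerIso hL (Sys.constTensor x y) fun U =>
        Sys.constSwap_tensor x y U.obj
      μIso_hom_natural_left f z := Center.ext _ _ (ObjectProperty.hom_ext _
        (Sys.constTensor_left f z))
      μIso_hom_natural_right z f := Center.ext _ _ (ObjectProperty.hom_ext _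
        (Sys.constTensor_right z f))
      associativity x y z := Center.ext _ _ (ObjectProperty.hom_ext _
        (Sys.constTensor_assoc x y z))
      left_unitality x := Center.ext _ _ (ObjectProperty.hom_ext _
        (Sys.constTensor_lunit x))
      right_unitality x := Center.ext _ _ (ObjectProperty.hom_ext _
        (Sys.constTensor_runit x)) }

instance centerFunctorBraided : (centerFunctor hL).Braided where
  braided x y := Center.ext _ _ (ObjectProperty.hom_ext _ (Sys.constSwap_const x y))

/-- The determinantal central extension of `GL(k'((t))((s)))` by the graded lines over `k`,
constructed from the lattice `L`. -/
def Det : CentralExtension (TateGL k k') (GradedLine k) (DetCat hL) where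
  π X := X.obj.g
  ι := centerFunctor hL
  ιBraided := inferInstance
  π_hom f := f.hom.g_eq
  π_unit := rfl
  π_tensor _ _ := rfl
  π_ι _ := rfl

/-- The map `ν : 𝕂ˣ × 𝕂ˣ → ℤ`, the `t`-adic valuation of the residue class of
`f ^ ν₁(g) / g ^ ν₁(f)`, where `ν₁` is the `s`-adic valuation. -/
def nu (f g : (LL k')ˣ) : ℤ :=
  (((f ^ (g : LL k').order / g ^ (f : LL k').order : (LL k')ˣ) : LL k').coeff 0).order

/-- The exponent of the sign of the two-dimensional tame symbol. -/
def tameExponent (f g h : (LL k')ˣ) : ℤ :=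
  nu f g * nu f h + nu g h * nu g f + nu h f * nu h g + nu f g * nu g h * nu h f

/-- The two-dimensional tame symbol
`(-1) ^ A f ^ ν(g, h) g ^ ν(h, f) h ^ ν(f, g)`, reduced modulo `s` and modulo `t`. -/
def tameSymbol (f g h : (LL k')ˣ) : k' :=
  (-1) ^ tameExponent f g h *
    (((f ^ nu g h * g ^ nu h f * h ^ nu f g : (LL k')ˣ) : LL k').coeff 0).coeff 0

end LL

end DetExtension

end

/-!
The proof reduces the category of systems to explicit scalars. Call *colattices* the subspaces `M`
of `k'((t))((s))` on which the systems are evaluated. Once a nonzero vector is chosen in each line,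
a system becomes a `Cochain`: the degrees `d M` of the lines and the structure constants
`c M (M + k v) v` of the steps. For the systems of the determinantal extension over `g`, these
satisfy local rules (`IsCo`) which only involve the lattices `L` and `gL`: they say that the system
behaves like the relative determinant of `M ∩ gL` and `M ∩ L`.

The colattices and their steps form a connected and simply connected complex: inside a window
`S_a / S_b`, any two colattices are joined by chains of steps, and two chains with the same ends
differ by squares (`eq_of_isStep`, `exists_potential`). Hence two cochains with the same local rules
differ by a shift of degrees and a change of bases (`IsCo.exists_tw`), and the change of bases is
unique up to a constant. This shows that the fibres of the extension are torsors
(`isCentralExtension_det`). It also yields, for commuting `g` and `h` and cochains `x`, `y` over them,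
scalars `l M` relating the cochains of `X ⊗ Y` and `Y ⊗ X` (`Swap`), hence the commutators. Evaluating
naturality and additivity in terms of these scalars, one finds that the triple commutator exists
(`exists_isTripleCommutator`) and is given by a closed formula (`triple`, `eq_triple`), which does not
depend on the choice of the cochains or of `M`. From this formula one reads off that the triple
commutator `comm₃` is multiplicative in each argument, is inverted by transpositions of the
arguments, and does not depend on `L`.

The tame symbol has the same properties, since modulo `2` the exponent of its sign is a symmetric
trilinear form in the valuations (`tameExponent_eq`). It remains to compare both sides on
generators: `s`, `t`, and the units of `k'[[t]] + s k'((t))[[s]]`. For `L = k'((t))[[s]]`, elements of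
`s`-adic valuation zero preserve `L` and have trivial cochains, while `s` has the cochain of the
determinantal theory of the Tate space `k'((t)) = L / sL`. At `(s, s, t)` and `(s, t, t)` only the
degrees matter: multiplication by `t` shifts the degree of this theory by the dimension of `k'` over
`k` (`deg_poleLattice`), which gives the sign `(-1) ^ [k' : k] = Nm (-1)`. The essential value is that
at `(s, t, w)` for a unit `w`: it compares the actions of `w` on the determinants of `k'[[t]]` and of
`t⁻¹ k'[[t]]`, that is, it is the inverse of the determinant of `w` on the quotient `k' t⁻¹`, which
is the norm of the residue of `w` (`norm_eq_of_transport`).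
-/


noncomputable section

/-! ### Lattices and colattices -/

namespace LL

variable {k k' : Type u} [Field k] [Field k'] [Algebra k k']

theorem isLattice_S (a : ℤ) : IsLattice (S k (k' := k') a) where
  exists_le := ⟨a, le_rfl⟩
  exists_ge := ⟨a, le_rfl⟩
  closed _ hx := mem_of_forall_S le_rfl hx

theorem IsLattice₁.sup {A N U V : Submodule k (LL k')} (hU : IsLattice₁ A N U)
    (hV : IsLattice₁ A N V) : IsLattice₁ A N (U ⊔ V) where
  ge := hU.ge.trans le_sup_left
  le := sup_le hU.le hV.le
  isOpen := by
    obtain ⟨m, n, h⟩ := hU.isOpen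
    exact ⟨m, n, h.trans le_sup_left⟩
  bounded m := by
    obtain ⟨n, h⟩ := hU.bounded m
    obtain ⟨n', h'⟩ := hV.bounded m
    refine ⟨min n n', sup_le ?_ ?_⟩
    · exact h.trans (sup_le_sup_right (Nbd_anti le_rfl (min_le_left _ _)) _)
    · exact h'.trans (sup_le_sup_right (Nbd_anti le_rfl (min_le_right _ _)) _)

/-- A subspace between two lattices of a Tate space is a lattice. -/
theorem IsLattice₁.between {A N U V W : Submodule k (LL k')} (hU : IsLattice₁ A N U)
    (hW : IsLattice₁ A N W) (h : U ≤ V) (h' : V ≤ W) : IsLattice₁ A N V where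
  ge := hU.ge.trans h
  le := h'.trans hW.le
  isOpen := by
    obtain ⟨m, n, h₁⟩ := hU.isOpen
    exact ⟨m, n, h₁.trans h⟩
  bounded m := (hW.bounded m).imp fun _ h₁ => h'.trans h₁

variable (k) in
/-- The coefficients `(x_i)_j` with `a ≤ i < b` and `c ≤ j < d`. -/
def coeffs (a b c d : ℤ) : LL k' →ₗ[k] (Finset.Ico a b × Finset.Ico c d → k') where
  toFun x p := (x.coeff p.1).coeff p.2
  map_add' x y := by ext; simp
  map_smul' c x := by ext; simp

theorem finite_map_of_ker {V F Q : Type*} [AddCommGroup V] [Module k V] [AddCommGroup F]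
    [Module k F] [AddCommGroup Q] [Module k Q] [Module.Finite k F] {W : Submodule k V}
    (φ : V →ₗ[k] F) (f : V →ₗ[k] Q) (h : ∀ x ∈ W, φ x = 0 → f x = 0) :
    Module.Finite k (W.map f) := by
  have hker : LinearMap.ker (φ.domRestrict W) ≤ LinearMap.ker (f.domRestrict W) :=
    fun x hx => h x x.2 hx
  have h₁ : Module.Finite k (W ⧸ LinearMap.ker (φ.domRestrict W)) :=
    Module.Finite.equiv (φ.domRestrict W).quotKerEquivRange.symm
  have h₂ : Module.Finite k (W ⧸ LinearMap.ker (f.domRestrict W)) :=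
    Module.Finite.of_surjective _ (Submodule.factor_surjective hker)
  have h₃ := Module.Finite.equiv (f.domRestrict W).quotKerEquivRange
  rwa [LinearMap.range_domRestrict] at h₃

/-- Two nested lattices of a Tate space have a finite-dimensional quotient. -/
theorem IsLattice₁.finite [FiniteDimensional k k'] {A N U U' : Submodule k (LL k')}
    (hA : IsLattice A) (hN : IsLattice N) (hU : IsLattice₁ A N U) (hU' : IsLattice₁ A N U') :
    Module.Finite k (quot U U') := by
  obtain ⟨a, ha⟩ := hA.exists_le
  obtain ⟨b, hb⟩ := hN.exists_ge
  obtain ⟨m, n, hmn⟩ := hU.isOpen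
  obtain ⟨n', hn'⟩ := hU'.bounded m
  have hfin : Module.Finite k ((A ⊓ Nbd k m n').map U.mkQ) := by
    refine finite_map_of_ker (coeffs k (k' := k') a m n' n) _ fun x hx h => ?_
    refine (Submodule.Quotient.mk_eq_zero U).2 (hmn ⟨hx.1, fun i hi j hj => ?_⟩)
    by_cases hia : i < a
    · exact congrArg (fun y => HahnSeries.coeff y j) (ha hx.1 i hia)
    by_cases hj' : j < n'
    · exact hx.2 i hi j hj'
    · exact congrFun h (⟨i, Finset.mem_Ico.2 (by omega)⟩, ⟨j, Finset.mem_Ico.2 (by omega)⟩)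
  refine Submodule.finiteDimensional_of_le (S₂ := (A ⊓ Nbd k m n').map U.mkQ) ?_
  rintro _ ⟨x, hx, rfl⟩
  obtain ⟨y, hy, z, hz, rfl⟩ := Submodule.mem_sup.1 (hn' hx)
  refine ⟨y, ⟨?_, hy⟩, (Submodule.Quotient.eq U).2 ?_⟩
  · simpa using sub_mem (hU'.le hx) (hU'.le (hU'.ge hz))
  · simpa using hU.ge hz

/-- The truncation `∑ x_i s ^ i ↦ ∑_{a ≤ i < b} x_i s ^ i`. -/
def trunc (a b : ℤ) : LL k' →ₗ[k] LL k' where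
  toFun x := ⟨fun i => if a ≤ i ∧ i < b then x.coeff i else 0, x.isPWO_support.mono fun i hi => by
    intro h
    simp [h] at hi⟩
  map_add' x y := by
    ext1; funext i
    by_cases h : a ≤ i ∧ i < b <;> simp [h]
  map_smul' c x := by
    ext1; funext i
    by_cases h : a ≤ i ∧ i < b <;> simp [h]

theorem trunc_coeff (a b : ℤ) (x : LL k') (i : ℤ) :
    (trunc (k := k) a b x).coeff i = if a ≤ i ∧ i < b then x.coeff i else 0 := rfl

theorem sub_trunc_mem {a b : ℤ} {x : LL k'} (hx : x ∈ S k a) :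
    x - trunc (k := k) a b x ∈ S k b := by
  intro i hi
  rw [HahnSeries.coeff_sub, trunc_coeff]
  split_ifs with h
  · exact sub_self _
  · rw [hx i (by omega), sub_zero]

theorem trunc_mem_S (a b : ℤ) (x : LL k') : trunc (k := k) a b x ∈ S k a := by
  intro i hi
  rw [trunc_coeff, if_neg (by omega)]

theorem trunc_trunc (a b : ℤ) (x : LL k') :
    trunc (k := k) a b (trunc (k := k) a b x) = trunc (k := k) a b x := by
  ext1; funext i
  rw [trunc_coeff, trunc_coeff]
  split_ifs <;> rfl

theorem trunc_mem_iff {a b : ℤ} {U : Submodule k (LL k')} (hU : S k b ≤ U) {x : LL k'}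
    (hx : x ∈ S k a) : trunc (k := k) a b x ∈ U ↔ x ∈ U := by
  have h := hU (sub_trunc_mem (k := k) (b := b) hx)
  constructor
  · intro h'
    simpa using add_mem h h'
  · intro h'
    simpa using sub_mem h' h

/-- A subspace of `k'((t))((s))` is a colattice as soon as it induces lattices in the `S_a / S_b`. -/
theorem isLattice₁_of_S {M : Submodule k (LL k')}
    (hM : ∀ a b, a ≤ b → IsLattice₁ (S k a) (S k b) (M ⊓ S k a ⊔ S k b))
    (A N : Submodule k (LL k')) (hA : IsLattice A) (hN : IsLattice N) (h : N ≤ A) :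
    IsLattice₁ A N (M ⊓ A ⊔ N) := by
  obtain ⟨a, ha⟩ := hA.exists_le
  obtain ⟨b, hb⟩ := hN.exists_ge
  have hab := hM a (max a b) (le_max_left _ _)
  have hb' : S k (max a b) ≤ N := (S_anti (le_max_right _ _)).trans hb
  refine ⟨le_sup_right, sup_le inf_le_right h, ?_, fun m => ?_⟩
  · obtain ⟨m, n, hmn⟩ := hab.isOpen
    refine ⟨m, n, fun x hx => ?_⟩
    obtain ⟨y, hy, z, hz, rfl⟩ := Submodule.mem_sup.1 (hmn ⟨ha hx.1, hx.2⟩)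
    refine Submodule.add_mem_sup ⟨hy.1, ?_⟩ (hb' hz)
    simpa using sub_mem hx.1 (h (hb' hz))
  · obtain ⟨n, hn⟩ := hab.bounded m
    refine ⟨n, sup_le (fun x hx => ?_) le_sup_right⟩
    exact sup_le_sup_left hb' _ (hn (Submodule.mem_sup_left ⟨hx.1, ha hx.2⟩))

/-- The colattice of the series whose coefficients at `s ^ i` are integral for `i < a` and for
`b ≤ i`, and whose part between `s ^ a` and `s ^ b` lies in a given lattice of `S_a / S_b`. -/
def lift {a b : ℤ} (U : Lattice₁ (S k (k' := k') a) (S k b)) : Colat k k' :=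
  ⟨{ carrier := {x | trunc (k := k) a b x ∈ U.1 ∧
        ∀ i, (i < a ∨ b ≤ i) → ∀ j < 0, (x.coeff i).coeff j = 0}
     add_mem' := fun {x y} hx hy => ⟨by rw [map_add]; exact add_mem hx.1 hy.1, fun i hi j hj => by
        simp [hx.2 i hi j hj, hy.2 i hi j hj]⟩
     zero_mem' := ⟨by rw [map_zero]; exact zero_mem _, fun i _ j _ => rfl⟩
     smul_mem' := fun c x hx => ⟨by rw [map_smul]; exact U.1.smul_mem c hx.1, fun i hi j hj => by
        simp [hx.2 i hi j hj]⟩ }, by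
    refine isLattice₁_of_S fun c e hce => ⟨le_sup_right, sup_le inf_le_right (S_anti hce), ?_,
      fun m => ?_⟩
    · obtain ⟨m, n, hmn⟩ := U.2.isOpen
      refine ⟨e, max n 0, fun x hx => ?_⟩
      have hy : ∀ i, ∀ j < max n 0, ((trunc (k := k) c e x).coeff i).coeff j = 0 := by
        intro i j hj
        rw [trunc_coeff]
        split_ifs with h
        · exact hx.2 i h.2 j hj
        · rfl
      rw [← add_sub_cancel (trunc (k := k) c e x) x]
      refine Submodule.add_mem_sup ⟨⟨hmn ⟨trunc_mem_S _ _ _, fun i _ j hj => ?_⟩, fun i _ j hj => ?_⟩,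
        trunc_mem_S _ _ _⟩ (sub_trunc_mem hx.1)
      · rw [trunc_coeff]
        split_ifs
        · exact hy i j (by omega)
        · rfl
      · exact hy i j (by omega)
    · obtain ⟨n, hn⟩ := U.2.bounded b
      refine ⟨min n 0, sup_le (fun x hx => Submodule.mem_sup_left fun i _ j hj => ?_) le_sup_right⟩
      by_cases hi : a ≤ i ∧ i < b
      · obtain ⟨y, hy, z, hz, hyz⟩ := Submodule.mem_sup.1 (hn hx.1.1)
        have h := trunc_coeff (k := k) a b x i
        rw [if_pos hi, ← hyz, HahnSeries.coeff_add, hz i hi.2, add_zero] at h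
        rw [← h]
        exact hy i hi.2 j (by omega)
      · exact hx.1.2 i (by omega) j (by omega)⟩

theorem lift_inf_sup {a b : ℤ} (U : Lattice₁ (S k (k' := k') a) (S k b)) :
    (lift U).1 ⊓ S k a ⊔ S k b = U.1 := by
  apply le_antisymm
  · exact sup_le (fun x hx => (trunc_mem_iff U.2.ge hx.2).1 hx.1.1) U.2.ge
  · intro x hx
    rw [← add_sub_cancel (trunc (k := k) a b x) x]
    refine Submodule.add_mem_sup ⟨⟨?_, fun i hi j _ => ?_⟩, trunc_mem_S _ _ _⟩
      (sub_trunc_mem (U.2.le hx))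
    · rw [trunc_trunc]
      exact (trunc_mem_iff U.2.ge (U.2.le hx)).2 hx
    · rw [trunc_coeff, if_neg (by omega)]
      rfl

theorem lift_step {a b : ℤ} {U U' : Lattice₁ (S k (k' := k') a) (S k b)} {v : LL k'}
    (hv : v ∉ U.1) (h : U'.1 = U.1 ⊔ Submodule.span k {v}) :
    IsStep (lift U) (lift U') (trunc (k := k) a b v) := by
  have hvU' : v ∈ U'.1 := h ▸ Submodule.mem_sup_right (Submodule.mem_span_singleton_self v)
  have hvS := U'.2.le hvU'
  refine ⟨fun hv' => hv ?_, le_antisymm (fun x hx => ?_) ?_⟩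
  · have := hv'.1
    rw [trunc_trunc] at this
    exact (trunc_mem_iff U.2.ge hvS).1 this
  · have h1 := hx.1
    rw [h] at h1
    obtain ⟨y, hy, z, hz, hyz⟩ := Submodule.mem_sup.1 h1
    obtain ⟨α, rfl⟩ := Submodule.mem_span_singleton.1 hz
    rw [← sub_add_cancel x (α • trunc (k := k) a b v)]
    refine Submodule.add_mem_sup ⟨?_, fun i hi j hj => ?_⟩ (Submodule.smul_mem _ _
      (Submodule.mem_span_singleton_self _))
    · rw [map_sub, map_smul, trunc_trunc, ← trunc_trunc, ← hyz, map_add, map_smul, add_sub_cancel_right]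
      exact (trunc_mem_iff U.2.ge (U.2.le hy)).2 hy
    · rw [HahnSeries.coeff_sub, HahnSeries.coeff_smul, trunc_coeff, if_neg (by omega), smul_zero,
        sub_zero]
      exact hx.2 i hi j hj
  · refine sup_le (fun x hx => ⟨?_, hx.2⟩) ?_
    · rw [h]; exact Submodule.mem_sup_left hx.1
    · rw [Submodule.span_singleton_le_iff_mem]
      refine ⟨?_, fun i hi j hj => ?_⟩
      · rw [trunc_trunc]
        exact (trunc_mem_iff U'.2.ge hvS).2 hvU'
      · rw [trunc_coeff, if_neg (by omega)]; rfl

/-- The image of a colattice in `S_a / S_b`. -/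
def winS {a b : ℤ} (h : a ≤ b) (M : Colat k k') : Lattice₁ (S k (k' := k') a) (S k b) :=
  win (isLattice_S a) (isLattice_S b) (S_anti h) M

theorem winS_lift {a b : ℤ} (h : a ≤ b) (U : Lattice₁ (S k (k' := k') a) (S k b)) :
    winS h (lift U) = U := Subtype.ext (lift_inf_sup U)

theorem agree_iff {a b : ℤ} (h : a ≤ b) {M M' : Colat k k'} :
    Agree a b M M' ↔ winS h M = winS h M' :=
  ⟨fun h => Subtype.ext h, fun h => congrArg Subtype.val h⟩

theorem agree_lift {a b : ℤ} (h : a ≤ b) (M : Colat k k') : Agree a b M (lift (winS h M)) :=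
  (agree_iff h).2 (winS_lift h _).symm

variable (k k') in
/-- The colattice `k'[[t]]((s))`. -/
def stdColat : Colat k k' :=
  lift (a := 0) (b := 0) ⟨S k 0, le_rfl, le_rfl, ⟨0, 0, inf_le_left⟩, fun _ => ⟨0, le_sup_right⟩⟩

theorem mem_stdColat {x : LL k'} :
    x ∈ (stdColat k k').1 ↔ ∀ i, ∀ j < 0, (x.coeff i).coeff j = 0 := by
  constructor
  · exact fun h i => h.2 i (by omega)
  · exact fun h => ⟨trunc_mem_S _ _ _, fun i _ => h i⟩

end LL

/-! ### Connectedness and simple connectedness of the colattices -/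

namespace LL

variable {k k' : Type u} [Field k] [Field k'] [Algebra k k']

theorem finrank_quot_add {U U' U'' : Submodule k (LL k')} (h : U ≤ U') (h' : U' ≤ U'')
    [Module.Finite k (quot U U'')] :
    Module.finrank k (quot U U'') =
      Module.finrank k (quot U U') + Module.finrank k (quot U' U'') := by
  let f : quot U U'' →ₗ[k] LL k' ⧸ U' := (Submodule.factor h).domRestrict (quot U U'')
  have hr : LinearMap.range f = quot U' U'' := by
    rw [LinearMap.range_domRestrict, ← Submodule.map_comp]
    rfl
  have hk : LinearMap.ker f = (quot U U').comap (quot U U'').subtype := by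
    ext ⟨x, hx⟩
    obtain ⟨x, rfl⟩ := U.mkQ_surjective x
    constructor
    · intro hx
      exact ⟨x, (Submodule.Quotient.mk_eq_zero U').1 hx, rfl⟩
    · rintro ⟨y, hy, e⟩
      change Submodule.factor h (U.mkQ x) = 0
      rw [show U.mkQ x = U.mkQ y from e.symm]
      exact (Submodule.Quotient.mk_eq_zero U').2 hy
  have := LinearMap.finrank_range_add_finrank_ker f
  rw [hr, hk, (Submodule.comapSubtypeEquivOfLe (Submodule.map_mono h')).finrank_eq] at this
  rw [← this, add_comm]

/-- The exchange property of one-dimensional extensions. -/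
theorem mem_sup_span_exchange {V : Type*} [AddCommGroup V] [Module k V] {U : Submodule k V}
    {v w : V} (h : w ∈ U ⊔ Submodule.span k {v}) (hw : w ∉ U) : v ∈ U ⊔ Submodule.span k {w} := by
  obtain ⟨m, hm, z, hz, e⟩ := Submodule.mem_sup.1 h
  obtain ⟨α, rfl⟩ := Submodule.mem_span_singleton.1 hz
  have hα : α ≠ 0 := by
    rintro rfl
    simp only [zero_smul, add_zero] at e
    exact hw (e ▸ hm)
  have : v = α⁻¹ • (-m) + α⁻¹ • w := by
    rw [← e, smul_add, smul_neg, neg_add_cancel_left, smul_smul, inv_mul_cancel₀ hα, one_smul]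
  rw [this]
  exact Submodule.add_mem_sup (Submodule.smul_mem _ _ (neg_mem hm))
    (Submodule.smul_mem _ _ (Submodule.mem_span_singleton_self _))

theorem IsStep.of_mem {M M' : Colat k k'} {v w : LL k'} (h : IsStep M M' v) (hw : w ∈ M'.1)
    (hw' : w ∉ M.1) : IsStep M M' w := by
  refine ⟨hw', le_antisymm ?_ (sup_le h.le (by simpa using hw))⟩
  rw [h.eq] at hw ⊢
  exact sup_le le_sup_left (by simpa using mem_sup_span_exchange hw hw')

theorem IsStep.mem {M M' : Colat k k'} {v : LL k'} (h : IsStep M M' v) : v ∈ M'.1 :=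
  h.eq ▸ Submodule.mem_sup_right (Submodule.mem_span_singleton_self v)

/-- If a step changes the image in `A / N`, it is a step by an element of `A`, and the image
changes by a step. -/
theorem IsStep.exists_mem {M M' : Colat k k'} {v : LL k'} (h : IsStep M M' v)
    {A N : Submodule k (LL k')} (hne : M.1 ⊓ A ⊔ N ≠ M'.1 ⊓ A ⊔ N) :
    ∃ w ∈ A, IsStep M M' w ∧ w ∉ M.1 ⊓ A ⊔ N ∧
      M'.1 ⊓ A ⊔ N = (M.1 ⊓ A ⊔ N) ⊔ Submodule.span k {w} := by
  obtain ⟨w, hw, hw'⟩ : ∃ w ∈ M'.1 ⊓ A, w ∉ M.1 ⊓ A ⊔ N := by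
    by_contra! H
    exact hne (le_antisymm (h.win_le A N) (sup_le H le_sup_right))
  have hs := h.of_mem hw.1 fun hm => hw' (Submodule.mem_sup_left ⟨hm, hw.2⟩)
  refine ⟨w, hw.2, hs, hw', le_antisymm (sup_le (fun x hx => ?_) ?_) (sup_le (h.win_le A N) ?_)⟩
  · have hx' := hx.1
    rw [hs.eq] at hx'
    obtain ⟨m, hm, z, hz, rfl⟩ := Submodule.mem_sup.1 hx'
    refine Submodule.add_mem_sup (Submodule.mem_sup_left ⟨hm, ?_⟩) hz
    obtain ⟨α, rfl⟩ := Submodule.mem_span_singleton.1 hz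
    simpa using sub_mem hx.2 (A.smul_mem α hw.2)
  · exact le_sup_right.trans le_sup_left
  · rw [Submodule.span_singleton_le_iff_mem]
    exact Submodule.mem_sup_left hw

section Chains

variable {a b : ℤ}

/-- `U' = U + k v` with `v ∉ U`. -/
def Cov (U U' : Lattice₁ (S k (k' := k') a) (S k b)) : Prop :=
  ∃ v, v ∉ U.1 ∧ U'.1 = U.1 ⊔ Submodule.span k {v}

theorem Cov.le {U U' : Lattice₁ (S k (k' := k') a) (S k b)} (h : Cov U U') : U.1 ≤ U'.1 := by
  obtain ⟨v, -, h⟩ := h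
  exact h ▸ le_sup_left

/-- `x` is the product of the values of `R` along a saturated chain from `U` to `V`. -/
inductive Chain (R : Lattice₁ (S k (k' := k') a) (S k b) → Lattice₁ (S k (k' := k') a) (S k b) → kˣ) :
    Lattice₁ (S k (k' := k') a) (S k b) → Lattice₁ (S k (k' := k') a) (S k b) → kˣ → Prop
  | refl (U) : Chain R U U 1
  | cons {U U' V : Lattice₁ (S k (k' := k') a) (S k b)} {x : kˣ} : Cov U U' → Chain R U' V x →
      Chain R U V (R U U' * x)

variable {R : Lattice₁ (S k (k' := k') a) (S k b) → Lattice₁ (S k (k' := k') a) (S k b) → kˣ}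

theorem Chain.le {U V : Lattice₁ (S k (k' := k') a) (S k b)} {x : kˣ} (h : Chain R U V x) :
    U.1 ≤ V.1 := by
  induction h with
  | refl => exact le_rfl
  | cons h _ ih => exact h.le.trans ih

theorem Chain.trans {U V W : Lattice₁ (S k (k' := k') a) (S k b)} {x y : kˣ} (h : Chain R U V x)
    (h' : Chain R V W y) : Chain R U W (x * y) := by
  induction h with
  | refl => rwa [one_mul]
  | cons h _ ih => rw [mul_assoc]; exact .cons h (ih h')

variable [FiniteDimensional k k']

theorem finite_lattice (U V : Lattice₁ (S k (k' := k') a) (S k b)) :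
    Module.Finite k (quot U.1 V.1) :=
  IsLattice₁.finite (isLattice_S a) (isLattice_S b) U.2 V.2

theorem Cov.finrank_lt {U U' V : Lattice₁ (S k (k' := k') a) (S k b)} (h : Cov U U')
    (h' : U'.1 ≤ V.1) : Module.finrank k (quot U'.1 V.1) < Module.finrank k (quot U.1 V.1) := by
  have := finite_lattice U V
  have := finite_lattice U U'
  rw [finrank_quot_add h.le h', lt_add_iff_pos_left]
  obtain ⟨v, hv, e⟩ := h
  have hv' : v ∈ U'.1 := e ▸ Submodule.mem_sup_right (Submodule.mem_span_singleton_self v)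
  have : Nontrivial (quot U.1 U'.1) := ⟨⟨⟨U.1.mkQ v, Submodule.mem_map_of_mem hv'⟩, 0, fun h =>
    hv ((Submodule.Quotient.mk_eq_zero U.1).1 (congrArg Subtype.val h))⟩⟩
  exact Module.finrank_pos

theorem exists_chain (R) (U V : Lattice₁ (S k (k' := k') a) (S k b)) (h : U.1 ≤ V.1) :
    ∃ x, Chain R U V x := by
  by_cases he : V.1 ≤ U.1
  · obtain rfl : U = V := Subtype.ext (le_antisymm h he)
    exact ⟨1, .refl U⟩
  obtain ⟨v, hv, hv'⟩ := SetLike.not_le_iff_exists.1 he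
  have hle : U.1 ⊔ Submodule.span k {v} ≤ V.1 := sup_le h (by simpa using hv)
  have hc : Cov U ⟨U.1 ⊔ Submodule.span k {v}, U.2.between V.2 le_sup_left hle⟩ :=
    ⟨v, hv', rfl⟩
  have := hc.finrank_lt hle
  obtain ⟨x, hx⟩ := exists_chain R ⟨U.1 ⊔ Submodule.span k {v}, U.2.between V.2 le_sup_left hle⟩ V hle
  exact ⟨_, .cons hc hx⟩
termination_by Module.finrank k (quot U.1 V.1)

/-- The product along a chain is determined by its end points, by the argument of Jordan and
Hölder: two chains with different first terms are compared through the sum of these. -/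
theorem Chain.unique (hR : ∀ {U V : Lattice₁ (S k (k' := k') a) (S k b)} {v w : LL k'},
      v ∉ U.1 → w ∉ U.1 ⊔ Submodule.span k {v} → ∀ {U₁ U₂ : Lattice₁ (S k (k' := k') a) (S k b)},
      U₁.1 = U.1 ⊔ Submodule.span k {v} → U₂.1 = U.1 ⊔ Submodule.span k {w} →
      V.1 = U₁.1 ⊔ U₂.1 → R U U₁ * R U₁ V = R U U₂ * R U₂ V) :
    ∀ (n : ℕ) {U V : Lattice₁ (S k (k' := k') a) (S k b)} {x y : kˣ},
      Module.finrank k (quot U.1 V.1) ≤ n → Chain R U V x → Chain R U V y → x = y := by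
  intro n
  induction n with
  | zero =>
    intro U V x y hn hx hy
    cases hx with
    | cons h h' => have := h.finrank_lt h'.le; omega
    | refl =>
      cases hy with
      | cons h h' => have := h.finrank_lt h'.le; omega
      | refl => rfl
  | succ n ih =>
    intro U V x y hn hx hy
    cases hx with
    | refl =>
      cases hy with
      | cons h h' =>
        obtain ⟨v, hv, e⟩ := h
        exact absurd (h'.le (e ▸ Submodule.mem_sup_right (Submodule.mem_span_singleton_self v))) hv
      | refl => rfl
    | @cons _ U₁ _ x h h' =>
      cases hy with
      | refl =>
        obtain ⟨v, hv, e⟩ := h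
        exact absurd (h'.le (e ▸ Submodule.mem_sup_right (Submodule.mem_span_singleton_self v))) hv
      | @cons _ U₂ _ y g g' =>
        have hn₁ := h.finrank_lt h'.le
        have hn₂ := g.finrank_lt g'.le
        by_cases he : U₁ = U₂
        · subst he
          rw [ih (by omega) h' g']
        obtain ⟨v, hv, e⟩ := h
        obtain ⟨w, hw, f⟩ := g
        have hw₁ : w ∉ U₁.1 := by
          intro hw₁
          refine he (Subtype.ext (le_antisymm ?_ ?_))
          · rw [e] at hw₁
            rw [e, f]
            exact sup_le le_sup_left (by simpa using mem_sup_span_exchange hw₁ hw)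
          · rw [f]
            exact sup_le (e ▸ le_sup_left) (by simpa using hw₁)
        have hv₂ : v ∉ U₂.1 := by
          intro hv₂
          rw [f] at hv₂
          exact hw₁ (e ▸ mem_sup_span_exchange hv₂ hv)
        let W : Lattice₁ (S k (k' := k') a) (S k b) := ⟨U₁.1 ⊔ U₂.1, U₁.2.sup U₂.2⟩
        have hWV : W.1 ≤ V.1 := sup_le h'.le g'.le
        have hW₁ : Cov U₁ W := ⟨w, hw₁, by
          change U₁.1 ⊔ U₂.1 = _
          rw [f, e, ← sup_assoc, sup_eq_left.2 (le_sup_left : U.1 ≤ U.1 ⊔ Submodule.span k {v})]⟩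
        have hW₂ : Cov U₂ W := ⟨v, hv₂, by
          change U₁.1 ⊔ U₂.1 = _
          rw [f, e, sup_comm, ← sup_assoc,
            sup_eq_left.2 (le_sup_left : U.1 ≤ U.1 ⊔ Submodule.span k {w})]⟩
        obtain ⟨z, hz⟩ := exists_chain R W V hWV
        rw [ih (by omega) h' (.cons hW₁ hz), ih (by omega) g' (.cons hW₂ hz), ← mul_assoc,
          ← mul_assoc, hR hv (by rwa [← e]) e f rfl]

/-- The complex of colattices is simply connected: a multiplicative cochain on the steps which
vanishes on squares, and which only depends on images in `S_a / S_b`, is a coboundary. -/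
theorem exists_potential (hab : a ≤ b) (r : Colat k k' → Colat k k' → kˣ)
    (sq : ∀ {M M₁ M₂ M₃ : Colat k k'} {v w : LL k'}, IsStep M M₁ v → IsStep M₁ M₃ w →
      IsStep M M₂ w → IsStep M₂ M₃ v → r M M₁ * r M₁ M₃ = r M M₂ * r M₂ M₃)
    (st : ∀ {M M' N N' : Colat k k'} {v w : LL k'}, IsStep M M' v → IsStep N N' w →
      Agree a b M N → Agree a b M' N' → r M M' = r N N')
    (tr : ∀ {M M' : Colat k k'} {v : LL k'}, IsStep M M' v → Agree a b M M' → r M M' = 1) :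
    ∃ f : Colat k k' → kˣ, (∀ M M', Agree a b M M' → f M = f M') ∧
      ∀ {M M' : Colat k k'} {v : LL k'}, IsStep M M' v → f M' = r M M' * f M := by
  let R : Lattice₁ (S k (k' := k') a) (S k b) → Lattice₁ (S k (k' := k') a) (S k b) → kˣ :=
    fun U V => r (lift U) (lift V)
  have hR : ∀ {U V : Lattice₁ (S k (k' := k') a) (S k b)} {x y : kˣ},
      Chain R U V x → Chain R U V y → x = y := by
    intro U V x y
    refine Chain.unique (R := R) (fun {U V v w} hv hw {U₁ U₂} h₁ h₂ h₃ => ?_) _ le_rfl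
    have hw' : w ∉ U.1 := fun h => hw (Submodule.mem_sup_left h)
    have hv₂ : v ∉ U₂.1 := by
      rw [h₂]
      intro hv₂
      exact hw (mem_sup_span_exchange hv₂ hv)
    refine sq (lift_step hv h₁) (lift_step (h₁ ▸ hw) ?_) (lift_step hw' h₂) (lift_step hv₂ ?_)
    · rw [h₃, h₂, h₁, ← sup_assoc, sup_eq_left.2 (le_sup_left : U.1 ≤ U.1 ⊔ Submodule.span k {v})]
    · rw [h₃, h₂, h₁, sup_comm, ← sup_assoc,
        sup_eq_left.2 (le_sup_left : U.1 ≤ U.1 ⊔ Submodule.span k {w})]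
  let U₀ : Lattice₁ (S k (k' := k') a) (S k b) := winS hab (stdColat k k')
  let Q : Lattice₁ (S k (k' := k') a) (S k b) → Lattice₁ (S k (k' := k') a) (S k b) :=
    fun U => ⟨U.1 ⊔ U₀.1, U.2.sup U₀.2⟩
  choose x hx using fun U => exists_chain R U (Q U) le_sup_left
  choose y hy using fun U => exists_chain R U₀ (Q U) le_sup_right
  refine ⟨fun M => y (winS hab M) / x (winS hab M), fun M M' h => ?_, fun {M M' v} h => ?_⟩
  · simp only [(agree_iff hab).1 h]
  · by_cases he : Agree a b M M'
    · rw [tr h he, one_mul]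
      simp only [(agree_iff hab).1 he]
    · obtain ⟨w, -, -, hw, e⟩ := h.exists_mem he
      have hc : Cov (winS hab M) (winS hab M') := ⟨w, hw, e⟩
      have hr : r M M' = R (winS hab M) (winS hab M') :=
        st h (lift_step hw e) (agree_lift hab M) (agree_lift hab M')
      obtain ⟨z, hz⟩ := exists_chain R (Q (winS hab M)) (Q (winS hab M')) (sup_le_sup_right hc.le _)
      have h₁ := hR ((hx (winS hab M)).trans hz) (.cons hc (hx (winS hab M')))
      have h₂ := hR ((hy (winS hab M)).trans hz) (hy (winS hab M'))
      rw [hr, div_eq_iff_eq_mul, ← h₂, mul_div_assoc', div_mul_eq_mul_div, eq_div_iff_mul_eq']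
      calc _ = y (winS hab M) * (x (winS hab M) * z) := by ac_rfl
        _ = _ := by rw [h₁]; ac_rfl

/-- The complex of colattices is connected: a function which is invariant under steps and only
depends on images in some `S_a / S_b` is constant. -/
theorem eq_of_isStep {α : Type*} (f : Colat k k' → α)
    (h : ∃ a b, ∀ M M', Agree a b M M' → f M = f M')
    (hs : ∀ {M M' : Colat k k'} {v : LL k'}, IsStep M M' v → f M = f M') (M M' : Colat k k') :
    f M = f M' := by
  obtain ⟨a, b, h⟩ : ∃ a b, a ≤ b ∧ ∀ M M', Agree a b M M' → f M = f M' := by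
    obtain ⟨a, b, h⟩ := h
    exact ⟨min a b, b, min_le_right _ _, fun M M' H => h M M' (H.mono (min_le_left _ _) le_rfl)⟩
  have hab := h.1
  replace h := h.2
  have key : ∀ {U V : Lattice₁ (S k (k' := k') a) (S k b)} {x : kˣ}, Chain (fun _ _ => 1) U V x →
      f (lift U) = f (lift V) := by
    intro U V x hc
    induction hc with
    | refl => rfl
    | cons hc _ ih =>
      obtain ⟨v, hv, e⟩ := hc
      exact (hs (lift_step hv e)).trans ih
  rw [h _ _ (agree_lift hab M), h _ _ (agree_lift hab M')]
  let W : Lattice₁ (S k (k' := k') a) (S k b) :=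
    ⟨(winS hab M).1 ⊔ (winS hab M').1, (winS hab M).2.sup (winS hab M').2⟩
  obtain ⟨x, hx⟩ := exists_chain (fun _ _ => 1) (winS hab M) W le_sup_left
  obtain ⟨y, hy⟩ := exists_chain (fun _ _ => 1) (winS hab M') W le_sup_right
  exact (key hx).trans (key hy).symm

end Chains

end LL

/-! ### Existence of determinantal theories -/

theorem AlternatingMap.map_matrix {R M N ι : Type*} [CommRing R] [AddCommGroup M] [Module R M]
    [AddCommGroup N] [Module R N] [Fintype ι] [DecidableEq ι] (f : M [⋀^ι]→ₗ[R] N)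
    (A : Matrix ι ι R) (v : ι → M) : f (fun i => ∑ j, A i j • v j) = A.det • f v := by
  have h : f.compLinearMap (Fintype.linearCombination R v) =
      (LinearMap.toSpanSingleton R N (f v)).compAlternatingMap Matrix.detRowAlternating := by
    refine (Pi.basisFun R ι).ext_alternating fun σ hσ => ?_
    have hσ' : Function.Bijective σ := Finite.injective_iff_bijective.1 hσ
    let τ := Equiv.ofBijective σ hσ'
    have h₁ : ∀ i, Fintype.linearCombination R v (Pi.basisFun R ι (σ i)) = v (τ i) := by
      intro i
      simp [Pi.basisFun_apply, τ]
    simp only [AlternatingMap.compLinearMap_apply, h₁, LinearMap.compAlternatingMap_apply,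
      LinearMap.toSpanSingleton_apply]
    rw [← Pi.basisFun_det]
    refine (f.map_perm v τ).trans ?_
    rw [show (fun i => Pi.basisFun R ι (σ i)) = (Pi.basisFun R ι) ∘ τ from rfl,
      AlternatingMap.map_perm, Module.Basis.det_self]
    rw [Units.smul_def, Units.smul_def, smul_assoc, one_smul]
  have := congrArg (fun g => g A) h
  exact this

namespace LL

open GradedLine

variable {k k' : Type u} [Field k] [Field k'] [Algebra k k']

/-- The classes of the vectors `a` span `U' / U`. -/
def Spans (U : Submodule k (LL k')) {U' : Submodule k (LL k')} {n : ℕ} (a : Fin n → U') : Prop :=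
  ∀ x ∈ U', ∃ c : Fin n → k, x - ∑ j, c j • (a j : LL k') ∈ U

theorem exists_spans {U U' : Submodule k (LL k')} [Module.Finite k (quot U U')] {n : ℕ}
    (hn : Module.finrank k (quot U U') = n) : ∃ a : Fin n → U', Spans U a := by
  let B := Module.finBasisOfFinrankEq k (quot U U') hn
  choose a ha e using fun i => (B i).2
  refine ⟨fun i => ⟨a i, ha i⟩, fun x hx => ?_⟩
  refine ⟨B.repr ⟨U.mkQ x, Submodule.mem_map_of_mem hx⟩, ?_⟩
  refine (Submodule.Quotient.mk_eq_zero U).1 ?_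
  change U.mkQ _ = 0
  rw [map_sub, map_sum, sub_eq_zero]
  have := congrArg Subtype.val (B.sum_repr ⟨U.mkQ x, Submodule.mem_map_of_mem hx⟩)
  simp only [AddSubmonoidClass.coe_finsetSum, Submodule.coe_smul] at this
  refine this.symm.trans (Finset.sum_congr rfl fun i _ => ?_)
  rw [map_smul, e]

theorem decomp_matrix {U U' : Submodule k (LL k')} {n : ℕ}
    (hn : Module.finrank k (quot U U') = n) {a a₀ : Fin n → U'} (A : Matrix (Fin n) (Fin n) k)
    (h : ∀ i, (a i : LL k') - ∑ j, A i j • (a₀ j : LL k') ∈ U) :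
    decomp hn a = A.det • decomp hn a₀ := by
  subst hn
  refine Eq.trans (congrArg (exteriorPower.ιMulti k _) ?_) (AlternatingMap.map_matrix _ A _)
  funext i
  ext1
  simp only [Fin.cast_eq_self, AddSubmonoidClass.coe_finsetSum, Submodule.coe_smul, ← map_smul,
    ← map_sum]
  exact (Submodule.Quotient.eq U).2 (h i)

theorem Spans.exists_matrix {U U' : Submodule k (LL k')} {m n : ℕ} {a₀ : Fin n → U'}
    (h : Spans U a₀) (a : Fin m → U') :
    ∃ A : Matrix (Fin m) (Fin n) k, ∀ i, (a i : LL k') - ∑ j, A i j • (a₀ j : LL k') ∈ U := by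
  choose A hA using fun i => h (a i) (a i).2
  exact ⟨A, hA⟩

theorem Spans.decomp_ne_zero {U U' : Submodule k (LL k')} {n : ℕ} {a : Fin n → U'}
    (h : Spans U a) (hn : Module.finrank k (quot U U') = n) : decomp hn a ≠ 0 := by
  intro h0
  have hz : ∀ b : Fin n → U', decomp hn b = 0 := fun b => by
    obtain ⟨A, hA⟩ := h.exists_matrix b
    rw [decomp_matrix hn A hA, h0, smul_zero]
  subst hn
  have h1 : (⊥ : Submodule k (detLine U U').V) = ⊤ := by
    rw [eq_top_iff]
    refine (exteriorPower.ιMulti_span k _ (quot U U')).ge.trans (Submodule.span_le.2 ?_)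
    rintro _ ⟨b, rfl⟩
    choose c hc e using fun i => (b i).2
    have := hz fun i => ⟨c i, hc i⟩
    refine Eq.trans (congrArg (exteriorPower.ιMulti k _) (funext fun i => ?_)) this
    exact Subtype.ext (e i).symm
  have h2 := (detLine U U').finrank_eq
  rw [← finrank_top, ← h1, finrank_bot] at h2
  exact zero_ne_one h2

theorem Spans.append {U U' U'' : Submodule k (LL k')} (h' : U' ≤ U'') {p q : ℕ} {a : Fin p → U'}
    {b : Fin q → U''} (ha : Spans U a) (hb : Spans U' b) :
    Spans U (Fin.append (fun i => Submodule.inclusion h' (a i)) b) := by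
  intro x hx
  obtain ⟨d, hd⟩ := hb x hx
  obtain ⟨c, hc⟩ := ha _ hd
  refine ⟨Fin.append c d, ?_⟩
  simp only [Fin.sum_univ_add, Fin.append_left, Fin.append_right, Submodule.coe_inclusion]
  convert hc using 1
  abel

/-- The determinant of a block triangular change of bases. -/
theorem decomp_append {U U' U'' : Submodule k (LL k')} (h' : U' ≤ U'') {p q : ℕ}
    (hpq : Module.finrank k (quot U U'') = p + q) {a a₀ : Fin p → U'} {b b₀ : Fin q → U''}
    (ha₀ : Spans U a₀) (A : Matrix (Fin p) (Fin p) k)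
    (hA : ∀ i, (a i : LL k') - ∑ j, A i j • (a₀ j : LL k') ∈ U) (B : Matrix (Fin q) (Fin q) k)
    (hB : ∀ i, (b i : LL k') - ∑ j, B i j • (b₀ j : LL k') ∈ U') :
    decomp hpq (Fin.append (fun i => Submodule.inclusion h' (a i)) b) =
      (A.det * B.det) •
        decomp hpq (Fin.append (fun i => Submodule.inclusion h' (a₀ i)) b₀) := by
  choose C hC using fun i => ha₀ _ (hB i)
  rw [decomp_matrix hpq (a₀ := Fin.append (fun i => Submodule.inclusion h' (a₀ i)) b₀)
    ((Matrix.fromBlocks A 0 (Matrix.of C) B).submatrix finSumFinEquiv.symm finSumFinEquiv.symm),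
    Matrix.det_submatrix_equiv_self, Matrix.det_fromBlocks_zero₁₂]
  intro i
  induction i using Fin.addCases with
  | left i =>
    have hz : ∑ j, (0 : k) • (b₀ j : LL k') = 0 :=
      Finset.sum_eq_zero fun j _ => zero_smul k (b₀ j : LL k')
    simp only [Fin.sum_univ_add, Matrix.submatrix_apply, finSumFinEquiv_symm_apply_castAdd,
      finSumFinEquiv_symm_apply_natAdd, Matrix.fromBlocks_apply₁₁, Matrix.fromBlocks_apply₁₂,
      Fin.append_left, Fin.append_right, Submodule.coe_inclusion, Matrix.zero_apply]
    rw [hz, add_zero]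
    exact hA i
  | right i =>
    have := hC i
    simp only [Fin.sum_univ_add, Matrix.submatrix_apply, finSumFinEquiv_symm_apply_castAdd,
      finSumFinEquiv_symm_apply_natAdd, Matrix.fromBlocks_apply₂₁, Matrix.fromBlocks_apply₂₂,
      Fin.append_left, Fin.append_right, Submodule.coe_inclusion, Matrix.of_apply]
    convert this using 1
    abel

/-- The linear equivalence `k ≃ ℓ` given by a nonzero vector of a line `ℓ`. -/
def lineEquiv (X : GradedLine k) {e : X.V} (he : e ≠ 0) : k ≃ₗ[k] X.V :=
  LinearEquiv.ofBijective (LinearMap.toSpanSingleton k X.V e) (by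
    have := Module.finite_of_finrank_pos (R := k) (M := X.V) (by rw [X.finrank_eq]; exact one_pos)
    have hi : Function.Injective (LinearMap.toSpanSingleton k X.V e) := by
      intro x y h
      exact smul_left_injective k he (by simpa using h)
    exact ⟨hi, (LinearMap.injective_iff_surjective_of_finrank_eq_finrank
      (by rw [X.finrank_eq, Module.finrank_self])).1 hi⟩)

@[simp]
theorem lineEquiv_apply (X : GradedLine k) {e : X.V} (he : e ≠ 0) (c : k) :
    lineEquiv X he c = c • e := rfl

theorem exists_smul (X : GradedLine k) {e : X.V} (he : e ≠ 0) (x : X.V) : ∃ c : k, x = c • e :=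
  ⟨(lineEquiv X he).symm x, ((lineEquiv X he).apply_symm_apply x).symm⟩

theorem exists_unit_smul (X : GradedLine k) {e x : X.V} (he : e ≠ 0) (hx : x ≠ 0) :
    ∃ c : kˣ, x = c • e := by
  obtain ⟨c, rfl⟩ := exists_smul X he x
  exact ⟨Units.mk0 c fun h => hx (by rw [h, zero_smul]), rfl⟩

theorem unit_smul_inj {V : Type*} [AddCommGroup V] [Module k V] {e : V} (he : e ≠ 0) {c d : kˣ} :
    c • e = d • e ↔ c = d :=
  ⟨fun h => Units.ext (smul_left_injective k he h), fun h => by rw [h]⟩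

section Existence

variable [FiniteDimensional k k'] {A N : Submodule k (LL k')} (hA : IsLattice A) (hN : IsLattice N)

/-- A basis of `U' / U`. -/
def basisVec (U U' : Lattice₁ A N) : Fin (Module.finrank k (quot U.1 U'.1)) → U'.1 :=
  have := IsLattice₁.finite hA hN U.2 U'.2
  (exists_spans (U := U.1) (U' := U'.1) rfl).choose

theorem basisVec_spans (U U' : Lattice₁ A N) : Spans U.1 (basisVec hA hN U U') :=
  have := IsLattice₁.finite hA hN U.2 U'.2
  (exists_spans (U := U.1) (U' := U'.1) rfl).choose_spec

include hA hN in
theorem finrank_lattice_add {U U' U'' : Lattice₁ A N} (h : U.1 ≤ U'.1) (h' : U'.1 ≤ U''.1) :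
    Module.finrank k (quot U.1 U''.1) =
      Module.finrank k (quot U.1 U'.1) + Module.finrank k (quot U'.1 U''.1) :=
  have := IsLattice₁.finite hA hN U.2 U''.2
  finrank_quot_add h h'

/-- The multiplicativity of determinant lines in the chosen bases of the `U' / U` holds up to a
scalar. -/
theorem exists_kappa (U U' U'' : Lattice₁ A N) : ∃ c : kˣ, ∀ (h : U.1 ≤ U'.1) (h' : U'.1 ≤ U''.1),
    decomp (finrank_lattice_add hA hN h h')
      (Fin.append (fun i => Submodule.inclusion h' (basisVec hA hN U U' i))
        (basisVec hA hN U' U'')) = c • decomp rfl (basisVec hA hN U U'') := by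
  by_cases H : U.1 ≤ U'.1 ∧ U'.1 ≤ U''.1
  · obtain ⟨c, hc⟩ := exists_unit_smul (detLine U.1 U''.1)
      ((basisVec_spans hA hN U U'').decomp_ne_zero rfl)
      (((basisVec_spans hA hN U U').append H.2 (basisVec_spans hA hN U' U'')).decomp_ne_zero
        (finrank_lattice_add hA hN H.1 H.2))
    exact ⟨c, fun _ _ => hc⟩
  · exact ⟨1, fun h h' => absurd ⟨h, h'⟩ H⟩

/-- The scalar of `exists_kappa`. -/
def kappa (U U' U'' : Lattice₁ A N) : kˣ := (exists_kappa hA hN U U' U'').choose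

theorem kappa_spec {U U' U'' : Lattice₁ A N} (h : U.1 ≤ U'.1) (h' : U'.1 ≤ U''.1) {p q : ℕ}
    (hp : Module.finrank k (quot U.1 U'.1) = p) (hq : Module.finrank k (quot U'.1 U''.1) = q)
    (hpq : Module.finrank k (quot U.1 U''.1) = p + q) {a : Fin p → U'.1} {b : Fin q → U''.1}
    {α β : k} (ha : decomp hp a = α • decomp rfl (basisVec hA hN U U'))
    (hb : decomp hq b = β • decomp rfl (basisVec hA hN U' U'')) :
    decomp hpq (Fin.append (fun i => Submodule.inclusion h' (a i)) b) =
      (α * β * kappa hA hN U U' U'' : k) • decomp rfl (basisVec hA hN U U'') := by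
  subst hp hq
  obtain ⟨P, hP⟩ := (basisVec_spans hA hN U U').exists_matrix a
  obtain ⟨Q, hQ⟩ := (basisVec_spans hA hN U' U'').exists_matrix b
  rw [decomp_append h' hpq (basisVec_spans hA hN U U') P hP Q hQ,
    (exists_kappa hA hN U U' U'').choose_spec h h']
  rw [decomp_matrix rfl P hP] at ha
  rw [decomp_matrix rfl Q hQ] at hb
  rw [smul_left_injective k ((basisVec_spans hA hN U U').decomp_ne_zero rfl) ha,
    smul_left_injective k ((basisVec_spans hA hN U' U'').decomp_ne_zero rfl) hb, mul_smul]
  exact congrArg _ (smul_smul _ (kappa hA hN U U' U'' : k) _) |>.trans (by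
    rw [smul_smul, mul_assoc])

theorem Fin.append_heq_assoc {α : Type*} {m n p : ℕ} (a : Fin m → α) (b : Fin n → α)
    (c : Fin p → α) :
    Fin.append (Fin.append a b) c = Fin.append a (Fin.append b c) ∘ Fin.cast (add_assoc m n p) :=
  Fin.append_assoc a b c

omit [FiniteDimensional k k'] in
theorem decomp_cast {U U' : Submodule k (LL k')} {m n : ℕ} (h : m = n)
    (hm : Module.finrank k (quot U U') = m) (hn : Module.finrank k (quot U U') = n)
    (a : Fin n → U') : decomp hm (a ∘ Fin.cast h) = decomp hn a := by
  subst h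
  rfl

theorem kappa_cocycle {U V W X : Lattice₁ A N} (h : U.1 ≤ V.1) (h' : V.1 ≤ W.1) (h'' : W.1 ≤ X.1) :
    kappa hA hN U V W * kappa hA hN U W X = kappa hA hN V W X * kappa hA hN U V X := by
  have e₁ := kappa_spec hA hN h h' rfl rfl (finrank_lattice_add hA hN h h') (one_smul k _).symm
    (one_smul k _).symm
  have e₂ := kappa_spec hA hN h' h'' rfl rfl (finrank_lattice_add hA hN h' h'') (one_smul k _).symm
    (one_smul k _).symm
  have f₁ := kappa_spec hA hN (h.trans h') h'' (finrank_lattice_add hA hN h h') rfl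
    (by rw [finrank_lattice_add hA hN (h.trans h') h'', finrank_lattice_add hA hN h h']) e₁
    (one_smul k _).symm
  have f₂ := kappa_spec hA hN h (h'.trans h'') rfl (finrank_lattice_add hA hN h' h'')
    (by rw [finrank_lattice_add hA hN h (h'.trans h''), finrank_lattice_add hA hN h' h''])
    (one_smul k _).symm e₂
  have key : ∀ x y : k, x • decomp rfl (basisVec hA hN U X) = y • decomp rfl (basisVec hA hN U X) →
      x = y := fun x y e =>
    smul_left_injective k ((basisVec_spans hA hN U X).decomp_ne_zero rfl) e
  have := key _ _ (f₁.symm.trans (Eq.trans ?_ f₂))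
  · simpa [Units.ext_iff] using this
  have hf := finrank_lattice_add hA hN (h.trans h') h''
  rw [finrank_lattice_add hA hN h h'] at hf
  rw [← decomp_cast (add_assoc _ _ _) hf]
  congr 1
  rw [← Fin.append_heq_assoc]
  congr 1
  funext i
  induction i using Fin.addCases with
  | left i => simp only [Fin.append_left]; rfl
  | right i => simp only [Fin.append_right]

/-- The sum of a lattice with the image of a fixed colattice. -/
def hull (hNA : N ≤ A) (U : Lattice₁ A N) : Lattice₁ A N :=
  ⟨U.1 ⊔ (win hA hN hNA (stdColat k k')).1, U.2.sup (win hA hN hNA (stdColat k k')).2⟩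

/-- A cochain with coboundary `kappa`, which exists since the lattices form a directed set. -/
def kappaPrim (hNA : N ≤ A) (U V : Lattice₁ A N) : kˣ :=
  kappa hA hN (win hA hN hNA (stdColat k k')) (hull hA hN hNA U) (hull hA hN hNA V) *
    kappa hA hN U V (hull hA hN hNA V) / kappa hA hN U (hull hA hN hNA U) (hull hA hN hNA V)

theorem kappaPrim_mul (hNA : N ≤ A) {U V W : Lattice₁ A N} (h : U.1 ≤ V.1) (h' : V.1 ≤ W.1) :
    kappaPrim hA hN hNA U V * kappaPrim hA hN hNA V W =
      kappaPrim hA hN hNA U W * kappa hA hN U V W := by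
  have i : ∀ U : Lattice₁ A N, U.1 ≤ (hull hA hN hNA U).1 := fun U => le_sup_left
  have i₀ : (win hA hN hNA (stdColat k k')).1 ≤ (hull hA hN hNA U).1 := le_sup_right
  have j : (hull hA hN hNA U).1 ≤ (hull hA hN hNA V).1 := sup_le_sup_right h _
  have j' : (hull hA hN hNA V).1 ≤ (hull hA hN hNA W).1 := sup_le_sup_right h' _
  have e₁ := kappa_cocycle hA hN i₀ j j'
  have e₂ := kappa_cocycle hA hN (i U) j j'
  have e₃ := kappa_cocycle hA hN h (i V) j'
  have e₄ := kappa_cocycle hA hN h h' (i W)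
  unfold kappaPrim
  generalize hull hA hN hNA U = U' at *
  generalize hull hA hN hNA V = V' at *
  generalize hull hA hN hNA W = W' at *
  generalize win hA hN hNA (stdColat k k') = O at *
  simp only [Units.ext_iff, Units.val_mul, Units.val_div_eq_div_val] at *
  have n : ∀ P Q R : Lattice₁ A N, (kappa hA hN P Q R : k) ≠ 0 := fun P Q R => Units.ne_zero _
  have a₁ := n U U' V'
  have a₂ := n V V' W'
  have a₃ := n U U' W'
  have a₄ := n U' V' W'
  have a₅ := n U V' W'
  have a₆ := n U V W'
  field_simp
  refine mul_right_cancel₀ (mul_ne_zero (mul_ne_zero a₄ a₅) a₆) ?_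
  generalize (kappa hA hN O U' V' : k) = c₁ at *
  generalize (kappa hA hN O V' W' : k) = c₂ at *
  generalize (kappa hA hN O U' W' : k) = c₃ at *
  generalize (kappa hA hN U' V' W' : k) = c₄ at *
  generalize (kappa hA hN U U' V' : k) = c₅ at *
  generalize (kappa hA hN U V' W' : k) = c₆ at *
  generalize (kappa hA hN U U' W' : k) = c₇ at *
  generalize (kappa hA hN U V V' : k) = c₈ at *
  generalize (kappa hA hN V V' W' : k) = c₉ at *
  generalize (kappa hA hN U V W' : k) = d₁ at *
  generalize (kappa hA hN U V W : k) = d₂ at *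
  generalize (kappa hA hN U W W' : k) = d₃ at *
  generalize (kappa hA hN V W W' : k) = d₄ at *
  calc _ = (c₁ * c₂) * (c₈ * c₆) * c₄ * c₇ * (d₄ * d₁) := by ring
    _ = (c₃ * (c₅ * c₆) * c₉ * (d₂ * d₃) * c₄ * d₁) := by rw [e₁, e₃, ← e₄, e₂]; ring
    _ = _ := by ring

include hA hN in
/-- Every Tate space `A / N` has a determinantal theory: all lines are `k`, and the isomorphisms are
those given by the chosen bases of the `U' / U`, corrected by `kappaPrim`. -/
theorem exists_detTheory (hNA : N ≤ A) : Nonempty (DetTheory A N) := by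
  let O := win hA hN hNA (stdColat k k')
  let deg : Lattice₁ A N → ℤ := fun U => Module.finrank k (quot O.1 (hull hA hN hNA U).1) -
    Module.finrank k (quot U.1 (hull hA hN hNA U).1)
  have hdeg : ∀ U U' : Lattice₁ A N, U.1 ≤ U'.1 →
      deg U + Module.finrank k (quot U.1 U'.1) = deg U' := by
    intro U U' h
    have j : (hull hA hN hNA U).1 ≤ (hull hA hN hNA U').1 := sup_le_sup_right h _
    have e₁ := finrank_lattice_add hA hN (U := O) (U' := hull hA hN hNA U) le_sup_right j
    have e₂ := finrank_lattice_add hA hN (U := U) (U' := hull hA hN hNA U) le_sup_left j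
    have e₃ := finrank_lattice_add hA hN (U := U) (U'' := hull hA hN hNA U') h le_sup_left
    simp only [deg]
    omega
  let Δ : Lattice₁ A N → GradedLine k := fun U => ⟨k, Module.finrank_self k, deg U⟩
  let ω : ∀ U U' : Lattice₁ A N, (detLine U.1 U'.1).V ≃ₗ[k] k := fun U U' =>
    (lineEquiv (detLine U.1 U'.1) ((basisVec_spans hA hN U U').decomp_ne_zero rfl)).symm
  let E : ∀ U U' : Lattice₁ A N, TensorProduct k k (detLine U.1 U'.1).V ≃ₗ[k] k := fun U U' =>
    (TensorProduct.congr (LinearEquiv.refl k k) (ω U U')).trans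
      ((TensorProduct.lid k k).trans (LinearEquiv.smulOfUnit (kappaPrim hA hN hNA U U')))
  have hE : ∀ (U U' : Lattice₁ A N) (x : k) (w : (detLine U.1 U'.1).V),
      E U U' (x ⊗ₜ[k] w) = kappaPrim hA hN hNA U U' * (x * ω U U' w) := fun _ _ _ _ => rfl
  have hω : ∀ (U U' : Lattice₁ A N) (c : k) (w : (detLine U.1 U'.1).V),
      w = c • decomp rfl (basisVec hA hN U U') → ω U U' w = c := by
    intro U U' c w h
    rw [LinearEquiv.symm_apply_eq, h]
    rfl
  refine ⟨⟨Δ, fun U U' h => mkIso (E U U') (hdeg U U' h), ?_⟩⟩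
  intro U U' U'' h h' p q hp hq hpq a b x
  change E U' U'' ((E U U' (x ⊗ₜ[k] decomp hp a)) ⊗ₜ[k] decomp hq b) =
    E U U'' (x ⊗ₜ[k] decomp hpq _)
  obtain ⟨α, hα⟩ := exists_smul (detLine U.1 U'.1)
    ((basisVec_spans hA hN U U').decomp_ne_zero rfl) (decomp hp a)
  obtain ⟨β, hβ⟩ := exists_smul (detLine U'.1 U''.1)
    ((basisVec_spans hA hN U' U'').decomp_ne_zero rfl) (decomp hq b)
  have e := kappaPrim_mul hA hN hNA h h'
  rw [Units.ext_iff, Units.val_mul, Units.val_mul] at e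
  rw [hE, hE, hE, hω _ _ _ _ hα, hω _ _ _ _ hβ,
    hω _ _ _ _ (kappa_spec hA hN h h' hp hq hpq hα hβ)]
  linear_combination (x * α * β) * e

end Existence

end LL

/-! ### Cochains -/

namespace LL

open GradedLine

variable {k k' : Type u} [Field k] [Field k'] [Algebra k k']

theorem sgn_congr {a b : ℤ} (t : ℤ) (h : a = b + 2 * t) : sgn k a = sgn k b := by
  rw [h, sgn_add, two_mul, sgn_add, sgn_mul_self, mul_one]

theorem sgn_neg (a : ℤ) : sgn k (-a) = sgn k a := sgn_congr (-a) (by ring)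

theorem sgn_inv (a : ℤ) : (sgn k a)⁻¹ = sgn k a := inv_eq_of_mul_eq_one_left (sgn_mul_self a)

theorem sub_smul_add_eq {V : Type*} [AddCommGroup V] [Module k V] {α β : k} {v w w₁ w₂ m ε : V}
    (e : m + ε = w - β • w₂) :
    (α - β) • w₁ + ((v - α • w₁) - m) = (v - w) + ε - β • (w₁ - w₂) := by
  rw [eq_sub_of_add_eq e, sub_smul, smul_sub]
  abel

theorem eq_inv_smul_add {V : Type*} [AddCommGroup V] [Module k V] {γ : k} (h : γ ≠ 0) (w d : V) :
    w = γ⁻¹ • (-d) + γ⁻¹ • (γ • w + d) := by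
  rw [← smul_add, neg_add_cancel_comm_assoc, smul_smul, inv_mul_cancel₀ h, one_smul]

theorem coeff_eq_of_sub_mem {V : Type*} [AddCommGroup V] [Module k V] {M P A N A' N' : Submodule k V}
    (hA : A ≤ A') (hN : N' ≤ N) (hNA : N ≤ A) (H : M ⊓ A' ⊔ N' = P ⊓ A' ⊔ N') {v w w₁ w₂ : V}
    {α β : k} (hw₁ : w₁ ∈ A) (hw₂ : w₂ ∈ A) (hN' : w₁ - w₂ ∈ N) (hn : w₁ ∉ M ⊓ A ⊔ N)
    (hα : v - α • w₁ ∈ M) (hβ : w - β • w₂ ∈ P) (hv : v ∈ A') (hw : w ∈ A') (hvw : v - w ∈ N') :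
    α = β := by
  by_contra hαβ
  apply hn
  have hm : v - α • w₁ ∈ M ⊓ A' := ⟨hα, sub_mem hv (A'.smul_mem _ (hA hw₁))⟩
  have hp : w - β • w₂ ∈ M ⊓ A' ⊔ N' := by
    rw [H]
    exact Submodule.mem_sup_left ⟨hβ, sub_mem hw (A'.smul_mem _ (hA hw₂))⟩
  obtain ⟨m', hm', ε, hε, e⟩ := Submodule.mem_sup.1 hp
  have hz : (α - β) • w₁ + ((v - α • w₁) - m') ∈ N := by
    rw [sub_smul_add_eq e]
    exact sub_mem (add_mem (hN hvw) (hN hε)) (N.smul_mem _ hN')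
  have hd : (v - α • w₁) - m' ∈ M ⊓ A := by
    refine ⟨sub_mem hm.1 hm'.1, ?_⟩
    have := sub_mem (hNA hz) (A.smul_mem (α - β) hw₁)
    rwa [add_sub_cancel_left] at this
  rw [eq_inv_smul_add (sub_ne_zero.2 hαβ) w₁ ((v - α • w₁) - m')]
  exact Submodule.add_mem_sup (Submodule.smul_mem _ _ (neg_mem hd)) (Submodule.smul_mem _ _ hz)

/-- `M` and `M'` have the same image in `A / N`. -/
def Win (A N : Submodule k (LL k')) (M M' : Colat k k') : Prop := M.1 ⊓ A ⊔ N = M'.1 ⊓ A ⊔ N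

theorem Win.mono {A N A' N' : Submodule k (LL k')} (hA : A ≤ A') (hN : N' ≤ N) (h : N ≤ A)
    {M M' : Colat k k'} (H : Win A' N' M M') : Win A N M M' := by
  have key : ∀ M M' : Colat k k', Win A' N' M M' → M.1 ⊓ A ⊔ N ≤ M'.1 ⊓ A ⊔ N := by
    intro M M' H
    refine sup_le (fun x hx => ?_) le_sup_right
    have hx' : x ∈ M'.1 ⊓ A' ⊔ N' := H ▸ Submodule.mem_sup_left ⟨hx.1, hA hx.2⟩
    obtain ⟨y, hy, z, hz, rfl⟩ := Submodule.mem_sup.1 hx'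
    refine Submodule.add_mem_sup ⟨hy.1, ?_⟩ (hN hz)
    simpa using sub_mem hx.2 (h (hN hz))
  exact le_antisymm (key M M' H) (key M' M H.symm)

theorem IsStep.exists_sub {M M' : Colat k k'} {v w : LL k'} (h : IsStep M M' v)
    (h' : IsStep M M' w) : ∃ α : kˣ, w - (α : k) • v ∈ M.1 := by
  have hw := h'.mem
  rw [h.eq] at hw
  obtain ⟨m, hm, z, hz, rfl⟩ := Submodule.mem_sup.1 hw
  obtain ⟨α, rfl⟩ := Submodule.mem_span_singleton.1 hz
  have hα : α ≠ 0 := by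
    rintro rfl
    refine h'.notMem ?_
    rwa [zero_smul k v, add_zero]
  exact ⟨Units.mk0 α hα, by simpa using hm⟩

/-- Steps with the same nontrivial image in `A / N` can be represented by vectors of `A` which
agree modulo `N`. -/
theorem IsStep.exists_match {M M' P P' : Colat k k'} {v w : LL k'} {A N : Submodule k (LL k')}
    (h : IsStep M M' v) (h' : IsStep P P' w) (H : Win A N M P) (H' : Win A N M' P')
    (hne : ¬ Win A N M M') : ∃ w₁ ∈ A, ∃ w₂ ∈ A, IsStep M M' w₁ ∧ IsStep P P' w₂ ∧ w₁ - w₂ ∈ N ∧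
      w₁ ∉ M.1 ⊓ A ⊔ N := by
  obtain ⟨w₁, hA, hs, hn, -⟩ := h.exists_mem hne
  have : w₁ ∈ P'.1 ⊓ A ⊔ N := H' ▸ Submodule.mem_sup_left ⟨hs.mem, hA⟩
  obtain ⟨w₂, hw₂, z, hz, e⟩ := Submodule.mem_sup.1 this
  refine ⟨w₁, hA, w₂, hw₂.2, hs, h'.of_mem hw₂.1 fun hP => hn ?_, ?_, hn⟩
  · rw [show M.1 ⊓ A ⊔ N = P.1 ⊓ A ⊔ N from H, ← e]
    exact Submodule.add_mem_sup ⟨hP, hw₂.2⟩ hz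
  · rwa [← e, add_sub_cancel_left]

theorem IsStep.win_congr {M M' P P' : Colat k k'} {v w : LL k'} {A N : Submodule k (LL k')}
    (h : IsStep M M' v) (h' : IsStep P P' w) (H : Win A N M P) (hv : v ∈ A) (hw : w ∈ A)
    (hvw : v - w ∈ N) : Win A N M' P' := by
  have key : ∀ {M M' P P' : Colat k k'} {v w : LL k'}, IsStep M M' v → IsStep P P' w →
      Win A N M P → v ∈ A → w ∈ A → v - w ∈ N → M'.1 ⊓ A ⊔ N ≤ P'.1 ⊓ A ⊔ N := by
    intro M M' P P' v w h h' H hv hw hvw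
    refine sup_le (fun x hx => ?_) le_sup_right
    have hx' := hx.1
    rw [h.eq] at hx'
    obtain ⟨m, hm, z, hz, rfl⟩ := Submodule.mem_sup.1 hx'
    obtain ⟨α, rfl⟩ := Submodule.mem_span_singleton.1 hz
    have hmA : m ∈ A := by simpa using sub_mem hx.2 (A.smul_mem α hv)
    have hm' : m ∈ P'.1 ⊓ A ⊔ N :=
      h'.win_le A N (H ▸ Submodule.mem_sup_left ⟨hm, hmA⟩ : m ∈ P.1 ⊓ A ⊔ N)
    refine add_mem hm' (Submodule.smul_mem _ _ ?_)
    rw [← add_sub_cancel w v]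
    exact Submodule.add_mem_sup ⟨h'.mem, hw⟩ hvw
  exact le_antisymm (key h h' H hv hw hvw)
    (key h' h H.symm hw hv (by rw [← neg_sub]; exact neg_mem hvw))

variable (k k') in
/-- The degrees and the structure constants of a system of lines with chosen bases: `d M` is the
degree of the line of `M`, and the step from `M` to `M' = M + k v` multiplies the basis vectors
by `c M M' v`. -/
structure Cochain where
  d : Colat k k' → ℤ
  c : Colat k k' → Colat k k' → LL k' → kˣ

open Classical in
/-- The dimension of the image of `k v` in `M + Λ / M`, dually: `1` if `v ∈ M + Λ` and `0`
otherwise. For `M' = M + k v` this is the dimension of `M' ∩ Λ / M ∩ Λ`. -/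
def jmp (Λ : Submodule k (LL k')) (M : Colat k k') (v : LL k') : ℤ :=
  if v ∈ M.1 ⊔ Λ then 1 else 0

open Classical in
/-- Given whether `v` and `w` represent zero and which `c` satisfy `w = -c v`, the factor by which
`v ∧ w` and `w ∧ v` have to be compared: see `tau`. -/
def tauAux (p q : Prop) (r : kˣ → Prop) : kˣ :=
  if h : ¬ p ∧ ¬ q ∧ ∃ c, r c then h.2.2.choose else if p ∧ q then -1 else 1

/-- The factor by which the multiplications `x ↦ x ∧ v ∧ w` and `x ↦ x ∧ w ∧ v` differ on the
determinant of `M ∩ Λ`, where `v` and `w` stand for representatives in `Λ`, if there are any. -/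
def tau (Λ : Submodule k (LL k')) (M : Colat k k') (v w : LL k') : kˣ :=
  tauAux (v ∈ M.1 ⊔ Λ) (w ∈ M.1 ⊔ Λ) fun c => w + (c : k) • v ∈ M.1 ⊔ Λ

/-- The commutation factor of the relative determinant of `Λ₂` and `Λ₁`. -/
def tauRel (Λ₁ Λ₂ : Submodule k (LL k')) (M : Colat k k') (v w : LL k') : kˣ :=
  (tau Λ₁ M v w)⁻¹ * tau Λ₂ M v w

theorem tauRel_mul (Λ₁ Λ₂ Λ₃ : Submodule k (LL k')) (M : Colat k k') (v w : LL k') :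
    tauRel Λ₁ Λ₂ M v w * tauRel Λ₂ Λ₃ M v w = tauRel Λ₁ Λ₃ M v w := by
  rw [tauRel, tauRel, tauRel, mul_assoc, mul_inv_cancel_left]

/-- The Koszul sign in the commutation rule of the relative determinant of `Λ₂` and `Λ₁`. -/
def koszul (Λ₁ Λ₂ : Submodule k (LL k')) (M M₁ M₂ : Colat k k') (v w : LL k') : ℤ :=
  jmp Λ₁ M₁ w * (jmp Λ₁ M v + jmp Λ₂ M v) + jmp Λ₁ M₂ v * (jmp Λ₁ M w + jmp Λ₂ M w)

/-- The cochains of the systems which behave like the relative determinant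
`M ↦ det (M ∩ Λ₂ | M ∩ Λ₁)` and which only depend on images in `A / N`. Here `jump` determines the
change of the degree in a step, `scale` the dependence of the structure constants on the vector `v`
which spans the step, and `square` the comparison of two orders of adding vectors `v` and `w`. The
fields `deg`, `win` and `triv` express the dependence on images in `A / N`. -/
structure IsCo (A N Λ₁ Λ₂ : Submodule k (LL k')) (x : Cochain k k') : Prop where
  jump : ∀ {M M' : Colat k k'} {v : LL k'}, IsStep M M' v →
    x.d M' - x.d M = jmp Λ₂ M v - jmp Λ₁ M v
  scale : ∀ {M M' : Colat k k'} {v w : LL k'}, IsStep M M' v → IsStep M M' w → ∀ α : kˣ,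
    w - (α : k) • v ∈ M.1 → x.c M M' w = α ^ (x.d M' - x.d M) * x.c M M' v
  square : ∀ {M M₁ M₂ M₃ : Colat k k'} {v w : LL k'}, IsStep M M₁ v → IsStep M₁ M₃ w →
    IsStep M M₂ w → IsStep M₂ M₃ v → x.c M M₁ v * x.c M₁ M₃ w =
      tauRel Λ₁ Λ₂ M v w * sgn k (koszul Λ₁ Λ₂ M M₁ M₂ v w) * (x.c M M₂ w * x.c M₂ M₃ v)
  deg : ∀ {M M' : Colat k k'}, Win A N M M' → x.d M = x.d M'
  win : ∀ {M M' P P' : Colat k k'} {v w : LL k'}, IsStep M M' v → IsStep P P' w → Win A N M P →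
    v ∈ A → w ∈ A → v - w ∈ N → x.c M M' v = x.c P P' w
  triv : ∀ {M M' : Colat k k'} {v : LL k'}, IsStep M M' v → Win A N M M' → x.c M M' v = 1

namespace Cochain

/-- The cochain of a tensor product. -/
def mul (x y : Cochain k k') : Cochain k k' where
  d M := x.d M + y.d M
  c M M' v := x.c M M' v * y.c M M' v * sgn k ((x.d M' - x.d M) * y.d M)

/-- The inverse with respect to `Cochain.mul`. -/
def inv (x : Cochain k k') : Cochain k k' where
  d M := -x.d M
  c M M' v := (x.c M M' v)⁻¹ * sgn k ((x.d M' - x.d M) * x.d M)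

/-- Transport by an automorphism. -/
def act (g : TateGL k k') (x : Cochain k k') : Cochain k k' where
  d M := x.d (LL.act g M)
  c M M' v := x.c (LL.act g M) (LL.act g M') ((g : LL k' ≃ₗ[k] LL k').symm v)

/-- Change of bases. -/
def tw (x : Cochain k k') (f : Colat k k' → kˣ) : Cochain k k' where
  d := x.d
  c M M' v := x.c M M' v * (f M * (f M')⁻¹)

variable (k k') in
/-- The cochain of a constant system. -/
def const (n : ℤ) : Cochain k k' where
  d _ := n
  c _ _ _ := 1

end Cochain

theorem mem_sup_im {g : TateGL k k'} {M : Colat k k'} {Λ : Submodule k (LL k')} {x : LL k'} :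
    x ∈ M.1 ⊔ im g Λ ↔ (g : LL k' ≃ₗ[k] LL k').symm x ∈ (act g M).1 ⊔ Λ := by
  constructor
  · intro h
    obtain ⟨m, hm, _, ⟨z, hz, rfl⟩, rfl⟩ := Submodule.mem_sup.1 h
    rw [map_add]
    refine Submodule.add_mem_sup ?_ (by simpa using hz)
    change (g : LL k' ≃ₗ[k] LL k') _ ∈ M.1
    simpa using hm
  · intro h
    obtain ⟨m, hm, z, hz, e⟩ := Submodule.mem_sup.1 h
    rw [LinearEquiv.eq_symm_apply, map_add] at e
    rw [← e]
    exact Submodule.add_mem_sup hm ⟨z, hz, rfl⟩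

theorem jmp_im (g : TateGL k k') (Λ : Submodule k (LL k')) (M : Colat k k') (v : LL k') :
    jmp (im g Λ) M v = jmp Λ (act g M) ((g : LL k' ≃ₗ[k] LL k').symm v) := by
  unfold jmp
  rw [mem_sup_im]

theorem tau_congr {Λ Λ' : Submodule k (LL k')} {M M' : Colat k k'} {v w v' w' : LL k'}
    (hv : v ∈ M.1 ⊔ Λ ↔ v' ∈ M'.1 ⊔ Λ') (hw : w ∈ M.1 ⊔ Λ ↔ w' ∈ M'.1 ⊔ Λ')
    (h : ∀ c : kˣ, w + (c : k) • v ∈ M.1 ⊔ Λ ↔ w' + (c : k) • v' ∈ M'.1 ⊔ Λ') :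
    tau Λ M v w = tau Λ' M' v' w' := by
  rw [tau, tau, propext hv, propext hw, funext fun c => propext (h c)]

theorem tau_im (g : TateGL k k') (Λ : Submodule k (LL k')) (M : Colat k k') (v w : LL k') :
    tau (im g Λ) M v w = tau Λ (act g M) ((g : LL k' ≃ₗ[k] LL k').symm v)
      ((g : LL k' ≃ₗ[k] LL k').symm w) := by
  refine tau_congr mem_sup_im mem_sup_im fun c => mem_sup_im.trans ?_
  rw [map_add, map_smul]

theorem Win.act {g : TateGL k k'} {A N : Submodule k (LL k')} {M M' : Colat k k'}
    (h : Win (im g A) (im g N) M M') : Win A N (act g M) (act g M') := by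
  rw [Win, LL.act, LL.act, comap_inf_sup, comap_inf_sup, show M.1 ⊓ im g A ⊔ im g N = _ from h]

namespace IsCo

variable {A N Λ₁ Λ₂ Λ₃ : Submodule k (LL k')} {x y : Cochain k k'}

theorem mul (hx : IsCo A N Λ₁ Λ₂ x) (hy : IsCo A N Λ₂ Λ₃ y) : IsCo A N Λ₁ Λ₃ (x.mul y) where
  jump h := by
    have h₁ := hx.jump h
    have h₂ := hy.jump h
    simp only [Cochain.mul]
    omega
  scale {M M' v w} h h' α hα := by
    simp only [Cochain.mul]
    rw [hx.scale h h' α hα, hy.scale h h' α hα,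
      show x.d M' + y.d M' - (x.d M + y.d M) = (x.d M' - x.d M) + (y.d M' - y.d M) by ring, zpow_add]
    ac_rfl
  square {M M₁ M₂ M₃ v w} h₁ h₂ h₃ h₄ := by
    have e₁ := hx.square h₁ h₂ h₃ h₄
    have e₂ := hy.square h₁ h₂ h₃ h₄
    have j₁ := hx.jump h₁
    have j₂ := hx.jump h₂
    have j₃ := hx.jump h₃
    have j₄ := hx.jump h₄
    have i₁ := hy.jump h₁
    have i₂ := hy.jump h₂
    have i₃ := hy.jump h₃
    have i₄ := hy.jump h₄
    simp only [Cochain.mul]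
    rw [← tauRel_mul Λ₁ Λ₂ Λ₃]
    have e : sgn k ((x.d M₁ - x.d M) * y.d M) * sgn k ((x.d M₃ - x.d M₁) * y.d M₁) *
        sgn k (koszul Λ₁ Λ₂ M M₁ M₂ v w) * sgn k (koszul Λ₂ Λ₃ M M₁ M₂ v w) =
        sgn k (koszul Λ₁ Λ₃ M M₁ M₂ v w) *
        (sgn k ((x.d M₂ - x.d M) * y.d M) * sgn k ((x.d M₃ - x.d M₂) * y.d M₂)) := by
      simp only [← sgn_add, koszul]
      rw [j₁, j₂, j₃, j₄]
      have k₁ : y.d M₁ = y.d M + (jmp Λ₃ M v - jmp Λ₂ M v) := by omega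
      have k₂ : y.d M₂ = y.d M + (jmp Λ₃ M w - jmp Λ₂ M w) := by omega
      have k₃ : jmp Λ₂ M v - jmp Λ₁ M v + (jmp Λ₂ M₁ w - jmp Λ₁ M₁ w) =
        jmp Λ₂ M w - jmp Λ₁ M w + (jmp Λ₂ M₂ v - jmp Λ₁ M₂ v) := by omega
      rw [k₁, k₂]
      generalize jmp Λ₁ M v = p₁ at *
      generalize jmp Λ₂ M v = p₂ at *
      generalize jmp Λ₃ M v = p₃ at *
      generalize jmp Λ₁ M w = r₁ at *
      generalize jmp Λ₂ M w = r₂ at *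
      generalize jmp Λ₃ M w = r₃ at *
      generalize jmp Λ₁ M₁ w = q₁ at *
      generalize jmp Λ₂ M₁ w = q₂ at *
      generalize jmp Λ₁ M₂ v = s₁ at *
      generalize jmp Λ₂ M₂ v = s₂ at *
      refine sgn_congr (q₁ * p₂ + q₂ * p₃ - q₁ * p₃ + s₁ * r₂ - s₁ * r₃ + s₂ * r₃
        - (s₂ - s₁) * (r₃ - r₂)) ?_
      linear_combination (y.d M) * k₃
    calc _ = (x.c M M₁ v * x.c M₁ M₃ w) * (y.c M M₁ v * y.c M₁ M₃ w) *
        (sgn k ((x.d M₁ - x.d M) * y.d M) * sgn k ((x.d M₃ - x.d M₁) * y.d M₁)) := by ac_rfl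
      _ = tauRel Λ₁ Λ₂ M v w * tauRel Λ₂ Λ₃ M v w * ((x.c M M₂ w * x.c M₂ M₃ v) *
        (y.c M M₂ w * y.c M₂ M₃ v)) * (sgn k ((x.d M₁ - x.d M) * y.d M) *
          sgn k ((x.d M₃ - x.d M₁) * y.d M₁) *
        sgn k (koszul Λ₁ Λ₂ M M₁ M₂ v w) * sgn k (koszul Λ₂ Λ₃ M M₁ M₂ v w)) := by
        rw [e₁, e₂]; ac_rfl
      _ = _ := by rw [e]; ac_rfl
  deg h := by simp only [Cochain.mul, hx.deg h, hy.deg h]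
  win {M M' P P' v w} h h' H hv hw hvw := by
    have H' := h.win_congr h' H hv hw hvw
    simp only [Cochain.mul, hx.deg H, hy.deg H, hx.deg H', hx.win h h' H hv hw hvw,
      hy.win h h' H hv hw hvw]
  triv h H := by
    simp only [Cochain.mul, hx.triv h H, hy.triv h H, hx.deg H, sub_self, zero_mul, mul_one,
      Sys.sgn_zero]

theorem inv (hx : IsCo A N Λ₁ Λ₂ x) : IsCo A N Λ₂ Λ₁ x.inv where
  jump h := by
    have h₁ := hx.jump h
    simp only [Cochain.inv]
    omega
  scale {M M' v w} h h' α hα := by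
    simp only [Cochain.inv]
    rw [hx.scale h h' α hα, show -x.d M' - -x.d M = -(x.d M' - x.d M) by ring, zpow_neg, mul_inv]
    ac_rfl
  square {M M₁ M₂ M₃ v w} h₁ h₂ h₃ h₄ := by
    have e₁ := hx.square h₁ h₂ h₃ h₄
    have j₁ := hx.jump h₁
    have j₂ := hx.jump h₂
    have j₃ := hx.jump h₃
    have j₄ := hx.jump h₄
    simp only [Cochain.inv]
    have e : sgn k ((x.d M₁ - x.d M) * x.d M) * sgn k ((x.d M₃ - x.d M₁) * x.d M₁) *
        sgn k (koszul Λ₁ Λ₂ M M₁ M₂ v w) =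
        sgn k (koszul Λ₂ Λ₁ M M₁ M₂ v w) *
        (sgn k ((x.d M₂ - x.d M) * x.d M) * sgn k ((x.d M₃ - x.d M₂) * x.d M₂)) := by
      simp only [← sgn_add, koszul]
      rw [j₁, j₂, j₃, j₄]
      have k₁ : x.d M₁ = x.d M + (jmp Λ₂ M v - jmp Λ₁ M v) := by omega
      have k₂ : x.d M₂ = x.d M + (jmp Λ₂ M w - jmp Λ₁ M w) := by omega
      have k₃ : jmp Λ₂ M v - jmp Λ₁ M v + (jmp Λ₂ M₁ w - jmp Λ₁ M₁ w) =
        jmp Λ₂ M w - jmp Λ₁ M w + (jmp Λ₂ M₂ v - jmp Λ₁ M₂ v) := by omega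
      rw [k₁, k₂]
      generalize jmp Λ₁ M v = p₁ at *
      generalize jmp Λ₂ M v = p₂ at *
      generalize jmp Λ₁ M w = r₁ at *
      generalize jmp Λ₂ M w = r₂ at *
      generalize jmp Λ₁ M₁ w = q₁ at *
      generalize jmp Λ₂ M₁ w = q₂ at *
      generalize jmp Λ₁ M₂ v = s₁ at *
      generalize jmp Λ₂ M₂ v = s₂ at *
      refine sgn_congr (q₁ * p₁ - q₂ * p₁ + s₁ * r₂ - s₂ * r₂) ?_
      linear_combination (x.d M) * k₃
    have eτ : tauRel Λ₂ Λ₁ M v w = (tauRel Λ₁ Λ₂ M v w)⁻¹ := by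
      rw [tauRel, tauRel, mul_inv, inv_inv, mul_comm]
    calc _ = (x.c M M₁ v * x.c M₁ M₃ w)⁻¹ *
        (sgn k ((x.d M₁ - x.d M) * x.d M) * sgn k ((x.d M₃ - x.d M₁) * x.d M₁)) := by
          rw [mul_inv]; ac_rfl
      _ = (tauRel Λ₁ Λ₂ M v w)⁻¹ * ((x.c M M₂ w)⁻¹ * (x.c M₂ M₃ v)⁻¹) *
          (sgn k ((x.d M₁ - x.d M) * x.d M) * sgn k ((x.d M₃ - x.d M₁) * x.d M₁) *
            sgn k (koszul Λ₁ Λ₂ M M₁ M₂ v w)) := by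
        rw [e₁, mul_inv, mul_inv, mul_inv, sgn_inv]; ac_rfl
      _ = _ := by rw [e, eτ]; ac_rfl
  deg h := by simp only [Cochain.inv, hx.deg h]
  win {M M' P P' v w} h h' H hv hw hvw := by
    have H' := h.win_congr h' H hv hw hvw
    simp only [Cochain.inv, hx.deg H, hx.deg H', hx.win h h' H hv hw hvw]
  triv h H := by
    simp only [Cochain.inv, hx.triv h H, hx.deg H, sub_self, zero_mul, mul_one, inv_one,
      Sys.sgn_zero]

theorem act (hx : IsCo A N Λ₁ Λ₂ x) (g : TateGL k k') :
    IsCo (im g A) (im g N) (im g Λ₁) (im g Λ₂) (x.act g) where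
  jump h := by
    rw [jmp_im, jmp_im]
    exact hx.jump (h.act g)
  scale {M M' v w} h h' α hα := by
    refine hx.scale (h.act g) (h'.act g) α ?_
    rw [← map_smul, ← map_sub]
    change (g : LL k' ≃ₗ[k] LL k') _ ∈ M.1
    rwa [LinearEquiv.apply_symm_apply]
  square h₁ h₂ h₃ h₄ := by
    simp only [koszul, jmp_im, tauRel, tau_im]
    exact hx.square (h₁.act g) (h₂.act g) (h₃.act g) (h₄.act g)
  deg h := hx.deg h.act
  win h h' H hv hw hvw :=
    hx.win (h.act g) (h'.act g) H.act (mem_im.1 hv) (mem_im.1 hw) (by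
      rw [← map_sub]; exact mem_im.1 hvw)
  triv h H := hx.triv (h.act g) H.act

theorem tw (hx : IsCo A N Λ₁ Λ₂ x) {f : Colat k k' → kˣ} (hf : ∀ M M', Win A N M M' → f M = f M') :
    IsCo A N Λ₁ Λ₂ (x.tw f) where
  jump h := hx.jump h
  scale {M M' v w} h h' α hα := by
    simp only [Cochain.tw]
    rw [hx.scale h h' α hα, mul_assoc]
  square {M M₁ M₂ M₃ v w} h₁ h₂ h₃ h₄ := by
    have e₁ := hx.square h₁ h₂ h₃ h₄
    simp only [Cochain.tw]
    calc _ = (x.c M M₁ v * x.c M₁ M₃ w) * (f M * (f M₃)⁻¹ * (f M₁ * (f M₁)⁻¹)) := by ac_rfl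
      _ = tauRel Λ₁ Λ₂ M v w * sgn k (koszul Λ₁ Λ₂ M M₁ M₂ v w) * (x.c M M₂ w * x.c M₂ M₃ v) *
        (f M * (f M₃)⁻¹ * (f M₂ * (f M₂)⁻¹)) := by rw [e₁, mul_inv_cancel, mul_inv_cancel]
      _ = _ := by ac_rfl
  deg h := hx.deg h
  win {M M' P P' v w} h h' H hv hw hvw := by
    simp only [Cochain.tw]
    rw [hx.win h h' H hv hw hvw, hf _ _ H, hf _ _ (h.win_congr h' H hv hw hvw)]
  triv h H := by
    simp only [Cochain.tw]
    rw [hx.triv h H, hf _ _ H, mul_inv_cancel, one_mul]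

theorem const (A N Λ : Submodule k (LL k')) (n : ℤ) : IsCo A N Λ Λ (Cochain.const k k' n) where
  jump _ := by simp [Cochain.const]
  scale _ _ _ _ := by simp [Cochain.const]
  square {M M₁ M₂ M₃ v w} _ _ _ _ := by
    simp only [Cochain.const, tauRel, inv_mul_cancel, mul_one, one_mul, koszul]
    exact ((sgn_congr (b := 0) (jmp Λ M₁ w * jmp Λ M v + jmp Λ M₂ v * jmp Λ M w)
      (by ring)).trans Sys.sgn_zero).symm
  deg _ := rfl
  win _ _ _ _ _ _ := rfl
  triv _ _ := rfl

theorem mono {A' N' : Submodule k (LL k')} (hx : IsCo A N Λ₁ Λ₂ x) (hA : A ≤ A') (hN : N' ≤ N)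
    (hNA : N ≤ A) : IsCo A' N' Λ₁ Λ₂ x where
  jump := hx.jump
  scale := hx.scale
  square := hx.square
  deg h := hx.deg (h.mono hA hN hNA)
  triv h H := hx.triv h (H.mono hA hN hNA)
  win {M M' P P' v w} h h' H hv hw hvw := by
    have H' := h.win_congr h' H hv hw hvw
    have W := H.mono hA hN hNA
    have W' := H'.mono hA hN hNA
    by_cases hne : Win A N M M'
    · rw [hx.triv h hne, hx.triv h' (W.symm.trans (hne.trans W'))]
    obtain ⟨w₁, hw₁, w₂, hw₂, s₁, s₂, hN', hn⟩ := h.exists_match h' W W' hne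
    obtain ⟨α, hα⟩ := s₁.exists_sub h
    obtain ⟨β, hβ⟩ := s₂.exists_sub h'
    have hαβ : α = β := Units.ext (coeff_eq_of_sub_mem hA hN hNA H hw₁ hw₂ hN' hn hα hβ hv hw hvw)
    rw [hx.scale s₁ h α hα, hx.scale s₂ h' β hβ, hx.win s₁ s₂ W hw₁ hw₂ hN', hαβ, hx.deg W,
      hx.deg W']

variable [FiniteDimensional k k']

/-- Cochains with the same local behaviour differ by a shift of degrees and a change of bases. -/
theorem exists_tw {a b : ℤ} (hab : a ≤ b) (hx : IsCo (S k a) (S k b) Λ₁ Λ₂ x)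
    (hy : IsCo (S k a) (S k b) Λ₁ Λ₂ y) :
    ∃ n : ℤ, (∀ M, y.d M = n + x.d M) ∧ ∃ f : Colat k k' → kˣ,
      (∀ M M', Agree a b M M' → f M = f M') ∧
      ∀ {M M' : Colat k k'} {v : LL k'}, IsStep M M' v →
        f M' * y.c M M' v = f M * x.c M M' v := by
  classical
  refine ⟨y.d (stdColat k k') - x.d (stdColat k k'), fun M => ?_, ?_⟩
  · have := eq_of_isStep (fun M => y.d M - x.d M) ⟨a, b, fun M M' h => by
      rw [hx.deg h, hy.deg h]⟩ (fun {M M' v} h => by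
        have h₁ := hx.jump h
        have h₂ := hy.jump h
        omega) M (stdColat k k')
    omega
  have hd : ∀ {M M' : Colat k k'} {v : LL k'}, IsStep M M' v → x.d M' - x.d M = y.d M' - y.d M :=
    fun h => by rw [hx.jump h, hy.jump h]
  let r : Colat k k' → Colat k k' → kˣ := fun M M' =>
    if h : ∃ v, IsStep M M' v then x.c M M' h.choose * (y.c M M' h.choose)⁻¹ else 1
  have hr : ∀ {M M' : Colat k k'} {v : LL k'}, IsStep M M' v →
      r M M' = x.c M M' v * (y.c M M' v)⁻¹ := by
    intro M M' v h
    have H : ∃ v, IsStep M M' v := ⟨v, h⟩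
    obtain ⟨α, hα⟩ := h.exists_sub H.choose_spec
    simp only [r, dif_pos H]
    rw [hx.scale h H.choose_spec α hα, hy.scale h H.choose_spec α hα, hd h, mul_inv]
    calc _ = α ^ (y.d M' - y.d M) * (α ^ (y.d M' - y.d M))⁻¹ * (x.c M M' v * (y.c M M' v)⁻¹) := by
          ac_rfl
      _ = _ := by rw [mul_inv_cancel, one_mul]
  obtain ⟨f, hf, hf'⟩ := exists_potential hab r
    (fun {M M₁ M₂ M₃ v w} h₁ h₂ h₃ h₄ => by
      rw [hr h₁, hr h₂, hr h₃, hr h₄]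
      have e₁ := hx.square h₁ h₂ h₃ h₄
      have e₂ := hy.square h₁ h₂ h₃ h₄
      calc _ = (x.c M M₁ v * x.c M₁ M₃ w) * (y.c M M₁ v * y.c M₁ M₃ w)⁻¹ := by
            rw [mul_inv]; ac_rfl
        _ = (tauRel Λ₁ Λ₂ M v w * sgn k (koszul Λ₁ Λ₂ M M₁ M₂ v w)) *
            (tauRel Λ₁ Λ₂ M v w * sgn k (koszul Λ₁ Λ₂ M M₁ M₂ v w))⁻¹ *
            ((x.c M M₂ w * x.c M₂ M₃ v) * (y.c M M₂ w * y.c M₂ M₃ v)⁻¹) := by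
            rw [e₁, e₂, mul_inv (_ * _) (_ * _)]; ac_rfl
        _ = _ := by rw [mul_inv_cancel, one_mul, mul_inv]; ac_rfl)
    (fun {M M' P P' v w} h h' H H' => by
      by_cases hne : Agree a b M M'
      · have hne' : Agree a b P P' := H.symm.trans (hne.trans H')
        rw [hr h, hr h', hx.triv h hne, hy.triv h hne, hx.triv h' hne', hy.triv h' hne']
      · obtain ⟨w₁, hw₁, w₂, hw₂, s₁, s₂, hN', -⟩ := h.exists_match h' H H' hne
        rw [hr s₁, hr s₂, hx.win s₁ s₂ H hw₁ hw₂ hN', hy.win s₁ s₂ H hw₁ hw₂ hN'])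
    (fun h H => by rw [hr h, hx.triv h H, hy.triv h H, mul_inv_cancel])
  refine ⟨f, hf, fun {M M' v} h => ?_⟩
  rw [hf' h, hr h]
  calc _ = f M * x.c M M' v * (y.c M M' v * (y.c M M' v)⁻¹) := by ac_rfl
    _ = _ := by rw [mul_inv_cancel, mul_one]

end IsCo

end LL

/-! ### The cochain of a determinantal theory -/

namespace LL

open GradedLine

section Generic

variable {k V : Type*} [Field k] [AddCommGroup V] [Module k V] {M M₁ Λ A N : Submodule k V}
  {v w a a' b m : V}

theorem mem_sup_iff_exists_sub : v ∈ M ⊔ A ↔ ∃ a ∈ A, a - v ∈ M := by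
  rw [Submodule.mem_sup]
  constructor
  · rintro ⟨m, hm, a, ha, rfl⟩
    exact ⟨a, ha, by simpa using hm⟩
  · rintro ⟨a, ha, h⟩
    exact ⟨v - a, by rw [← neg_sub]; exact neg_mem h, a, ha, sub_add_cancel _ _⟩

theorem mem_inf_sup_iff (hNA : N ≤ A) (ha : a ∈ A) (h : a - v ∈ M) :
    a ∈ M ⊓ A ⊔ N ↔ v ∈ M ⊔ N := by
  constructor
  · intro h'
    rw [← sub_sub_cancel a v]
    exact sub_mem (sup_le_sup_right inf_le_left N h') (Submodule.mem_sup_left h)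
  · intro h'
    obtain ⟨m, hm, n, hn, e⟩ := Submodule.mem_sup.1 h'
    have : a - n ∈ M := by
      rw [show a - n = (a - v) + m by rw [← e]; abel]
      exact add_mem h hm
    rw [← sub_add_cancel a n]
    exact Submodule.add_mem_sup ⟨this, sub_mem ha (hNA hn)⟩ hn

theorem mem_span_sup_iff (h : M₁ = M ⊔ Submodule.span k {v}) :
    w ∈ M₁ ⊔ Λ ↔ ∃ c : k, w + c • v ∈ M ⊔ Λ := by
  rw [h, sup_right_comm, Submodule.mem_sup]
  constructor
  · rintro ⟨m, hm, z, hz, rfl⟩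
    obtain ⟨c, rfl⟩ := Submodule.mem_span_singleton.1 hz
    exact ⟨-c, by rwa [neg_smul, add_neg_cancel_right]⟩
  · rintro ⟨c, hc⟩
    exact ⟨_, hc, -(c • v), neg_mem (Submodule.smul_mem _ _ (Submodule.mem_span_singleton_self v)),
      add_neg_cancel_right _ _⟩

theorem mem_of_add_smul {c : k} (hv : v ∈ M) (h : w + c • v ∈ M) : w ∈ M := by
  simpa using sub_mem h (M.smul_mem c hv)

theorem mem_of_add_smul' {c : k} (hc : c ≠ 0) (hw : w ∈ M) (h : w + c • v ∈ M) : v ∈ M := by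
  have := sub_mem h hw
  rw [add_sub_cancel_left] at this
  exact (M.smul_mem_iff hc).1 this

theorem add_inv_smul_mem {c : k} (hc : c ≠ 0) (h : w + c • v ∈ M) : v + c⁻¹ • w ∈ M := by
  have := M.smul_mem c⁻¹ h
  rwa [smul_add, smul_smul, inv_mul_cancel₀ hc, one_smul, add_comm] at this

theorem coeff_unique {c d : k} (hv : v ∉ M) (h : w + c • v ∈ M) (h' : w + d • v ∈ M) : c = d := by
  by_contra hne
  have := sub_mem h h'
  rw [add_sub_add_left_eq_sub, ← sub_smul] at this
  exact hv ((M.smul_mem_iff (sub_ne_zero.2 hne)).1 this)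

theorem sub_smul_mem_of_sub {α : k} (ha : a - v ∈ M) (hb : b - w ∈ M) (h : w - α • v ∈ M) :
    b - α • a ∈ M := by
  rw [show b - α • a = (b - w) + (w - α • v) - α • (a - v) by rw [smul_sub]; abel]
  exact sub_mem (add_mem hb h) (M.smul_mem _ ha)

theorem sub_mem_of_add_smul {c : k} (hMM : M ≤ M₁) (hv : v ∈ M₁) (h : a - (w + c • v) ∈ M) :
    a - w ∈ M₁ := by
  rw [show a - w = (a - (w + c • v)) + c • v by abel]
  exact add_mem (hMM h) (M₁.smul_mem _ hv)

theorem inv_smul_sub_mem {c : k} (hc : c ≠ 0) (hMM : M ≤ M₁) (hw : w ∈ M₁)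
    (h : a - (w + c • v) ∈ M) : c⁻¹ • a - v ∈ M₁ := by
  rw [show c⁻¹ • a - v = c⁻¹ • (a - (w + c • v)) + c⁻¹ • w by
    rw [smul_sub, smul_add, smul_smul, inv_mul_cancel₀ hc, one_smul]; abel]
  exact add_mem (M₁.smul_mem _ (hMM h)) (M₁.smul_mem _ hw)

theorem finrank_map_mkQ_eq_one {U U' : Submodule k V} (ha : a ∉ U)
    (h : U' = U ⊔ Submodule.span k {a}) : Module.finrank k (U'.map U.mkQ) = 1 := by
  have e : U'.map U.mkQ = Submodule.span k {U.mkQ a} := by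
    rw [h, Submodule.map_sup, Submodule.map_span, Submodule.mkQ_map_self, bot_sup_eq,
      Set.image_singleton]
  rw [e]
  exact finrank_span_singleton fun h => ha ((Submodule.Quotient.mk_eq_zero U).1 h)

theorem finite_map_mkQ {U U' : Submodule k V}
    (h : U' = (U ⊔ Submodule.span k {a}) ⊔ Submodule.span k {b}) :
    Module.Finite k (U'.map U.mkQ) := by
  rw [h, Submodule.map_sup, Submodule.map_sup, Submodule.map_span, Submodule.map_span,
    Submodule.mkQ_map_self, bot_sup_eq, Set.image_singleton, Set.image_singleton]
  infer_instance

end Generic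

variable {k k' : Type u} [Field k] [Field k'] [Algebra k k']

theorem tau_eq_of_dep {Λ : Submodule k (LL k')} {M : Colat k k'} {v w : LL k'} (hv : v ∉ M.1 ⊔ Λ)
    {c : kˣ} (h : w + (c : k) • v ∈ M.1 ⊔ Λ) : tau Λ M v w = c := by
  have H : v ∉ M.1 ⊔ Λ ∧ w ∉ M.1 ⊔ Λ ∧ ∃ c : kˣ, w + (c : k) • v ∈ M.1 ⊔ Λ :=
    ⟨hv, fun hw => hv (mem_of_add_smul' c.ne_zero hw h), c, h⟩
  rw [tau, tauAux, dif_pos H]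
  exact Units.ext (coeff_unique hv H.2.2.choose_spec h)

theorem tau_eq_neg_one {Λ : Submodule k (LL k')} {M : Colat k k'} {v w : LL k'} (hv : v ∈ M.1 ⊔ Λ)
    (hw : w ∈ M.1 ⊔ Λ) : tau Λ M v w = -1 := by
  rw [tau, tauAux, dif_neg fun h => h.1 hv, if_pos ⟨hv, hw⟩]

theorem tau_eq_one {Λ : Submodule k (LL k')} {M : Colat k k'} {v w : LL k'}
    (h : ¬(v ∈ M.1 ⊔ Λ ∧ w ∈ M.1 ⊔ Λ))
    (h' : ¬(v ∉ M.1 ⊔ Λ ∧ ∃ c : kˣ, w + (c : k) • v ∈ M.1 ⊔ Λ)) : tau Λ M v w = 1 := by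
  rw [tau, tauAux, dif_neg fun h => h' ⟨h.1, h.2.2⟩, if_neg h]

theorem jmp_eq_one {Λ : Submodule k (LL k')} {M : Colat k k'} {v : LL k'} (h : v ∈ M.1 ⊔ Λ) :
    jmp Λ M v = 1 := if_pos h

theorem jmp_eq_zero {Λ : Submodule k (LL k')} {M : Colat k k'} {v : LL k'} (h : v ∉ M.1 ⊔ Λ) :
    jmp Λ M v = 0 := if_neg h

theorem exists_ne_zero (X : GradedLine k) : ∃ e : X.V, e ≠ 0 := by
  have : Nontrivial X.V := Module.nontrivial_of_finrank_pos (R := k) (by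
    rw [X.finrank_eq]; exact one_pos)
  exact exists_ne 0

/-- A nonzero vector of a line. -/
def vec (X : GradedLine k) : X.V := (exists_ne_zero X).choose

theorem vec_ne_zero (X : GradedLine k) : vec X ≠ 0 := (exists_ne_zero X).choose_spec

theorem finrank_quot_eq_one {U U' : Submodule k (LL k')} {a : LL k'} (ha : a ∉ U)
    (h : U' = U ⊔ Submodule.span k {a}) : Module.finrank k (quot U U') = 1 :=
  finrank_map_mkQ_eq_one ha h

theorem spans_one {U U' : Submodule k (LL k')} {a : U'}
    (h : U' = U ⊔ Submodule.span k {(a : LL k')}) : Spans U (fun _ : Fin 1 => a) := by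
  intro x hx
  rw [h] at hx
  obtain ⟨y, hy, z, hz, rfl⟩ := Submodule.mem_sup.1 hx
  obtain ⟨c, rfl⟩ := Submodule.mem_span_singleton.1 hz
  exact ⟨fun _ => c, by simpa using hy⟩

theorem decomp_eq_decomp {U U' : Submodule k (LL k')} {n : ℕ}
    (hn : Module.finrank k (quot U U') = n) (a : U') :
    decomp rfl (fun _ => a) = decomp hn fun _ => a := by
  subst hn
  rfl

theorem decomp_smul {U U' : Submodule k (LL k')} (hn : Module.finrank k (quot U U') = 1)
    {a b : U'} {α : k} (h : (b : LL k') - α • (a : LL k') ∈ U) :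
    decomp hn (fun _ => b) = α • decomp hn fun _ => a := by
  rw [decomp_matrix hn (a₀ := fun _ => a) (Matrix.of fun _ _ => α) fun i => by simpa using h]
  simp

theorem decomp_swap {U U₁ U₂ U' : Submodule k (LL k')} (h₁ : U₁ ≤ U') (h₂ : U₂ ≤ U')
    (hn : Module.finrank k (quot U U') = 1 + 1) {a : U₁} {a' : U'} {b : U₂} {b' : U'}
    (ha : (a : LL k') = a') (hb : (b : LL k') = b') :
    decomp hn (Fin.append (fun _ => Submodule.inclusion h₁ a) fun _ => b') =
      (-1 : k) • decomp hn (Fin.append (fun _ => Submodule.inclusion h₂ b) fun _ => a') := by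
  have e₁ : Submodule.inclusion h₁ a = a' := Subtype.ext ha
  have e₂ : Submodule.inclusion h₂ b = b' := Subtype.ext hb
  rw [e₁, e₂, decomp_matrix hn (a₀ := Fin.append (fun _ : Fin 1 => b') fun _ : Fin 1 => a')
    !![0, 1; 1, 0], Matrix.det_fin_two_of]
  · congr 1
    ring
  · intro i
    have key : ∀ x y : LL k', x - ((0 : k) • y + (1 : k) • x) ∈ U := fun x y => by
      rw [show (0 : k) • y = 0 from zero_smul k y, one_smul, zero_add, sub_self]
      exact zero_mem _
    have key' : ∀ x y : LL k', x - ((1 : k) • x + (0 : k) • y) ∈ U := fun x y => by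
      rw [show (0 : k) • y = 0 from zero_smul k y, one_smul, add_zero, sub_self]
      exact zero_mem _
    rw [Fin.sum_univ_two]
    fin_cases i
    · exact key _ _
    · exact key' _ _

namespace DetTheory

variable {A N : Submodule k (LL k')} (D : DetTheory A N)

theorem iso_injective {U U' : Lattice₁ A N} (h : U.1 ≤ U'.1) {x y}
    (e : (D.iso U U' h).hom.e x = (D.iso U U' h).hom.e y) : x = y :=
  (D.iso U U' h).hom.e.injective e

theorem tm_ne_zero {X Y : GradedLine k} {x : X.V} {y : Y.V} (hx : x ≠ 0) (hy : y ≠ 0) :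
    (tm x y : (X ⊗ Y).V) ≠ 0 := by
  intro h
  have := congrArg (TensorProduct.lid k k ∘ TensorProduct.map (lineEquiv X hx).symm.toLinearMap
    (lineEquiv Y hy).symm.toLinearMap) h
  have e₁ : (lineEquiv X hx).symm x = 1 := by
    rw [LinearEquiv.symm_apply_eq, lineEquiv_apply, one_smul]
  have e₂ : (lineEquiv Y hy).symm y = 1 := by
    rw [LinearEquiv.symm_apply_eq, lineEquiv_apply, one_smul]
  refine one_ne_zero (α := k) (Eq.trans ?_ (this.trans ?_))
  · change 1 = TensorProduct.lid k k (TensorProduct.map _ _ (x ⊗ₜ[k] y))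
    rw [TensorProduct.map_tmul, LinearEquiv.coe_coe, LinearEquiv.coe_coe, e₁, e₂,
      TensorProduct.lid_tmul, smul_eq_mul, mul_one]
  · change TensorProduct.lid k k (TensorProduct.map _ _ 0) = 0
    rw [map_zero, map_zero]

theorem wedge_apply {U U' : Lattice₁ A N} (h : U.1 ≤ U'.1) (a : U'.1) (x : (D.Δ U).V) :
    D.wedge U U' h a x = (D.iso U U' h).hom.e (tm x (decomp rfl fun _ => a)) := rfl

theorem wedge_smul {U U' : Lattice₁ A N} (h : U.1 ≤ U'.1) (a : U'.1) (c : kˣ) (x : (D.Δ U).V) :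
    D.wedge U U' h a (c • x) = c • D.wedge U U' h a x := (D.wedge U U' h a).map_smul (c : k) x

theorem wedge_apply_of_finrank {U U' : Lattice₁ A N} (h : U.1 ≤ U'.1) (a : U'.1) (x : (D.Δ U).V)
    {n : ℕ} (hn : Module.finrank k (quot U.1 U'.1) = n) :
    D.wedge U U' h a x = (D.iso U U' h).hom.e (tm x (decomp hn fun _ => a)) := by
  rw [wedge_apply, decomp_eq_decomp hn]

theorem wedge_ne_zero {U U' : Lattice₁ A N} (h : U.1 ≤ U'.1) (a : U'.1) {x : (D.Δ U).V} (hx : x ≠ 0)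
    (ha : (a : LL k') ∉ U.1) (he : U'.1 = U.1 ⊔ Submodule.span k {(a : LL k')}) :
    D.wedge U U' h a x ≠ 0 := by
  rw [D.wedge_apply_of_finrank h a x (finrank_quot_eq_one ha he)]
  exact ((D.iso U U' h).hom.e.map_ne_zero_iff).2 (tm_ne_zero hx ((spans_one he).decomp_ne_zero _))

theorem wedge_self (U : Lattice₁ A N) (a : U.1) (x : (D.Δ U).V) : D.wedge U U le_rfl a x = x := by
  have h0 : Module.finrank k (quot U.1 U.1) = 0 := by
    rw [show quot U.1 U.1 = ⊥ from Submodule.mkQ_map_self U.1, finrank_bot]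
  have hd : ∀ b : Fin 0 → U.1, decomp h0 b = decomp h0 fun _ => a := fun b => by
    congr 1
    exact Subsingleton.elim _ _
  have hne : decomp h0 (fun _ => a) ≠ 0 := by
    refine Spans.decomp_ne_zero (fun y hy => ⟨0, by rwa [Fin.sum_univ_zero, sub_zero]⟩) h0
  have := D.cocycle U U U le_rfl le_rfl h0 h0 h0 (fun _ => a) (fun _ => a) x
  rw [D.wedge_apply_of_finrank le_rfl a x h0]
  have h := D.iso_injective _ (this.trans (congrArg (fun z => (D.iso U U le_rfl).hom.e (tm x z))
    (hd _)))
  obtain ⟨c, hc⟩ : ∃ c : k, (D.iso U U le_rfl).hom.e (tm x (decomp h0 fun _ => a)) = c • x := by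
    by_cases hx : x = 0
    · refine ⟨0, ?_⟩
      rw [zero_smul, hx]
      change (D.iso U U le_rfl).hom.e (0 ⊗ₜ[k] _) = 0
      rw [TensorProduct.zero_tmul, map_zero]
    · exact exists_smul _ hx _
  by_cases hx : x = 0
  · rw [hc, hx, smul_zero]
  · rw [hc] at h ⊢
    have h' : c • (tm x (decomp h0 fun _ => a) : (D.Δ U ⊗ detLine U.1 U.1).V) =
        tm x (decomp h0 fun _ => a) := (TensorProduct.smul_tmul' c x _).trans h
    have : c = 1 := smul_left_injective k (tm_ne_zero hx hne) (h'.trans (one_smul k _).symm)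
    rw [this, one_smul]

theorem deg_eq {U U' : Lattice₁ A N} (h : U.1 ≤ U'.1) :
    (D.Δ U').deg = (D.Δ U).deg + Module.finrank k (quot U.1 U'.1) :=
  (D.iso U U' h).hom.deg_eq.symm

open Classical in
/-- The scalar by which multiplication with `a` maps the basis of `Δ (U)` to that of `Δ (U')`. -/
def coef (U U' : Lattice₁ A N) (a : LL k') : kˣ :=
  if h : ∃ c : kˣ, ∃ (h : U.1 ≤ U'.1) (ha : a ∈ U'.1),
    D.wedge U U' h ⟨a, ha⟩ (vec (D.Δ U)) = c • vec (D.Δ U') then h.choose else 1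

theorem coef_eq {U U' : Lattice₁ A N} {a : LL k'} {c : kˣ} (h : U.1 ≤ U'.1) (ha : a ∈ U'.1)
    (e : D.wedge U U' h ⟨a, ha⟩ (vec (D.Δ U)) = c • vec (D.Δ U')) : D.coef U U' a = c := by
  have H : ∃ c : kˣ, ∃ (h : U.1 ≤ U'.1) (ha : a ∈ U'.1),
    D.wedge U U' h ⟨a, ha⟩ (vec (D.Δ U)) = c • vec (D.Δ U') := ⟨c, h, ha, e⟩
  rw [coef, dif_pos H]
  obtain ⟨_, _, e'⟩ := H.choose_spec
  exact (unit_smul_inj (vec_ne_zero _)).1 (e'.symm.trans e)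

theorem coef_self (U : Lattice₁ A N) (a : LL k') : D.coef U U a = 1 := by
  by_cases ha : a ∈ U.1
  · exact D.coef_eq le_rfl ha ((D.wedge_self U _ _).trans (one_smul _ _).symm)
  · rw [coef, dif_neg fun h => ha h.choose_spec.2.1]

theorem wedge_vec {U U' : Lattice₁ A N} {a : LL k'} (h : U.1 ≤ U'.1) (h' : a ∈ U'.1) (ha : a ∉ U.1)
    (he : U'.1 = U.1 ⊔ Submodule.span k {a}) :
    D.wedge U U' h ⟨a, h'⟩ (vec (D.Δ U)) = D.coef U U' a • vec (D.Δ U') := by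
  obtain ⟨c, hc⟩ := exists_unit_smul (D.Δ U') (vec_ne_zero _)
    (D.wedge_ne_zero h ⟨a, h'⟩ (vec_ne_zero _) ha he)
  rw [D.coef_eq h h' hc, hc]

theorem coef_smul {U U' : Lattice₁ A N} {a b : LL k'} {α : kˣ} (h : b - (α : k) • a ∈ U.1)
    (ha : a ∉ U.1) (he : U'.1 = U.1 ⊔ Submodule.span k {a}) :
    D.coef U U' b = α * D.coef U U' a := by
  have hU : U.1 ≤ U'.1 := he ▸ le_sup_left
  have ha' : a ∈ U'.1 := he ▸ Submodule.mem_sup_right (Submodule.mem_span_singleton_self a)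
  have hb : b ∈ U'.1 := by simpa using add_mem (hU h) (U'.1.smul_mem (α : k) ha')
  refine D.coef_eq hU hb ?_
  have h1 := finrank_quot_eq_one ha he
  rw [D.wedge_apply_of_finrank hU _ _ h1, decomp_smul h1 (a := ⟨a, ha'⟩) (α := (α : k)) h]
  refine (congrArg _ (tm_smul (X := D.Δ U) (Y := detLine U.1 U'.1) α _ _)).trans
    ((e_smul _ _ _).trans ?_)
  rw [← D.wedge_apply_of_finrank hU _ _ h1, D.wedge_vec hU ha' ha he, smul_smul]

theorem coef_swap {U U₁ U₂ U' : Lattice₁ A N} {a b : LL k'} (ha : a ∉ U.1) (hb : b ∉ U.1)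
    (hb' : b ∉ U₁.1) (ha' : a ∉ U₂.1)
    (h₁ : U₁.1 = U.1 ⊔ Submodule.span k {a}) (h₂ : U₂.1 = U.1 ⊔ Submodule.span k {b})
    (h₁' : U'.1 = U₁.1 ⊔ Submodule.span k {b}) (h₂' : U'.1 = U₂.1 ⊔ Submodule.span k {a}) :
    D.coef U U₁ a * D.coef U₁ U' b = -(D.coef U U₂ b * D.coef U₂ U' a) := by
  have l₁ : U.1 ≤ U₁.1 := h₁ ▸ le_sup_left
  have l₂ : U.1 ≤ U₂.1 := h₂ ▸ le_sup_left
  have l₁' : U₁.1 ≤ U'.1 := h₁' ▸ le_sup_left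
  have l₂' : U₂.1 ≤ U'.1 := h₂' ▸ le_sup_left
  have m₁ : a ∈ U₁.1 := h₁ ▸ Submodule.mem_sup_right (Submodule.mem_span_singleton_self a)
  have m₂ : b ∈ U₂.1 := h₂ ▸ Submodule.mem_sup_right (Submodule.mem_span_singleton_self b)
  have f₁ := finrank_quot_eq_one ha h₁
  have f₂ := finrank_quot_eq_one hb h₂
  have f₁' := finrank_quot_eq_one hb' h₁'
  have f₂' := finrank_quot_eq_one ha' h₂'
  have : Module.Finite k (quot U.1 U'.1) := finite_map_mkQ (by rw [h₁', h₁])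
  have hn : Module.finrank k (quot U.1 U'.1) = 1 + 1 := by
    rw [finrank_quot_add l₁ l₁', f₁, f₁']
  have c₁ := D.cocycle U U₁ U' l₁ l₁' f₁ f₁' hn (fun _ => ⟨a, m₁⟩) (fun _ => ⟨b, l₂' m₂⟩)
    (vec (D.Δ U))
  have c₂ := D.cocycle U U₂ U' l₂ l₂' f₂ f₂' hn (fun _ => ⟨b, m₂⟩) (fun _ => ⟨a, l₁' m₁⟩)
    (vec (D.Δ U))
  rw [← D.wedge_apply_of_finrank, ← D.wedge_apply_of_finrank, D.wedge_vec l₁ m₁ ha h₁,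
    wedge_smul, D.wedge_vec l₁' (l₂' m₂) hb' h₁'] at c₁
  rw [← D.wedge_apply_of_finrank, ← D.wedge_apply_of_finrank, D.wedge_vec l₂ m₂ hb h₂,
    wedge_smul, D.wedge_vec l₂' (l₁' m₁) ha' h₂'] at c₂
  rw [decomp_swap l₁' l₂' hn (b := ⟨b, m₂⟩) (a' := ⟨a, l₁' m₁⟩) rfl rfl] at c₁
  have c₃ := c₁.trans ((congrArg _ (TensorProduct.tmul_smul _ _ _)).trans
    ((LinearEquiv.map_smul _ _ _).trans (congrArg _ c₂.symm)))
  rw [smul_smul, smul_smul] at c₃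
  refine (unit_smul_inj (vec_ne_zero (D.Δ U'))).1 (c₃.trans ?_)
  rw [Units.neg_smul, neg_smul, one_smul]

end DetTheory

end LL

namespace LL

open GradedLine

theorem exists_unit_add_smul_mem {k V : Type*} [Field k] [AddCommGroup V] [Module k V]
    {M : Submodule k V} {v w : V} (hw : w ∉ M) (h : ∃ c : k, w + c • v ∈ M) :
    ∃ c : kˣ, w + (c : k) • v ∈ M := by
  obtain ⟨c, hc⟩ := h
  refine ⟨Units.mk0 c fun h0 => hw ?_, hc⟩
  rwa [h0, zero_smul, add_zero] at hc

theorem sub_neg_smul_mem {k V : Type*} [Field k] [AddCommGroup V] [Module k V]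
    {M A N : Submodule k V} (hNA : N ≤ A) {v w a b : V} {c : kˣ} (ha : a ∈ A) (hb : b ∈ A)
    (hav : a - v ∈ M) (hbw : b - w ∈ M) (hc : w + (c : k) • v ∈ M ⊔ N) :
    b - ((-c : kˣ) : k) • a ∈ M ⊓ A ⊔ N := by
  rw [Units.val_neg, neg_smul, sub_neg_eq_add]
  refine (mem_inf_sup_iff hNA (add_mem hb (A.smul_mem _ ha)) ?_).2 hc
  rw [add_sub_add_comm, ← smul_sub]
  exact add_mem hbw (M.smul_mem _ hav)

theorem sub_smul_inv_smul_mem {k V : Type*} [Field k] [AddCommGroup V] [Module k V]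
    {M : Submodule k V} (c : kˣ) (a : V) : a - (c : k) • (c : k)⁻¹ • a ∈ M := by
  rw [smul_smul, mul_inv_cancel₀ c.ne_zero, one_smul, sub_self]
  exact zero_mem _

variable {k k' : Type u} [Field k] [Field k'] [Algebra k k']

section Steps

variable {A N : Submodule k (LL k')} {M M' : Colat k k'} {v a : LL k'}

theorem IsStep.win_of_mem (h : IsStep M M' v) (hNA : N ≤ A) (hv : v ∈ M.1 ⊔ N) : Win A N M M' := by
  by_contra hne
  obtain ⟨w, hw, hs, hn, -⟩ := h.exists_mem hne
  obtain ⟨α, hα⟩ := h.exists_sub hs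
  refine hn ((mem_inf_sup_iff hNA hw (by rw [sub_self]; exact zero_mem _)).2 ?_)
  rw [← sub_add_cancel w ((α : k) • v)]
  exact add_mem (Submodule.mem_sup_left hα) (Submodule.smul_mem _ _ hv)

theorem IsStep.win_of_notMem (h : IsStep M M' v) (hv : v ∉ M.1 ⊔ A) : Win A N M M' := by
  by_contra hne
  obtain ⟨w, hw, hs, hn, -⟩ := h.exists_mem hne
  obtain ⟨α, hα⟩ := hs.exists_sub h
  refine hv ?_
  rw [← sub_add_cancel v ((α : k) • w)]
  exact add_mem (Submodule.mem_sup_left hα) (Submodule.mem_sup_right (A.smul_mem _ hw))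

theorem IsStep.notMem_win (hNA : N ≤ A) (ha : a ∈ A) (hav : a - v ∈ M.1)
    (hv : v ∉ M.1 ⊔ N) : a ∉ M.1 ⊓ A ⊔ N :=
  fun h => hv ((mem_inf_sup_iff hNA ha hav).1 h)

theorem IsStep.win_eq (h : IsStep M M' v) (hNA : N ≤ A) (ha : a ∈ A) (hav : a - v ∈ M.1)
    (hv : v ∉ M.1 ⊔ N) : M'.1 ⊓ A ⊔ N = (M.1 ⊓ A ⊔ N) ⊔ Submodule.span k {a} := by
  have hn := IsStep.notMem_win hNA ha hav hv
  have ha' : a ∈ M'.1 := by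
    have := add_mem (h.le hav) h.mem
    rwa [sub_add_cancel] at this
  have haw : a ∈ M'.1 ⊓ A ⊔ N := Submodule.mem_sup_left ⟨ha', ha⟩
  obtain ⟨w, -, -, -, e⟩ := h.exists_mem (A := A) (N := N) fun H => hn (H ▸ haw)
  refine le_antisymm ?_ (sup_le (h.win_le A N) (by simpa using haw))
  rw [e]
  rw [e] at haw
  exact sup_le le_sup_left (by simpa using mem_sup_span_exchange haw hn)

theorem rep_mem_left (h : v ∈ M.1 ⊔ A) : rep A M v ∈ A ∧ rep A M v - v ∈ M.1 := by
  have h' := mem_sup_iff_exists_sub.1 h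
  rw [rep, dif_pos h']
  exact h'.choose_spec

end Steps

namespace DetTheory

variable {A N : Submodule k (LL k')} (D : DetTheory A N) (hA : IsLattice A) (hN : IsLattice N)
  (hNA : N ≤ A)

/-- The cochain of the system `M ↦ Δ (M ∩ A + N)` in the bases `vec`. -/
def cochain : Cochain k k' where
  d M := (D.Δ (win hA hN hNA M)).deg
  c M M' v := D.coef (win hA hN hNA M) (win hA hN hNA M') (rep A M v)

variable {hA hN hNA} {M M' : Colat k k'} {v w a : LL k'}

theorem win_eq (h : Win A N M M') : win hA hN hNA M = win hA hN hNA M' := Subtype.ext h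

theorem cochain_c_of_win (h : Win A N M M') : (D.cochain hA hN hNA).c M M' v = 1 := by
  change D.coef _ _ _ = 1
  rw [← win_eq h, coef_self]

theorem cochain_c_eq (h : IsStep M M' v) (ha : a ∈ A) (hav : a - v ∈ M.1) :
    (D.cochain hA hN hNA).c M M' v = D.coef (win hA hN hNA M) (win hA hN hNA M') a := by
  by_cases hv : v ∈ M.1 ⊔ N
  · have H := h.win_of_mem hNA hv
    rw [D.cochain_c_of_win H, ← win_eq H, coef_self]
  · obtain ⟨h₁, h₂⟩ := rep_mem_left (mem_sup_iff_exists_sub.2 ⟨a, ha, hav⟩)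
    refine (D.coef_smul (U := win hA hN hNA M) (U' := win hA hN hNA M') (α := 1) ?_
      (IsStep.notMem_win hNA ha hav hv) (h.win_eq hNA ha hav hv)).trans (one_mul _)
    refine Submodule.mem_sup_left ⟨?_, ?_⟩
    · rw [Units.val_one, one_smul, ← sub_sub_sub_cancel_right _ _ v]
      exact sub_mem h₂ hav
    · rw [Units.val_one, one_smul]
      exact sub_mem h₁ ha

theorem cochain_jump (h : IsStep M M' v) :
    (D.cochain hA hN hNA).d M' - (D.cochain hA hN hNA).d M = jmp A M v - jmp N M v := by
  have hle : M.1 ⊔ N ≤ M.1 ⊔ A := sup_le_sup_left hNA _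
  by_cases hv : v ∈ M.1 ⊔ A
  · by_cases hv' : v ∈ M.1 ⊔ N
    · simp only [cochain]
      rw [win_eq (h.win_of_mem hNA hv'), jmp_eq_one hv, jmp_eq_one hv', sub_self, sub_self]
    · rw [jmp_eq_one hv, jmp_eq_zero hv']
      obtain ⟨a, ha, hav⟩ := mem_sup_iff_exists_sub.1 hv
      have := D.deg_eq (U := win hA hN hNA M) (U' := win hA hN hNA M') (h.win_le A N)
      simp only [cochain]
      rw [this, finrank_quot_eq_one (U := (win hA hN hNA M).1) (U' := (win hA hN hNA M').1)
        (IsStep.notMem_win hNA ha hav hv') (h.win_eq hNA ha hav hv')]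
      push_cast
      ring
  · simp only [cochain]
    rw [win_eq (h.win_of_notMem hv), jmp_eq_zero hv, jmp_eq_zero fun h => hv (hle h), sub_self,
      sub_self]

theorem cochain_scale (h : IsStep M M' v) (h' : IsStep M M' w) (α : kˣ)
    (hα : w - (α : k) • v ∈ M.1) : (D.cochain hA hN hNA).c M M' w =
      α ^ ((D.cochain hA hN hNA).d M' - (D.cochain hA hN hNA).d M) *
        (D.cochain hA hN hNA).c M M' v := by
  by_cases hv : v ∈ M.1 ⊔ A
  · by_cases hv' : v ∈ M.1 ⊔ N
    · rw [D.cochain_jump h, jmp_eq_one hv, jmp_eq_one hv', sub_self, zpow_zero,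
        D.cochain_c_of_win (h.win_of_mem hNA hv'), D.cochain_c_of_win (h.win_of_mem hNA hv'), one_mul]
    · rw [D.cochain_jump h, jmp_eq_one hv, jmp_eq_zero hv', sub_zero, zpow_one]
      obtain ⟨a, ha, hav⟩ := mem_sup_iff_exists_sub.1 hv
      have hw : w ∈ M.1 ⊔ A := by
        rw [← sub_add_cancel w ((α : k) • v)]
        exact add_mem (Submodule.mem_sup_left hα) (Submodule.smul_mem _ _ hv)
      obtain ⟨b, hb, hbw⟩ := mem_sup_iff_exists_sub.1 hw
      rw [D.cochain_c_eq h ha hav, D.cochain_c_eq h' hb hbw]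
      exact D.coef_smul (Submodule.mem_sup_left
        ⟨sub_smul_mem_of_sub hav hbw hα, sub_mem hb (A.smul_mem _ ha)⟩)
        (IsStep.notMem_win hNA ha hav hv') (h.win_eq hNA ha hav hv')
  · have hv' : v ∉ M.1 ⊔ N := fun h => hv (sup_le_sup_left hNA _ h)
    rw [D.cochain_jump h, jmp_eq_zero hv, jmp_eq_zero hv', sub_self, zpow_zero,
        D.cochain_c_of_win (h.win_of_notMem hv), D.cochain_c_of_win (h.win_of_notMem hv), one_mul]

/-- The two orders of adding `v` and `w`. The cases are distinguished by which of the steps change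
`M ∩ A` and `M ∩ N`; the sign of `v ∧ w = -w ∧ v` appears if both steps are nontrivial in `A / N`. -/
theorem cochain_square {M₁ M₂ M₃ : Colat k k'} (h₁ : IsStep M M₁ v) (h₂ : IsStep M₁ M₃ w)
    (h₃ : IsStep M M₂ w) (h₄ : IsStep M₂ M₃ v) :
    (D.cochain hA hN hNA).c M M₁ v * (D.cochain hA hN hNA).c M₁ M₃ w =
      tauRel N A M v w * sgn k (koszul N A M M₁ M₂ v w) *
        ((D.cochain hA hN hNA).c M M₂ w * (D.cochain hA hN hNA).c M₂ M₃ v) := by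
  have hle : M.1 ⊔ N ≤ M.1 ⊔ A := sup_le_sup_left hNA _
  have sgn_one : sgn k (1 : ℤ) = -1 := zpow_one _
  have sgn_two : sgn k (2 : ℤ) = 1 := (sgn_congr (b := 0) 1 rfl).trans Sys.sgn_zero
  -- the conditions on `M₁` and `M₂` in terms of `M`
  have hq : ∀ Λ, w ∉ M.1 ⊔ Λ → w ∈ M₁.1 ⊔ Λ → ∃ c : kˣ, w + (c : k) • v ∈ M.1 ⊔ Λ :=
    fun Λ hw h => exists_unit_add_smul_mem hw ((mem_span_sup_iff h₁.eq).1 h)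
  have hs : ∀ Λ, v ∉ M.1 ⊔ Λ → v ∈ M₂.1 ⊔ Λ → ∃ c : kˣ, w + (c : k) • v ∈ M.1 ⊔ Λ := by
    intro Λ hv h
    obtain ⟨c, hc⟩ := exists_unit_add_smul_mem hv ((mem_span_sup_iff h₃.eq).1 h)
    exact ⟨c⁻¹, by rw [Units.val_inv_eq_inv_val]; exact add_inv_smul_mem c.ne_zero hc⟩
  have hq' : ∀ Λ, ∀ c : kˣ, w + (c : k) • v ∈ M.1 ⊔ Λ → w ∈ M₁.1 ⊔ Λ :=
    fun Λ c hc => (mem_span_sup_iff h₁.eq).2 ⟨c, hc⟩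
  have hs' : ∀ Λ, ∀ c : kˣ, w + (c : k) • v ∈ M.1 ⊔ Λ → v ∈ M₂.1 ⊔ Λ :=
    fun Λ c hc => (mem_span_sup_iff h₃.eq).2 ⟨_, add_inv_smul_mem c.ne_zero hc⟩
  rw [tauRel, koszul]
  by_cases hvA : v ∈ M.1 ⊔ A <;> by_cases hwA : w ∈ M.1 ⊔ A
  · obtain ⟨a, ha, hav⟩ := mem_sup_iff_exists_sub.1 hvA
    obtain ⟨b, hb, hbw⟩ := mem_sup_iff_exists_sub.1 hwA
    rw [tau_eq_neg_one hvA hwA, jmp_eq_one hvA, jmp_eq_one hwA]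
    by_cases hvN : v ∈ M.1 ⊔ N <;> by_cases hwN : w ∈ M.1 ⊔ N
    · have hw₁ : w ∈ M₁.1 ⊔ N := sup_le_sup_right h₁.le _ hwN
      have hv₂ : v ∈ M₂.1 ⊔ N := sup_le_sup_right h₃.le _ hvN
      rw [tau_eq_neg_one hvN hwN, jmp_eq_one hvN, jmp_eq_one hwN, jmp_eq_one hw₁, jmp_eq_one hv₂,
        D.cochain_c_of_win (h₁.win_of_mem hNA hvN), D.cochain_c_of_win (h₂.win_of_mem hNA hw₁),
        D.cochain_c_of_win (h₃.win_of_mem hNA hwN), D.cochain_c_of_win (h₄.win_of_mem hNA hv₂),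
        inv_mul_cancel, one_mul, mul_one, one_mul]
      exact ((sgn_congr (b := 0) 2 rfl).trans Sys.sgn_zero).symm
    · have hw₁ : w ∉ M₁.1 ⊔ N := fun h => by
        obtain ⟨c, hc⟩ := hq N hwN h
        exact hwN (mem_of_add_smul hvN hc)
      have hv₂ : v ∈ M₂.1 ⊔ N := sup_le_sup_right h₃.le _ hvN
      rw [tau_eq_one (fun h => hwN h.2) (fun h => h.1 hvN), jmp_eq_zero hwN, jmp_eq_zero hw₁,
        jmp_eq_one hv₂, D.cochain_c_of_win (h₁.win_of_mem hNA hvN),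
        D.cochain_c_of_win (h₄.win_of_mem hNA hv₂), D.cochain_c_eq h₂ hb (h₁.le hbw),
        D.cochain_c_eq h₃ hb hbw, win_eq (h₁.win_of_mem hNA hvN), win_eq (h₄.win_of_mem hNA hv₂)]
      simp [sgn_one]
    · have hw₁ : w ∈ M₁.1 ⊔ N := sup_le_sup_right h₁.le _ hwN
      have hv₂ : v ∉ M₂.1 ⊔ N := fun h => by
        obtain ⟨c, hc⟩ := hs N hvN h
        exact hvN (mem_of_add_smul' c.ne_zero hwN hc)
      rw [tau_eq_one (fun h => hvN h.1) (fun ⟨_, c, hc⟩ => hv₂ (hs' N c hc)), jmp_eq_zero hvN,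
        jmp_eq_one hw₁, jmp_eq_zero hv₂, D.cochain_c_of_win (h₂.win_of_mem hNA hw₁),
        D.cochain_c_of_win (h₃.win_of_mem hNA hwN), D.cochain_c_eq h₁ ha hav,
        D.cochain_c_eq h₄ ha (h₃.le hav), win_eq (h₂.win_of_mem hNA hw₁),
        win_eq (h₃.win_of_mem hNA hwN)]
      simp [sgn_one]
    · by_cases hd : ∃ c : kˣ, w + (c : k) • v ∈ M.1 ⊔ N
      · obtain ⟨c, hc⟩ := hd
        have hw₁ := hq' N c hc
        have hv₂ := hs' N c hc
        have e : win hA hN hNA M₂ = win hA hN hNA M₁ :=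
          (win_eq (h₄.win_of_mem hNA hv₂)).trans (win_eq (h₂.win_of_mem hNA hw₁)).symm
        have hcoef : D.coef (win hA hN hNA M) (win hA hN hNA M₁) b =
            -c * D.coef (win hA hN hNA M) (win hA hN hNA M₁) a := by
          exact D.coef_smul (sub_neg_smul_mem hNA ha hb hav hbw hc)
            (IsStep.notMem_win hNA ha hav hvN) (h₁.win_eq hNA ha hav hvN)
        rw [tau_eq_of_dep hvN hc, jmp_eq_zero hvN, jmp_eq_zero hwN, jmp_eq_one hw₁, jmp_eq_one hv₂,
          D.cochain_c_of_win (h₂.win_of_mem hNA hw₁), D.cochain_c_of_win (h₄.win_of_mem hNA hv₂),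
          D.cochain_c_eq h₁ ha hav, D.cochain_c_eq h₃ hb hbw, e, hcoef]
        simp [sgn_two]
      · have hw₁ : w ∉ M₁.1 ⊔ N := fun h => hd (hq N hwN h)
        have hv₂ : v ∉ M₂.1 ⊔ N := fun h => hd (hs N hvN h)
        rw [tau_eq_one (fun h => hvN h.1) (fun h => hd h.2), jmp_eq_zero hw₁, jmp_eq_zero hv₂,
          D.cochain_c_eq h₁ ha hav, D.cochain_c_eq h₂ hb (h₁.le hbw), D.cochain_c_eq h₃ hb hbw,
          D.cochain_c_eq h₄ ha (h₃.le hav),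
          D.coef_swap (U := win hA hN hNA M) (U₁ := win hA hN hNA M₁) (U₂ := win hA hN hNA M₂)
            (U' := win hA hN hNA M₃) (IsStep.notMem_win hNA ha hav hvN)
            (IsStep.notMem_win hNA hb hbw hwN)
            (IsStep.notMem_win hNA hb (h₁.le hbw) hw₁) (IsStep.notMem_win hNA ha (h₃.le hav) hv₂)
            (h₁.win_eq hNA ha hav hvN) (h₃.win_eq hNA hb hbw hwN)
            (h₂.win_eq hNA hb (h₁.le hbw) hw₁) (h₄.win_eq hNA ha (h₃.le hav) hv₂)]
        simp [Sys.sgn_zero]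
  · have hwN : w ∉ M.1 ⊔ N := fun h => hwA (hle h)
    obtain ⟨a, ha, hav⟩ := mem_sup_iff_exists_sub.1 hvA
    have hw₁ : w ∉ M₁.1 ⊔ A := fun h => by
      obtain ⟨c, hc⟩ := hq A hwA h
      exact hwA (mem_of_add_smul hvA hc)
    rw [tau_eq_one (fun h => hwA h.2) (fun h => h.1 hvA),
      tau_eq_one (fun h => hwN h.2) (fun ⟨_, c, hc⟩ => hwA (mem_of_add_smul hvA (hle hc))),
      jmp_eq_zero hwN, jmp_eq_zero hwA, jmp_eq_zero fun h => hw₁ (sup_le_sup_left hNA _ h),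
      D.cochain_c_of_win (h₂.win_of_notMem hw₁), D.cochain_c_of_win (h₃.win_of_notMem hwA),
      D.cochain_c_eq h₁ ha hav, D.cochain_c_eq h₄ ha (h₃.le hav), win_eq (h₂.win_of_notMem hw₁),
      win_eq (h₃.win_of_notMem hwA)]
    simp [Sys.sgn_zero]
  · have hvN : v ∉ M.1 ⊔ N := fun h => hvA (hle h)
    obtain ⟨b, hb, hbw⟩ := mem_sup_iff_exists_sub.1 hwA
    have hv₂ : v ∉ M₂.1 ⊔ A := fun h => by
      obtain ⟨c, hc⟩ := hs A hvA h
      exact hvA (mem_of_add_smul' c.ne_zero hwA hc)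
    rw [tau_eq_one (fun h => hvA h.1) (fun ⟨_, c, hc⟩ => hv₂ (hs' A c hc)),
      tau_eq_one (fun h => hvN h.1) (fun ⟨_, c, hc⟩ => hv₂ (hs' A c (hle hc))),
      jmp_eq_zero hvN, jmp_eq_zero hvA, jmp_eq_zero fun h => hv₂ (sup_le_sup_left hNA _ h),
      D.cochain_c_of_win (h₁.win_of_notMem hvA), D.cochain_c_of_win (h₄.win_of_notMem hv₂),
      D.cochain_c_eq h₂ hb (h₁.le hbw), D.cochain_c_eq h₃ hb hbw, win_eq (h₁.win_of_notMem hvA),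
      win_eq (h₄.win_of_notMem hv₂)]
    simp [Sys.sgn_zero]
  · have hvN : v ∉ M.1 ⊔ N := fun h => hvA (hle h)
    have hwN : w ∉ M.1 ⊔ N := fun h => hwA (hle h)
    rw [jmp_eq_zero hvN, jmp_eq_zero hvA, jmp_eq_zero hwN, jmp_eq_zero hwA,
      D.cochain_c_of_win (h₁.win_of_notMem hvA), D.cochain_c_of_win (h₃.win_of_notMem hwA)]
    by_cases hd : ∃ c : kˣ, w + (c : k) • v ∈ M.1 ⊔ A
    · obtain ⟨c, hc⟩ := hd
      rw [tau_eq_of_dep hvA hc]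
      by_cases hd' : ∃ c : kˣ, w + (c : k) • v ∈ M.1 ⊔ N
      · obtain ⟨c', hc'⟩ := hd'
        rw [tau_eq_of_dep hvN hc', Units.ext (coeff_unique hvA hc (hle hc')),
          D.cochain_c_of_win (h₂.win_of_mem hNA (hq' N c' hc')),
          D.cochain_c_of_win (h₄.win_of_mem hNA (hs' N c' hc'))]
        simp [Sys.sgn_zero]
      · have hv₂ : v ∉ M₂.1 ⊔ N := fun h => hd' (hs N hvN h)
        obtain ⟨a, ha, hac⟩ := mem_sup_iff_exists_sub.1 hc
        have ha' : (c : k)⁻¹ • a ∈ A := A.smul_mem _ ha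
        have hcv : (c : k)⁻¹ • a - v ∈ M₂.1 := inv_smul_sub_mem c.ne_zero h₃.le h₃.mem hac
        rw [tau_eq_one (fun h => hvN h.1) (fun h => hd' h.2),
          D.cochain_c_eq h₂ ha (sub_mem_of_add_smul h₁.le h₁.mem hac), D.cochain_c_eq h₄ ha' hcv,
          ← win_eq (h₁.win_of_notMem hvA), win_eq (h₃.win_of_notMem hwA),
          D.coef_smul (α := c) (U := win hA hN hNA M₂) (U' := win hA hN hNA M₃)
            (a := (c : k)⁻¹ • a) (b := a) (sub_smul_inv_smul_mem c a)
            (IsStep.notMem_win hNA ha' hcv hv₂) (h₄.win_eq hNA ha' hcv hv₂)]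
        simp [Sys.sgn_zero]
    · have hw₁ : w ∉ M₁.1 ⊔ A := fun h => hd (hq A hwA h)
      have hv₂ : v ∉ M₂.1 ⊔ A := fun h => hd (hs A hvA h)
      rw [tau_eq_one (fun h => hvA h.1) (fun h => hd h.2),
        tau_eq_one (fun h => hvN h.1) (fun ⟨_, c, hc⟩ => hd ⟨c, hle hc⟩),
        D.cochain_c_of_win (h₂.win_of_notMem hw₁), D.cochain_c_of_win (h₄.win_of_notMem hv₂)]
      simp [Sys.sgn_zero]

/-- A determinantal theory on `A / N` behaves like the relative determinant of `A` and `N`. -/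
theorem isCo_cochain : IsCo A N N A (D.cochain hA hN hNA) where
  jump := D.cochain_jump
  scale := D.cochain_scale
  square := D.cochain_square
  deg h := by simp only [cochain]; rw [win_eq h]
  triv _ h := D.cochain_c_of_win h
  win {M M' P P' v w} h h' H hv hw hvw := by
    have H' := h.win_congr h' H hv hw hvw
    have h0 : ∀ (M : Colat k k') (v : LL k'), v - v ∈ M.1 := fun M v => by
      rw [sub_self]; exact zero_mem _
    by_cases hvN : v ∈ M.1 ⊔ N
    · have e := h.win_of_mem hNA hvN
      rw [D.cochain_c_of_win e, D.cochain_c_of_win (H.symm.trans (e.trans H'))]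
    · rw [D.cochain_c_eq h hv (h0 _ _), D.cochain_c_eq h' hw (h0 _ _), ← win_eq H, ← win_eq H']
      refine Eq.symm ((D.coef_smul (U := win hA hN hNA M) (U' := win hA hN hNA M') (α := 1) ?_
        (IsStep.notMem_win hNA hv (h0 _ _) hvN) (h.win_eq hNA hv (h0 _ _) hvN)).trans (one_mul _))
      rw [Units.val_one, one_smul, ← neg_sub]
      exact Submodule.mem_sup_right (neg_mem hvw)

theorem stepMap_vec (h : IsStep M M' v) :
    D.stepMap hA hN hNA h (vec (D.Δ (win hA hN hNA M))) =
      (D.cochain hA hN hNA).c M M' v • vec (D.Δ (win hA hN hNA M')) := by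
  have key : ∀ (U : Lattice₁ A N) (hU : win hA hN hNA M = U)
      (hle : (win hA hN hNA M).1 ≤ U.1) (a : U.1),
      D.wedge (win hA hN hNA M) U hle a (vec (D.Δ (win hA hN hNA M))) = vec (D.Δ U) := by
    intro U hU hle a
    subst hU
    exact D.wedge_self _ _ _
  by_cases hv : v ∈ M.1 ⊔ A
  · by_cases hv' : v ∈ M.1 ⊔ N
    · have H := h.win_of_mem hNA hv'
      rw [D.cochain_c_of_win H, one_smul]
      exact key _ (win_eq H) _ _
    · obtain ⟨h₁, h₂⟩ := rep_mem_left hv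
      exact D.wedge_vec (U := win hA hN hNA M) (U' := win hA hN hNA M') (h.win_le A N)
        (h.rep_mem A N) (IsStep.notMem_win hNA h₁ h₂ hv') (h.win_eq hNA h₁ h₂ hv')
  · have H := h.win_of_notMem (N := N) hv
    rw [D.cochain_c_of_win H, one_smul]
    exact key _ (win_eq H) _ _

end DetTheory

end LL

/-! ### Systems and cochains -/

namespace LL

open GradedLine

variable {k k' : Type u} [Field k] [Field k'] [Algebra k k']

theorem im_mul (g h : TateGL k k') (Λ : Submodule k (LL k')) : im g (im h Λ) = im (g * h) Λ :=
  (Submodule.map_comp _ _ _).symm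

theorem im_one (Λ : Submodule k (LL k')) : im (1 : TateGL k k') Λ = Λ := Submodule.map_id _

theorem act_mul (g h : TateGL k k') (M : Colat k k') : act (g * h) M = act h (act g M) := rfl

/-- The cochains of the systems which behave like the relative determinant
`M ↦ det (M ∩ Λ₂ | M ∩ Λ₁)`. -/
def IsCoc (Λ₁ Λ₂ : Submodule k (LL k')) (x : Cochain k k') : Prop :=
  ∃ a b, a ≤ b ∧ IsCo (S k a) (S k b) Λ₁ Λ₂ x

/-- A function on colattices which depends only on the images in some `S_a / S_b`. -/
def Stable {α : Type*} (f : Colat k k' → α) : Prop := ∃ a b, ∀ M M', Agree a b M M' → f M = f M'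

theorem Stable.mul {f f' : Colat k k' → kˣ} (h : Stable f) (h' : Stable f') :
    Stable fun M => f M * f' M :=
  Sys.window_mono (Sys.exists_window h h') fun _ _ e => congrArg₂ _ e.1 e.2

theorem Stable.comp {α β : Type*} {f : Colat k k' → α} (h : Stable f) (φ : α → β) :
    Stable fun M => φ (f M) :=
  Sys.window_mono h fun _ _ e => congrArg φ e

theorem Stable.act {α : Type*} {f : Colat k k' → α} (h : Stable f) (g : TateGL k k') :
    Stable fun M => f (act g M) :=
  Sys.exists_window_act g h

theorem stable_const {α : Type*} (c : α) : Stable fun _ : Colat k k' => c := ⟨0, 0, fun _ _ _ => rfl⟩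

namespace IsCoc

variable {Λ₁ Λ₂ Λ₃ : Submodule k (LL k')} {x y : Cochain k k'}

theorem of_isCo {A N : Submodule k (LL k')} (hA : IsLattice A) (hN : IsLattice N) (hNA : N ≤ A)
    (h : IsCo A N Λ₁ Λ₂ x) : IsCoc Λ₁ Λ₂ x := by
  obtain ⟨a, ha⟩ := hA.exists_le
  obtain ⟨b, hb⟩ := hN.exists_ge
  exact ⟨min a b, b, min_le_right _ _, h.mono (ha.trans (S_anti (min_le_left _ _))) hb hNA⟩

theorem exists_common (hx : IsCoc Λ₁ Λ₂ x) {Λ₁' Λ₂' : Submodule k (LL k')} (hy : IsCoc Λ₁' Λ₂' y) :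
    ∃ a b, a ≤ b ∧ IsCo (S k a) (S k b) Λ₁ Λ₂ x ∧ IsCo (S k a) (S k b) Λ₁' Λ₂' y := by
  obtain ⟨a, b, h, hx⟩ := hx
  obtain ⟨a', b', h', hy⟩ := hy
  exact ⟨min a a', max b b', (min_le_left _ _).trans (h.trans (le_max_left _ _)),
    hx.mono (S_anti (min_le_left _ _)) (S_anti (le_max_left _ _)) (S_anti h),
    hy.mono (S_anti (min_le_right _ _)) (S_anti (le_max_right _ _)) (S_anti h')⟩

theorem mul (hx : IsCoc Λ₁ Λ₂ x) (hy : IsCoc Λ₂ Λ₃ y) : IsCoc Λ₁ Λ₃ (x.mul y) := by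
  obtain ⟨a, b, h, hx, hy⟩ := hx.exists_common hy
  exact ⟨a, b, h, hx.mul hy⟩

theorem inv (hx : IsCoc Λ₁ Λ₂ x) : IsCoc Λ₂ Λ₁ x.inv := by
  obtain ⟨a, b, h, hx⟩ := hx
  exact ⟨a, b, h, hx.inv⟩

theorem act (hx : IsCoc Λ₁ Λ₂ x) (g : TateGL k k') : IsCoc (im g Λ₁) (im g Λ₂) (x.act g) := by
  obtain ⟨a, b, h, hx⟩ := hx
  exact of_isCo ((isLattice_S a).im g) ((isLattice_S b).im g) (Submodule.map_mono (S_anti h))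
    (hx.act g)

theorem const (Λ : Submodule k (LL k')) (n : ℤ) : IsCoc Λ Λ (Cochain.const k k' n) :=
  ⟨0, 0, le_rfl, IsCo.const _ _ _ _⟩

theorem tw (hx : IsCoc Λ₁ Λ₂ x) {f : Colat k k' → kˣ} (hf : Stable f) : IsCoc Λ₁ Λ₂ (x.tw f) := by
  obtain ⟨a, b, h, hx⟩ := hx
  obtain ⟨a', b', hf⟩ := hf
  refine ⟨min a a', max b b', (min_le_left _ _).trans (h.trans (le_max_left _ _)),
    (hx.mono (S_anti (min_le_left _ _)) (S_anti (le_max_left _ _)) (S_anti h)).tw fun M M' H => ?_⟩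
  exact hf M M' (Agree.mono (min_le_right _ _) (le_max_right _ _) H)

theorem stable_d (hx : IsCoc Λ₁ Λ₂ x) : Stable x.d := by
  obtain ⟨a, b, -, hx⟩ := hx
  exact ⟨a, b, fun _ _ h => hx.deg h⟩

theorem exists_tw [FiniteDimensional k k'] (hx : IsCoc Λ₁ Λ₂ x) (hy : IsCoc Λ₁ Λ₂ y) :
    ∃ n : ℤ, (∀ M, y.d M = n + x.d M) ∧ ∃ f : Colat k k' → kˣ, Stable f ∧
      ∀ {M M' : Colat k k'} {v : LL k'}, IsStep M M' v →
        f M' * y.c M M' v = f M * x.c M M' v := by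
  obtain ⟨a, b, h, hx, hy⟩ := hx.exists_common hy
  obtain ⟨n, hn, f, hf, h'⟩ := IsCo.exists_tw h hx hy
  exact ⟨n, hn, f, ⟨a, b, hf⟩, h'⟩

end IsCoc

/-- A choice of a nonzero vector in each line of a system, in terms of which the degrees and the
steps of the system are given by the cochain `x`. -/
structure IsFrame (X : Sys k k') (x : Cochain k k') (e : ∀ M, (X.line M).V) : Prop where
  ne : ∀ M, e M ≠ 0
  deg : ∀ M, (X.line M).deg = x.d M
  step : ∀ {M M' : Colat k k'} {v : LL k'} (h : IsStep M M' v),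
    X.step h (e M) = x.c M M' v • e M'
  stable : ∃ a b, ∀ M M', Agree a b M M' → ∃ h : X.line M = X.line M',
    Hom.e (eqToHom h) (e M) = e M'

theorem eqToHom_tm {A A' B B' : GradedLine k} {a : A.V} {a' : A'.V} {b : B.V} {b' : B'.V}
    (h : ∃ h : A = A', Hom.e (eqToHom h) a = a') (h' : ∃ h : B = B', Hom.e (eqToHom h) b = b') :
    ∃ h : A ⊗ B = A' ⊗ B', Hom.e (eqToHom h) (tm a b) = tm a' b' := by
  obtain ⟨rfl, rfl⟩ := h
  obtain ⟨rfl, rfl⟩ := h'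
  exact ⟨rfl, rfl⟩

theorem eqToHom_smul {A A' : GradedLine k} {a : A.V} {a' : A'.V}
    (h : ∃ h : A = A', Hom.e (eqToHom h) a = a') {c c' : kˣ} (hc : c = c') :
    ∃ h : A = A', Hom.e (eqToHom h) (c • a) = c' • a' := by
  obtain ⟨rfl, rfl⟩ := h
  exact ⟨rfl, by rw [hc]; rfl⟩

namespace IsFrame

variable {X Y : Sys k k'} {x y : Cochain k k'} {e : ∀ M, (X.line M).V} {f : ∀ M, (Y.line M).V}

theorem const (l : GradedLine k) {v : l.V} (hv : v ≠ 0) :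
    IsFrame (Sys.const l) (Cochain.const k k' l.deg) fun _ => v where
  ne _ := hv
  deg _ := rfl
  step _ := (one_smul _ _).symm
  stable := ⟨0, 0, fun _ _ _ => ⟨rfl, rfl⟩⟩

theorem mul (hX : IsFrame X x e) (hY : IsFrame Y y f) :
    IsFrame (X ⊗ Y) (x.mul (y.act X.g)) fun M => tm (e M) (f (act X.g M)) where
  ne M := DetTheory.tm_ne_zero (hX.ne M) (hY.ne _)
  deg M := congrArg₂ (· + ·) (hX.deg M) (hY.deg _)
  step {M M' v} h := by
    refine (Sys.mul_step X Y h _ _).trans ?_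
    rw [hX.step, hY.step, smul_tm, tm_smul, smul_smul, smul_smul, hX.deg, hX.deg, hY.deg]
    refine Sys.smul_congr ?_ rfl
    exact (mul_assoc _ _ _).trans (mul_comm _ _)
  stable := Sys.window_mono (Sys.exists_window hX.stable (Sys.exists_window_act X.g hY.stable))
    fun _ _ h => eqToHom_tm h.1 h.2

theorem tw (hX : IsFrame X x e) {φ : Colat k k' → kˣ} (hφ : Stable φ) (hd : ∀ M, y.d M = x.d M)
    (hc : ∀ {M M' : Colat k k'} {v : LL k'}, IsStep M M' v →
      φ M' * y.c M M' v = φ M * x.c M M' v) : IsFrame X y fun M => φ M • e M where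
  ne M := by
    rw [Ne, smul_eq_zero_iff_eq]
    exact hX.ne M
  deg M := (hX.deg M).trans (hd M).symm
  step h := by rw [Sys.step_smul, hX.step, smul_smul, smul_smul, ← hc h, mul_comm]
  stable := Sys.window_mono (Sys.exists_window hX.stable hφ) fun _ _ h => eqToHom_smul h.1 h.2

end IsFrame

/-- The vector of `Hom (X, Y)` which maps `e` to `f`. -/
def homVec {X Y : GradedLine k} {e : X.V} {f : Y.V} (he : e ≠ 0) (hf : f ≠ 0) : (homLine X Y).V :=
  (lineEquiv Y hf).toLinearMap ∘ₗ (lineEquiv X he).symm.toLinearMap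

theorem homVec_apply {X Y : GradedLine k} {e : X.V} {f : Y.V} (he : e ≠ 0) (hf : f ≠ 0) :
    (show X.V →ₗ[k] Y.V from homVec he hf) e = f := by
  change lineEquiv Y hf ((lineEquiv X he).symm e) = f
  rw [show (lineEquiv X he).symm e = 1 by
    rw [LinearEquiv.symm_apply_eq, lineEquiv_apply, one_smul], lineEquiv_apply, one_smul]

theorem homVec_ne_zero {X Y : GradedLine k} {e : X.V} {f : Y.V} (he : e ≠ 0) (hf : f ≠ 0) :
    homVec he hf ≠ 0 := by
  intro h
  have h₁ := homVec_apply he hf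
  have h₂ : (show X.V →ₗ[k] Y.V from homVec he hf) = 0 := h
  rw [h₂, LinearMap.zero_apply] at h₁
  exact hf h₁.symm

theorem inverse_apply {X Y : GradedLine k} {e : X.V} {f : Y.V} (he : e ≠ 0) (hf : f ≠ 0)
    {φ : X.V →ₗ[k] Y.V} {c : kˣ} (h : φ e = c • f) : inverse φ f = c⁻¹ • e := by
  have hφ : φ = ((lineEquiv X he).symm.trans ((LinearEquiv.smulOfUnit c).trans
      (lineEquiv Y hf))).toLinearMap := by
    refine LinearMap.ext fun x => ?_
    obtain ⟨a, rfl⟩ := exists_smul X he x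
    have : (lineEquiv X he).symm (a • e) = a := by
      rw [LinearEquiv.symm_apply_eq, lineEquiv_apply]
    rw [map_smul, h]
    change _ = lineEquiv Y hf (c • (lineEquiv X he).symm (a • e))
    rw [this, lineEquiv_apply, smul_assoc, smul_comm]
  have hb : Function.Bijective φ := by
    rw [hφ]
    exact LinearEquiv.bijective _
  rw [inverse, dif_pos hb, LinearEquiv.coe_coe, LinearEquiv.symm_apply_eq]
  change f = φ ((c⁻¹ : kˣ) • e)
  rw [Units.smul_def, map_smul, h, ← Units.smul_def, inv_smul_smul]

/-- A linear map between the lines `Hom (X, Y)` and `Hom (X', Y')` in terms of bases. -/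
theorem homLine_step {X X' Y Y' : GradedLine k} {e : X.V} {e' : X'.V} {f : Y.V} {f' : Y'.V}
    (he : e ≠ 0) (he' : e' ≠ 0) (hf : f ≠ 0) (hf' : f' ≠ 0) {φ : X.V →ₗ[k] X'.V}
    {ψ : Y.V →ₗ[k] Y'.V} {a b s c : kˣ} (hφ : φ e = a • e') (hψ : ψ f = b • f')
    (h : s * (b * a⁻¹) = c) :
    ((s : k) • homMap (inverse φ) ψ) (homVec he hf) = c • (homVec he' hf' : (homLine X' Y').V) := by
  refine LinearMap.ext fun z => ?_
  obtain ⟨r, rfl⟩ := exists_smul _ he' z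
  have h₁ : (show X'.V →ₗ[k] Y'.V from ((s : k) • homMap (inverse φ) ψ) (homVec he hf)) e' =
      (show X'.V →ₗ[k] Y'.V from c • (homVec he' hf' : (homLine X' Y').V)) e' := by
    change (s : k) • ψ ((show X.V →ₗ[k] Y.V from homVec he hf) (inverse φ e')) =
      (c : k) • (show X'.V →ₗ[k] Y'.V from homVec he' hf') e'
    rw [homVec_apply, inverse_apply he he' hφ, Units.smul_def, map_smul, homVec_apply, map_smul,
      hψ, ← h, ← Units.smul_def, ← Units.smul_def, ← Units.smul_def, smul_smul, smul_smul,
      mul_assoc, mul_comm a⁻¹ b]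
  exact (LinearMap.map_smul _ _ _).trans ((congrArg _ h₁).trans (LinearMap.map_smul _ _ _).symm)

section Leaf

variable {L : Submodule k (LL k')} (hL : IsLattice L) (g : TateGL k k')
  (Dp : DetTheory (im g L) (L ⊓ im g L)) (Dm : DetTheory L (L ⊓ im g L))

/-- The sign relating the frame of `leaf` to the product of the cochains of the two determinantal
theories, as a function of the degrees. -/
def leafExp (m p : ℤ) : ℤ := m * p + m * (m - 1) / 2

theorem leafExp_congr {m p m' p' : ℤ} (h : m' - m = 0 ∨ m' - m = 1) :
    ∃ t : ℤ, (p' - p) * m' =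
      (m' - m) * m + (-m' - -m) * p + leafExp m p - leafExp m' p' + 2 * t := by
  have key : ∀ m : ℤ, ∃ q, m * (m - 1) = 2 * q := fun m => by
    obtain ⟨q, hq⟩ := Int.even_mul_pred_self m
    exact ⟨q, by rw [hq]; ring⟩
  obtain ⟨q, hq⟩ := key m
  rcases h with h | h
  · obtain rfl : m' = m := by omega
    exact ⟨m' * (p' - p), by simp only [leafExp]; ring⟩
  · obtain rfl : m' = m + 1 := by omega
    have e : (m + 1) * (m + 1 - 1) / 2 = q + m := by
      rw [show (m + 1) * (m + 1 - 1) = 2 * (q + m) by linear_combination hq]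
      exact Int.mul_ediv_cancel_left _ two_ne_zero
    have e' : m * (m - 1) / 2 = q := by
      rw [hq]
      exact Int.mul_ediv_cancel_left _ two_ne_zero
    refine ⟨p' * (m + 1) - p * m, ?_⟩
    simp only [leafExp, e, e']
    ring

/-- The cochain of a relative determinantal theory. -/
def leafCochain : Cochain k k' :=
  (((Dm.cochain hL (hL.inf (hL.im g)) inf_le_left).inv.mul
    (Dp.cochain (hL.im g) (hL.inf (hL.im g)) inf_le_right))).tw fun M =>
      sgn k (leafExp ((Dm.cochain hL (hL.inf (hL.im g)) inf_le_left).d M)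
        ((Dp.cochain (hL.im g) (hL.inf (hL.im g)) inf_le_right).d M))

/-- A relative determinantal theory behaves like the relative determinant of `g L` and `L`: up to a
change of bases by signs, its cochain is the product of the inverse of the cochain for
`L / L ∩ g L` with the cochain for `g L / L ∩ g L`. -/
theorem isCoc_leafCochain : IsCoc L (im g L) (leafCochain hL g Dp Dm) := by
  have h₁ := IsCoc.of_isCo hL (hL.inf (hL.im g)) inf_le_left
    (Dm.isCo_cochain (hA := hL) (hN := hL.inf (hL.im g)) (hNA := inf_le_left))
  have h₂ := IsCoc.of_isCo (hL.im g) (hL.inf (hL.im g)) inf_le_right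
    (Dp.isCo_cochain (hA := hL.im g) (hN := hL.inf (hL.im g)) (hNA := inf_le_right))
  refine (h₁.inv.mul h₂).tw ?_
  exact Sys.window_mono (Sys.exists_window h₁.stable_d h₂.stable_d) fun M M' h =>
    congrArg₂ (fun m p => sgn k (leafExp m p)) h.1 h.2

/-- The vector of the line of `leaf` over `M` which maps the chosen vector of `Δ₋` to that of
`Δ₊`. -/
def leafVec (M : Colat k k') : ((leaf hL g Dp Dm).line M).V :=
  homVec (vec_ne_zero (Dm.Δ (win hL (hL.inf (hL.im g)) inf_le_left M)))
    (vec_ne_zero (Dp.Δ (win (hL.im g) (hL.inf (hL.im g)) inf_le_right M)))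

theorem leafVec_ne_zero (M : Colat k k') : leafVec hL g Dp Dm M ≠ 0 := homVec_ne_zero _ _

theorem leaf_step {M M' : Colat k k'} {v : LL k'} (h : IsStep M M' v) :
    (leaf hL g Dp Dm).step h (leafVec hL g Dp Dm M) =
      (leafCochain hL g Dp Dm).c M M' v • leafVec hL g Dp Dm M' := by
  have hm := Dm.stepMap_vec (hA := hL) (hN := hL.inf (hL.im g)) (hNA := inf_le_left) h
  have hp := Dp.stepMap_vec (hA := hL.im g) (hN := hL.inf (hL.im g)) (hNA := inf_le_right) h
  have hj := Dm.cochain_jump (hA := hL) (hN := hL.inf (hL.im g)) (hNA := inf_le_left) h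
  have h01 : (Dm.cochain hL (hL.inf (hL.im g)) inf_le_left).d M' -
      (Dm.cochain hL (hL.inf (hL.im g)) inf_le_left).d M = 0 ∨
      (Dm.cochain hL (hL.inf (hL.im g)) inf_le_left).d M' -
      (Dm.cochain hL (hL.inf (hL.im g)) inf_le_left).d M = 1 := by
    rw [hj]
    by_cases h₁ : v ∈ M.1 ⊔ (L ⊓ im g L)
    · have h₂ : v ∈ M.1 ⊔ L := (sup_le_sup_left inf_le_left _ : M.1 ⊔ (L ⊓ im g L) ≤ M.1 ⊔ L) h₁
      rw [jmp_eq_one h₁, jmp_eq_one h₂]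
      exact Or.inl rfl
    · rw [jmp_eq_zero h₁, sub_zero]
      by_cases h₂ : v ∈ M.1 ⊔ L
      · exact Or.inr (jmp_eq_one h₂)
      · exact Or.inl (jmp_eq_zero h₂)
  obtain ⟨t, ht⟩ := leafExp_congr
    (p := (Dp.cochain (hL.im g) (hL.inf (hL.im g)) inf_le_right).d M)
    (p' := (Dp.cochain (hL.im g) (hL.inf (hL.im g)) inf_le_right).d M') h01
  refine homLine_step (vec_ne_zero _) (vec_ne_zero _) (vec_ne_zero _) (vec_ne_zero _) hm hp ?_
  set cm := (Dm.cochain hL (hL.inf (hL.im g)) inf_le_left) with hcm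
  set cp := (Dp.cochain (hL.im g) (hL.inf (hL.im g)) inf_le_right) with hcp
  change sgn k ((cp.d M' - cp.d M) * cm.d M') * (cp.c M M' v * (cm.c M M' v)⁻¹) =
    (cm.c M M' v)⁻¹ * sgn k ((cm.d M' - cm.d M) * cm.d M) * cp.c M M' v *
    sgn k ((-cm.d M' - -cm.d M) * cp.d M) * (sgn k (leafExp (cm.d M) (cp.d M)) *
      (sgn k (leafExp (cm.d M') (cp.d M')))⁻¹)
  have e : sgn k ((cp.d M' - cp.d M) * cm.d M') = sgn k ((cm.d M' - cm.d M) * cm.d M) *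
      sgn k ((-cm.d M' - -cm.d M) * cp.d M) * (sgn k (leafExp (cm.d M) (cp.d M)) *
      (sgn k (leafExp (cm.d M') (cp.d M')))⁻¹) := by
    rw [sgn_congr t ht, sub_eq_add_neg _ (leafExp _ _), sgn_add, sgn_add, sgn_add, sgn_neg, sgn_inv,
      mul_assoc (_ * _) (sgn k _) (sgn k _)]
  rw [e]
  ac_rfl
/-- The scalar which relates two choices of a vector of the line `Hom (Δ₋ (U), Δ₊ (V))`. -/
def homScalar (U : Lattice₁ L (L ⊓ im g L)) (V : Lattice₁ (im g L) (L ⊓ im g L)) : kˣ :=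
  (exists_unit_smul (homLine (Dm.Δ U) (Dp.Δ V)) (vec_ne_zero _)
    (homVec_ne_zero (vec_ne_zero _) (vec_ne_zero _))).choose

theorem leafVec_eq (M : Colat k k') : leafVec hL g Dp Dm M =
    homScalar g Dp Dm (win hL (hL.inf (hL.im g)) inf_le_left M)
      (win (hL.im g) (hL.inf (hL.im g)) inf_le_right M) • vec ((leaf hL g Dp Dm).line M) :=
  (exists_unit_smul (homLine (Dm.Δ _) (Dp.Δ _)) (vec_ne_zero _)
    (homVec_ne_zero (vec_ne_zero _) (vec_ne_zero _))).choose_spec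

theorem eqToHom_vec {X Y : GradedLine k} (h : X = Y) :
    ∃ h : X = Y, Hom.e (eqToHom h) (vec X) = vec Y := by
  subst h
  exact ⟨rfl, rfl⟩

theorem leafVec_stable : ∃ a b, ∀ M M', Agree a b M M' →
    ∃ h : (leaf hL g Dp Dm).line M = (leaf hL g Dp Dm).line M',
      Hom.e (eqToHom h) (leafVec hL g Dp Dm M) = leafVec hL g Dp Dm M' := by
  obtain ⟨a, ha⟩ := hL.exists_le
  obtain ⟨a', ha'⟩ := (hL.im g).exists_le
  obtain ⟨b, hb⟩ := (hL.inf (hL.im g)).exists_ge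
  have h₁ : ∃ a b, ∀ M M', Agree a b M M' → win hL (hL.inf (hL.im g)) inf_le_left M =
      win hL (hL.inf (hL.im g)) inf_le_left M' :=
    ⟨a, b, fun M M' h => Subtype.ext (h.inf_sup ha hb inf_le_left)⟩
  have h₂ : ∃ a b, ∀ M M', Agree a b M M' → win (hL.im g) (hL.inf (hL.im g)) inf_le_right M =
      win (hL.im g) (hL.inf (hL.im g)) inf_le_right M' :=
    ⟨a', b, fun M M' h => Subtype.ext (h.inf_sup ha' hb inf_le_right)⟩
  refine Sys.window_mono (Sys.exists_window (leaf hL g Dp Dm).stable (Sys.exists_window h₁ h₂))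
    fun M M' ⟨h, h₁, h₂⟩ => ?_
  rw [leafVec_eq, leafVec_eq]
  exact eqToHom_smul (eqToHom_vec h) (congrArg₂ _ h₁ h₂)

theorem leaf_deg (M : Colat k k') :
    ((leaf hL g Dp Dm).line M).deg = (leafCochain hL g Dp Dm).d M := (neg_add_eq_sub _ _).symm

theorem isFrame_leaf : IsFrame (leaf hL g Dp Dm) (leafCochain hL g Dp Dm) (leafVec hL g Dp Dm) where
  ne := leafVec_ne_zero hL g Dp Dm
  deg := leaf_deg hL g Dp Dm
  step := leaf_step hL g Dp Dm
  stable := leafVec_stable hL g Dp Dm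

end Leaf

variable {L : Submodule k (LL k')} (hL : IsLattice L)

variable (L) in
/-- A frame of a system whose cochain behaves like the relative determinant of `g L` and `L`, where
the system lies over `g`. -/
structure IsDetFrame (X : Sys k k') (x : Cochain k k') (e : ∀ M, (X.line M).V) : Prop where
  frame : IsFrame X x e
  coc : IsCoc L (im X.g L) x

theorem IsDetFrame.mul {X Y : Sys k k'} {x y : Cochain k k'} {e : ∀ M, (X.line M).V}
    {f : ∀ M, (Y.line M).V} (hX : IsDetFrame L X x e) (hY : IsDetFrame L Y y f) :
    IsDetFrame L (X ⊗ Y) (x.mul (y.act X.g)) fun M => tm (e M) (f (act X.g M)) where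
  frame := hX.frame.mul hY.frame
  coc := hX.coc.mul (im_mul X.g Y.g L ▸ hY.coc.act X.g)

theorem IsDetFrame.const (l : GradedLine k) {v : l.V} (hv : v ≠ 0) :
    IsDetFrame L (Sys.const l) (Cochain.const k k' l.deg) fun _ => v where
  frame := IsFrame.const l hv
  coc := by
    have := IsCoc.const L l.deg
    change IsCoc L (im (1 : TateGL k k') L) _
    rwa [im_one]

variable {hL} in
theorem IsDet.exists_frame {X : Sys k k'} (h : IsDet hL X) : ∃ x e, IsDetFrame L X x e := by
  induction h with
  | const l => exact ⟨_, _, IsDetFrame.const l (vec_ne_zero l)⟩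
  | leaf g Dp Dm =>
    exact ⟨_, _, isFrame_leaf hL g Dp Dm, isCoc_leafCochain hL g Dp Dm⟩
  | tensor X Y _ _ ihX ihY =>
    obtain ⟨x, e, hX⟩ := ihX
    obtain ⟨y, f, hY⟩ := ihY
    exact ⟨_, _, hX.mul hY⟩

variable (k) in
/-- A graded line of degree `n`. -/
def lineOf (n : ℤ) : GradedLine k := ⟨k, Module.finrank_self k, n⟩

variable [FiniteDimensional k k']

/-- Every cochain which behaves like the relative determinant of `g L` and `L` is that of a system
in the determinantal extension. -/
theorem exists_isDetFrame {g : TateGL k k'} {y : Cochain k k'} (hy : IsCoc L (im g L) y) :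
    ∃ X, IsDet hL X ∧ X.g = g ∧ ∃ e, IsDetFrame L X y e := by
  obtain ⟨Dp⟩ := exists_detTheory (hL.im g) (hL.inf (hL.im g)) inf_le_right
  obtain ⟨Dm⟩ := exists_detTheory hL (hL.inf (hL.im g)) inf_le_left
  have he := isFrame_leaf hL g Dp Dm
  have hc := isCoc_leafCochain hL g Dp Dm
  obtain ⟨n, hn, f, hf, h⟩ := hc.exists_tw hy
  refine ⟨Sys.const (lineOf k n) ⊗ leaf hL g Dp Dm, .tensor _ _ (.const _) (.leaf _ _ _),
    one_mul g, _, ((IsFrame.const (lineOf k n) (vec_ne_zero _)).mul he).tw hf hn fun {M M' v} hs => ?_, ?_⟩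
  · rw [h hs]
    change _ = f M * (1 * (leafCochain hL g Dp Dm).c M M' v * sgn k ((n - n) * _))
    rw [sub_self, zero_mul, Sys.sgn_zero, one_mul, mul_one]
  · change IsCoc L (im (1 * g) L) y
    rwa [one_mul]

end LL

/-! ### Morphisms in terms of frames -/

namespace LL

open GradedLine

variable {k k' : Type u} [Field k] [Field k'] [Algebra k k']

theorem IsFrame.exists_scalar {X Y : Sys k k'} {x y : Cochain k k'} {e : ∀ M, (X.line M).V}
    {f : ∀ M, (Y.line M).V} (hX : IsFrame X x e) (hY : IsFrame Y y f) (φ : X ⟶ Y) :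
    ∃ lam : Colat k k' → kˣ, Stable lam ∧ (∀ M, (φ.app M).e (e M) = lam M • f M) ∧
      ∀ {M M' : Colat k k'} {v : LL k'}, IsStep M M' v →
        lam M' * x.c M M' v = lam M * y.c M M' v := by
  have h : ∀ M, ∃ c : kˣ, (φ.app M).e (e M) = c • f M := fun M =>
    exists_unit_smul _ (hY.ne M) (((φ.app M).e.map_ne_zero_iff).2 (hX.ne M))
  choose lam hlam using h
  refine ⟨lam, ?_, hlam, fun {M M' v} h => ?_⟩
  · refine Sys.window_mono (Sys.exists_window φ.stable (Sys.exists_window hX.stable hY.stable))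
      fun M M' ⟨⟨h₁, h₂, h⟩, ⟨_, hx⟩, ⟨_, hy⟩⟩ => ?_
    have := congrArg (fun ψ => Hom.e ψ (e M)) h
    simp only [comp_e] at this
    rw [hlam, e_smul, hy, hx, hlam] at this
    exact (unit_smul_inj (hY.ne M')).1 this
  · have := φ.comm h (e M)
    rw [hX.step, hlam, Sys.step_smul, hY.step, e_smul, hlam, smul_smul, smul_smul] at this
    rw [mul_comm]
    exact (unit_smul_inj (hY.ne M')).1 this

/-- The morphism of graded lines which maps `a` to `b`. -/
def lineIso {X Y : GradedLine k} {a : X.V} {b : Y.V} (ha : a ≠ 0) (hb : b ≠ 0) (h : X.deg = Y.deg) :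
    X ≅ Y :=
  mkIso ((lineEquiv X ha).symm.trans (lineEquiv Y hb)) h

theorem lineIso_apply {X Y : GradedLine k} {a : X.V} {b : Y.V} (ha : a ≠ 0) (hb : b ≠ 0)
    (h : X.deg = Y.deg) : (lineIso ha hb h).hom.e a = b := by
  change lineEquiv Y hb ((lineEquiv X ha).symm a) = b
  rw [show (lineEquiv X ha).symm a = 1 by
    rw [LinearEquiv.symm_apply_eq, lineEquiv_apply, one_smul], lineEquiv_apply, one_smul]

theorem line_hom_ext {X Y : GradedLine k} {φ ψ : X ⟶ Y} {a : X.V} (ha : a ≠ 0)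
    (h : φ.e a = ψ.e a) : φ = ψ := by
  refine hom_ext _ _ fun v => ?_
  obtain ⟨c, rfl⟩ := exists_smul X ha v
  rw [map_smul, map_smul, h]

theorem IsFrame.exists_iso {X Y : Sys k k'} {x y : Cochain k k'} {e : ∀ M, (X.line M).V}
    {f : ∀ M, (Y.line M).V} (hX : IsFrame X x e) (hY : IsFrame Y y f) (hg : X.g = Y.g)
    (hd : ∀ M, x.d M = y.d M) {lam : Colat k k' → kˣ} (hlam : Stable lam)
    (h : ∀ {M M' : Colat k k'} {v : LL k'}, IsStep M M' v →
      lam M' * x.c M M' v = lam M * y.c M M' v) :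
    ∃ φ : X ≅ Y, ∀ M, (φ.hom.app M).e (e M) = lam M • f M := by
  have hne : ∀ M, lam M • f M ≠ 0 := fun M => by
    rw [Ne, smul_eq_zero_iff_eq]
    exact hY.ne M
  have hdeg : ∀ M, (X.line M).deg = (Y.line M).deg := fun M => by rw [hX.deg, hY.deg, hd]
  refine ⟨Sys.isoOfHom ⟨hg, fun M => (lineIso (hX.ne M) (hne M) (hdeg M)).hom,
    fun {M M' v} hs z => ?_, ?_⟩ (fun M => lineIso (hX.ne M) (hne M) (hdeg M)) fun _ => rfl,
    fun M => lineIso_apply _ _ _⟩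
  · obtain ⟨c, rfl⟩ := exists_smul _ (hX.ne M) z
    rw [map_smul, map_smul, map_smul, map_smul, lineIso_apply, hX.step, e_smul, lineIso_apply,
      Sys.step_smul, hY.step, smul_smul, smul_smul, ← h hs, mul_comm]
  · refine Sys.window_mono (Sys.exists_window hX.stable (Sys.exists_window hY.stable hlam))
      fun M M' ⟨⟨h₁, hx⟩, ⟨h₂, hy⟩, hl⟩ => ⟨h₁, h₂, line_hom_ext (hX.ne M) ?_⟩
    rw [comp_e, comp_e, lineIso_apply, hx, lineIso_apply, e_smul, hy, hl]

/-- Two stable solutions of the equation for the scalars of a morphism differ by a constant. -/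
theorem exists_const_of_stable [FiniteDimensional k k'] {c c' : Colat k k' → Colat k k' → LL k' → kˣ}
    {l l' : Colat k k' → kˣ} (hl : Stable l) (hl' : Stable l')
    (h : ∀ {M M' : Colat k k'} {v : LL k'}, IsStep M M' v → l M' * c M M' v = l M * c' M M' v)
    (h' : ∀ {M M' : Colat k k'} {v : LL k'}, IsStep M M' v → l' M' * c M M' v = l' M * c' M M' v) :
    ∃ μ : kˣ, ∀ M, l M = μ * l' M := by
  refine ⟨l (stdColat k k') * (l' (stdColat k k'))⁻¹, fun M => ?_⟩
  have := eq_of_isStep (fun M => l M * (l' M)⁻¹) (hl.mul (hl'.comp (·⁻¹)))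
    (fun {M M' v} hs => by
      have e₁ : l M' = l M * (c' M M' v * (c M M' v)⁻¹) := by
        rw [← mul_assoc, ← h hs, mul_inv_cancel_right]
      have e₂ : l' M' = l' M * (c' M M' v * (c M M' v)⁻¹) := by
        rw [← mul_assoc, ← h' hs, mul_inv_cancel_right]
      rw [e₁, e₂, ← div_eq_mul_inv, ← div_eq_mul_inv, mul_div_mul_right_eq_div]) M (stdColat k k')
  rw [← this, inv_mul_cancel_right]

section Category

variable {L : Submodule k (LL k')} {hL : IsLattice L}

/-- A choice of vectors in the lines of an object. -/
abbrev Fr (X : DetCat hL) : Type u := ∀ M, (X.obj.line M).V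

/-- The tensor product of two choices of vectors. -/
def Fr.tm {X Y : DetCat hL} (a : Fr X) (b : Fr Y) : Fr (X ⊗ Y) :=
  fun M => GradedLine.tm (a M) (b (act X.obj.g M))

/-- A constant choice of a vector in a constant object. -/
def kvec (hL : IsLattice L) {l : GradedLine k} (v : l.V) : Fr ((Det hL).T l) := fun _ => v

/-- The morphism `φ` maps the vectors `e` to the multiples `l • f` of the vectors `f`. -/
def Carries {X Y : DetCat hL} (φ : X ⟶ Y) (e : Fr X) (f : Fr Y) (l : Colat k k' → kˣ) : Prop :=
  ∀ M, (φ.hom.app M).e (e M) = l M • f M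

namespace Carries

variable {X X' Y Y' Z : DetCat hL} {e : Fr X} {e' : Fr X'} {f : Fr Y} {f' : Fr Y'} {h : Fr Z}
  {φ : X ⟶ Y} {ψ : Y ⟶ Z} {l l' : Colat k k' → kˣ}

theorem comp (hφ : Carries φ e f l) (hψ : Carries ψ f h l') :
    Carries (φ ≫ ψ) e h fun M => l M * l' M := fun M => by
  refine (congrArg _ (hφ M)).trans ((e_smul _ _ _).trans ?_)
  rw [hψ M, smul_smul]

theorem congr (hφ : Carries φ e f l) (h : ∀ M, l M = l' M) : Carries φ e f l' := fun M => by
  rw [hφ M, h]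

theorem unique (hφ : Carries φ e f l) (hφ' : Carries φ e f l') (hf : ∀ M, f M ≠ 0) (M : Colat k k') :
    l M = l' M :=
  (unit_smul_inj (hf M)).1 ((hφ M).symm.trans (hφ' M))

theorem hom_ext {φ' : X ⟶ Y} (hφ : Carries φ e f l) (hφ' : Carries φ' e f l) (he : ∀ M, e M ≠ 0) :
    φ = φ' := by
  refine ObjectProperty.hom_ext _ (Sys.hom_ext _ _ fun M => line_hom_ext (he M) ?_)
  rw [hφ M, hφ' M]

theorem id (e : Fr X) : Carries (𝟙 X) e e 1 := fun _ => (one_smul _ _).symm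

theorem inv {φ : X ≅ Y} (hφ : Carries φ.hom e f l) : Carries φ.inv f e fun M => (l M)⁻¹ := by
  intro M
  have h₁ : (φ.inv.hom.app M).e ((φ.hom.hom.app M).e (e M)) = e M :=
    congrArg (fun ψ : X ⟶ X => (ψ.hom.app M).e (e M)) φ.hom_inv_id
  rw [hφ M, e_smul] at h₁
  rw [← h₁, inv_smul_smul]

theorem whiskerLeft (a : Fr Z) (hφ : Carries φ e f l) :
    Carries (Z ◁ φ) (a.tm e) (a.tm f) fun M => l (act Z.obj.g M) := fun M => by
  refine (congrArg (GradedLine.tm (a M)) (hφ (act Z.obj.g M))).trans (tm_smul _ _ _)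

theorem eqToHom_act {g g' : TateGL k k'} (h : g = g') {Y : DetCat hL} (b : Fr Y) (M : Colat k k') :
    Hom.e (eqToHom (Sys.line_act h Y.obj M)) (b (act g M)) = b (act g' M) := by
  subst h
  rfl

theorem whiskerRight (hφ : Carries φ e f l) (b : Fr Z) :
    Carries (φ ▷ Z) (e.tm b) (f.tm b) l := fun M => by
  refine (Sys.tm_congr (hφ M) (eqToHom_act φ.hom.g_eq b M)).trans (smul_tm _ _ _)

theorem tensor {φ' : X' ⟶ Y'} (hφ : Carries φ e f l) (hφ' : Carries φ' e' f' l') :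
    Carries (φ ⊗ₘ φ') (e.tm e') (f.tm f') fun M => l M * l' (act X.obj.g M) := by
  rw [MonoidalCategory.tensorHom_def' φ φ']
  exact (hφ'.whiskerLeft e |>.comp (hφ.whiskerRight f')).congr fun M => mul_comm _ _

theorem associator (a : Fr X) (b : Fr Y) (c : Fr Z) :
    Carries (α_ X Y Z).hom ((a.tm b).tm c) (a.tm (b.tm c)) 1 := fun _ => (one_smul _ _).symm

theorem associator_inv (a : Fr X) (b : Fr Y) (c : Fr Z) :
    Carries (α_ X Y Z).inv (a.tm (b.tm c)) ((a.tm b).tm c) 1 :=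
  (associator a b c).inv.congr fun _ => inv_one

theorem swap {l : GradedLine k} (v : l.V) {d : Colat k k' → ℤ} (hd : ∀ M, (X.obj.line M).deg = d M) (a : Fr X) :
    Carries ((Det hL).swap l X).hom ((kvec hL v).tm a) (a.tm (kvec hL v)) fun M =>
      sgn k (l.deg * d M) := fun M =>
  (braid_e l (X.obj.line M) v (a M)).trans (Sys.smul_congr (by rw [hd]) rfl)

theorem swap_inv {l : GradedLine k} (v : l.V) {d : Colat k k' → ℤ} (hd : ∀ M, (X.obj.line M).deg = d M)
    (a : Fr X) : Carries ((Det hL).swap l X).inv (a.tm (kvec hL v)) ((kvec hL v).tm a) fun M =>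
      sgn k (l.deg * d M) :=
  (swap v hd a).inv.congr fun _ => sgn_inv _

theorem split {x y : GradedLine k} (v : x.V) (w : y.V) :
    Carries ((Det hL).split x y) (kvec hL (GradedLine.tm v w)) ((kvec hL v).tm (kvec hL w)) 1 := by
  have h : Carries (φ := ((Center.forget _).mapIso (Functor.Monoidal.μIso (Det hL).ι x y)).hom)
      ((kvec hL v).tm (kvec hL w)) (kvec hL (GradedLine.tm v w)) 1 :=
    fun _ => (one_smul kˣ (GradedLine.tm v w)).symm
  exact h.inv.congr fun _ => inv_one

theorem map {x y : GradedLine k} (a : x ⟶ y) {v : x.V} {w : y.V} {c : kˣ} (h : a.e v = c • w) :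
    Carries ((Det hL).ι.map a).f (kvec hL v) (kvec hL w) fun _ => c :=
  fun _ => h

end Carries

/-- A choice of vectors of the object `X` with structure constants given by `x`. -/
abbrev HasFr (X : DetCat hL) (x : Cochain k k') (e : Fr X) : Prop := IsDetFrame L X.obj x e

theorem HasFr.tensor {X Y : DetCat hL} {x y : Cochain k k'} {e : Fr X} {f : Fr Y}
    (hX : HasFr X x e) (hY : HasFr Y y f) : HasFr (X ⊗ Y) (x.mul (y.act X.obj.g)) (e.tm f) :=
  hX.mul hY

theorem HasFr.const (l : GradedLine k) {v : l.V} (hv : v ≠ 0) :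
    HasFr ((Det hL).T l) (Cochain.const k k' l.deg) (kvec hL v) :=
  IsDetFrame.const l hv

theorem exists_hasFr (X : DetCat hL) : ∃ x e, HasFr X x e := X.property.exists_frame

theorem HasFr.const_tensor {X : DetCat hL} {x : Cochain k k'} {e : Fr X} (hX : HasFr X x e)
    (l : GradedLine k) {v : l.V} (hv : v ≠ 0) :
    HasFr ((Det hL).T l ⊗ X) ((Cochain.const k k' l.deg).mul x) ((kvec hL v).tm e) :=
  (HasFr.const l hv).tensor hX

theorem const_mul_c (n : ℤ) (x : Cochain k k') (M M' : Colat k k') (v : LL k') :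
    ((Cochain.const k k' n).mul x).c M M' v = x.c M M' v := by
  change 1 * x.c M M' v * sgn k ((n - n) * _) = _
  rw [sub_self, zero_mul, Sys.sgn_zero, one_mul, mul_one]

theorem HasFr.exists_iso {X Y : DetCat hL} {x y : Cochain k k'} {e : Fr X} {f : Fr Y}
    (hX : HasFr X x e) (hY : HasFr Y y f) (hg : X.obj.g = Y.obj.g)
    (hd : ∀ M, x.d M = y.d M) {l : Colat k k' → kˣ} (hl : Stable l)
    (h : ∀ {M M' : Colat k k'} {v : LL k'}, IsStep M M' v →
      l M' * x.c M M' v = l M * y.c M M' v) :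
    ∃ φ : X ≅ Y, Carries φ.hom e f l := by
  obtain ⟨φ, hφ⟩ := hX.frame.exists_iso hY.frame hg hd hl h
  exact ⟨(IsDet hL).isoMk φ, hφ⟩

theorem HasFr.exists_carries {X Y : DetCat hL} {x y : Cochain k k'} {e : Fr X} {f : Fr Y}
    (hX : HasFr X x e) (hY : HasFr Y y f) (φ : X ⟶ Y) :
    ∃ l, Stable l ∧ Carries φ e f l ∧ ∀ {M M' : Colat k k'} {v : LL k'}, IsStep M M' v →
      l M' * x.c M M' v = l M * y.c M M' v :=
  hX.frame.exists_scalar hY.frame φ.hom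

theorem HasFr.d_eq {X Y : DetCat hL} {x y : Cochain k k'} {e : Fr X} {f : Fr Y}
    (hX : HasFr X x e) (hY : HasFr Y y f) (φ : X ⟶ Y) (M : Colat k k') : x.d M = y.d M := by
  rw [← hX.frame.deg, ← hY.frame.deg]
  exact (φ.hom.app M).deg_eq

variable [FiniteDimensional k k']

theorem exists_tensor_iso (X Y : DetCat hL) (h : X.obj.g = Y.obj.g) :
    ∃ x : GradedLine k, Nonempty ((Det hL).T x ⊗ X ≅ Y) := by
  obtain ⟨x, e, hX⟩ := exists_hasFr X
  obtain ⟨y, f, hY⟩ := exists_hasFr Y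
  obtain ⟨n, hn, φ, hφ, hc⟩ := hX.coc.exists_tw (h ▸ hY.coc : IsCoc L (im X.obj.g L) y)
  obtain ⟨i, -⟩ := (hX.const_tensor (lineOf k n) (vec_ne_zero _)).exists_iso hY
    ((one_mul _).trans h) (fun M => (hn M).symm) (hφ.comp (·⁻¹)) fun {M M' v} hs => by
      rw [const_mul_c]
      have := hc hs
      rw [inv_mul_eq_iff_eq_mul, mul_left_comm, this, inv_mul_cancel_left]
  exact ⟨_, ⟨i⟩⟩

theorem fullyFaithful (X : DetCat hL) (x y : GradedLine k) :
    Function.Bijective fun a : x ⟶ y => ((Det hL).ι.map a).f ▷ X := by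
  obtain ⟨c, e, hX⟩ := exists_hasFr X
  have key : ∀ (a : x ⟶ y) {s : kˣ}, a.e (vec x) = s • vec y →
      Carries (((Det hL).ι.map a).f ▷ X) ((kvec hL (vec x)).tm e) ((kvec hL (vec y)).tm e)
        fun _ => s := fun a s h => (Carries.map a h).whiskerRight e
  have hx := hX.const_tensor x (vec_ne_zero x)
  have hy := hX.const_tensor y (vec_ne_zero y)
  constructor
  · intro a b hab
    obtain ⟨s, hs⟩ := exists_unit_smul y (vec_ne_zero y) ((a.e.map_ne_zero_iff).2 (vec_ne_zero x))
    obtain ⟨t, ht⟩ := exists_unit_smul y (vec_ne_zero y) ((b.e.map_ne_zero_iff).2 (vec_ne_zero x))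
    have h := key a hs
    dsimp only at hab
    rw [hab] at h
    refine line_hom_ext (vec_ne_zero x) ?_
    rw [hs, ht, h.unique (key b ht) hy.frame.ne (stdColat k k')]
  · intro φ
    obtain ⟨l, hl, hφ, hs⟩ := hx.exists_carries hy φ
    obtain ⟨s, hs⟩ := exists_const_of_stable hl (stable_const 1) hs fun {M M' v} _ => by
      rw [const_mul_c, const_mul_c]
    have hd : x.deg = y.deg := by
      have := hx.d_eq hy φ (stdColat k k')
      exact add_right_cancel this
    have hne : s • vec y ≠ 0 := by
      rw [Ne, smul_eq_zero_iff_eq]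
      exact vec_ne_zero y
    refine ⟨(lineIso (vec_ne_zero x) hne hd).hom, ?_⟩
    refine (key _ (lineIso_apply (vec_ne_zero x) hne hd)).hom_ext (hφ.congr fun M => ?_) hx.frame.ne
    rw [hs, mul_one]

/-- The determinantal extension is a central extension: the fibres are torsors, since two cochains
over the same group element differ by a shift of degrees and a change of bases. -/
theorem isCentralExtension_det (hL : IsLattice L) : (Det hL).IsCentralExtension where
  isIso {X Y} f := by
    let i : X.obj ≅ Y.obj := Sys.isoOfHom f.hom
      (fun M => mkIso (f.hom.app M).e (f.hom.app M).deg_eq) fun _ => rfl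
    have : f = ((IsDet hL).isoMk i).hom := ObjectProperty.hom_ext _ rfl
    rw [this]
    infer_instance
  exists_obj g := by
    obtain ⟨Dp⟩ := exists_detTheory (hL.im g) (hL.inf (hL.im g)) inf_le_right
    obtain ⟨Dm⟩ := exists_detTheory hL (hL.inf (hL.im g)) inf_le_left
    exact ⟨⟨leaf hL g Dp Dm, .leaf _ _ _⟩, rfl⟩
  exists_iso X Y h := exists_tensor_iso X Y h
  fullyFaithful := fullyFaithful

end Category

end LL

/-! ### Commutators in terms of frames -/

section

variable {E : Type*} [Category E] [MonoidalCategory E]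

theorem linear_left_explicit {O T X Y : E} (a : O ⊗ T ⟶ T ⊗ O) (b : O ⊗ (X ⊗ Y) ⟶ Y ⊗ X)
    (c : T ⊗ Y ⟶ Y ⊗ T) :
    (𝟙 (O ⊗ ((T ⊗ X) ⊗ Y)) ⊗≫ a ▷ (X ⊗ Y) ⊗≫ T ◁ b ⊗≫ c ▷ X ⊗≫ 𝟙 (Y ⊗ (T ⊗ X))) =
      O ◁ (α_ T X Y).hom ≫ (α_ O T (X ⊗ Y)).inv ≫ a ▷ (X ⊗ Y) ≫ (α_ T O (X ⊗ Y)).hom ≫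
        T ◁ b ≫ (α_ T Y X).inv ≫ c ▷ X ≫ (α_ Y T X).hom := by
  monoidal

theorem linear_right_explicit {O T X Y : E} (a : X ⊗ T ⟶ T ⊗ X) (b : O ⊗ T ⟶ T ⊗ O)
    (c : O ⊗ (X ⊗ Y) ⟶ Y ⊗ X) :
    (𝟙 (O ⊗ (X ⊗ (T ⊗ Y))) ⊗≫ O ◁ a ▷ Y ⊗≫ b ▷ (X ⊗ Y) ⊗≫ T ◁ c ⊗≫ 𝟙 ((T ⊗ Y) ⊗ X)) =
      O ◁ (α_ X T Y).inv ≫ O ◁ a ▷ Y ≫ O ◁ (α_ T X Y).hom ≫ (α_ O T (X ⊗ Y)).inv ≫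
        b ▷ (X ⊗ Y) ≫ (α_ T O (X ⊗ Y)).hom ≫ T ◁ c ≫ (α_ T Y X).inv := by
  monoidal

theorem additivity_explicit {O A B X Y Z : E} (s : O ⟶ A ⊗ B) (a : A ⊗ B ⟶ B ⊗ A)
    (b : A ⊗ (X ⊗ Y) ⟶ Y ⊗ X) (c : B ⊗ Y ⟶ Y ⊗ B) (d : B ⊗ (X ⊗ Z) ⟶ Z ⊗ X) :
    s ▷ (X ⊗ Y ⊗ Z) ⊗≫ a ▷ (X ⊗ Y ⊗ Z) ⊗≫ B ◁ b ▷ Z ⊗≫ c ▷ (X ⊗ Z) ⊗≫ Y ◁ d ⊗≫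
        𝟙 ((Y ⊗ Z) ⊗ X) =
      s ▷ (X ⊗ Y ⊗ Z) ≫ a ▷ (X ⊗ Y ⊗ Z) ≫ (α_ B A (X ⊗ Y ⊗ Z)).hom ≫
        B ◁ A ◁ (α_ X Y Z).inv ≫ B ◁ (α_ A (X ⊗ Y) Z).inv ≫ B ◁ b ▷ Z ≫
        B ◁ (α_ Y X Z).hom ≫ (α_ B Y (X ⊗ Z)).inv ≫ c ▷ (X ⊗ Z) ≫ (α_ Y B (X ⊗ Z)).hom ≫
        Y ◁ d ≫ (α_ Y Z X).inv := by
  monoidal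

end

namespace LL

open GradedLine

variable {k k' : Type u} [Field k] [Field k'] [Algebra k k']
  {L : Submodule k (LL k')} {hL : IsLattice L}

namespace Carries

variable {X Y Z : DetCat hL} {e : Fr X} {f : Fr Y} {w : Fr Z} {o t : GradedLine k} {P : o.V} {v : t.V}
  {dX dY : Colat k k' → ℤ} {l : Colat k k' → kˣ}

theorem linear_left {b : (Det hL).T o ⊗ (X ⊗ Y) ⟶ Y ⊗ X}
    (hb : Carries b ((kvec hL P).tm (e.tm f)) (f.tm e) l)
    (hd : ∀ M, (Y.obj.line M).deg = dY M) :
    Carries (𝟙 _ ⊗≫ ((Det hL).swap o ((Det hL).T t)).hom ▷ (X ⊗ Y) ⊗≫ (Det hL).T t ◁ b ⊗≫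
      ((Det hL).swap t Y).hom ▷ X ⊗≫ 𝟙 _) ((kvec hL P).tm (((kvec hL v).tm e).tm f))
      (f.tm ((kvec hL v).tm e)) fun M => sgn k (o.deg * t.deg) * l M * sgn k (t.deg * dY M) := by
  rw [linear_left_explicit]
  refine Carries.congr (((Carries.associator (kvec hL v) e f).whiskerLeft (kvec hL P)).comp
    ((Carries.associator_inv (kvec hL P) (kvec hL v) (e.tm f)).comp
    (((Carries.swap P (d := fun _ => t.deg) (fun _ => rfl) (kvec hL v)).whiskerRight (e.tm f)).comp
    ((Carries.associator (kvec hL v) (kvec hL P) (e.tm f)).comp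
    ((hb.whiskerLeft (kvec hL v)).comp
    ((Carries.associator_inv (kvec hL v) f e).comp
    (((Carries.swap v hd f).whiskerRight e).comp
    (Carries.associator f (kvec hL v) e)))))))) fun M => ?_
  simp only [Pi.one_apply, one_mul, mul_one, mul_assoc]
  rfl

theorem linear_right {b : (Det hL).T o ⊗ (X ⊗ Y) ⟶ Y ⊗ X}
    (hb : Carries b ((kvec hL P).tm (e.tm f)) (f.tm e) l)
    (hd : ∀ M, (X.obj.line M).deg = dX M) :
    Carries (𝟙 _ ⊗≫ (Det hL).T o ◁ ((Det hL).swap t X).inv ▷ Y ⊗≫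
      ((Det hL).swap o ((Det hL).T t)).hom ▷ (X ⊗ Y) ⊗≫ (Det hL).T t ◁ b ⊗≫ 𝟙 _)
      ((kvec hL P).tm (e.tm ((kvec hL v).tm f)))
      (((kvec hL v).tm f).tm e) fun M => sgn k (t.deg * dX M) * sgn k (o.deg * t.deg) * l M := by
  rw [linear_right_explicit]
  refine Carries.congr (((Carries.associator_inv e (kvec hL v) f).whiskerLeft (kvec hL P)).comp
    ((((Carries.swap_inv v hd e).whiskerRight f).whiskerLeft (kvec hL P)).comp
    (((Carries.associator (kvec hL v) e f).whiskerLeft (kvec hL P)).comp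
    ((Carries.associator_inv (kvec hL P) (kvec hL v) (e.tm f)).comp
    (((Carries.swap P (d := fun _ => t.deg) (fun _ => rfl) (kvec hL v)).whiskerRight (e.tm f)).comp
    ((Carries.associator (kvec hL v) (kvec hL P) (e.tm f)).comp
    ((hb.whiskerLeft (kvec hL v)).comp
    (Carries.associator_inv (kvec hL v) f e)))))))) fun M => ?_
  simp only [Pi.one_apply, one_mul, mul_one, mul_assoc]
  rfl

theorem additivity {a b c : GradedLine k} {P : a.V} {R : b.V} {Q : c.V} {m : c ⟶ a ⊗ b} {μ : kˣ}
    (hm : m.e Q = μ • GradedLine.tm P R) {α : (Det hL).T a ⊗ (X ⊗ Y) ⟶ Y ⊗ X}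
    {β : (Det hL).T b ⊗ (X ⊗ Z) ⟶ Z ⊗ X} {l' : Colat k k' → kˣ}
    (hα : Carries α ((kvec hL P).tm (e.tm f)) (f.tm e) l)
    (hβ : Carries β ((kvec hL R).tm (e.tm w)) (w.tm e) l')
    (hd : ∀ M, (Y.obj.line M).deg = dY M) :
    Carries ((((Det hL).ι.map m).f ≫ (Det hL).split a b) ▷ (X ⊗ Y ⊗ Z) ⊗≫
        ((Det hL).swap a ((Det hL).T b)).hom ▷ (X ⊗ Y ⊗ Z) ⊗≫
        (Det hL).T b ◁ α ▷ Z ⊗≫ ((Det hL).swap b Y).hom ▷ (X ⊗ Z) ⊗≫ Y ◁ β ⊗≫ 𝟙 _)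
      ((kvec hL Q).tm (e.tm (f.tm w))) ((f.tm w).tm e)
      fun M => μ * sgn k (a.deg * b.deg) * l M * sgn k (b.deg * dY M) * l' (act Y.obj.g M) := by
  rw [additivity_explicit]
  refine Carries.congr ((((Carries.map m hm).comp (Carries.split P R)).whiskerRight
      (e.tm (f.tm w))).comp
    (((Carries.swap P (d := fun _ => b.deg) (fun _ => rfl) (kvec hL R)).whiskerRight
      (e.tm (f.tm w))).comp
    ((Carries.associator (kvec hL R) (kvec hL P) (e.tm (f.tm w))).comp
    ((((Carries.associator_inv e f w).whiskerLeft (kvec hL P)).whiskerLeft (kvec hL R)).comp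
    (((Carries.associator_inv (kvec hL P) (e.tm f) w).whiskerLeft (kvec hL R)).comp
    (((hα.whiskerRight w).whiskerLeft (kvec hL R)).comp
    (((Carries.associator f e w).whiskerLeft (kvec hL R)).comp
    ((Carries.associator_inv (kvec hL R) f (e.tm w)).comp
    (((Carries.swap R hd f).whiskerRight (e.tm w)).comp
    ((Carries.associator f (kvec hL R) (e.tm w)).comp
    ((hβ.whiskerLeft f).comp
    (Carries.associator_inv f w e)))))))))))) fun M => ?_
  simp only [Pi.one_apply, one_mul, mul_one, mul_assoc]
  rfl

end Carries

end LL

/-! ### The triple commutator in terms of cochains -/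

namespace LL

open GradedLine

variable {k k' : Type u} [Field k] [Field k'] [Algebra k k']

/-- The scalars `l` and the shift of degrees `δ` relate the cochains of the products `X ⊗ Y` and
`Y ⊗ X`, for systems `X` over `g` and `Y` over `h` with cochains `x` and `y`. -/
structure Swap (g h : TateGL k k') (x y : Cochain k k') (δ : ℤ) (l : Colat k k' → kˣ) : Prop where
  stable : Stable l
  deg : ∀ M, y.d M + x.d (act h M) = δ + (x.d M + y.d (act g M))
  step : ∀ {M M' : Colat k k'} {v : LL k'}, IsStep M M' v →
    l M' * (x.mul (y.act g)).c M M' v = l M * (y.mul (x.act h)).c M M' v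

/-- The triple commutator, in terms of the scalars relating the products of three cochains. -/
def triple (g h h' : TateGL k k') (x y z : Cochain k k') (p r q : ℤ)
    (lxy lxz lyz : Colat k k' → kˣ) (M : Colat k k') : kˣ :=
  sgn k (p * r + p * q + r * q + p * z.d M + r * y.d M + q * x.d M) *
    (lxy (act h' M) * (lxy M)⁻¹) * (lxz M * (lxz (act h M))⁻¹) * (lyz (act g M) * (lyz M)⁻¹)

/-- The computation which extracts the value of the triple commutator from the naturality and the
additivity of the commutators. -/
theorem triple_aux {G : Type*} [CommGroup G] {a μ μ' s₁ s₂ s₃ s₄ s₅ α β A A' B B' C C' : G}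
    (h₁ : s₁ * s₁ = 1) (h₂ : s₂ * s₂ = 1) (h : a * μ' = s₁ * μ)
    (e : C' * (μ' * s₁ * (β * B) * s₂ * (α * A')) =
      s₃ * s₄ * (μ * s₁ * (α * A) * s₅ * (β * B')) * C) :
    s₃ * s₄ * s₅ * s₂ * s₁ * a = (A' * A⁻¹) * (B * B'⁻¹) * (C' * C⁻¹) := by
  have hμ : μ = s₁ * a * μ' := by rw [mul_assoc, h, ← mul_assoc, h₁, one_mul]
  rw [hμ] at e
  have e' : C' * B * A' * (μ' * s₁ * β * α * s₂) =
      s₃ * s₄ * s₅ * (s₁ * s₁) * a * A * B' * C * (μ' * β * α) := by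
    calc _ = C' * (μ' * s₁ * (β * B) * s₂ * (α * A')) := by ac_rfl
      _ = _ := e
      _ = _ := by ac_rfl
  have e'' : C' * B * A' * (μ' * β * α) =
      s₃ * s₄ * s₅ * s₂ * s₁ * a * A * B' * C * (μ' * β * α) := by
    calc _ = C' * B * A' * (μ' * β * α) * ((s₁ * s₁) * (s₂ * s₂)) := by
          rw [h₁, h₂, mul_one, mul_one]
      _ = C' * B * A' * (μ' * s₁ * β * α * s₂) * (s₁ * s₂) := by ac_rfl
      _ = s₃ * s₄ * s₅ * s₂ * s₁ * a * A * B' * C * (μ' * β * α) * (s₁ * s₁) := by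
          rw [e']; ac_rfl
      _ = _ := by rw [h₁, mul_one]
  have := mul_right_cancel e''
  calc _ = s₃ * s₄ * s₅ * s₂ * s₁ * a * A * B' * C * (A⁻¹ * B'⁻¹ * C⁻¹) := by
        rw [mul_assoc _ C, mul_assoc _ B', mul_assoc _ A,
          show A * (B' * (C * (A⁻¹ * B'⁻¹ * C⁻¹))) = (A * A⁻¹) * (B' * B'⁻¹) * (C * C⁻¹) by ac_rfl,
          mul_inv_cancel, mul_inv_cancel, mul_inv_cancel, one_mul, mul_one, mul_one]
    _ = C' * B * A' * (A⁻¹ * B'⁻¹ * C⁻¹) := by rw [this]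
    _ = _ := by ac_rfl

theorem scalarAut_whiskerRight_e (a : kˣ) (X : GradedLine k) (v : X.V) :
    ((λ_ X).inv ≫ (scalarAut a).hom ▷ X ≫ (λ_ X).hom).e v = a • v := by
  rw [comp_e, inv_apply (λ_ X) (x := tm (1 : k) v) (y := v)
    ((leftUnitor_e _ _ _).trans (one_smul _ _)), comp_e]
  refine (leftUnitor_e X (a • (1 : k)) v).trans ?_
  change (a • (1 : k)) • v = _
  rw [smul_assoc, one_smul]

variable {L : Submodule k (LL k')} {hL : IsLattice L}

theorem Swap.deg_eq {g h : TateGL k k'} {x y : Cochain k k'} {δ δ' : ℤ} {l l' : Colat k k' → kˣ}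
    (hs : Swap g h x y δ l) (hs' : Swap g h x y δ' l') : δ = δ' := by
  have h₁ := hs.deg (stdColat k k')
  have h₂ := hs'.deg (stdColat k k')
  omega

theorem exists_carries_alpha {g h : TateGL k k'} (A : (Det hL).Commutator g h) {X Y : DetCat hL}
    {x y : Cochain k k'} {e : Fr X} {f : Fr Y} (hX : HasFr X x e) (hY : HasFr Y y f)
    (hg : (Det hL).π X = g) (hh : (Det hL).π Y = h) {P : A.obj.V} (hP : P ≠ 0) :
    ∃ l, Swap g h x y A.obj.deg l ∧
      Carries (A.α X Y hg hh).hom ((kvec hL P).tm (e.tm f)) (f.tm e) l := by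
  have h₁ := (hX.tensor hY).const_tensor A.obj hP
  have h₂ := hY.tensor hX
  obtain ⟨l, hl, hc, hs⟩ := h₁.exists_carries h₂ (A.α X Y hg hh).hom
  subst hg hh
  refine ⟨l, ⟨hl, fun M => (h₁.d_eq h₂ (A.α X Y rfl rfl).hom M).symm, fun h => ?_⟩, hc⟩
  exact (congrArg _ (const_mul_c A.obj.deg _ _ _ _)).symm.trans (hs h)

variable [FiniteDimensional k k']

theorem Swap.exists_const {g h : TateGL k k'} {x y : Cochain k k'} {δ δ' : ℤ}
    {l l' : Colat k k' → kˣ} (hs : Swap g h x y δ l) (hs' : Swap g h x y δ' l') :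
    ∃ μ : kˣ, ∀ M, l M = μ * l' M :=
  exists_const_of_stable hs.stable hs'.stable hs.step hs'.step

theorem exists_swap {g h : TateGL k k'} (comm : g * h = h * g) {x y : Cochain k k'}
    (hx : IsCoc L (im g L) x) (hy : IsCoc L (im h L) y) : ∃ δ l, Swap g h x y δ l := by
  have h₁ := hx.mul (hy.act g)
  have h₂ := hy.mul (hx.act h)
  rw [im_mul] at h₁ h₂
  obtain ⟨n, hn, f, hf, hs⟩ := h₁.exists_tw (comm ▸ h₂)
  refine ⟨n, fun M => (f M)⁻¹, hf.comp _, hn, fun h => ?_⟩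
  rw [inv_mul_eq_iff_eq_mul, mul_left_comm, hs h, inv_mul_cancel_left]

/-- The value of the triple commutator, computed by means of arbitrary cochains over `g`, `h`, `h'`:
the commutation of `X` with `Z ⊗ Y` is compared with that of `X` with `Y ⊗ Z` by naturality with
respect to the commutation of `Y` and `Z`. -/
theorem eq_triple {g h h' : TateGL k k'} {a : kˣ} (hL : IsLattice L)
    (hT : (Det hL).IsTripleCommutator g h h' (scalarAut a)) {x y z : Cochain k k'}
    (hx : IsCoc L (im g L) x) (hy : IsCoc L (im h L) y) (hz : IsCoc L (im h' L) z) {p r q : ℤ}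
    {lxy lxz lyz : Colat k k' → kˣ} (sxy : Swap g h x y p lxy) (sxz : Swap g h' x z r lxz)
    (syz : Swap h h' y z q lyz) (M : Colat k k') : a = triple g h h' x y z p r q lxy lxz lyz M := by
  obtain ⟨comm, A, B, C, m, m', hm, hm', hu⟩ := hT
  obtain ⟨X', hX', rfl, e, hX⟩ := exists_isDetFrame hL hx
  obtain ⟨Y', hY', rfl, f, hY⟩ := exists_isDetFrame hL hy
  obtain ⟨Z', hZ', rfl, w, hZ⟩ := exists_isDetFrame hL hz
  let X : DetCat hL := ⟨X', hX'⟩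
  let Y : DetCat hL := ⟨Y', hY'⟩
  let Z : DetCat hL := ⟨Z', hZ'⟩
  replace hX : HasFr X x e := hX
  replace hY : HasFr Y y f := hY
  replace hZ : HasFr Z z w := hZ
  obtain ⟨lA, sA, cA⟩ := exists_carries_alpha A hX hY rfl rfl (vec_ne_zero A.obj)
  obtain ⟨lB, sB, cB⟩ := exists_carries_alpha B hX hZ rfl rfl (vec_ne_zero B.obj)
  obtain ⟨α, hα⟩ := sA.exists_const sxy
  obtain ⟨β, hβ⟩ := sB.exists_const sxz
  obtain rfl := sA.deg_eq sxy
  obtain rfl := sB.deg_eq sxz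
  obtain ⟨μ, hμ⟩ := exists_unit_smul _ (DetTheory.tm_ne_zero (vec_ne_zero A.obj) (vec_ne_zero B.obj))
    ((m.hom.e.map_ne_zero_iff).2 (vec_ne_zero C.obj))
  obtain ⟨μ', hμ'⟩ := exists_unit_smul _ (DetTheory.tm_ne_zero (vec_ne_zero B.obj) (vec_ne_zero A.obj))
    ((m'.hom.e.map_ne_zero_iff).2 (vec_ne_zero C.obj))
  have hdeg : C.obj.deg = A.obj.deg + B.obj.deg := m.hom.deg_eq
  -- the relation of the two additivity isomorphisms which defines the triple commutator
  have hu' : a * μ' = sgn k (A.obj.deg * B.obj.deg) * μ := by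
    have h₁ : m.hom ≫ (β_ A.obj B.obj).hom =
        ((λ_ C.obj).inv ≫ (scalarAut a).hom ▷ C.obj ≫ (λ_ C.obj).hom) ≫ m'.hom := by
      rw [← hu, Category.assoc, Category.assoc, Iso.inv_hom_id, Category.comp_id]
    have h₂ := scalarAut_whiskerRight_e a C.obj (vec C.obj)
    have h₃ := congrArg (fun φ : C.obj ⟶ B.obj ⊗ A.obj => φ.e (vec C.obj)) h₁
    simp only [comp_e] at h₂ h₃
    rw [h₂, hμ, e_smul, e_smul, hμ'] at h₃
    rw [show (β_ A.obj B.obj).hom.e (tm (vec A.obj) (vec B.obj)) = _ from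
      braid_e A.obj B.obj (vec A.obj) (vec B.obj), smul_smul, smul_smul] at h₃
    rw [← (unit_smul_inj (DetTheory.tm_ne_zero (vec_ne_zero B.obj) (vec_ne_zero A.obj))).1 h₃,
      mul_comm]
  obtain ⟨κ, hκ⟩ := ((hY.tensor hZ).const_tensor (lineOf k q) (vec_ne_zero _)).exists_iso
    (hZ.tensor hY) ((one_mul _).trans comm.symm) (fun M => (syz.deg M).symm) syz.stable
    fun {M M' v} hs => by rw [const_mul_c]; exact syz.step hs
  have c₁ := Carries.additivity hμ cA cB (hY.frame.deg)
  have c₂ := Carries.additivity hμ' cB cA (hZ.frame.deg)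
  have e₁ := hm X Y Z rfl rfl rfl
  have e₂ := hm' X Z Y rfl rfl rfl
  rw [← e₁] at c₁
  rw [← e₂] at c₂
  have c₃ := Carries.linear_right (v := vec (lineOf k q)) c₁ hX.frame.deg
  rw [← C.linear_right (lineOf k q) (X := X) (Y := Y ⊗ Z) rfl rfl (one_mul _)] at c₃
  have nat := C.naturality (X := X) (X' := X) (Y := (Det hL).T (lineOf k q) ⊗ (Y ⊗ Z))
    (Y' := Z ⊗ Y) rfl rfl (one_mul _) comm (𝟙 X) κ.hom
  have c₄ := (((Carries.id (X := X) e).tensor hκ).whiskerLeft (kvec hL (vec C.obj))).comp c₂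
  have c₅ := c₃.comp (hκ.tensor (Carries.id (X := X) e))
  rw [nat] at c₄
  have key := c₄.unique c₅ ((hZ.tensor hY).tensor hX).frame.ne M
  simp only [hα, hβ] at key
  have res := triple_aux (C := lyz M) (C' := lyz (act X'.g M)) (s₃ := sgn k (q * x.d M))
    (s₄ := sgn k (C.obj.deg * q)) (s₅ := sgn k (B.obj.deg * y.d M))
    (s₂ := sgn k (A.obj.deg * z.d M)) (α := α) (β := β) (A := lxy M) (A' := lxy (act Z'.g M))
    (B := lxz M) (B' := lxz (act Y'.g M)) (sgn_mul_self _) (sgn_mul_self _) hu'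
    (by
      rw [mul_comm B.obj.deg A.obj.deg, Pi.one_apply, Pi.one_apply, one_mul, mul_one] at key
      exact key)
  unfold triple
  rw [mul_assoc (sgn k _ * _), mul_assoc (sgn k _), ← mul_assoc (_ * _) _ (lyz _ * _), ← res,
    ← mul_assoc, ← sgn_add, ← sgn_add, ← sgn_add, ← sgn_add, ← sgn_add, hdeg]
  rw [sgn_congr (b := 0) (A.obj.deg * B.obj.deg + A.obj.deg * q + B.obj.deg * q +
    A.obj.deg * z.d M + B.obj.deg * y.d M + q * x.d M) (by ring), Sys.sgn_zero, one_mul]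

end LL

/-! ### Construction of the commutators -/

namespace LL

open GradedLine

variable {k k' : Type u} [Field k] [Field k'] [Algebra k k']

/-- The cochain `x` with the degrees shifted by `n`. -/
def Cochain.shift (n : ℤ) (x : Cochain k k') : Cochain k k' where
  d M := n + x.d M
  c := x.c

theorem Cochain.ext_of_eq {x y : Cochain k k'} (hd : x.d = y.d) (hc : x.c = y.c) : x = y := by
  cases x
  cases y
  cases hd
  cases hc
  rfl

theorem Cochain.const_mul_shift (t n : ℤ) (x : Cochain k k') :
    (Cochain.const k k' t).mul (x.shift n) = x.shift (t + n) :=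
  Cochain.ext_of_eq (funext fun _ => (add_assoc t n _).symm)
    (funext fun M => funext fun M' => funext fun v => const_mul_c t (x.shift n) M M' v)

theorem IsCoc.shift {Λ₁ Λ₂ : Submodule k (LL k')} {x : Cochain k k'} (hx : IsCoc Λ₁ Λ₂ x) (n : ℤ) :
    IsCoc Λ₁ Λ₂ (x.shift n) := by
  have : (Cochain.const k k' n).mul x = x.shift n :=
    Cochain.ext_of_eq rfl (funext fun M => funext fun M' => funext fun v => const_mul_c n x M M' v)
  rw [← this]
  exact (IsCoc.const Λ₁ n).mul hx

/-- The sign of the commutator of two objects, as a function of their degrees. -/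
def psi (δ n m a b : ℤ) : ℤ := δ * (n + m) + n * m + n * b + m * a

variable {L : Submodule k (LL k')} {hL : IsLattice L}

theorem HasFr.const_tensor_shift {X : DetCat hL} {x : Cochain k k'} {n : ℤ} {e : Fr X}
    (hX : HasFr X (x.shift n) e) (l : GradedLine k) {v : l.V} (hv : v ≠ 0) :
    HasFr ((Det hL).T l ⊗ X) (x.shift (l.deg + n)) ((kvec hL v).tm e) := by
  rw [← Cochain.const_mul_shift]
  exact hX.const_tensor l hv

theorem Carries.of_smul {o : GradedLine k} {X Y : DetCat hL}
    {α : (Det hL).T o ⊗ (X ⊗ Y) ⟶ Y ⊗ X} {a : Fr ((Det hL).T o)} {e : Fr X}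
    {f : Fr Y} {φ S : Colat k k' → kˣ}
    (hα : Carries α (a.tm (e.tm fun M => φ M • f M)) (Fr.tm (X := Y) (fun M => φ M • f M) e) S) :
    Carries α (a.tm (e.tm f)) (f.tm e) fun M => S M * φ M * (φ (act X.obj.g M))⁻¹ := fun M => by
  have h₁ : (a.tm (e.tm fun M => φ M • f M)) M = φ (act X.obj.g M) • (a.tm (e.tm f)) M := by
    exact (congrArg (GradedLine.tm _) (tm_smul _ _ _)).trans (tm_smul _ _ _)
  have h₂ : (Fr.tm (X := Y) (fun M => φ M • f M) e) M = φ M • (f.tm e) M := smul_tm _ _ _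
  have := hα M
  rw [h₁, h₂, e_smul, smul_smul] at this
  change _ = (S M * φ M * (φ (act X.obj.g M))⁻¹) • _
  rw [mul_comm (S M * φ M), mul_smul, ← this, inv_smul_smul]

theorem HasFr.tensor_shift {h h' : TateGL k k'} {y z w : Cochain k k'} {s : ℤ} {F : Colat k k' → kˣ}
    (hy : IsCoc L (im h L) y) (hw : IsCoc L (im (h * h') L) w) (hF : Stable F)
    (hd : ∀ M, w.d M = s + (y.mul (z.act h)).d M)
    (hc : ∀ {M M' : Colat k k'} {v : LL k'}, IsStep M M' v →
      F M' * w.c M M' v = F M * (y.mul (z.act h)).c M M' v) {Y Z : DetCat hL}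
    (hh : (Det hL).π Y = h) (hh' : (Det hL).π Z = h') {a b : ℤ} {f : Fr Y} {e : Fr Z}
    (hY : HasFr Y (y.shift a) f) (hZ : HasFr Z (z.shift b) e) :
    HasFr (Y ⊗ Z) (w.shift (a + b - s)) fun M => (F M * sgn k (b * y.d M)) • (f.tm e) M := by
  subst hh hh'
  refine ⟨(hY.tensor hZ).frame.tw (hF.mul (hy.stable_d.comp fun n => sgn k (b * n)))
    (fun M => ?_) fun {M M' v} hs => ?_, hw.shift _⟩
  · have := hd M
    change _ = s + (y.d M + z.d (act Y.obj.g M)) at this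
    change a + b - s + w.d M = a + y.d M + (b + z.d (act Y.obj.g M))
    rw [this]
    ring
  · have := hc hs
    change _ = F M * (y.c M M' v * z.c _ _ _ * sgn k ((y.d M' - y.d M) * z.d _)) at this
    change F M' * sgn k (b * y.d M') * w.c M M' v = F M * sgn k (b * y.d M) *
      (y.c M M' v * z.c _ _ _ * sgn k ((a + y.d M' - (a + y.d M)) * (b + z.d _)))
    rw [mul_right_comm, this, add_sub_add_left_eq_sub, mul_add, sgn_add]
    have : sgn k (b * y.d M') = sgn k (b * y.d M) * sgn k ((y.d M' - y.d M) * b) := by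
      rw [← sgn_add]
      exact sgn_congr 0 (by ring)
    rw [this]
    ac_rfl

variable [FiniteDimensional k k']

theorem exists_obj_frame {g : TateGL k k'} {x : Cochain k k'} (hx : IsCoc L (im g L) x) :
    ∃ X : DetCat hL, (Det hL).π X = g ∧ ∃ e : Fr X, HasFr X x e := by
  obtain ⟨X, hX, hg, e, he⟩ := exists_isDetFrame hL hx
  exact ⟨⟨X, hX⟩, hg, e, he⟩

theorem exists_shift_frame {X : DetCat hL} {x : Cochain k k'} (hx : IsCoc L (im X.obj.g L) x) :
    ∃ n e, HasFr X (x.shift n) e := by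
  obtain ⟨x', e, hX⟩ := exists_hasFr X
  obtain ⟨n, hn, f, hf, h⟩ := hX.coc.exists_tw hx
  refine ⟨-n, _, hX.frame.tw hf (fun M => ?_) h, ?_⟩
  · change -n + x.d M = _
    rw [hn, neg_add_cancel_left]
  · exact hx.shift _

/-- A morphism between two objects with the same cochain is multiplication by a constant. -/
theorem exists_const_carries {X Y : DetCat hL} {x : Cochain k k'} {n m : ℤ} {e : Fr X} {f : Fr Y}
    (hX : HasFr X (x.shift n) e) (hY : HasFr Y (x.shift m) f) (φ : X ⟶ Y) :
    n = m ∧ ∃ μ : kˣ, Carries φ e f fun _ => μ := by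
  obtain ⟨l, hl, hφ, hs⟩ := hX.exists_carries hY φ
  obtain ⟨μ, hμ⟩ := exists_const_of_stable hl (stable_const 1) hs fun _ => rfl
  refine ⟨add_right_cancel (hX.d_eq hY φ (stdColat k k')), μ, hφ.congr fun M => ?_⟩
  rw [hμ, mul_one]

variable {g h : TateGL k k'} {x y : Cochain k k'} {δ : ℤ} {l : Colat k k' → kˣ}

theorem Swap.exists_alpha (s : Swap g h x y δ l) (comm : g * h = h * g) {X Y : DetCat hL}
    (hg : (Det hL).π X = g) (hh : (Det hL).π Y = h) (hx : IsCoc L (im g L) x)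
    (hy : IsCoc L (im h L) y) :
    ∃ α : (Det hL).T (lineOf k δ) ⊗ (X ⊗ Y) ≅ Y ⊗ X, ∀ {n m : ℤ} {e : Fr X} {f : Fr Y},
      HasFr X (x.shift n) e → HasFr Y (y.shift m) f →
      Carries α.hom ((kvec hL (vec (lineOf k δ))).tm (e.tm f)) (f.tm e)
        fun M => sgn k (psi δ n m (x.d M) (y.d M)) * l M := by
  subst hg hh
  obtain ⟨n, e, hX⟩ := exists_shift_frame hx
  obtain ⟨m, f, hY⟩ := exists_shift_frame hy
  have hst : Stable fun M => sgn k (psi δ n m (x.d M) (y.d M)) * l M :=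
    Stable.mul (Sys.window_mono (Sys.exists_window hx.stable_d hy.stable_d) fun M M' H =>
      congrArg₂ (fun a b => sgn k (psi δ n m a b)) H.1 H.2) s.stable
  obtain ⟨α, hα⟩ := ((hX.tensor hY).const_tensor (lineOf k δ) (vec_ne_zero _)).exists_iso
    (hY.tensor hX) ((one_mul _).trans comm) (fun M => by
      have := s.deg M
      change δ + ((n + x.d M) + (m + y.d _)) = (m + y.d M) + (n + x.d _)
      change y.d M + x.d (act Y.obj.g M) = δ + (x.d M + y.d (act X.obj.g M)) at this
      omega) hst
    fun {M M' v} hs => by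
      rw [const_mul_c]
      have h₁ := s.step hs
      change l M' * (x.c M M' v * y.c _ _ _ * sgn k ((x.d M' - x.d M) * y.d _)) =
        l M * (y.c M M' v * x.c _ _ _ * sgn k ((y.d M' - y.d M) * x.d _)) at h₁
      change sgn k (psi δ n m (x.d M') (y.d M')) * l M' * (x.c M M' v * y.c _ _ _ *
          sgn k (((n + x.d M') - (n + x.d M)) * (m + y.d _))) =
        sgn k (psi δ n m (x.d M) (y.d M)) * l M * (y.c M M' v * x.c _ _ _ *
          sgn k (((m + y.d M') - (m + y.d M)) * (n + x.d _)))
      rw [add_sub_add_left_eq_sub, add_sub_add_left_eq_sub, mul_add, mul_add, sgn_add, sgn_add]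
      have h₂ : sgn k (psi δ n m (x.d M') (y.d M')) * sgn k ((x.d M' - x.d M) * m) =
          sgn k (psi δ n m (x.d M) (y.d M)) * sgn k ((y.d M' - y.d M) * n) := by
        rw [← sgn_add, ← sgn_add]
        exact sgn_congr (x.d M' * m - x.d M * m) (by unfold psi; ring)
      refine Eq.trans ?_ ((congrArg₂ (· * ·) h₂ h₁).trans ?_)
      · ac_rfl
      · ac_rfl
  refine ⟨α, fun {n' m' e' f'} hX' hY' => ?_⟩
  obtain ⟨rfl, μ, hμ⟩ := exists_const_carries hX' hX (𝟙 X)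
  obtain ⟨rfl, ν, hν⟩ := exists_const_carries hY' hY (𝟙 Y)
  have e₁ : e' = fun M => μ • e M := funext hμ
  have e₂ : f' = fun M => ν • f M := funext hν
  intro M
  have h₁ : ((kvec hL (vec (lineOf k δ))).tm (e'.tm f')) M =
      (μ * ν) • ((kvec hL (vec (lineOf k δ))).tm (e.tm f)) M := by
    rw [e₁, e₂]
    refine (congrArg (GradedLine.tm _) ((smul_tm _ _ _).trans (congrArg _ (tm_smul _ _ _)))).trans ?_
    rw [smul_smul]
    exact tm_smul _ _ _
  have h₂ : (f'.tm e') M = (μ * ν) • (f.tm e) M := by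
    rw [e₁, e₂]
    refine ((smul_tm _ _ _).trans (congrArg _ (tm_smul _ _ _))).trans ?_
    rw [smul_smul, mul_comm]
    rfl
  rw [h₁, h₂, e_smul, hα M, smul_smul, smul_smul, mul_comm]

/-- The value of the commutator which is determined by cochains over `g` and `h`. -/
def Swap.commutator (s : Swap g h x y δ l) (comm : g * h = h * g) (hx : IsCoc L (im g L) x)
    (hy : IsCoc L (im h L) y) : (Det hL).Commutator g h where
  obj := lineOf k δ
  α X Y hX hY := (s.exists_alpha comm hX hY hx hy).choose
  naturality {X X' Y Y'} hX hX' hY hY' a b := by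
    obtain ⟨n, e, he⟩ := exists_shift_frame (X := X) (hX.symm ▸ hx)
    obtain ⟨m, f, hf⟩ := exists_shift_frame (X := Y) (hY.symm ▸ hy)
    obtain ⟨n', e', he'⟩ := exists_shift_frame (X := X') (hX'.symm ▸ hx)
    obtain ⟨m', f', hf'⟩ := exists_shift_frame (X := Y') (hY'.symm ▸ hy)
    obtain ⟨rfl, μ, hμ⟩ := exists_const_carries he he' a
    obtain ⟨rfl, ν, hν⟩ := exists_const_carries hf hf' b
    have h₁ := (((hμ.tensor hν).whiskerLeft (kvec hL (vec (lineOf k δ)))).comp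
      ((s.exists_alpha comm hX' hY' hx hy).choose_spec he' hf'))
    have h₂ := ((s.exists_alpha comm hX hY hx hy).choose_spec he hf).comp (hν.tensor hμ)
    exact (h₁.congr fun M => by rw [mul_comm, mul_comm μ]).hom_ext h₂
      ((he.tensor hf).const_tensor _ (vec_ne_zero _)).frame.ne
  linear_left t {X Y} hX hxX hY := by
    obtain ⟨n, e, he⟩ := exists_shift_frame (X := X) (hX.symm ▸ hx)
    obtain ⟨m, f, hf⟩ := exists_shift_frame (X := Y) (hY.symm ▸ hy)
    have h₁ := (s.exists_alpha comm hxX hY hx hy).choose_spec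
      (he.const_tensor_shift t (vec_ne_zero t)) hf
    have h₂ := Carries.linear_left (v := vec t)
      ((s.exists_alpha comm hX hY hx hy).choose_spec he hf) hf.frame.deg
    refine h₁.hom_ext (h₂.congr fun M => ?_)
      (((he.const_tensor_shift t (vec_ne_zero t)).tensor hf).const_tensor _ (vec_ne_zero _)).frame.ne
    change sgn k (δ * t.deg) * (sgn k (psi δ n m _ _) * l M) * sgn k (t.deg * (m + y.d M)) = _
    rw [mul_right_comm, ← mul_assoc, mul_right_comm _ (sgn k _) (sgn k _), ← sgn_add, ← sgn_add]
    congr 1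
    exact sgn_congr 0 (by unfold psi; ring)
  linear_right t {X Y} hX hY hxY := by
    obtain ⟨n, e, he⟩ := exists_shift_frame (X := X) (hX.symm ▸ hx)
    obtain ⟨m, f, hf⟩ := exists_shift_frame (X := Y) (hY.symm ▸ hy)
    have h₁ := (s.exists_alpha comm hX hxY hx hy).choose_spec he
      (hf.const_tensor_shift t (vec_ne_zero t))
    have h₂ := Carries.linear_right (v := vec t)
      ((s.exists_alpha comm hX hY hx hy).choose_spec he hf) he.frame.deg
    refine h₁.hom_ext (h₂.congr fun M => ?_)
      ((he.tensor (hf.const_tensor_shift t (vec_ne_zero t))).const_tensor _ (vec_ne_zero _)).frame.ne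
    change sgn k (t.deg * (n + x.d M)) * sgn k (δ * t.deg) * (sgn k (psi δ n m _ _) * l M) = _
    rw [← mul_assoc, ← sgn_add, ← sgn_add]
    congr 1
    exact sgn_congr 0 (by unfold psi; ring)

theorem Swap.carries_commutator (s : Swap g h x y δ l) (comm : g * h = h * g)
    (hx : IsCoc L (im g L) x) (hy : IsCoc L (im h L) y) {X Y : DetCat hL}
    (hg : (Det hL).π X = g) (hh : (Det hL).π Y = h) {n m : ℤ} {e : Fr X} {f : Fr Y}
    (he : HasFr X (x.shift n) e) (hf : HasFr Y (y.shift m) f) :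
    Carries ((s.commutator comm hx hy (hL := hL)).α X Y hg hh).hom
      ((kvec hL (vec (lineOf k δ))).tm (e.tm f)) (f.tm e)
      fun M => sgn k (psi δ n m (x.d M) (y.d M)) * l M :=
  (s.exists_alpha comm hg hh hx hy).choose_spec he hf

/-- The comparison of the signs of the commutators of `X` with `Y ⊗ Z`, with `Y` and with `Z`. -/
theorem sgn_psi_additivity {p r q s n a b x y z x' y' w : ℤ} (hq : q = p + r) (hw : w = s + y + z)
    (hy : y + x' = p + x + y') {F F' C A B μ : kˣ}
    (e : sgn k (psi q 0 (-s) x w) * C * F * F'⁻¹ = μ * sgn k (p * r) * A * sgn k (r * y) * B) :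
    sgn k (psi q n (a + b - s) x w) * C * (F * sgn k (b * y)) * (F' * sgn k (b * y'))⁻¹ =
      μ * sgn k (p * r) * (sgn k (psi p n a x y) * A) * sgn k (r * (a + y)) *
        (sgn k (psi r n b x' z) * B) := by
  have h₁ : sgn k (psi q n (a + b - s) x w) * sgn k (b * y) * sgn k (b * y') =
      sgn k (psi q 0 (-s) x w) * sgn k (psi p n a x y) * sgn k (r * a) * sgn k (psi r n b x' z) := by
    simp only [← sgn_add]
    refine sgn_congr (b * y) ?_
    subst hq hw
    unfold psi
    obtain rfl : x' = p + x + y' - y := by omega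
    ring
  have h₂ : sgn k (psi q n (a + b - s) x w) * C * (F * sgn k (b * y)) * (F' * sgn k (b * y'))⁻¹ =
      sgn k (psi q n (a + b - s) x w) * sgn k (b * y) * sgn k (b * y') * (C * F * F'⁻¹) := by
    rw [mul_inv, sgn_inv]
    ac_rfl
  rw [h₂, h₁, mul_add, sgn_add]
  have : sgn k (psi q 0 (-s) x w) * sgn k (psi p n a x y) * sgn k (r * a) * sgn k (psi r n b x' z) *
      (C * F * F'⁻¹) = (sgn k (psi q 0 (-s) x w) * C * F * F'⁻¹) *
      (sgn k (psi p n a x y) * sgn k (r * a) * sgn k (psi r n b x' z)) := by ac_rfl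
  rw [this, e]
  ac_rfl

/-- The additivity of the commutators of an element with two elements `h` and `h'`. -/
theorem exists_additivity {g h h' j : TateGL k k'} {x y z w : Cochain k k'} {p r q : ℤ}
    {lA lB lC : Colat k k' → kˣ} (hj : h * h' = j) (sA : Swap g h x y p lA)
    (sB : Swap g h' x z r lB) (sC : Swap g j x w q lC) (cA : g * h = h * g) (cB : g * h' = h' * g)
    (cC : g * j = j * g) (hx : IsCoc L (im g L) x) (hy : IsCoc L (im h L) y)
    (hz : IsCoc L (im h' L) z) (hw : IsCoc L (im j L) w) :
    ∃ m : lineOf k q ≅ lineOf k p ⊗ lineOf k r,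
      CentralExtension.IsAdditivity hj (sA.commutator cA hx hy (hL := hL))
        (sB.commutator cB hx hz) (sC.commutator cC hx hw) m := by
  subst hj
  have hyz := hy.mul (hz.act h)
  rw [im_mul] at hyz
  obtain ⟨s, hs, F, hF, hc⟩ := hyz.exists_tw hw
  have hd : ∀ M, w.d M = s + y.d M + z.d (act h M) := fun M => (hs M).trans (add_assoc _ _ _).symm
  have hact : ∀ M : Colat k k', act h (act g M) = act g (act h M) := fun M => by
    rw [← act_mul, ← act_mul, cA]
  have hq : q = p + r := by
    have h₁ := sA.deg (stdColat k k')
    have h₂ := sB.deg (act h (stdColat k k'))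
    have h₃ := sC.deg (stdColat k k')
    rw [hd, hd, act_mul, hact] at h₃
    omega
  have hne : tm (vec (lineOf k p)) (vec (lineOf k r)) ≠ 0 :=
    DetTheory.tm_ne_zero (vec_ne_zero _) (vec_ne_zero _)
  have key : ∀ {X Y Z : DetCat hL} (hX : (Det hL).π X = g) (hY : (Det hL).π Y = h)
      (hZ : (Det hL).π Z = h') {n a b : ℤ} {e : Fr X} {f : Fr Y} {i : Fr Z},
      HasFr X (x.shift n) e → HasFr Y (y.shift a) f → HasFr Z (z.shift b) i →
      Carries ((sC.commutator cC hx hw).α X (Y ⊗ Z) hX (by rw [(Det hL).π_tensor, hY, hZ])).hom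
        ((kvec hL (vec (lineOf k q))).tm (e.tm (f.tm i))) ((f.tm i).tm e) fun M =>
        sgn k (psi q n (a + b - s) (x.d M) (w.d M)) * lC M * (F M * sgn k (b * y.d M)) *
          (F (act g M) * sgn k (b * y.d (act g M)))⁻¹ := by
    intro X Y Z hX hY hZ n a b e f i he hf hi
    have h₁ := HasFr.tensor_shift hy hw hF hs hc hY hZ hf hi
    have h₂ := sC.carries_commutator cC hx hw hX (by rw [(Det hL).π_tensor, hY, hZ]) he h₁
    subst hX
    exact h₂.of_smul
  obtain ⟨X, hX, e, he⟩ := exists_obj_frame (hL := hL) (hx.shift 0)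
  obtain ⟨Y, hY, f, hf⟩ := exists_obj_frame (hL := hL) (hy.shift 0)
  obtain ⟨Z, hZ, i, hi⟩ := exists_obj_frame (hL := hL) (hz.shift 0)
  have hm₀ : (lineIso (vec_ne_zero (lineOf k q)) hne hq).hom.e (vec (lineOf k q)) =
      (1 : kˣ) • tm (vec (lineOf k p)) (vec (lineOf k r)) :=
    (lineIso_apply _ _ _).trans (one_smul _ _).symm
  have c₁ := key hX hY hZ he hf hi
  have c₂ := Carries.additivity hm₀ (sA.carries_commutator cA hx hy hX hY he hf)
    (sB.carries_commutator cB hx hz hX hZ he hi) hf.frame.deg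
  have hsrc := (he.tensor (hf.tensor hi)).const_tensor (lineOf k q) (vec_ne_zero _)
  have htgt := (hf.tensor hi).tensor he
  obtain ⟨l₁, hl₁, hC₁, hs₁⟩ := hsrc.exists_carries htgt
    ((sC.commutator cC hx hw).α X (Y ⊗ Z) hX (by rw [(Det hL).π_tensor, hY, hZ])).hom
  obtain ⟨l₂, hl₂, hC₂, hs₂⟩ := hsrc.exists_carries htgt _
  obtain ⟨μ, hμ⟩ := exists_const_of_stable hl₁ hl₂ hs₁ hs₂
  have hrel : ∀ M, _ = μ * _ := fun M => (c₁.unique hC₁ htgt.frame.ne M).trans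
    ((hμ M).trans (congrArg _ (c₂.unique hC₂ htgt.frame.ne M).symm))
  have hneμ : μ • tm (vec (lineOf k p)) (vec (lineOf k r)) ≠ 0 := by
    rw [Ne, smul_eq_zero_iff_eq]
    exact hne
  refine ⟨lineIso (vec_ne_zero (lineOf k q)) hneμ hq, fun X₁ Y₁ Z₁ hX₁ hY₁ hZ₁ => ?_⟩
  obtain ⟨n, e₁, he₁⟩ := exists_shift_frame (X := X₁) (hX₁.symm ▸ hx)
  obtain ⟨a, f₁, hf₁⟩ := exists_shift_frame (X := Y₁) (hY₁.symm ▸ hy)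
  obtain ⟨b, i₁, hi₁⟩ := exists_shift_frame (X := Z₁) (hZ₁.symm ▸ hz)
  have c₃ := key hX₁ hY₁ hZ₁ he₁ hf₁ hi₁
  have c₄ := Carries.additivity (lineIso_apply (vec_ne_zero (lineOf k q)) hneμ hq)
    (sA.carries_commutator cA hx hy hX₁ hY₁ he₁ hf₁)
    (sB.carries_commutator cB hx hz hX₁ hZ₁ he₁ hi₁) hf₁.frame.deg
  refine c₃.hom_ext (c₄.congr fun M => ?_)
    ((he₁.tensor (hf₁.tensor hi₁)).const_tensor (lineOf k q) (vec_ne_zero _)).frame.ne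
  have hM := hrel M
  have hY' : Y.obj.g = h := hY
  have hY₁' : Y₁.obj.g = h := hY₁
  rw [hY'] at hM
  rw [hY₁']
  refine (sgn_psi_additivity hq (hd M) ((sA.deg M).trans (add_assoc _ _ _).symm) ?_).symm
  change sgn k (psi q 0 (0 + 0 - s) _ _) * _ * (F M * sgn k (0 * _)) * (_ * sgn k (0 * _))⁻¹ =
    μ * (1 * sgn k (p * r) * (sgn k (psi p 0 0 _ _) * _) * sgn k (r * (0 + _)) *
      (sgn k (psi r 0 0 _ _) * _)) at hM
  simp only [psi, zero_mul, mul_zero, add_zero, zero_add, Sys.sgn_zero, mul_one, one_mul,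
    zero_sub] at hM
  simp only [psi, zero_mul, add_zero, zero_add]
  rw [hM]
  simp only [mul_assoc]

theorem exists_scalarAut {X : GradedLine k} (φ : X ⟶ X) :
    ∃ a : kˣ, φ = (λ_ X).inv ≫ (scalarAut a).hom ▷ X ≫ (λ_ X).hom := by
  obtain ⟨a, ha⟩ := exists_unit_smul X (vec_ne_zero X) ((φ.e.map_ne_zero_iff).2 (vec_ne_zero X))
  exact ⟨a, line_hom_ext (vec_ne_zero X) (ha.trans (scalarAut_whiskerRight_e a X _).symm)⟩

/-- Commuting automorphisms have a triple commutator: the commutators are built from the scalars of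
`exists_swap`, and an automorphism of a line is a scalar. -/
theorem exists_isTripleCommutator (hL : IsLattice L) {g h h' : TateGL k k'} (hgh : g * h = h * g)
    (hgh' : g * h' = h' * g) (hhh' : h * h' = h' * h) :
    ∃ a : kˣ, (Det hL).IsTripleCommutator g h h' (scalarAut a) := by
  have hcoc : ∀ g : TateGL k k', ∃ x, IsCoc L (im g L) x := fun g => by
    obtain ⟨X, hX⟩ := (isCentralExtension_det hL).exists_obj g
    obtain ⟨x, e, he⟩ := exists_hasFr X
    subst hX
    exact ⟨x, he.coc⟩
  obtain ⟨x, hx⟩ := hcoc g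
  obtain ⟨y, hy⟩ := hcoc h
  obtain ⟨z, hz⟩ := hcoc h'
  obtain ⟨w, hw⟩ := hcoc (h * h')
  have hC : g * (h * h') = h * h' * g := by rw [← mul_assoc, hgh, mul_assoc, hgh', mul_assoc]
  obtain ⟨p, lA, sA⟩ := exists_swap hgh hx hy
  obtain ⟨r, lB, sB⟩ := exists_swap hgh' hx hz
  obtain ⟨q, lC, sC⟩ := exists_swap hC hx hw
  obtain ⟨m, hm⟩ := exists_additivity (hL := hL) rfl sA sB sC hgh hgh' hC hx hy hz hw
  obtain ⟨m', hm'⟩ := exists_additivity (hL := hL) hhh'.symm sB sA sC hgh' hgh hC hx hz hy hw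
  obtain ⟨a, ha⟩ := exists_scalarAut (m.hom ≫ (β_ (lineOf k p) (lineOf k r)).hom ≫ m'.inv)
  exact ⟨a, hhh'.symm, sA.commutator hgh hx hy, sB.commutator hgh' hx hz, sC.commutator hC hx hw,
    m, m', hm, hm', ha⟩

end LL

/-! ### Trilinearity of the triple commutator -/

namespace LL

open GradedLine

variable {k k' : Type u} [Field k] [Field k'] [Algebra k k']

namespace Cochain

theorem mul_assoc' (x y z : Cochain k k') : (x.mul y).mul z = x.mul (y.mul z) := by
  refine ext_of_eq (funext fun M => add_assoc _ _ _)
    (funext fun M => funext fun M' => funext fun v => ?_)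
  change x.c M M' v * y.c M M' v * sgn k ((x.d M' - x.d M) * y.d M) * z.c M M' v *
      sgn k ((x.d M' + y.d M' - (x.d M + y.d M)) * z.d M) =
    x.c M M' v * (y.c M M' v * z.c M M' v * sgn k ((y.d M' - y.d M) * z.d M)) *
      sgn k ((x.d M' - x.d M) * (y.d M + z.d M))
  have : sgn k ((x.d M' - x.d M) * y.d M) *
        sgn k ((x.d M' + y.d M' - (x.d M + y.d M)) * z.d M) =
      sgn k ((y.d M' - y.d M) * z.d M) * sgn k ((x.d M' - x.d M) * (y.d M + z.d M)) := by
    rw [← sgn_add, ← sgn_add]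
    congr 1
    ring
  calc _ = x.c M M' v * y.c M M' v * z.c M M' v * (sgn k ((x.d M' - x.d M) * y.d M) *
        sgn k ((x.d M' + y.d M' - (x.d M + y.d M)) * z.d M)) := by ac_rfl
    _ = _ := by
      rw [this]
      ac_rfl

theorem act_act (g h : TateGL k k') (x : Cochain k k') : (x.act h).act g = x.act (g * h) := rfl

theorem mul_act (g : TateGL k k') (x y : Cochain k k') :
    (x.mul y).act g = (x.act g).mul (y.act g) := rfl

theorem const_zero_mul (x : Cochain k k') : (Cochain.const k k' 0).mul x = x :=
  ext_of_eq (funext fun _ => zero_add _)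
    (funext fun M => funext fun M' => funext fun v => const_mul_c 0 x M M' v)

theorem mul_const_zero (x : Cochain k k') : x.mul (Cochain.const k k' 0) = x :=
  ext_of_eq (funext fun _ => add_zero _) (funext fun M => funext fun M' => funext fun v => by
    change x.c M M' v * 1 * sgn k ((x.d M' - x.d M) * 0) = _
    rw [mul_zero, Sys.sgn_zero, mul_one, mul_one])

theorem act_const (g : TateGL k k') (n : ℤ) : (Cochain.const k k' n).act g = Cochain.const k k' n :=
  rfl

theorem mul_inv' (x : Cochain k k') : x.mul x.inv = Cochain.const k k' 0 :=
  ext_of_eq (funext fun _ => add_neg_cancel _) (funext fun M => funext fun M' => funext fun v => by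
    change x.c M M' v * ((x.c M M' v)⁻¹ * sgn k ((x.d M' - x.d M) * x.d M)) *
      sgn k ((x.d M' - x.d M) * -x.d M) = 1
    rw [mul_neg, sgn_neg, mul_inv_cancel_left, sgn_mul_self])

end Cochain

/-- The scalars `l` and the shift `δ` of degrees relate the cochains `x` and `y`. A `Swap` is such a
relation between `x.mul (y.act g)` and `y.mul (x.act h)`. -/
structure Cob (x y : Cochain k k') (δ : ℤ) (l : Colat k k' → kˣ) : Prop where
  stable : Stable l
  deg : ∀ M, y.d M = δ + x.d M
  step : ∀ {M M' : Colat k k'} {v : LL k'}, IsStep M M' v → l M' * x.c M M' v = l M * y.c M M' v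

namespace Cob

variable {x y z : Cochain k k'} {δ δ' : ℤ} {l l' : Colat k k' → kˣ}

theorem mul_right (h : Cob x y δ l) (z : Cochain k k') : Cob (x.mul z) (y.mul z) δ l where
  stable := h.stable
  deg M := by
    change y.d M + z.d M = δ + (x.d M + z.d M)
    rw [h.deg, add_assoc]
  step {M M' v} hs := by
    change l M' * (x.c M M' v * z.c M M' v * sgn k ((x.d M' - x.d M) * z.d M)) =
      l M * (y.c M M' v * z.c M M' v * sgn k ((y.d M' - y.d M) * z.d M))
    rw [h.deg, h.deg, add_sub_add_left_eq_sub, ← mul_assoc, ← mul_assoc, h.step hs, ← mul_assoc,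
      ← mul_assoc]

theorem mul_left (h : Cob x y δ l) {z : Cochain k k'} (hz : Stable z.d) :
    Cob (z.mul x) (z.mul y) δ fun M => l M * sgn k (δ * z.d M) where
  stable := h.stable.mul (hz.comp fun n => sgn k (δ * n))
  deg M := by
    change z.d M + y.d M = δ + (z.d M + x.d M)
    rw [h.deg, add_left_comm]
  step {M M' v} hs := by
    change l M' * sgn k (δ * z.d M') * (z.c M M' v * x.c M M' v * sgn k ((z.d M' - z.d M) * x.d M)) =
      l M * sgn k (δ * z.d M) * (z.c M M' v * y.c M M' v * sgn k ((z.d M' - z.d M) * y.d M))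
    have : sgn k (δ * z.d M') * sgn k ((z.d M' - z.d M) * x.d M) =
        sgn k (δ * z.d M) * sgn k ((z.d M' - z.d M) * y.d M) := by
      rw [← sgn_add, ← sgn_add, h.deg]
      exact sgn_congr 0 (by ring)
    calc _ = z.c M M' v * (l M' * x.c M M' v) *
          (sgn k (δ * z.d M') * sgn k ((z.d M' - z.d M) * x.d M)) := by ac_rfl
      _ = _ := by
        rw [this, h.step hs]
        ac_rfl

theorem trans (h : Cob x y δ l) (h' : Cob y z δ' l') : Cob x z (δ + δ') fun M => l M * l' M where
  stable := h.stable.mul h'.stable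
  deg M := by rw [h'.deg, h.deg, add_left_comm, add_assoc]
  step {M M' v} hs := by
    rw [mul_right_comm, h.step hs, mul_right_comm, mul_assoc, mul_assoc,
      h'.step hs]

theorem symm (h : Cob x y δ l) : Cob y x (-δ) fun M => (l M)⁻¹ where
  stable := h.stable.comp _
  deg M := by rw [h.deg, neg_add_cancel_left]
  step {M M' v} hs := by
    rw [inv_mul_eq_iff_eq_mul, mul_left_comm, h.step hs, inv_mul_cancel_left]

theorem act (h : Cob x y δ l) (g : TateGL k k') : Cob (x.act g) (y.act g) δ fun M => l (act g M) where
  stable := h.stable.act g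
  deg _ := h.deg _
  step hs := h.step (hs.act g)

theorem refl (x : Cochain k k') : Cob x x 0 1 where
  stable := stable_const 1
  deg _ := (zero_add _).symm
  step _ := rfl

end Cob

namespace Swap

variable {g g' h h' : TateGL k k'} {x x' y z q : Cochain k k'} {p p' r δ : ℤ}
  {l l' lxy lxz lyz : Colat k k' → kˣ}

theorem cob (s : Swap g h x y δ l) : Cob (x.mul (y.act g)) (y.mul (x.act h)) δ l :=
  ⟨s.stable, s.deg, s.step⟩

theorem of_cob (s : Cob (x.mul (y.act g)) (y.mul (x.act h)) δ l) : Swap g h x y δ l :=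
  ⟨s.stable, s.deg, s.step⟩

theorem symm (s : Swap g h x y δ l) : Swap h g y x (-δ) fun M => (l M)⁻¹ := of_cob s.cob.symm

theorem self (g : TateGL k k') (x : Cochain k k') : Swap g g x x 0 1 := of_cob (.refl _)

theorem mul (s : Swap g h x y p l) (s' : Swap g' h x' y p' l') (comm : g * h = h * g)
    (hx : Stable x.d) : Swap (g * g') h (x.mul (x'.act g)) y (p' + p)
      fun M => l' (act g M) * sgn k (p' * x.d M) * l M := by
  have h₁ := (s'.cob.act g).mul_left hx
  have h₂ := s.cob.mul_right ((x'.act g).act h)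
  rw [Cochain.mul_assoc', Cochain.mul_assoc', Cochain.act_act h g, ← comm] at h₂
  refine of_cob ?_
  rw [Cochain.mul_assoc']
  exact h₁.trans (by
    rw [Cochain.mul_act h, Cochain.act_act h g, ← comm]
    exact h₂)

theorem conj (s : Swap g h x y δ l) (comm : g * h = h * g) (hq : Stable q.d) :
    Swap g h (q.inv.mul (x.mul (q.act g))) (q.inv.mul (y.mul (q.act h))) δ
      fun M => l M * sgn k (δ * q.d M) := by
  have key : ∀ (g h : TateGL k k') (x y : Cochain k k'),
      (q.inv.mul (x.mul (q.act g))).mul ((q.inv.mul (y.mul (q.act h))).act g) =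
        q.inv.mul ((x.mul (y.act g)).mul (q.act (g * h))) := fun g h x y => by
    rw [Cochain.mul_act, Cochain.mul_assoc', Cochain.mul_assoc', ← Cochain.mul_assoc' (q.act g),
      ← Cochain.mul_act g, Cochain.mul_inv', Cochain.act_const, Cochain.const_zero_mul,
      Cochain.mul_act, Cochain.act_act, Cochain.mul_assoc']
  refine of_cob ?_
  rw [key, key h g, ← comm]
  have := (s.cob.mul_right (q.act (g * h))).mul_left (z := q.inv) (hq.comp fun n => -n)
  have e : (fun M => l M * sgn k (δ * q.d M)) = fun M => l M * sgn k (δ * q.inv.d M) :=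
    funext fun M => by
      change _ = l M * sgn k (δ * -q.d M)
      rw [mul_neg, sgn_neg]
  rw [e]
  exact this

end Swap

section Triple

variable {g g' h h' : TateGL k k'} {x x' y z c : Cochain k k'} {p p' r r' q : ℤ}
  {l l' lxy lxz lxy' lxz' lyz : Colat k k' → kˣ}

theorem triple_swap_right (M : Colat k k') :
    triple g h' h x z y r p (-q) lxz lxy (fun M => (lyz M)⁻¹) M =
      (triple g h h' x y z p r q lxy lxz lyz M)⁻¹ := by
  unfold triple
  rw [sgn_congr (b := p * r + p * q + r * q + p * z.d M + r * y.d M + q * x.d M)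
    (-(q * p) - r * q - q * x.d M) (by ring)]
  simp only [mul_inv, inv_inv, sgn_inv]
  ac_rfl

theorem triple_swap_left (M : Colat k k') :
    triple h g h' y x z (-p) q r (fun M => (lxy M)⁻¹) lyz lxz M =
      (triple g h h' x y z p r q lxy lxz lyz M)⁻¹ := by
  unfold triple
  rw [sgn_congr (b := p * r + p * q + r * q + p * z.d M + r * y.d M + q * x.d M)
    (-(q * p) - r * p - p * z.d M) (by ring)]
  simp only [mul_inv, inv_inv, sgn_inv]
  ac_rfl

/-- For two equal arguments only the sign coming from the commutativity constraint remains. -/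
theorem triple_self (M : Colat k k') :
    triple g g h' x x z 0 r r 1 lxz lxz M = sgn k r := by
  unfold triple
  obtain ⟨t, ht⟩ := Int.even_mul_pred_self r
  rw [sgn_congr (b := r) (t + r * x.d M) (by linear_combination ht), Pi.one_apply, Pi.one_apply,
    inv_one, mul_one, mul_one]
  calc _ = sgn k r * ((lxz M * (lxz M)⁻¹) * (lxz (act g M) * (lxz (act g M))⁻¹)) := by ac_rfl
    _ = _ := by rw [mul_inv_cancel, mul_inv_cancel, mul_one, mul_one]

/-- The triple commutator is multiplicative in the first argument. The factor of `g'` is evaluated at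
`act g M`; this is immaterial, since `triple` does not depend on the colattice. -/
theorem triple_mul (sxy : Swap g h x y p lxy) (sxz : Swap g h' x z r lxz)
    (hgh : g * h = h * g) (hgh' : g * h' = h' * g) (M : Colat k k') :
    triple (g * g') h h' (x.mul (x'.act g)) y z (p' + p) (r' + r) q
      (fun M => lxy' (act g M) * sgn k (p' * x.d M) * lxy M)
      (fun M => lxz' (act g M) * sgn k (r' * x.d M) * lxz M) lyz M =
    triple g h h' x y z p r q lxy lxz lyz M *
      triple g' h h' x' y z p' r' q lxy' lxz' lyz (act g M) := by
  have e₁ : act g (act h' M) = act h' (act g M) := by rw [← act_mul, ← act_mul, hgh']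
  have e₂ : act g (act h M) = act h (act g M) := by rw [← act_mul, ← act_mul, hgh]
  have hp := sxy.deg M
  have hr := sxz.deg M
  unfold triple
  simp only [act_mul]
  change sgn k ((p' + p) * (r' + r) + (p' + p) * q + (r' + r) * q + (p' + p) * z.d M +
      (r' + r) * y.d M + q * (x.d M + x'.d (act g M))) * _ * _ * _ = _
  rw [e₁, e₂]
  have hs : sgn k ((p' + p) * (r' + r) + (p' + p) * q + (r' + r) * q + (p' + p) * z.d M +
      (r' + r) * y.d M + q * (x.d M + x'.d (act g M))) * (sgn k (p' * x.d (act h' M)) *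
      sgn k (p' * x.d M) * sgn k (r' * x.d M) * sgn k (r' * x.d (act h M))) =
      sgn k (p * r + p * q + r * q + p * z.d M + r * y.d M + q * x.d M) *
      sgn k (p' * r' + p' * q + r' * q + p' * z.d (act g M) + r' * y.d (act g M) +
        q * x'.d (act g M)) := by
    simp only [← sgn_add]
    refine sgn_congr (p' * r + r' * p + p' * x.d M + r' * x.d M) ?_
    have hp' : x.d (act h M) = p + (x.d M + y.d (act g M)) - y.d M := by omega
    have hr' : x.d (act h' M) = r + (x.d M + z.d (act g M)) - z.d M := by omega
    rw [hp', hr']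
    ring
  simp only [mul_inv, sgn_inv]
  set A := lyz (act g M)
  calc _ = (sgn k ((p' + p) * (r' + r) + (p' + p) * q + (r' + r) * q + (p' + p) * z.d M +
      (r' + r) * y.d M + q * (x.d M + x'.d (act g M))) * (sgn k (p' * x.d (act h' M)) *
      sgn k (p' * x.d M) * sgn k (r' * x.d M) * sgn k (r' * x.d (act h M)))) *
      ((lxy' (act h' (act g M)) * lxy (act h' M) * ((lxy' (act g M))⁻¹ * (lxy M)⁻¹)) *
      (lxz' (act g M) * lxz M * ((lxz' (act h (act g M)))⁻¹ * (lxz (act h M))⁻¹)) *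
      (lyz (act g' (act g M)) * (lyz M)⁻¹)) := by ac_rfl
    _ = (sgn k (p * r + p * q + r * q + p * z.d M + r * y.d M + q * x.d M) *
      sgn k (p' * r' + p' * q + r' * q + p' * z.d (act g M) + r' * y.d (act g M) +
        q * x'.d (act g M))) *
      ((lxy' (act h' (act g M)) * lxy (act h' M) * ((lxy' (act g M))⁻¹ * (lxy M)⁻¹)) *
      (lxz' (act g M) * lxz M * ((lxz' (act h (act g M)))⁻¹ * (lxz (act h M))⁻¹)) *
      (lyz (act g' (act g M)) * (lyz M)⁻¹)) * (A * A⁻¹) := by rw [hs, mul_inv_cancel, mul_one]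
    _ = _ := by ac_rfl

/-- Passing to another lattice changes the cochain over `g` to `c⁻¹ x g(c)`, where `c` is a cochain
comparing the two lattices. This does not affect the triple commutator. -/
theorem triple_conj (M : Colat k k') :
    triple g h h' (c.inv.mul (x.mul (c.act g))) (c.inv.mul (y.mul (c.act h)))
      (c.inv.mul (z.mul (c.act h'))) p r q (fun M => lxy M * sgn k (p * c.d M))
      (fun M => lxz M * sgn k (r * c.d M)) (fun M => lyz M * sgn k (q * c.d M)) M =
      triple g h h' x y z p r q lxy lxz lyz M := by
  unfold triple
  change sgn k (p * r + p * q + r * q + p * (-c.d M + (z.d M + c.d (act h' M))) +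
    r * (-c.d M + (y.d M + c.d (act h M))) + q * (-c.d M + (x.d M + c.d (act g M)))) * _ * _ * _ = _
  have hs : sgn k (p * r + p * q + r * q + p * (-c.d M + (z.d M + c.d (act h' M))) +
      r * (-c.d M + (y.d M + c.d (act h M))) + q * (-c.d M + (x.d M + c.d (act g M)))) *
      (sgn k (p * c.d (act h' M)) * sgn k (p * c.d M) * sgn k (r * c.d M) *
        sgn k (r * c.d (act h M)) * sgn k (q * c.d (act g M)) * sgn k (q * c.d M)) =
      sgn k (p * r + p * q + r * q + p * z.d M + r * y.d M + q * x.d M) := by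
    simp only [← sgn_add]
    exact sgn_congr (p * c.d (act h' M) + r * c.d (act h M) + q * c.d (act g M)) (by ring)
  rw [← hs]
  simp only [mul_inv, sgn_inv]
  ac_rfl

end Triple

end LL

namespace LL

open GradedLine

variable {k k' : Type u} [Field k] [Field k'] [Algebra k k']

theorem mulGL_mul (f g : (LL k')ˣ) : mulGL k (f * g) = mulGL k f * mulGL k g :=
  Subtype.ext (LinearEquiv.ext fun x => mul_assoc (f : LL k') (g : LL k') x)

theorem mulGL_comm (f g : (LL k')ˣ) : mulGL k f * mulGL k g = mulGL k g * mulGL k f := by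
  rw [← mulGL_mul, ← mulGL_mul, mul_comm f]

variable [FiniteDimensional k k']

theorem exists_isCoc {L L' : Submodule k (LL k')} (hL : IsLattice L) (hL' : IsLattice L') :
    ∃ c : Cochain k k', IsCoc L L' c := by
  obtain ⟨Dp⟩ := exists_detTheory hL' (hL.inf hL') inf_le_right
  obtain ⟨Dm⟩ := exists_detTheory hL (hL.inf hL') inf_le_left
  have h₁ := IsCoc.of_isCo hL (hL.inf hL') inf_le_left
    (Dm.isCo_cochain (hA := hL) (hN := hL.inf hL') (hNA := inf_le_left))
  have h₂ := IsCoc.of_isCo hL' (hL.inf hL') inf_le_right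
    (Dp.isCo_cochain (hA := hL') (hN := hL.inf hL') (hNA := inf_le_right))
  exact ⟨_, h₁.inv.mul h₂⟩

variable {L : Submodule k (LL k')} (hL : IsLattice L)

/-- The triple commutator of the multiplications by three elements of the field. -/
def comm₃ (f g h : (LL k')ˣ) : kˣ :=
  (exists_isTripleCommutator hL (mulGL_comm f g) (mulGL_comm f h) (mulGL_comm g h)).choose

theorem isTripleCommutator_comm₃ (f g h : (LL k')ˣ) :
    (Det hL).IsTripleCommutator (mulGL k f) (mulGL k g) (mulGL k h) (scalarAut (comm₃ hL f g h)) :=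
  (exists_isTripleCommutator hL (mulGL_comm f g) (mulGL_comm f h) (mulGL_comm g h)).choose_spec

variable {f f' g h : (LL k')ˣ} {x y z : Cochain k k'} {p r q : ℤ}
  {lxy lxz lyz : Colat k k' → kˣ}

theorem comm₃_eq (hx : IsCoc L (im (mulGL k f) L) x) (hy : IsCoc L (im (mulGL k g) L) y)
    (hz : IsCoc L (im (mulGL k h) L) z) (sxy : Swap (mulGL k f) (mulGL k g) x y p lxy)
    (sxz : Swap (mulGL k f) (mulGL k h) x z r lxz) (syz : Swap (mulGL k g) (mulGL k h) y z q lyz)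
    (M : Colat k k') : comm₃ hL f g h =
      triple (mulGL k f) (mulGL k g) (mulGL k h) x y z p r q lxy lxz lyz M :=
  eq_triple hL (isTripleCommutator_comm₃ hL f g h) hx hy hz sxy sxz syz M

/-- The triple commutator is unique, since `eq_triple` expresses it by any choice of cochains. -/
theorem isTripleCommutator_iff {a : kˣ} :
    (Det hL).IsTripleCommutator (mulGL k f) (mulGL k g) (mulGL k h) (scalarAut a) ↔
      a = comm₃ hL f g h := by
  refine ⟨fun H => ?_, fun H => H ▸ isTripleCommutator_comm₃ hL f g h⟩
  obtain ⟨x, hx⟩ := exists_isCoc hL (hL.im (mulGL k f))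
  obtain ⟨y, hy⟩ := exists_isCoc hL (hL.im (mulGL k g))
  obtain ⟨z, hz⟩ := exists_isCoc hL (hL.im (mulGL k h))
  obtain ⟨p, lxy, sxy⟩ := exists_swap (mulGL_comm f g) hx hy
  obtain ⟨r, lxz, sxz⟩ := exists_swap (mulGL_comm f h) hx hz
  obtain ⟨q, lyz, syz⟩ := exists_swap (mulGL_comm g h) hy hz
  rw [comm₃_eq hL hx hy hz sxy sxz syz (stdColat k k'),
    eq_triple hL H hx hy hz sxy sxz syz (stdColat k k')]

/-- The triple commutator may be computed by means of the cochains for another lattice. -/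
theorem comm₃_eq_of_lattice {L₀ : Submodule k (LL k')} (hL₀ : IsLattice L₀)
    (hx : IsCoc L₀ (im (mulGL k f) L₀) x) (hy : IsCoc L₀ (im (mulGL k g) L₀) y)
    (hz : IsCoc L₀ (im (mulGL k h) L₀) z) (sxy : Swap (mulGL k f) (mulGL k g) x y p lxy)
    (sxz : Swap (mulGL k f) (mulGL k h) x z r lxz) (syz : Swap (mulGL k g) (mulGL k h) y z q lyz)
    (M : Colat k k') : comm₃ hL f g h =
      triple (mulGL k f) (mulGL k g) (mulGL k h) x y z p r q lxy lxz lyz M := by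
  obtain ⟨c, hc⟩ := exists_isCoc hL₀ hL
  have key : ∀ {f : (LL k')ˣ} {x : Cochain k k'}, IsCoc L₀ (im (mulGL k f) L₀) x →
      IsCoc L (im (mulGL k f) L) (c.inv.mul (x.mul (c.act (mulGL k f)))) := fun hx =>
    hc.inv.mul (hx.mul (hc.act _))
  rw [comm₃_eq hL (key hx) (key hy) (key hz) (sxy.conj (mulGL_comm f g) hc.stable_d)
    (sxz.conj (mulGL_comm f h) hc.stable_d) (syz.conj (mulGL_comm g h) hc.stable_d) M, triple_conj]

theorem comm₃_swap_right (f g h : (LL k')ˣ) : comm₃ hL f h g = (comm₃ hL f g h)⁻¹ := by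
  obtain ⟨x, hx⟩ := exists_isCoc hL (hL.im (mulGL k f))
  obtain ⟨y, hy⟩ := exists_isCoc hL (hL.im (mulGL k g))
  obtain ⟨z, hz⟩ := exists_isCoc hL (hL.im (mulGL k h))
  obtain ⟨p, lxy, sxy⟩ := exists_swap (mulGL_comm f g) hx hy
  obtain ⟨r, lxz, sxz⟩ := exists_swap (mulGL_comm f h) hx hz
  obtain ⟨q, lyz, syz⟩ := exists_swap (mulGL_comm g h) hy hz
  rw [comm₃_eq hL hx hy hz sxy sxz syz (stdColat k k'),
    comm₃_eq hL hx hz hy sxz sxy syz.symm (stdColat k k'), triple_swap_right]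

theorem comm₃_swap_left (f g h : (LL k')ˣ) : comm₃ hL g f h = (comm₃ hL f g h)⁻¹ := by
  obtain ⟨x, hx⟩ := exists_isCoc hL (hL.im (mulGL k f))
  obtain ⟨y, hy⟩ := exists_isCoc hL (hL.im (mulGL k g))
  obtain ⟨z, hz⟩ := exists_isCoc hL (hL.im (mulGL k h))
  obtain ⟨p, lxy, sxy⟩ := exists_swap (mulGL_comm f g) hx hy
  obtain ⟨r, lxz, sxz⟩ := exists_swap (mulGL_comm f h) hx hz
  obtain ⟨q, lyz, syz⟩ := exists_swap (mulGL_comm g h) hy hz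
  rw [comm₃_eq hL hx hy hz sxy sxz syz (stdColat k k'),
    comm₃_eq hL hy hx hz sxy.symm syz sxz (stdColat k k'), triple_swap_left]

theorem comm₃_mul (f f' g h : (LL k')ˣ) :
    comm₃ hL (f * f') g h = comm₃ hL f g h * comm₃ hL f' g h := by
  obtain ⟨x, hx⟩ := exists_isCoc hL (hL.im (mulGL k f))
  obtain ⟨x', hx'⟩ := exists_isCoc hL (hL.im (mulGL k f'))
  obtain ⟨y, hy⟩ := exists_isCoc hL (hL.im (mulGL k g))
  obtain ⟨z, hz⟩ := exists_isCoc hL (hL.im (mulGL k h))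
  obtain ⟨p, lxy, sxy⟩ := exists_swap (mulGL_comm f g) hx hy
  obtain ⟨r, lxz, sxz⟩ := exists_swap (mulGL_comm f h) hx hz
  obtain ⟨p', lxy', sxy'⟩ := exists_swap (mulGL_comm f' g) hx' hy
  obtain ⟨r', lxz', sxz'⟩ := exists_swap (mulGL_comm f' h) hx' hz
  obtain ⟨q, lyz, syz⟩ := exists_swap (mulGL_comm g h) hy hz
  have hxx : IsCoc L (im (mulGL k (f * f')) L) (x.mul (x'.act (mulGL k f))) := by
    rw [mulGL_mul, ← im_mul]
    exact hx.mul (hx'.act _)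
  have s₁ := sxy.mul sxy' (mulGL_comm f g) hx.stable_d
  have s₂ := sxz.mul sxz' (mulGL_comm f h) hx.stable_d
  rw [← mulGL_mul] at s₁ s₂
  rw [comm₃_eq hL hxx hy hz s₁ s₂ syz (stdColat k k'),
    comm₃_eq hL hx hy hz sxy sxz syz (stdColat k k'),
    comm₃_eq hL hx' hy hz sxy' sxz' syz (act (mulGL k f) (stdColat k k')), mulGL_mul,
    triple_mul sxy sxz (mulGL_comm f g) (mulGL_comm f h)]

end LL

/-! ### Products of wedge multiplications along a chain -/

namespace LL

open GradedLine

variable {k k' : Type u} [Field k] [Field k'] [Algebra k k']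

namespace DetTheory

variable {a b : ℤ} (D : DetTheory (S k (k' := k') a) (S k b))

theorem iso_matrix {U U' : Lattice₁ (S k (k' := k') a) (S k b)} {n : ℕ} (hle : U.1 ≤ U'.1)
    (hn : Module.finrank k (quot U.1 U'.1) = n) {v v' : Fin n → U'.1} {c c' d : kˣ}
    (e : (D.iso U U' hle).hom.e (tm (vec (D.Δ U)) (decomp hn v)) = c • vec (D.Δ U'))
    (e' : (D.iso U U' hle).hom.e (tm (vec (D.Δ U)) (decomp hn v')) = c' • vec (D.Δ U'))
    (A : Matrix (Fin n) (Fin n) k) (hd : A.det = d)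
    (hA : ∀ i, (v' i : LL k') - ∑ j, A i j • (v j : LL k') ∈ U.1) : c' = d * c := by
  rw [decomp_matrix hn A hA, hd, ← Units.smul_def, tm_smul, e_smul, e, smul_smul] at e'
  exact ((unit_smul_inj (vec_ne_zero _)).1 e').symm

variable [FiniteDimensional k k']

/-- The successive multiplications by `v 0, …, v (n - 1)` along a chain of lattices amount to
the multiplication by `v 0 ∧ … ∧ v (n - 1)`. -/
theorem exists_prod_coef {W : ℕ → Lattice₁ (S k (k' := k') a) (S k b)} {v : ℕ → LL k'} {n : ℕ}
    (h : ∀ i < n, v i ∉ (W i).1 ∧ (W (i + 1)).1 = (W i).1 ⊔ Submodule.span k {v i}) :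
    ∃ (hle : (W 0).1 ≤ (W n).1) (hn : Module.finrank k (quot (W 0).1 (W n).1) = n)
      (hm : ∀ i : Fin n, v i ∈ (W n).1),
      (D.iso (W 0) (W n) hle).hom.e (tm (vec (D.Δ (W 0))) (decomp hn fun i => ⟨v i, hm i⟩)) =
        (∏ i ∈ Finset.range n, D.coef (W i) (W (i + 1)) (v i)) • vec (D.Δ (W n)) := by
  induction n with
  | zero =>
    have h0 : Module.finrank k (quot (W 0).1 (W 0).1) = 0 := by
      rw [show quot (W 0).1 (W 0).1 = ⊥ from Submodule.mkQ_map_self _, finrank_bot]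
    refine ⟨le_rfl, h0, fun i => i.elim0, ?_⟩
    rw [Finset.prod_range_zero, one_smul]
    refine Eq.trans ?_ (D.wedge_self (W 0) 0 (vec (D.Δ (W 0))))
    rw [D.wedge_apply_of_finrank _ _ _ h0]
    congr 3
    exact Subsingleton.elim _ _
  | succ n ih =>
    obtain ⟨hle, hn, hm, e⟩ := ih fun i hi => h i (hi.trans n.lt_succ_self)
    obtain ⟨hv, hW⟩ := h n n.lt_succ_self
    have hle' : (W n).1 ≤ (W (n + 1)).1 := hW ▸ le_sup_left
    have hv' : v n ∈ (W (n + 1)).1 :=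
      hW ▸ Submodule.mem_sup_right (Submodule.mem_span_singleton_self _)
    have h1 := finrank_quot_eq_one hv hW
    have : Module.Finite k (quot (W 0).1 (W (n + 1)).1) := finite_lattice _ _
    have hn' : Module.finrank k (quot (W 0).1 (W (n + 1)).1) = n + 1 := by
      rw [finrank_quot_add hle hle', hn, h1]
    have hm' : ∀ i : Fin (n + 1), v i ∈ (W (n + 1)).1 := fun i => by
      rcases Nat.lt_succ_iff_lt_or_eq.1 i.2 with hi | hi
      · exact hle' (hm ⟨i, hi⟩)
      · rw [hi]
        exact hv'
    refine ⟨hle.trans hle', hn', hm', ?_⟩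
    have hc := D.cocycle (W 0) (W n) (W (n + 1)) hle hle' hn h1 hn' (fun i => ⟨v i, hm i⟩)
      (fun _ => ⟨v n, hv'⟩) (vec (D.Δ (W 0)))
    have ha : (Fin.append (fun i : Fin n => Submodule.inclusion hle' ⟨v i, hm i⟩)
        fun _ : Fin 1 => (⟨v n, hv'⟩ : (W (n + 1)).1)) = fun i => ⟨v i, hm' i⟩ := by
      funext i
      induction i using Fin.addCases with
      | left i => rw [Fin.append_left]; rfl
      | right i =>
        rw [Fin.append_right]
        ext1
        change v n = v (n + i)
        rw [Fin.val_eq_zero i, add_zero]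
    rw [ha, e, ← D.wedge_apply_of_finrank hle' _ _ h1, wedge_smul, D.wedge_vec hle' hv' hv hW,
      smul_smul] at hc
    rw [← hc, Finset.prod_range_succ]

/-- Two chains of lattices with the same ends are compared by the determinant of the matrix
relating the vectors. -/
theorem prod_coef_eq {W W' : ℕ → Lattice₁ (S k (k' := k') a) (S k b)} {v v' : ℕ → LL k'} {n : ℕ}
    (h : ∀ i < n, v i ∉ (W i).1 ∧ (W (i + 1)).1 = (W i).1 ⊔ Submodule.span k {v i})
    (h' : ∀ i < n, v' i ∉ (W' i).1 ∧ (W' (i + 1)).1 = (W' i).1 ⊔ Submodule.span k {v' i})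
    (h₀ : W 0 = W' 0) (h₁ : W n = W' n) (A : Matrix (Fin n) (Fin n) k) {d : kˣ} (hd : A.det = d)
    (hA : ∀ i : Fin n, v' i - ∑ j, A i j • v j ∈ (W 0).1) :
    ∏ i ∈ Finset.range n, D.coef (W' i) (W' (i + 1)) (v' i) =
      d * ∏ i ∈ Finset.range n, D.coef (W i) (W (i + 1)) (v i) := by
  obtain ⟨hle, hn, hm, e⟩ := D.exists_prod_coef h
  have key : ∀ (U U' : Lattice₁ (S k (k' := k') a) (S k b)) (c' : kˣ), U = W 0 → U' = W n →
      (∃ (hle : U.1 ≤ U'.1) (hn : Module.finrank k (quot U.1 U'.1) = n)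
        (hm : ∀ i : Fin n, v' i ∈ U'.1), (D.iso U U' hle).hom.e
          (tm (vec (D.Δ U)) (decomp hn fun i => ⟨v' i, hm i⟩)) = c' • vec (D.Δ U')) →
      c' = d * ∏ i ∈ Finset.range n, D.coef (W i) (W (i + 1)) (v i) := by
    rintro _ _ c' rfl rfl ⟨hle', hn', hm', e'⟩
    exact D.iso_matrix hle hn e e' A hd hA
  exact key _ _ _ h₀.symm h₁.symm (D.exists_prod_coef h')

end DetTheory

end LL

/-! ### Units and windows in `k'((t))` -/

theorem HahnSeries.coeff_mul_of_vanish {R : Type*} [CommRing R] {x y : HahnSeries ℤ R} {a b : ℤ}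
    (hx : ∀ i < a, x.coeff i = 0) (hy : ∀ i < b, y.coeff i = 0) :
    (x * y).coeff (a + b) = x.coeff a * y.coeff b := by
  rw [HahnSeries.coeff_mul, Finset.sum_eq_single (a, b)]
  · rintro ⟨i, j⟩ hp hne
    obtain ⟨-, -, h⟩ := Finset.mem_antidiagonal.1 hp
    change i + j = a + b at h
    by_cases h1 : i < a
    · exact (congrArg (· * _) (hx i h1)).trans (zero_mul _)
    · have : j < b := by
        by_contra h2
        exact hne (Prod.ext (by change i = a; omega) (by change j = b; omega))
      exact (congrArg (_ * ·) (hy j this)).trans (mul_zero _)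
  · intro h
    by_contra h'
    refine h (Finset.mem_antidiagonal.2 ⟨left_ne_zero_of_mul h', right_ne_zero_of_mul h', rfl⟩)

theorem HahnSeries.mul_vanish_iff {R : Type*} [CommRing R] [IsDomain R] {x y : HahnSeries ℤ R}
    (hx : x ≠ 0) {n : ℤ} :
    (∀ i < x.order + n, (x * y).coeff i = 0) ↔ ∀ i < n, y.coeff i = 0 := by
  refine ⟨fun h i hi => ?_, fun h => LL.mul_vanish
    (fun i hi => HahnSeries.coeff_eq_zero_of_lt_order hi) h⟩
  by_contra hy
  have hy0 : y ≠ 0 := fun h => hy (by rw [h]; rfl)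
  have := HahnSeries.order_le_of_coeff_ne_zero hy
  have h' := h (x.order + y.order) (by omega)
  rw [HahnSeries.coeff_mul_order_add_order] at h'
  exact mul_ne_zero (HahnSeries.leadingCoeff_ne_zero.2 hx) (HahnSeries.leadingCoeff_ne_zero.2 hy0) h'

namespace LL

open GradedLine

variable {k k' : Type u} [Field k] [Field k'] [Algebra k k']

theorem mem_S_order (f : LL k') : f ∈ S k f.order := fun _ hi => HahnSeries.coeff_eq_zero_of_lt_order hi

theorem mulGL_symm_apply (f : (LL k')ˣ) (x : LL k') :
    (mulGL k f : LL k' ≃ₗ[k] LL k').symm x = ((f⁻¹ : (LL k')ˣ) : LL k') * x := rfl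

theorem im_mulGL_S (f : (LL k')ˣ) (n : ℤ) :
    im (mulGL k f) (S k n) = S k ((f : LL k').order + n) := by
  ext x
  have e : (f : LL k') * ((f⁻¹ : (LL k')ˣ) * x) = x := f.mul_inv_cancel_left x
  rw [mem_im, mulGL_symm_apply]
  refine (HahnSeries.mul_vanish_iff f.ne_zero).symm.trans ?_
  rw [e]
  rfl

theorem coeff_zero_ne_zero {u : (LL k')ˣ} (hu : (u : LL k').order = 0) : (u : LL k').coeff 0 ≠ 0 := by
  rw [← hu, ← HahnSeries.leadingCoeff_eq]
  exact HahnSeries.leadingCoeff_ne_zero.2 u.ne_zero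

theorem residue_ne_zero {u : (LL k')ˣ} (hu : (u : LL k').order = 0)
    (hu' : ((u : LL k').coeff 0).order = 0) : ((u : LL k').coeff 0).coeff 0 ≠ 0 := by
  have := HahnSeries.leadingCoeff_ne_zero.2 (coeff_zero_ne_zero hu)
  rwa [HahnSeries.leadingCoeff_eq, hu'] at this

theorem coeff_zero_mul {x y : LL k'} (hx : x ∈ S k 0) (hy : y ∈ S k 0) :
    (x * y).coeff 0 = x.coeff 0 * y.coeff 0 := by
  have := HahnSeries.coeff_mul_of_vanish hx hy
  rwa [add_zero] at this

theorem mem_S_zero {u : (LL k')ˣ} (hu : (u : LL k').order = 0) : (u : LL k') ∈ S k 0 :=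
  hu ▸ mem_S_order _

theorem mul_mem_S_zero {u : (LL k')ˣ} (hu : (u : LL k').order = 0) {x : LL k'} :
    (u : LL k') * x ∈ S k 0 ↔ x ∈ S k 0 := by
  have := HahnSeries.mul_vanish_iff (y := x) (n := 0) u.ne_zero
  rwa [hu, add_zero] at this

theorem mem_win_act {u : (LL k')ˣ} (hu : (u : LL k').order = 0) {M : Colat k k'} {x : LL k'} :
    x ∈ (act (mulGL k u) M).1 ⊓ S k 0 ⊔ S k 1 ↔ (u : LL k') * x ∈ M.1 ⊓ S k 0 ⊔ S k 1 := by
  change x ∈ M.1.comap _ ⊓ S k 0 ⊔ S k 1 ↔ _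
  rw [comap_inf_sup, im_mulGL_S, im_mulGL_S, hu, zero_add, zero_add, mem_im]
  rfl

theorem mem_win_stdColat {x : LL k'} : x ∈ (stdColat k k').1 ⊓ S k 0 ⊔ S k 1 ↔
    x ∈ S k 0 ∧ ∀ j < 0, (x.coeff 0).coeff j = 0 := by
  constructor
  · intro h
    obtain ⟨y, hy, z, hz, rfl⟩ := Submodule.mem_sup.1 h
    refine ⟨add_mem hy.2 (S_anti zero_le_one hz), fun j hj => ?_⟩
    rw [HahnSeries.coeff_add, hz 0 one_pos, add_zero]
    exact mem_stdColat.1 hy.1 0 j hj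
  · rintro ⟨h, h'⟩
    rw [← add_sub_cancel (trunc (k := k) 0 1 x) x]
    refine Submodule.add_mem_sup ⟨mem_stdColat.2 fun i j hj => ?_, trunc_mem_S _ _ _⟩
      (sub_trunc_mem h)
    rw [trunc_coeff]
    split_ifs with hi
    · obtain rfl : i = 0 := by omega
      exact h' j hj
    · rfl

/-- The window of `u⁻¹ k'[[t]]((s))` in `k'((t))[[s]] / s` is a fractional ideal of `k'[[t]]`. -/
theorem mem_win_unit {u : (LL k')ˣ} (hu : (u : LL k').order = 0) {x : LL k'} :
    x ∈ (act (mulGL k u) (stdColat k k')).1 ⊓ S k 0 ⊔ S k 1 ↔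
      x ∈ S k 0 ∧ ∀ j < -((u : LL k').coeff 0).order, (x.coeff 0).coeff j = 0 := by
  rw [mem_win_act hu, mem_win_stdColat, mul_mem_S_zero hu]
  refine and_congr_right fun hx => ?_
  rw [coeff_zero_mul (mem_S_zero hu) hx]
  have := HahnSeries.mul_vanish_iff (y := x.coeff 0) (n := -((u : LL k').coeff 0).order)
    (coeff_zero_ne_zero hu)
  rwa [add_neg_cancel] at this

/-- A unit of `k'[[t]] + s k'((t))[[s]]` preserves the window of the standard colattice. -/
theorem agree_act_stdColat {u : (LL k')ˣ} (hu : (u : LL k').order = 0)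
    (hu' : ((u : LL k').coeff 0).order = 0) :
    Agree 0 1 (act (mulGL k u) (stdColat k k')) (stdColat k k') := by
  ext x
  rw [mem_win_unit hu, mem_win_stdColat, hu', neg_zero]

/-- The subspace of all `x` in `k'((t))[[s]]` such that `x mod s` lies in `F t ^ (-1) + k'[[t]]`. -/
def poleSpace (F : Submodule k k') : Submodule k (LL k') where
  carrier := {x | x ∈ S k 0 ∧ (∀ j < -1, (x.coeff 0).coeff j = 0) ∧ (x.coeff 0).coeff (-1) ∈ F}
  add_mem' hx hy := ⟨add_mem hx.1 hy.1, fun j hj => by simp [hx.2.1 j hj, hy.2.1 j hj],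
    by simpa using add_mem hx.2.2 hy.2.2⟩
  zero_mem' := ⟨zero_mem _, fun _ _ => rfl, zero_mem _⟩
  smul_mem' c x hx := ⟨Submodule.smul_mem _ c hx.1, fun j hj => by simp [hx.2.1 j hj],
    by simpa using F.smul_mem c hx.2.2⟩

theorem mem_poleSpace {F : Submodule k k'} {x : LL k'} : x ∈ poleSpace F ↔
    x ∈ S k 0 ∧ (∀ j < -1, (x.coeff 0).coeff j = 0) ∧ (x.coeff 0).coeff (-1) ∈ F := Iff.rfl

theorem mem_poleSpace_bot {x : LL k'} : x ∈ poleSpace (⊥ : Submodule k k') ↔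
    x ∈ S k 0 ∧ ∀ j < 0, (x.coeff 0).coeff j = 0 := by
  rw [mem_poleSpace, Submodule.mem_bot]
  refine and_congr_right fun _ => ⟨fun h j hj => ?_, fun h =>
    ⟨fun j hj => h j (by omega), h _ (by omega)⟩⟩
  rcases eq_or_ne j (-1) with rfl | hj'
  · exact h.2
  · exact h.1 j (by omega)

theorem mul_mem_poleSpace {w : (LL k')ˣ} (hw : (w : LL k').order = 0)
    (hw' : ((w : LL k').coeff 0).order = 0) {F : Submodule k k'} {x : LL k'} :
    (w : LL k') * x ∈ poleSpace F ↔ x ∈ S k 0 ∧ (∀ j < -1, (x.coeff 0).coeff j = 0) ∧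
      ((w : LL k').coeff 0).coeff 0 * (x.coeff 0).coeff (-1) ∈ F := by
  rw [mem_poleSpace, mul_mem_S_zero hw]
  refine and_congr_right fun hx => ?_
  rw [coeff_zero_mul (mem_S_zero hw) hx]
  have h1 := HahnSeries.mul_vanish_iff (y := x.coeff 0) (n := -1) (coeff_zero_ne_zero hw)
  rw [hw', zero_add] at h1
  rw [h1]
  refine and_congr_right fun h2 => ?_
  have h3 := HahnSeries.coeff_mul_of_vanish (x := (w : LL k').coeff 0) (a := 0)
    (fun i hi => HahnSeries.coeff_eq_zero_of_lt_order (hw'.symm ▸ hi)) h2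
  rw [zero_add] at h3
  rw [h3]

theorem single_single_coeff (b : k') (i j n : ℤ) :
    ((HahnSeries.single (0 : ℤ) (HahnSeries.single n b) : LL k').coeff i).coeff j =
      if i = 0 ∧ j = n then b else 0 := by
  by_cases hi : i = 0
  · subst hi
    rw [HahnSeries.coeff_single_same, HahnSeries.coeff_single]
    simp
  · rw [HahnSeries.coeff_single_of_ne hi, if_neg fun h => hi h.1]
    rfl

/-- The vectors `b t ^ (-1)`. -/
def pole : k' →ₗ[k] LL k' where
  toFun b := HahnSeries.single 0 (HahnSeries.single (-1) b)
  map_add' b c := by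
    ext i j
    rw [HahnSeries.coeff_add, HahnSeries.coeff_add, single_single_coeff, single_single_coeff,
      single_single_coeff]
    split_ifs <;> simp
  map_smul' r b := by
    ext i j
    rw [RingHom.id_apply, HahnSeries.coeff_smul, HahnSeries.coeff_smul, single_single_coeff,
      single_single_coeff]
    split_ifs <;> simp

theorem pole_coeff (b : k') (i j : ℤ) :
    ((pole (k := k) b).coeff i).coeff j = if i = 0 ∧ j = -1 then b else 0 :=
  single_single_coeff b i j (-1)

theorem pole_mem_S (b : k') : pole (k := k) b ∈ S k 0 := fun i hi => by
  ext j
  rw [pole_coeff, if_neg (by omega)]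
  rfl

theorem trunc_pole (b : k') : trunc (k := k) 0 1 (pole (k := k) b) = pole (k := k) b := by
  ext i j
  rw [trunc_coeff]
  split_ifs with h
  · rfl
  · rw [pole_coeff, if_neg (by omega)]
    rfl

theorem pole_mem_iff {F : Submodule k k'} {b : k'} : pole (k := k) b ∈ poleSpace F ↔ b ∈ F := by
  rw [mem_poleSpace, pole_coeff, if_pos ⟨rfl, rfl⟩]
  exact ⟨fun h => h.2.2, fun h => ⟨pole_mem_S b, fun j hj => by rw [pole_coeff, if_neg (by omega)], h⟩⟩

/-- Modulo `k'[[t]] + s k'((t))[[s]]`, a unit of this ring acts on `k' t ^ (-1)` through its residue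
in `k'`. -/
theorem mul_pole_sub_mem {w : (LL k')ˣ} (hw : (w : LL k').order = 0)
    (hw' : ((w : LL k').coeff 0).order = 0) (b : k') :
    (w : LL k') * pole (k := k) b - pole (k := k) (((w : LL k').coeff 0).coeff 0 * b) ∈
      poleSpace (⊥ : Submodule k k') := by
  have h1 : ∀ j < -1, ((pole (k := k) b).coeff 0).coeff j = 0 := fun j hj => by
    rw [pole_coeff, if_neg (by omega)]
  have h3 := HahnSeries.coeff_mul_of_vanish (x := (w : LL k').coeff 0) (a := 0)
    (fun i hi => HahnSeries.coeff_eq_zero_of_lt_order (hw'.symm ▸ hi)) h1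
  have h4 := mul_vanish (x := (w : LL k').coeff 0) (a := 0)
    (fun i hi => HahnSeries.coeff_eq_zero_of_lt_order (hw'.symm ▸ hi)) h1
  rw [zero_add] at h3 h4
  refine mem_poleSpace_bot.2 ⟨sub_mem ((mul_mem_S_zero hw).2 (pole_mem_S b)) (pole_mem_S _),
    fun j hj => ?_⟩
  rw [HahnSeries.coeff_sub, HahnSeries.coeff_sub, coeff_zero_mul (mem_S_zero hw) (pole_mem_S b),
    pole_coeff]
  rcases eq_or_ne j (-1) with rfl | hj'
  · rw [h3, pole_coeff, if_pos ⟨rfl, rfl⟩, if_pos ⟨rfl, rfl⟩, sub_self]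
  · rw [h4 j (by omega), if_neg (by omega), sub_zero]

theorem poleSpace_mono {F F' : Submodule k k'} (h : F ≤ F') : poleSpace F ≤ poleSpace F' :=
  fun _ hx => ⟨hx.1, hx.2.1, h hx.2.2⟩

theorem poleSpace_sup_span (F : Submodule k k') (b : k') :
    poleSpace (F ⊔ Submodule.span k {b}) =
      poleSpace F ⊔ Submodule.span k {pole (k := k) b} := by
  refine le_antisymm (fun x hx => ?_) (sup_le (poleSpace_mono le_sup_left)
    ((Submodule.span_singleton_le_iff_mem _ _).2 (pole_mem_iff.2
      (Submodule.mem_sup_right (Submodule.mem_span_singleton_self b)))))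
  obtain ⟨y, hy, z, hz, hyz⟩ := Submodule.mem_sup.1 hx.2.2
  obtain ⟨α, rfl⟩ := Submodule.mem_span_singleton.1 hz
  rw [← sub_add_cancel x (α • pole (k := k) b)]
  refine Submodule.add_mem_sup ⟨sub_mem hx.1 (Submodule.smul_mem _ α (pole_mem_S b)), fun j hj => ?_, ?_⟩
    (Submodule.smul_mem _ α (Submodule.mem_span_singleton_self _))
  · rw [HahnSeries.coeff_sub, HahnSeries.coeff_sub, hx.2.1 j hj, ← map_smul, pole_coeff,
      if_neg (by omega), sub_zero]
  · rw [HahnSeries.coeff_sub, HahnSeries.coeff_sub, ← map_smul, pole_coeff, if_pos ⟨rfl, rfl⟩, ← hyz,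
      add_sub_cancel_right]
    exact hy

variable (k') in
/-- The element `s` of `k'((t))((s))`. -/
def s₀ : (LL k')ˣ := Units.mk0 (HahnSeries.single 1 1) (HahnSeries.single_ne_zero one_ne_zero)

variable (k') in
/-- The element `t` of `k'((t))((s))`. -/
def t₀ : (LL k')ˣ := Units.mk0 (HahnSeries.single 0 (HahnSeries.single 1 1))
  (HahnSeries.single_ne_zero (HahnSeries.single_ne_zero one_ne_zero))

theorem order_s₀ : (s₀ k' : LL k').order = 1 := HahnSeries.order_single one_ne_zero

theorem order_t₀ : (t₀ k' : LL k').order = 0 :=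
  HahnSeries.order_single (HahnSeries.single_ne_zero one_ne_zero)

theorem coeff_t₀ : (t₀ k' : LL k').coeff 0 = HahnSeries.single 1 1 := HahnSeries.coeff_single_same _ _

theorem mem_win_t₀ {x : LL k'} :
    x ∈ (act (mulGL k (t₀ k')) (stdColat k k')).1 ⊓ S k 0 ⊔ S k 1 ↔
      x ∈ poleSpace (⊤ : Submodule k k') := by
  rw [mem_win_unit order_t₀, coeff_t₀, HahnSeries.order_single one_ne_zero, mem_poleSpace]
  exact and_congr_right fun _ => ⟨fun h => ⟨h, trivial⟩, fun h => h.1⟩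

theorem mem_win_stdColat' {x : LL k'} :
    x ∈ (stdColat k k').1 ⊓ S k 0 ⊔ S k 1 ↔ x ∈ poleSpace (⊥ : Submodule k k') := by
  rw [mem_win_stdColat, mem_poleSpace_bot]

/-- `poleSpace F` as a lattice of `k'((t))[[s]] / s`. -/
def poleLattice (F : Submodule k k') : Lattice₁ (S k (k' := k') 0) (S k 1) :=
  ⟨poleSpace F, (winS zero_le_one (stdColat k k')).2.between
    (winS zero_le_one (act (mulGL k (t₀ k')) (stdColat k k'))).2
    (fun _ hx => poleSpace_mono bot_le (mem_win_stdColat'.1 hx))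
    fun _ hx => mem_win_t₀.2 (poleSpace_mono le_top hx)⟩

theorem winS_stdColat : winS zero_le_one (stdColat k k') = poleLattice ⊥ :=
  Subtype.ext (Submodule.ext fun _ => mem_win_stdColat')

theorem winS_t₀ : winS zero_le_one (act (mulGL k (t₀ k')) (stdColat k k')) = poleLattice ⊤ :=
  Subtype.ext (Submodule.ext fun _ => mem_win_t₀)

/-- `poleSpace F` as a colattice. -/
def poleColat (F : Submodule k k') : Colat k k' := lift (poleLattice F)

theorem mem_win_poleColat {F : Submodule k k'} {x : LL k'} :
    x ∈ (poleColat F).1 ⊓ S k 0 ⊔ S k 1 ↔ x ∈ poleSpace F :=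
  iff_of_eq (congrArg (x ∈ ·) (lift_inf_sup (poleLattice F)))

theorem agree_poleColat_bot : Agree 0 1 (poleColat (⊥ : Submodule k k')) (stdColat k k') := by
  ext x
  rw [mem_win_poleColat, mem_win_stdColat']

theorem agree_poleColat_top :
    Agree 0 1 (poleColat (⊤ : Submodule k k')) (act (mulGL k (t₀ k')) (stdColat k k')) := by
  ext x
  rw [mem_win_poleColat, mem_win_t₀]

theorem isStep_poleColat {F F' : Submodule k k'} {b : k'} (hb : b ∉ F)
    (h : F' = F ⊔ Submodule.span k {b}) :
    IsStep (poleColat F) (poleColat F') (pole (k := k) b) := by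
  have := lift_step (U := poleLattice F) (U' := poleLattice F') (v := pole (k := k) b)
    (fun h => hb (pole_mem_iff.1 h)) (h ▸ poleSpace_sup_span F b)
  rwa [trunc_pole] at this

theorem agree_act_poleColat_bot {w : (LL k')ˣ} (hw : (w : LL k').order = 0)
    (hw' : ((w : LL k').coeff 0).order = 0) :
    Agree 0 1 (act (mulGL k w) (poleColat ⊥)) (poleColat (⊥ : Submodule k k')) := by
  ext x
  rw [mem_win_act hw, mem_win_poleColat, mem_win_poleColat, mul_mem_poleSpace hw hw',
    mem_poleSpace, Submodule.mem_bot, Submodule.mem_bot,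
    mul_eq_zero_iff_left (residue_ne_zero hw hw')]

theorem agree_act_poleColat_top {w : (LL k')ˣ} (hw : (w : LL k').order = 0)
    (hw' : ((w : LL k').coeff 0).order = 0) :
    Agree 0 1 (act (mulGL k w) (poleColat ⊤)) (poleColat (⊤ : Submodule k k')) := by
  ext x
  rw [mem_win_act hw, mem_win_poleColat, mem_win_poleColat, mul_mem_poleSpace hw hw']
  rfl

end LL

/-! ### The triple commutator on generators -/

namespace LL

open GradedLine

variable {k k' : Type u} [Field k] [Field k'] [Algebra k k']

/-- The span of the first `i` vectors of a basis of `k'` over `k`. -/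
def flag {d : ℕ} (b : Module.Basis (Fin d) k k') (i : ℕ) : Submodule k k' :=
  Submodule.span k (b '' {j | j.val < i})

theorem flag_zero {d : ℕ} (b : Module.Basis (Fin d) k k') : flag b 0 = ⊥ := by
  simp [flag]

theorem flag_top {d : ℕ} (b : Module.Basis (Fin d) k k') : flag b d = ⊤ := by
  rw [flag, show {j : Fin d | j.val < d} = Set.univ from Set.eq_univ_of_forall fun j => j.2,
    Set.image_univ, b.span_eq]

theorem flag_succ {d : ℕ} (b : Module.Basis (Fin d) k k') (i : Fin d) :
    flag b (i + 1) = flag b i ⊔ Submodule.span k {b i} := by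
  rw [flag, flag, ← Submodule.span_union, ← Set.image_singleton, ← Set.image_union]
  congr 2
  ext j
  simp only [Set.mem_ofPred_eq, Set.mem_union, Set.mem_singleton_iff, Fin.ext_iff]
  omega

theorem notMem_flag {d : ℕ} (b : Module.Basis (Fin d) k k') (i : Fin d) : b i ∉ flag b i :=
  b.linearIndependent.notMem_span_image (by simp)

theorem IsStep.winS_succ {M M' : Colat k k'} {v : LL k'} (h : IsStep M M' v) (hv : v ∈ S k 0)
    (hN : v ∉ M.1 ⊔ S k 1) : v ∉ (winS zero_le_one M).1 ∧
      (winS zero_le_one M').1 = (winS zero_le_one M).1 ⊔ Submodule.span k {v} := by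
  have h₀ : v - v ∈ M.1 := by rw [sub_self]; exact zero_mem _
  exact ⟨IsStep.notMem_win (S_anti zero_le_one) hv h₀ hN,
    h.win_eq (S_anti zero_le_one) hv h₀ hN⟩

/-- The matrix of the multiplication by `w` on the vectors `b t ^ (-1)`. -/
theorem pole_sub_sum_mem {w : (LL k')ˣ} (hw : (w : LL k').order = 0)
    (hw' : ((w : LL k').coeff 0).order = 0) {d : ℕ} (b : Module.Basis (Fin d) k k') (i : Fin d) :
    pole (k := k) (b i) -
      ∑ j, (Algebra.leftMulMatrix b (((w : LL k').coeff 0).coeff 0)).transpose i j •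
        (mulGL k w : LL k' ≃ₗ[k] LL k').symm (pole (k := k) (b j)) ∈
      (act (mulGL k w) (poleColat (⊥ : Submodule k k'))).1 ⊓ S k 0 ⊔ S k 1 := by
  rw [mem_win_act hw, mem_win_poleColat]
  have e : ((w : LL k').coeff 0).coeff 0 * b i =
      ∑ j, (Algebra.leftMulMatrix b (((w : LL k').coeff 0).coeff 0)).transpose i j • b j := by
    simp only [Matrix.transpose_apply, Algebra.leftMulMatrix_eq_repr_mul, b.sum_repr]
  have h := mul_pole_sub_mem (k := k) hw hw' (b i)
  rw [e, map_sum] at h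
  change (mulGL k w : LL k' ≃ₗ[k] LL k') (_ - _) ∈ _
  rw [map_sub, map_sum]
  refine (congrArg (· ∈ poleSpace (⊥ : Submodule k k')) (congrArg (_ - ·)
    (Finset.sum_congr rfl fun j _ => ?_))).mp h
  rw [map_smul, map_smul, LinearEquiv.apply_symm_apply]

/-- The product of the relations between the structure constants of a cochain and those of its
transport along a chain of steps. -/
theorem prod_step_eq {y : Cochain k k'} {g : TateGL k k'} {l : Colat k k' → kˣ}
    (hd : ∀ M, y.d (act g M) = y.d M)
    (hs : ∀ {M M' : Colat k k'} {v : LL k'}, IsStep M M' v →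
      l M' * y.inv.c M M' v = l M * (y.inv.act g).c M M' v)
    {M : ℕ → Colat k k'} {v : ℕ → LL k'} {n : ℕ} (h : ∀ i < n, IsStep (M i) (M (i + 1)) (v i)) :
    l (M n) * ∏ i ∈ Finset.range n, (y.act g).c (M i) (M (i + 1)) (v i) =
      l (M 0) * ∏ i ∈ Finset.range n, y.c (M i) (M (i + 1)) (v i) := by
  induction n with
  | zero => rfl
  | succ n ih =>
    have h₁ := hs (h n n.lt_succ_self)
    change l (M (n + 1)) * ((y.c (M n) (M (n + 1)) (v n))⁻¹ *
      sgn k ((y.d (M (n + 1)) - y.d (M n)) * y.d (M n))) =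
        l (M n) * (((y.act g).c (M n) (M (n + 1)) (v n))⁻¹ *
          sgn k ((y.d (act g (M (n + 1))) - y.d (act g (M n))) * y.d (act g (M n)))) at h₁
    rw [hd, hd, ← mul_assoc, ← mul_assoc] at h₁
    have h₂ := mul_right_cancel h₁
    rw [mul_inv_eq_iff_eq_mul, mul_assoc, mul_comm _ (y.c _ _ _), ← mul_assoc,
      eq_mul_inv_iff_mul_eq] at h₂
    rw [Finset.prod_range_succ, Finset.prod_range_succ, ← mul_assoc (l (M 0)),
      ← ih fun i hi => h i (hi.trans n.lt_succ_self), mul_right_comm (l (M n)), ← h₂]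
    ac_rfl

variable [FiniteDimensional k k']

/-- The scalars comparing a relative determinant of `k'((t))[[s]]` and `s k'((t))[[s]]` with its
transport by a unit of `k'[[t]] + s k'((t))[[s]]` are given by the norm of the residue of the
unit: they are multiplied by the determinant of the multiplication by this residue on
`k' t ^ (-1)`. -/
theorem norm_eq_of_transport (D : DetTheory (S k (k' := k') 0) (S k 1)) {y : Cochain k k'}
    (hy : y = D.cochain (isLattice_S 0) (isLattice_S 1) (S_anti zero_le_one))
    {w : (LL k')ˣ} (hw : (w : LL k').order = 0) (hw' : ((w : LL k').coeff 0).order = 0)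
    {l : Colat k k' → kˣ} (hl : ∀ M M', Agree 0 1 M M' → l M = l M')
    (hd : ∀ M, y.d (act (mulGL k w) M) = y.d M)
    (hs : ∀ {M M' : Colat k k'} {v : LL k'}, IsStep M M' v →
      l M' * y.inv.c M M' v = l M * (y.inv.act (mulGL k w)).c M M' v) {ν : kˣ}
    (hν : (ν : k) = Algebra.norm k (((w : LL k').coeff 0).coeff 0)) :
    l (stdColat k k') * ν = l (act (mulGL k (t₀ k')) (stdColat k k')) := by
  obtain ⟨d, ⟨b⟩⟩ : ∃ d, Nonempty (Module.Basis (Fin d) k k') := ⟨_, ⟨Module.finBasis k k'⟩⟩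
  let M : ℕ → Colat k k' := fun i => poleColat (flag b i)
  let v : ℕ → LL k' := fun i => if h : i < d then pole (k := k) (b ⟨i, h⟩) else 0
  have hv : ∀ i : Fin d, v i = pole (k := k) (b i) := fun i => dif_pos i.2
  have hM₀ : M 0 = poleColat ⊥ := congrArg poleColat (flag_zero b)
  have hM₁ : M d = poleColat ⊤ := congrArg poleColat (flag_top b)
  have hstep : ∀ i < d, IsStep (M i) (M (i + 1)) (v i) := fun i hi => by
    rw [hv ⟨i, hi⟩]
    exact isStep_poleColat (notMem_flag b ⟨i, hi⟩) (flag_succ b ⟨i, hi⟩)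
  have hvS : ∀ i < d, v i ∈ S k 0 := fun i hi => hv ⟨i, hi⟩ ▸ pole_mem_S _
  have hvN : ∀ i < d, v i ∉ (M i).1 ⊔ S k 1 := fun i hi h => by
    rw [← mem_inf_sup_iff (S_anti zero_le_one) (hvS i hi) (by rw [sub_self]; exact zero_mem _),
      mem_win_poleColat, hv ⟨i, hi⟩, pole_mem_iff] at h
    exact notMem_flag b ⟨i, hi⟩ h
  clear_value M
  let v' : ℕ → LL k' := fun i => (mulGL k w : LL k' ≃ₗ[k] LL k').symm (v i)
  have hvS' : ∀ i < d, v' i ∈ S k 0 := fun i hi => by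
    rw [← mul_mem_S_zero hw, show (w : LL k') * v' i = v i from w.mul_inv_cancel_left _]
    exact hvS i hi
  have hvN' : ∀ i < d, v' i ∉ (act (mulGL k w) (M i)).1 ⊔ S k 1 := fun i hi h => by
    have := mem_sup_im.2 h
    rw [im_mulGL_S, hw, zero_add] at this
    exact hvN i hi this
  have hprod := D.prod_coef_eq (W := fun i => winS zero_le_one (act (mulGL k w) (M i))) (v := v')
    (W' := fun i => winS zero_le_one (M i)) (v' := v) (n := d)
    (fun i hi => ((hstep i hi).act _).winS_succ (hvS' i hi) (hvN' i hi))
    (fun i hi => (hstep i hi).winS_succ (hvS i hi) (hvN i hi))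
    ((agree_iff zero_le_one).1 (hM₀ ▸ agree_act_poleColat_bot hw hw'))
    ((agree_iff zero_le_one).1 (hM₁ ▸ agree_act_poleColat_top hw hw'))
    (Algebra.leftMulMatrix b (((w : LL k').coeff 0).coeff 0)).transpose (d := ν)
    (by rw [Matrix.det_transpose, ← Algebra.norm_eq_matrix_det, hν]) (fun i => by
      have h := pole_sub_sum_mem (k := k) hw hw' b i
      rw [← hM₀] at h
      simp only [hv, v']
      exact h)
  have coef : ∀ {M M' : Colat k k'} {v : LL k'}, IsStep M M' v → v ∈ S k 0 →
      y.c M M' v = D.coef (winS zero_le_one M) (winS zero_le_one M') v := fun h h₁ => by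
    rw [hy]
    exact D.cochain_c_eq h h₁ (by rw [sub_self]; exact zero_mem _)
  have h : l (M d) * ∏ i ∈ Finset.range d, D.coef (winS zero_le_one (act (mulGL k w) (M i)))
      (winS zero_le_one (act (mulGL k w) (M (i + 1)))) (v' i) =
      l (M 0) * ∏ i ∈ Finset.range d,
        D.coef (winS zero_le_one (M i)) (winS zero_le_one (M (i + 1))) (v i) := by
    refine (congrArg (l (M d) * ·) (Finset.prod_congr rfl fun i hi => ?_)).trans
      ((prod_step_eq hd hs hstep).trans
        (congrArg (l (M 0) * ·) (Finset.prod_congr rfl fun i hi => ?_)))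
    · exact (coef ((hstep i (Finset.mem_range.1 hi)).act _) (hvS' i (Finset.mem_range.1 hi))).symm
    · exact coef (hstep i (Finset.mem_range.1 hi)) (hvS i (Finset.mem_range.1 hi))
  rw [hprod, ← mul_assoc] at h
  have h := mul_right_cancel h
  rw [hM₀, hM₁, hl _ _ agree_poleColat_bot, hl _ _ agree_poleColat_top] at h
  exact h.symm

end LL

namespace LL

open GradedLine

variable {k k' : Type u} [Field k] [Field k'] [Algebra k k']

section Units

variable {u u' : (LL k')ˣ}

theorem isCoc_const_unit (hu : (u : LL k').order = 0) :
    IsCoc (S k 0) (im (mulGL k u) (S k 0)) (Cochain.const k k' 0) := by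
  rw [im_mulGL_S, hu, zero_add]
  exact .const _ _

theorem swap_const (g h : TateGL k k') :
    Swap g h (Cochain.const k k' 0) (Cochain.const k k' 0) 0 1 :=
  .of_cob (by
    rw [Cochain.act_const, Cochain.act_const]
    exact .refl _)

variable (D : DetTheory (S k (k' := k') 0) (S k 1))

/-- The cochain of the relative determinant of `s k'((t))[[s]]` and `k'((t))[[s]]`, given by a
determinantal theory on their quotient. -/
def windowCochain : Cochain k k' :=
  (D.cochain (isLattice_S 0) (isLattice_S 1) (S_anti zero_le_one)).inv

theorem isCo_windowCochain : IsCo (S k 0) (S k 1) (S k 0) (S k 1) (windowCochain D) :=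
  D.isCo_cochain.inv

theorem isCoc_windowCochain : IsCoc (S k 0) (im (mulGL k (s₀ k')) (S k 0)) (windowCochain D) := by
  rw [im_mulGL_S, order_s₀, add_zero]
  exact ⟨0, 1, zero_le_one, isCo_windowCochain D⟩

variable {D}

/-- An element of `s`-adic valuation `0` preserves `S_0` and `S_1`, so that it transports the cochain of
their relative determinant to an equivalent one. -/
theorem exists_swap_unit [FiniteDimensional k k'] (hu : (u : LL k').order = 0) : ∃ n l,
    (∀ M M', Agree 0 1 M M' → l M = l M') ∧
      Swap (mulGL k (s₀ k')) (mulGL k u) (windowCochain D) (Cochain.const k k' 0) n l := by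
  have h := (isCo_windowCochain D).act (mulGL k u)
  simp only [im_mulGL_S, hu, zero_add] at h
  obtain ⟨n, hn, f, hf, hs⟩ := (isCo_windowCochain D).exists_tw zero_le_one h
  refine ⟨n, fun M => (f M)⁻¹, fun M M' h => congrArg _ (hf M M' h), .of_cob ?_⟩
  rw [Cochain.act_const, Cochain.mul_const_zero, Cochain.const_zero_mul]
  refine ⟨⟨0, 1, fun M M' h => congrArg _ (hf M M' h)⟩, hn, fun h => ?_⟩
  rw [inv_mul_eq_iff_eq_mul, mul_left_comm, hs h, inv_mul_cancel_left]

theorem swap_unit_deg {n : ℤ} {l : Colat k k' → kˣ}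
    (h : Swap (mulGL k (s₀ k')) (mulGL k u) (windowCochain D) (Cochain.const k k' 0) n l) (M : Colat k k') :
    (windowCochain D).d (act (mulGL k u) M) = n + (windowCochain D).d M := by
  have := h.deg M
  change 0 + _ = n + (_ + 0) at this
  omega

theorem swap_deg_eq_zero (hu : (u : LL k').order = 0) (hu' : ((u : LL k').coeff 0).order = 0) {n : ℤ}
    {l : Colat k k' → kˣ}
    (h : Swap (mulGL k (s₀ k')) (mulGL k u) (windowCochain D) (Cochain.const k k' 0) n l) : n = 0 := by
  have h₁ := swap_unit_deg h (stdColat k k')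
  have h₂ := (isCo_windowCochain D).deg (agree_act_stdColat hu hu')
  omega

/-- The lattice `t⁻¹ k'[[t]]` of `k'((t))` has relative dimension `[k' : k]` over `k'[[t]]`. -/
theorem deg_poleLattice [FiniteDimensional k k'] : (D.Δ (poleLattice ⊤)).deg =
    (D.Δ (poleLattice ⊥)).deg + Module.finrank k k' := by
  let b := Module.finBasis k k'
  have key : ∀ n ≤ Module.finrank k k',
      (D.Δ (poleLattice (flag b n))).deg = (D.Δ (poleLattice (flag b 0))).deg + n := by
    intro n
    induction n with
    | zero => intro _; simp
    | succ n ih =>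
      intro hn
      have h₁ : pole (k := k) (b ⟨n, hn⟩) ∉ (poleLattice (flag b n)).1 := fun h =>
        notMem_flag b ⟨n, hn⟩ (pole_mem_iff.1 h)
      have h₂ : (poleLattice (flag b (n + 1))).1 =
          (poleLattice (flag b n)).1 ⊔ Submodule.span k {pole (k := k) (b ⟨n, hn⟩)} :=
        (congrArg poleSpace (flag_succ b ⟨n, hn⟩)).trans (poleSpace_sup_span _ _)
      rw [D.deg_eq (h₂ ▸ le_sup_left), finrank_quot_eq_one h₁ h₂, ih (Nat.le_of_succ_le hn)]
      push_cast
      ring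
  have := key _ le_rfl
  rwa [flag_top, flag_zero] at this

theorem swap_deg_t₀ [FiniteDimensional k k'] {n : ℤ} {l : Colat k k' → kˣ}
    (h : Swap (mulGL k (s₀ k')) (mulGL k (t₀ k')) (windowCochain D) (Cochain.const k k' 0) n l) :
    n = -Module.finrank k k' := by
  have h₁ := swap_unit_deg h (stdColat k k')
  change -(D.Δ (winS zero_le_one _)).deg = n + -(D.Δ (winS zero_le_one _)).deg at h₁
  rw [winS_t₀, winS_stdColat, deg_poleLattice] at h₁
  omega

end Units

variable [FiniteDimensional k k'] {L : Submodule k (LL k')} (hL : IsLattice L)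

theorem exists_detTheory_S : Nonempty (DetTheory (S k (k' := k') 0) (S k 1)) :=
  exists_detTheory (isLattice_S 0) (isLattice_S 1) (S_anti zero_le_one)

theorem comm₃_units {u u' u'' : (LL k')ˣ} (hu : (u : LL k').order = 0) (hu' : (u' : LL k').order = 0)
    (hu'' : (u'' : LL k').order = 0) : comm₃ hL u u' u'' = 1 := by
  rw [comm₃_eq_of_lattice hL (isLattice_S 0) (isCoc_const_unit hu) (isCoc_const_unit hu')
    (isCoc_const_unit hu'') (swap_const _ _) (swap_const _ _) (swap_const _ _) (stdColat k k')]
  simp [triple, Cochain.const, sgn]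

theorem comm₃_s_s_s : comm₃ hL (s₀ k') (s₀ k') (s₀ k') = 1 := by
  obtain ⟨D⟩ := exists_detTheory_S (k := k) (k' := k')
  rw [comm₃_eq_of_lattice hL (isLattice_S 0) (isCoc_windowCochain D) (isCoc_windowCochain D) (isCoc_windowCochain D)
    (.self _ _) (.self _ _) (.self _ _) (stdColat k k'), triple_self]
  simp [sgn]

theorem comm₃_s_s_t : comm₃ hL (s₀ k') (s₀ k') (t₀ k') = sgn k (Module.finrank k k') := by
  obtain ⟨D⟩ := exists_detTheory_S (k := k) (k' := k')
  obtain ⟨n, l, hl, h⟩ := exists_swap_unit (D := D) (order_t₀ (k' := k'))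
  rw [comm₃_eq_of_lattice hL (isLattice_S 0) (isCoc_windowCochain D) (isCoc_windowCochain D) (isCoc_const_unit order_t₀)
    (.self _ _) h h (stdColat k k'), triple_self, swap_deg_t₀ h, sgn_neg]

theorem comm₃_s_t_t : comm₃ hL (s₀ k') (t₀ k') (t₀ k') = sgn k (Module.finrank k k') := by
  obtain ⟨D⟩ := exists_detTheory_S (k := k) (k' := k')
  obtain ⟨n, l, hl, h⟩ := exists_swap_unit (D := D) (order_t₀ (k' := k'))
  have hn := swap_deg_t₀ h
  rw [comm₃_eq_of_lattice hL (isLattice_S 0) (isCoc_windowCochain D) (isCoc_const_unit order_t₀)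
    (isCoc_const_unit order_t₀) h h (swap_const _ _) (stdColat k k'), triple]
  obtain ⟨t, ht⟩ := Int.even_mul_pred_self n
  rw [sgn_congr (b := -n) (n + t) (by simp only [Cochain.const]; linarith), hn, neg_neg]
  simp [mul_assoc]

variable {v w : (LL k')ˣ}

theorem comm₃_s_s_unit (hv : (v : LL k').order = 0) (hv' : ((v : LL k').coeff 0).order = 0) :
    comm₃ hL (s₀ k') (s₀ k') v = 1 := by
  obtain ⟨D⟩ := exists_detTheory_S (k := k) (k' := k')
  obtain ⟨n, l, hl, h⟩ := exists_swap_unit (D := D) hv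
  rw [comm₃_eq_of_lattice hL (isLattice_S 0) (isCoc_windowCochain D) (isCoc_windowCochain D) (isCoc_const_unit hv)
    (.self _ _) h h (stdColat k k'), triple_self, swap_deg_eq_zero hv hv' h]
  simp [sgn]

theorem comm₃_s_unit_unit (hv : (v : LL k').order = 0) (hv' : ((v : LL k').coeff 0).order = 0)
    (hw : (w : LL k').order = 0) (hw' : ((w : LL k').coeff 0).order = 0) :
    comm₃ hL (s₀ k') v w = 1 := by
  obtain ⟨D⟩ := exists_detTheory_S (k := k) (k' := k')
  obtain ⟨n, l, hl, h⟩ := exists_swap_unit (D := D) hv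
  obtain ⟨m, l', hl', h'⟩ := exists_swap_unit (D := D) hw
  obtain rfl := swap_deg_eq_zero hv hv' h
  obtain rfl := swap_deg_eq_zero hw hw' h'
  rw [comm₃_eq_of_lattice hL (isLattice_S 0) (isCoc_windowCochain D) (isCoc_const_unit hv)
    (isCoc_const_unit hw) h h' (swap_const _ _) (stdColat k k'), triple,
    hl _ _ (agree_act_stdColat hw hw'), hl' _ _ (agree_act_stdColat hv hv')]
  simp [sgn]

theorem comm₃_s_t_unit (hw : (w : LL k').order = 0) (hw' : ((w : LL k').coeff 0).order = 0) {ν : kˣ}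
    (hν : (ν : k) = Algebra.norm k (((w : LL k').coeff 0).coeff 0)) :
    comm₃ hL (s₀ k') (t₀ k') w = ν⁻¹ := by
  obtain ⟨D⟩ := exists_detTheory_S (k := k) (k' := k')
  obtain ⟨n, l, hl, h⟩ := exists_swap_unit (D := D) (order_t₀ (k' := k'))
  obtain ⟨m, l', hl', h'⟩ := exists_swap_unit (D := D) hw
  obtain rfl := swap_deg_eq_zero hw hw' h'
  have hd := swap_unit_deg h'
  have key := norm_eq_of_transport D rfl hw hw' hl' (fun M => by
    have := hd M
    rw [zero_add] at this
    exact neg_injective this) (fun {M M' v} hs => by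
    have := h'.step hs
    rw [Cochain.act_const, Cochain.mul_const_zero, Cochain.const_zero_mul] at this
    exact this) hν
  rw [comm₃_eq_of_lattice hL (isLattice_S 0) (isCoc_windowCochain D) (isCoc_const_unit order_t₀)
    (isCoc_const_unit hw) h h' (swap_const _ _) (stdColat k k'), triple,
    hl _ _ (agree_act_stdColat hw hw'), ← key]
  simp [sgn, Cochain.const]

end LL

/-! ### The tame symbol -/

namespace LL

open GradedLine

section Symbol

variable {k' : Type u} [Field k']

theorem leadingCoeff_ne_zero (f : (LL k')ˣ) : (f : LL k').leadingCoeff ≠ 0 :=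
  HahnSeries.leadingCoeff_ne_zero.2 f.ne_zero

/-- The `s`-adic valuation. -/
def ord₁ : (LL k')ˣ →* Multiplicative ℤ :=
  MonoidHom.mk' (fun f => .ofAdd (f : LL k').order) fun f g =>
    congrArg Multiplicative.ofAdd (HahnSeries.order_mul f.ne_zero g.ne_zero)

/-- The `t`-adic valuation of the leading coefficient. -/
def ord₂ : (LL k')ˣ →* Multiplicative ℤ :=
  MonoidHom.mk' (fun f => .ofAdd (f : LL k').leadingCoeff.order) fun f g =>
    congrArg Multiplicative.ofAdd ((congrArg HahnSeries.order (HahnSeries.leadingCoeff_mul _ _)).trans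
      (HahnSeries.order_mul (leadingCoeff_ne_zero f) (leadingCoeff_ne_zero g)))

/-- The leading coefficient of the leading coefficient. -/
def lc : (LL k')ˣ →* k'ˣ :=
  MonoidHom.mk' (fun f => .mk0 (f : LL k').leadingCoeff.leadingCoeff
    (HahnSeries.leadingCoeff_ne_zero.2 (leadingCoeff_ne_zero f))) fun f g => Units.ext (by
    change HahnSeries.leadingCoeff (HahnSeries.leadingCoeff _) = _
    rw [Units.val_mul, HahnSeries.leadingCoeff_mul, HahnSeries.leadingCoeff_mul]
    rfl)

/-- The `s`-adic valuation, as an integer. -/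
def v₁ (f : (LL k')ˣ) : ℤ := (ord₁ f).toAdd

/-- The `t`-adic valuation of the leading coefficient, as an integer. -/
def v₂ (f : (LL k')ˣ) : ℤ := (ord₂ f).toAdd

theorem v₁_mul (f g : (LL k')ˣ) : v₁ (f * g) = v₁ f + v₁ g := by rw [v₁, map_mul]; rfl
theorem v₂_mul (f g : (LL k')ˣ) : v₂ (f * g) = v₂ f + v₂ g := by rw [v₂, map_mul]; rfl
theorem v₁_zpow (f : (LL k')ˣ) (n : ℤ) : v₁ (f ^ n) = n * v₁ f := by
  rw [v₁, map_zpow, toAdd_zpow, smul_eq_mul]; rfl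
theorem v₂_zpow (f : (LL k')ˣ) (n : ℤ) : v₂ (f ^ n) = n * v₂ f := by
  rw [v₂, map_zpow, toAdd_zpow, smul_eq_mul]; rfl
theorem v₁_div (f g : (LL k')ˣ) : v₁ (f / g) = v₁ f - v₁ g := by rw [v₁, map_div]; rfl
theorem v₂_div (f g : (LL k')ˣ) : v₂ (f / g) = v₂ f - v₂ g := by rw [v₂, map_div]; rfl

theorem coeff_zero_eq {f : (LL k')ˣ} (h : v₁ f = 0) :
    (f : LL k').coeff 0 = (f : LL k').leadingCoeff := by
  rw [HahnSeries.leadingCoeff_eq]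
  exact congrArg _ h.symm

theorem v₂_eq {f : (LL k')ˣ} (h : v₁ f = 0) : ((f : LL k').coeff 0).order = v₂ f := by
  rw [coeff_zero_eq h]; rfl

theorem residue_eq {f : (LL k')ˣ} (h : v₁ f = 0) (h' : v₂ f = 0) :
    ((f : LL k').coeff 0).coeff 0 = lc f := by
  rw [coeff_zero_eq h]
  change _ = HahnSeries.leadingCoeff _
  rw [HahnSeries.leadingCoeff_eq (x := HahnSeries.leadingCoeff _)]
  exact congrArg _ h'.symm

theorem nu_eq (f g : (LL k')ˣ) : nu f g = v₂ f * v₁ g - v₁ f * v₂ g := by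
  change HahnSeries.order (HahnSeries.coeff ((f ^ v₁ g / g ^ v₁ f : (LL k')ˣ) : LL k') 0) = _
  rw [v₂_eq (by rw [v₁_div, v₁_zpow, v₁_zpow]; ring), v₂_div, v₂_zpow, v₂_zpow]
  ring

/-- The exponent of the sign of the tame symbol, modulo `2`, as a trilinear form. -/
def tameForm (f g h : (LL k')ˣ) : ℤ :=
  v₁ f * v₂ g * v₂ h + v₁ g * v₂ f * v₂ h + v₁ h * v₂ f * v₂ g +
    v₂ f * v₁ g * v₁ h + v₂ g * v₁ f * v₁ h + v₂ h * v₁ f * v₁ g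

theorem sgn_congr_zmod {k : Type u} [Field k] {a b : ℤ} (h : (a : ZMod 2) = b) :
    sgn k a = sgn k b := by
  obtain ⟨c, hc⟩ := (ZMod.intCast_eq_intCast_iff_dvd_sub b a 2).1 h.symm
  exact sgn_congr c (by push_cast at hc; omega)

theorem tameExponent_eq (f g h : (LL k')ˣ) :
    (tameExponent f g h : ZMod 2) = tameForm f g h := by
  have key : ∀ a a' a'' b b' b'' : ZMod 2,
      (b * a' - a * b') * (b * a'' - a * b'') + (b' * a'' - a' * b'') * (b' * a - a' * b) +
        (b'' * a - a'' * b) * (b'' * a' - a'' * b') +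
        (b * a' - a * b') * (b' * a'' - a' * b'') * (b'' * a - a'' * b) =
      a * b' * b'' + a' * b * b'' + a'' * b * b' + b * a' * a'' + b' * a * a'' + b'' * a * a' := by
    decide
  simp only [tameExponent, tameForm, nu_eq]
  push_cast
  exact key _ _ _ _ _ _

/-- The tame symbol, as a unit. -/
def tameUnit (f g h : (LL k')ˣ) : k'ˣ :=
  sgn k' (tameForm f g h) * (lc f ^ nu g h * lc g ^ nu h f * lc h ^ nu f g)

theorem tameUnit_eq (f g h : (LL k')ˣ) : (tameUnit f g h : k') = tameSymbol f g h := by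
  rw [tameSymbol, residue_eq, tameUnit, ← sgn_congr_zmod (tameExponent_eq f g h), map_mul, map_mul,
    map_zpow, map_zpow, map_zpow, Units.val_mul]
  · simp [sgn]
  · simp only [v₁_mul, v₁_zpow, nu_eq]
    ring
  · simp only [v₂_mul, v₂_zpow, nu_eq]
    ring

theorem nu_swap (f g : (LL k')ˣ) : nu g f = -nu f g := by
  rw [nu_eq, nu_eq]
  ring

theorem tameUnit_swap_left (f g h : (LL k')ˣ) : tameUnit g f h = (tameUnit f g h)⁻¹ := by
  rw [tameUnit, tameUnit, mul_inv, mul_inv, mul_inv, sgn_inv, ← zpow_neg, ← zpow_neg, ← zpow_neg,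
    ← nu_swap, ← nu_swap, ← nu_swap, mul_comm (lc g ^ _)]
  congr 2
  rw [tameForm, tameForm]
  ring

theorem tameUnit_swap_right (f g h : (LL k')ˣ) : tameUnit f h g = (tameUnit f g h)⁻¹ := by
  rw [tameUnit, tameUnit, mul_inv, mul_inv, mul_inv, sgn_inv, ← zpow_neg, ← zpow_neg, ← zpow_neg,
    ← nu_swap, ← nu_swap, ← nu_swap, mul_right_comm (lc f ^ _)]
  congr 2
  rw [tameForm, tameForm]
  ring

theorem tameUnit_mul (f f' g h : (LL k')ˣ) :
    tameUnit (f * f') g h = tameUnit f g h * tameUnit f' g h := by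
  have h₁ : tameForm (f * f') g h = tameForm f g h + tameForm f' g h := by
    simp only [tameForm, v₁_mul, v₂_mul]
    ring
  have h₂ : nu h (f * f') = nu h f + nu h f' := by
    simp only [nu_eq, v₁_mul, v₂_mul]
    ring
  have h₃ : nu (f * f') g = nu f g + nu f' g := by
    simp only [nu_eq, v₁_mul, v₂_mul]
    ring
  rw [tameUnit, tameUnit, tameUnit, h₁, h₂, h₃, sgn_add, map_mul, mul_zpow, zpow_add, zpow_add]
  ac_rfl

theorem v₁_s₀ : v₁ (s₀ k') = 1 := order_s₀
theorem v₂_s₀ : v₂ (s₀ k') = 0 := by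
  change HahnSeries.order (HahnSeries.leadingCoeff (HahnSeries.single 1 1)) = 0
  rw [HahnSeries.leadingCoeff_of_single, HahnSeries.order_one]
theorem lc_s₀ : lc (s₀ k') = 1 := Units.ext (by
  change HahnSeries.leadingCoeff (HahnSeries.leadingCoeff (HahnSeries.single 1 1)) = 1
  rw [HahnSeries.leadingCoeff_of_single, HahnSeries.leadingCoeff_one])
theorem v₁_t₀ : v₁ (t₀ k') = 0 := order_t₀
theorem v₂_t₀ : v₂ (t₀ k') = 1 := by
  rw [← v₂_eq v₁_t₀, coeff_t₀, HahnSeries.order_single one_ne_zero]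
theorem lc_t₀ : lc (t₀ k') = 1 := Units.ext (by
  change HahnSeries.leadingCoeff (HahnSeries.leadingCoeff (HahnSeries.single 0 (HahnSeries.single 1 1)))
    = 1
  rw [HahnSeries.leadingCoeff_of_single, HahnSeries.leadingCoeff_of_single])

/-- The elements `s`, `t` and the units of `k'[[t]] + s k'((t))[[s]]`. -/
def gens (k' : Type u) [Field k'] : Set (LL k')ˣ := {f | f = s₀ k' ∨ f = t₀ k' ∨ v₁ f = 0 ∧ v₂ f = 0}

theorem closure_gens : Subgroup.closure (gens k') = ⊤ := by
  refine eq_top_iff.2 fun f _ => ?_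
  have hs := Subgroup.subset_closure (show s₀ k' ∈ gens k' from .inl rfl)
  have ht := Subgroup.subset_closure (show t₀ k' ∈ gens k' from .inr (.inl rfl))
  have hv := Subgroup.subset_closure (show f / (s₀ k' ^ v₁ f * t₀ k' ^ v₂ f) ∈ gens k' from
    .inr (.inr ⟨by rw [v₁_div, v₁_mul, v₁_zpow, v₁_zpow, v₁_s₀, v₁_t₀]; ring,
      by rw [v₂_div, v₂_mul, v₂_zpow, v₂_zpow, v₂_s₀, v₂_t₀]; ring⟩))
  have := mul_mem hv (mul_mem (zpow_mem hs (v₁ f)) (zpow_mem ht (v₂ f)))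
  rwa [div_mul_cancel] at this

end Symbol

/-- A map in three variables which is multiplicative in each of them and inverted by transpositions is
trivial if it is so on generators. -/
theorem eq_one_of_closure {G K : Type*} [CommGroup G] [CommGroup K] {Γ : Set G}
    (hΓ : Subgroup.closure Γ = ⊤) {R : G → G → G → K}
    (mul : ∀ f f' g h, R (f * f') g h = R f g h * R f' g h)
    (left : ∀ f g h, R g f h = (R f g h)⁻¹) (right : ∀ f g h, R f h g = (R f g h)⁻¹)
    (h₁ : ∀ f ∈ Γ, ∀ g ∈ Γ, ∀ h ∈ Γ, R f g h = 1) (f g h : G) : R f g h = 1 := by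
  have key : ∀ g h, (∀ f ∈ Γ, R f g h = 1) → ∀ f, R f g h = 1 := fun g h H f => by
    have hf : f ∈ Subgroup.closure Γ := hΓ ▸ Subgroup.mem_top f
    let φ : G →* K := MonoidHom.mk' (fun f => R f g h) fun f f' => mul f f' g h
    exact ((Subgroup.closure_le φ.ker).2 H) hf
  have l : ∀ {f g h}, R f g h = 1 → R g f h = 1 := fun e => by rw [left, e, inv_one]
  have r : ∀ {f g h}, R f g h = 1 → R f h g = 1 := fun e => by rw [right, e, inv_one]
  refine key g h (fun f hf => ?_) f
  refine l (key f h (fun g hg => ?_) g)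
  exact r (l (key g f (fun h hh => h₁ h hh g hg f hf) h))

end LL

namespace LL

open GradedLine

variable {k k' : Type u} [Field k] [Field k'] [Algebra k k']

theorem norm_sgn [FiniteDimensional k k'] :
    Units.map (Algebra.norm k : k' →* k) (sgn k' 1) = sgn k (Module.finrank k k') := by
  ext
  have := Algebra.norm_algebraMap (R := k) (S := k') (-1)
  rw [map_neg, map_one] at this
  simpa [sgn] using this

variable [FiniteDimensional k k'] {L : Submodule k (LL k')} (hL : IsLattice L)

/-- The triple commutator agrees with the norm of the tame symbol on the generators. -/
theorem comm₃_eq_on_gens {f g h : (LL k')ˣ} (hf : f ∈ gens k') (hg : g ∈ gens k')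
    (hh : h ∈ gens k') :
    comm₃ hL f g h / Units.map (Algebra.norm k : k' →* k) (tameUnit f g h) = 1 := by
  set R : (LL k')ˣ → (LL k')ˣ → (LL k')ˣ → kˣ := fun f g h =>
    comm₃ hL f g h / Units.map (Algebra.norm k : k' →* k) (tameUnit f g h) with hR
  have l : ∀ {f g h}, R f g h = 1 → R g f h = 1 := fun {f g h} e => by
    simp only [hR] at e ⊢
    rw [comm₃_swap_left, tameUnit_swap_left, map_inv, ← inv_div', e, inv_one]
  have r : ∀ {f g h}, R f g h = 1 → R f h g = 1 := fun {f g h} e => by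
    simp only [hR] at e ⊢
    rw [comm₃_swap_right, tameUnit_swap_right, map_inv, ← inv_div', e, inv_one]
  have uuu : ∀ {u u' u'' : (LL k')ˣ}, v₁ u = 0 → v₁ u' = 0 → v₁ u'' = 0 → R u u' u'' = 1 :=
    fun h h' h'' => by
      simp only [hR]
      rw [comm₃_units hL h h' h'']
      simp [tameUnit, tameForm, nu_eq, h, h', h'', sgn]
  have sss : R (s₀ k') (s₀ k') (s₀ k') = 1 := by
    simp only [hR]
    rw [comm₃_s_s_s]
    simp [tameUnit, tameForm, nu_eq, lc_s₀, v₂_s₀, sgn]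
  have sst : R (s₀ k') (s₀ k') (t₀ k') = 1 := by
    simp only [hR]
    rw [comm₃_s_s_t, ← norm_sgn]
    simp [tameUnit, tameForm, nu_eq, lc_s₀, v₂_s₀, v₁_s₀, lc_t₀, v₁_t₀, v₂_t₀]
  have stt : R (s₀ k') (t₀ k') (t₀ k') = 1 := by
    simp only [hR]
    rw [comm₃_s_t_t, ← norm_sgn]
    simp [tameUnit, tameForm, nu_eq, lc_s₀, v₂_s₀, v₁_s₀, lc_t₀, v₁_t₀, v₂_t₀]
  have ssv : ∀ {v : (LL k')ˣ}, v₁ v = 0 → v₂ v = 0 → R (s₀ k') (s₀ k') v = 1 := fun h h' => by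
    simp only [hR]
    rw [comm₃_s_s_unit hL h ((v₂_eq h).trans h')]
    simp [tameUnit, tameForm, nu_eq, lc_s₀, v₂_s₀, v₁_s₀, h, h', sgn]
  have stv : ∀ {v : (LL k')ˣ}, v₁ v = 0 → v₂ v = 0 → R (s₀ k') (t₀ k') v = 1 := fun {v} h h' => by
    simp only [hR]
    rw [comm₃_s_t_unit hL h ((v₂_eq h).trans h') (ν := Units.map (Algebra.norm k : k' →* k) (lc v))
      (by rw [residue_eq h h']; rfl)]
    simp [tameUnit, tameForm, nu_eq, lc_s₀, v₂_s₀, v₁_s₀, lc_t₀, v₁_t₀, v₂_t₀, h, h', sgn]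
  have svv : ∀ {v w : (LL k')ˣ}, v₁ v = 0 → v₂ v = 0 → v₁ w = 0 → v₂ w = 0 →
      R (s₀ k') v w = 1 := fun h h' e e' => by
    simp only [hR]
    rw [comm₃_s_unit_unit hL h ((v₂_eq h).trans h') e ((v₂_eq e).trans e')]
    simp [tameUnit, tameForm, nu_eq, lc_s₀, v₂_s₀, v₁_s₀, h, h', e, e', sgn]
  -- By antisymmetry, the arguments equal to `s` may be moved to the front.
  have split : ∀ {f : (LL k')ˣ}, f ∈ gens k' → f = s₀ k' ∨ v₁ f = 0 := by
    rintro f (h | rfl | h)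
    exacts [.inl h, .inr v₁_t₀, .inr h.1]
  have ssu : ∀ {u : (LL k')ˣ}, u ∈ gens k' → R (s₀ k') (s₀ k') u = 1 := by
    rintro u (rfl | rfl | h)
    exacts [sss, sst, ssv h.1 h.2]
  have suu : ∀ {u u' : (LL k')ˣ}, u ∈ gens k' → u' ∈ gens k' → R (s₀ k') u u' = 1 := by
    rintro u u' (rfl | rfl | h) h'
    · exact ssu h'
    · rcases h' with rfl | rfl | h'
      exacts [r sst, stt, stv h'.1 h'.2]
    · rcases h' with rfl | rfl | h'
      exacts [r (ssv h.1 h.2), r (stv h.1 h.2), svv h.1 h.2 h'.1 h'.2]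
  change R f g h = 1
  rcases split hf with rfl | hf'
  · exact suu hg hh
  rcases split hg with rfl | hg'
  · exact l (suu hf hh)
  rcases split hh with rfl | hh'
  · exact r (l (suu hf hg))
  · exact uuu hf' hg' hh'

/-- The triple commutator of multiplications is the norm of the tame symbol. -/
theorem comm₃_eq_norm (f g h : (LL k')ˣ) :
    comm₃ hL f g h = Units.map (Algebra.norm k : k' →* k) (tameUnit f g h) := by
  refine div_eq_one.1 (eq_one_of_closure closure_gens
    (R := fun f g h => comm₃ hL f g h / Units.map (Algebra.norm k : k' →* k) (tameUnit f g h))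
    (fun f f' g h => ?_) (fun f g h => ?_) (fun f g h => ?_)
    (fun f hf g hg h hh => comm₃_eq_on_gens hL hf hg hh) f g h)
  · rw [comm₃_mul, tameUnit_mul, map_mul, mul_div_mul_comm]
  · rw [comm₃_swap_left, tameUnit_swap_left, map_inv, inv_div, inv_div_inv]
  · rw [comm₃_swap_right, tameUnit_swap_right, map_inv, inv_div, inv_div_inv]

end LL

end

/-- Let `k' / k` be a finite field extension and let `L` be a lattice of the `2`-Tate space
`k'((t))((s))` over `k`. Then `Det` is a central extension of `GL(k'((t))((s)))` by the Picard
category of graded lines, and for nonzero `f`, `g`, `h` in `k'((t))((s))` the triple commutator of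
the multiplications by `f`, `g`, `h` is the norm of their two-dimensional tame symbol. -/
theorem mainTheorem2 {k k' : Type u} [Field k] [Field k'] [Algebra k k'] [FiniteDimensional k k']
    {L : Submodule k (LL k')} (hL : LL.IsLattice L) :
    (LL.Det hL).IsCentralExtension ∧
      ∀ (f g h : (LL k')ˣ) (a : kˣ),
        (LL.Det hL).IsTripleCommutator (LL.mulGL k f) (LL.mulGL k g) (LL.mulGL k h)
          (GradedLine.scalarAut a) ↔
        (a : k) = Algebra.norm k (LL.tameSymbol f g h) :=
  ⟨LL.isCentralExtension_det hL, fun f g h a => by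
    rw [LL.isTripleCommutator_iff hL, LL.comm₃_eq_norm, Units.ext_iff, Units.coe_map,
      LL.tameUnit_eq]⟩
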